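/- Let $\Omega\subset\mathbb{C}$ be open. For a potential $V\in L^2_{\mathrm{loc}}(\Omega)$ and $2<q<\infty$, a spinor $\psi=(\psi_1,\psi_2)\in L^q_{\mathrm{loc}}(\Omega,\mathbb{C}^2)$, identified with the quaternion-valued function $\begin{pmatrix}\psi_1&-\bar\psi_2\\ \psi_2&\bar\psi_1\end{pmatrix}$, is said to lie in the $L^q$-kernel of $\begin{pmatrix}\bar\partial&-\bar V\\ V&\partial\end{pmatrix}$ on $\Omega$ if $\bar\partial\psi_1=\bar V\psi_2$ and $\partial\psi_2=-V\psi_1$ on $\Omega$ in the sense of distributions. The order of such a $\psi$ at $z_0\in\Omega$ is the largest integer $m$ such that $\begin{pmatrix}z-z_0&0\\0&\bar z-\bar z_0\end{pmatrix}^{-m}\psi$ belongs to $L^q_{\mathrm{loc}}(\Omega,\mathbb{C}^2)$ and lies in the $L^q$-kernel of the operator with potential $V\left(\frac{z-z_0}{\bar z-\bar z_0}\right)^m$ in place of $V$; $\psi$ has no zeros on $\Omega$ if its order is $0$ at every point of $\Omega$. **Weyl's Lemma.** Let $U\in L^2_{\mathrm{loc}}(\Omega)$, let $2<q<\infty$,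 and let $\phi=(\phi_1,\phi_2)$ lie in the $L^q$-kernel of $\begin{pmatrix}\bar\partial&U\\-\bar U&\partial\end{pmatrix}$ on $\Omega$ (the operator with potential $V=-\bar U$) and have no zeros on $\Omega$. Let $1<p<2$ and $\psi=(\psi_1,\psi_2)\in L^p_{\mathrm{loc}}(\Omega,\mathbb{C}^2)$. If the matrix-valued $1$-form $$\begin{pmatrix}\phi_1&\phi_2\\-\bar\phi_2&\bar\phi_1\end{pmatrix}\begin{pmatrix}dz&0\\0&d\bar z\end{pmatrix}\begin{pmatrix}\psi_1&-\bar\psi_2\\ \psi_2&\bar\psi_1\end{pmatrix}$$ is a closed current on $\Omega$ (each entry $a\,dz+b\,d\bar z$ has locally integrable coefficients and satisfies $\int_\Omega(a\,dz+b\,d\bar z)\wedge d\eta=0$ for all $\eta\in C_c^\infty(\Omega,\mathbb{C})$), then $\psi$ lies, for every $2<r<\infty$, in the $L^r$-kernel of $\begin{pmatrix}\bar\partial&-\bar U\\U&\partial\end{pmatrix}$ on $\Omega$; in particular $\psi\in L^r_{\mathrm{loc}}(\Omega,\mathbb{C}^2)$. -/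

import Mathlib

open MeasureTheory TopologicalSpace
open scoped ENNReal ComplexConjugate Matrix Distributions

noncomputable section

namespace QuaternionicSpinor

/-- `f ∈ L^p_loc(Ω)`: `f` is of class `L^p` on every compact subset of `Ω`. -/
def MemLpLoc (p : ℝ≥0∞) (Ω : Opens ℂ) (f : ℂ → ℂ) : Prop :=
  ∀ K : Set ℂ, IsCompact K → K ⊆ Ω → MemLp f p (volume.restrict K)

/-- The Wirtinger derivative `∂η = (∂_x η - i ∂_y η) / 2`. -/
def del (η : ℂ → ℂ) (z : ℂ) : ℂ :=
  (1 / 2) * (fderiv ℝ η z 1 - Complex.I * fderiv ℝ η z Complex.I)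

/-- The Wirtinger derivative `∂̄η = (∂_x η + i ∂_y η) / 2`. -/
def delBar (η : ℂ → ℂ) (z : ℂ) : ℂ :=
  (1 / 2) * (fderiv ℝ η z 1 + Complex.I * fderiv ℝ η z Complex.I)

/-- `∂f = g` on `Ω` in the sense of distributions. -/
def WeakDel (Ω : Opens ℂ) (f g : ℂ → ℂ) : Prop :=
  ∀ η : 𝓓(Ω, ℂ), ∫ z in (Ω : Set ℂ), f z * del η z = -∫ z in (Ω : Set ℂ), g z * η z

/-- `∂̄f = g` on `Ω` in the sense of distributions. -/
def WeakDelBar (Ω : Opens ℂ) (f g : ℂ → ℂ) : Prop :=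
  ∀ η : 𝓓(Ω, ℂ), ∫ z in (Ω : Set ℂ), f z * delBar η z = -∫ z in (Ω : Set ℂ), g z * η z

/-- A spinor `ψ = (ψ₁, ψ₂)`; here `ψ z 0` is `ψ₁` and `ψ z 1` is `ψ₂`. -/
abbrev Spinor : Type := ℂ → Fin 2 → ℂ

/-- The spinor, seen as a quaternion-valued function: the matrix `(ψ₁, -ψ̄₂; ψ₂, ψ̄₁)`. -/
def quat (ψ : Spinor) (z : ℂ) : Matrix (Fin 2) (Fin 2) ℂ :=
  !![ψ z 0, -conj (ψ z 1); ψ z 1, conj (ψ z 0)]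

/-- The matrix `(φ₁, φ₂; -φ̄₂, φ̄₁)`, by which the spinors of the paired structure multiply
from the left. -/
def pairedQuat (φ : Spinor) (z : ℂ) : Matrix (Fin 2) (Fin 2) ℂ :=
  !![φ z 0, φ z 1; -conj (φ z 1), conj (φ z 0)]

/-- `ψ ∈ L^q_loc(Ω)` lies on `Ω` in the kernel of the operator `(∂̄, -V̄; V, ∂)`, that is,
`∂̄ψ₁ = V̄ψ₂` and `∂ψ₂ = -Vψ₁` in the sense of distributions. (The second column of `quat ψ` is
then annihilated too: its two equations are the complex conjugates of these.) -/
structure InKernel (q : ℝ≥0∞) (Ω : Opens ℂ) (V : ℂ → ℂ) (ψ : Spinor) : Prop where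
  memLpLoc : ∀ i, MemLpLoc q Ω (fun z => ψ z i)
  delBar_fst : WeakDelBar Ω (fun z => ψ z 0) (fun z => conj (V z) * ψ z 1)
  del_snd : WeakDel Ω (fun z => ψ z 1) (fun z => -(V z * ψ z 0))

/-- The potential `-Ū` of the paired structure: `(∂̄, -V̄; V, ∂)` with `V = -Ū` is
`(∂̄, U; -Ū, ∂)`. -/
def pairedPotential (U : ℂ → ℂ) (z : ℂ) : ℂ := -conj (U z)

/-- The spinor `diag(z - z₀, conj (z - z₀))^(-m) ψ`. -/
def divPow (z₀ : ℂ) (m : ℤ) (ψ : Spinor) : Spinor := fun z =>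
  ![(z - z₀) ^ (-m) * ψ z 0, conj (z - z₀) ^ (-m) * ψ z 1]

/-- The potential `V ((z - z₀) / conj (z - z₀))^m`. -/
def twistPotential (z₀ : ℂ) (m : ℤ) (V : ℂ → ℂ) (z : ℂ) : ℂ :=
  V z * ((z - z₀) / conj (z - z₀)) ^ m

/-- The spinor `ψ`, an element of the kernel of `(∂̄, -V̄; V, ∂)` on `Ω`, has at `z₀` a zero of
order `m`: `m` is the largest integer for which `diag(z - z₀, conj (z - z₀))^(-m) ψ` is in
`L^q_loc(Ω)` and lies in the kernel of the operator with the correspondingly twisted potential. -/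
def HasOrderAt (q : ℝ≥0∞) (Ω : Opens ℂ) (V : ℂ → ℂ) (ψ : Spinor) (z₀ : ℂ) (m : ℤ) : Prop :=
  IsGreatest {k : ℤ | InKernel q Ω (twistPotential z₀ k V) (divPow z₀ k ψ)} m

/-- `ψ` has no zeros on `Ω`: its order is `0` at all points of `Ω`. -/
def HasNoZeros (q : ℝ≥0∞) (Ω : Opens ℂ) (V : ℂ → ℂ) (ψ : Spinor) : Prop :=
  ∀ z₀ ∈ Ω, HasOrderAt q Ω V ψ z₀ 0

/-- The 1-form `a dz + b dz̄` is a closed current on `Ω`: it has locally integrable coefficients,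
and `∫ (a dz + b dz̄) ∧ dη = 0` for all test functions `η`. Here
`(a dz + b dz̄) ∧ dη = (a ∂̄η - b ∂η) dz ∧ dz̄`, and `dz ∧ dz̄` is `-2i` times Lebesgue measure. -/
structure IsClosedCurrent (Ω : Opens ℂ) (a b : ℂ → ℂ) : Prop where
  integrable_dz : LocallyIntegrableOn a Ω
  integrable_dzbar : LocallyIntegrableOn b Ω
  closed : ∀ η : 𝓓(Ω, ℂ), ∫ z in (Ω : Set ℂ), (a z * delBar η z - b z * del η z) = 0

/-- The matrix-valued 1-form `(φ₁, φ₂; -φ̄₂, φ̄₁) diag(dz, dz̄) (ψ₁, -ψ̄₂; ψ₂, ψ̄₁)` is a closed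
current on `Ω` (all its entries are). Its `dz`-part and its `dz̄`-part are obtained by putting
`diag(1, 0)` and `diag(0, 1)` in the middle. -/
def PairingIsClosedCurrent (Ω : Opens ℂ) (φ ψ : Spinor) : Prop :=
  ∀ i j, IsClosedCurrent Ω
    (fun z => (pairedQuat φ z * !![1, 0; 0, 0] * quat ψ z : Matrix (Fin 2) (Fin 2) ℂ) i j)
    (fun z => (pairedQuat φ z * !![0, 0; 0, 1] * quat ψ z : Matrix (Fin 2) (Fin 2) ℂ) i j)

end QuaternionicSpinor

end

noncomputable section

namespace QuaternionicSpinor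

open scoped ContDiff
open Filter Metric Topology
open scoped Real
open Real (log exp sin cos norm_of_nonneg exp_pos log_le_sub_one_of_pos pi_gt_three pi_pos
  rpow_pos_of_pos)
open Complex (I norm_real normSq_eq_norm_sq normSq continuous_conj continuous_ofReal conj_ofReal
  real_smul)
open ENNReal (ofReal ofReal_mul ofReal_rpow_of_pos rpow_ne_top_of_nonneg inv_two_add_inv_two
  zero_rpow_of_pos ofReal_le_ofReal toReal_pos ofReal_ne_top lintegral_mul_le_Lp_mul_Lq
  ofReal_lt_top inv_le_inv mul_rpow_of_nonneg toReal_lt_toReal)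
open Set (indicator_of_mem indicator_of_notMem Icc Ioi)

/-- Lebesgue measure restricted to a set. -/
notation "vol" => Measure.restrict volume

theorem restrict_le {μ : Measure ℂ} {s : Set ℂ} : μ.restrict s ≤ μ := Measure.restrict_le_self

theorem off_tsupport {E : Type*} [Zero E] {f : ℂ → E} {z : ℂ} (h : z ∉ tsupport f) : f z = 0 :=
  image_eq_zero_of_notMem_tsupport h

/-! ### Wirtinger calculus -/

section Wirtinger

variable {f g : ℂ → ℂ} {z : ℂ}

theorem del_congr (h : f =ᶠ[nhds z] g) : del f z = del g z := by
  simp only [del, h.fderiv_eq]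

theorem delBar_congr (h : f =ᶠ[nhds z] g) : delBar f z = delBar g z := by
  simp only [delBar, h.fderiv_eq]

@[simp] theorem del_const (c : ℂ) : del (fun _ => c) z = 0 := by simp [del]

@[simp] theorem delBar_const (c : ℂ) : delBar (fun _ => c) z = 0 := by simp [delBar]

theorem del_add (hf : DifferentiableAt ℝ f z) (hg : DifferentiableAt ℝ g z) :
    del (fun w => f w + g w) z = del f z + del g z := by
  simp only [del, fderiv_fun_add hf hg, add_apply]; ring

theorem delBar_add (hf : DifferentiableAt ℝ f z) (hg : DifferentiableAt ℝ g z) :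
    delBar (fun w => f w + g w) z = delBar f z + delBar g z := by
  simp only [delBar, fderiv_fun_add hf hg, add_apply]; ring

theorem del_neg : del (fun w => -f w) z = -del f z := by
  simp only [del, fderiv_fun_neg, neg_apply]; ring

theorem delBar_neg : delBar (fun w => -f w) z = -delBar f z := by
  simp only [delBar, fderiv_fun_neg, neg_apply]; ring

theorem delBar_sub (hf : DifferentiableAt ℝ f z) (hg : DifferentiableAt ℝ g z) :
    delBar (fun w => f w - g w) z = delBar f z - delBar g z := by
  simp only [delBar, fderiv_fun_sub hf hg, sub_apply]; ring

theorem del_mul (hf : DifferentiableAt ℝ f z) (hg : DifferentiableAt ℝ g z) :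
    del (fun w => f w * g w) z = del f z * g z + f z * del g z := by
  simp only [del, fderiv_fun_mul hf hg, add_apply,
    smul_apply, smul_eq_mul]; ring

theorem delBar_mul (hf : DifferentiableAt ℝ f z) (hg : DifferentiableAt ℝ g z) :
    delBar (fun w => f w * g w) z = delBar f z * g z + f z * delBar g z := by
  simp only [delBar, fderiv_fun_mul hf hg, add_apply,
    smul_apply, smul_eq_mul]; ring

theorem fderiv_conj_apply (hf : DifferentiableAt ℝ f z) (v : ℂ) :
    fderiv ℝ (fun w => conj (f w)) z v = conj (fderiv ℝ f z v) := by
  have := (Complex.conjCLE.toContinuousLinearMap.hasFDerivAt.comp z hf.hasFDerivAt).fderiv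
  have h2 : fderiv ℝ (fun w => conj (f w)) z
      = Complex.conjCLE.toContinuousLinearMap.comp (fderiv ℝ f z) := by
    rw [← this]; rfl
  rw [h2]; simp

theorem del_conj (hf : DifferentiableAt ℝ f z) :
    del (fun w => conj (f w)) z = conj (delBar f z) := by
  simp only [del, delBar, fderiv_conj_apply hf, map_mul, map_add, Complex.conj_I, map_div₀,
    map_one, map_ofNat]; ring

theorem delBar_conj (hf : DifferentiableAt ℝ f z) :
    delBar (fun w => conj (f w)) z = conj (del f z) := by
  simp only [del, delBar, fderiv_conj_apply hf, map_mul, map_sub, Complex.conj_I, map_div₀,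
    map_one, map_ofNat]; ring

theorem fderiv_comp_hol {F : ℂ → ℂ} {F' : ℂ} (hF : HasDerivAt F F' (f z))
    (hf : DifferentiableAt ℝ f z) (v : ℂ) :
    fderiv ℝ (fun w => F (f w)) z v = F' * fderiv ℝ f z v := by
  have h := (hF.hasFDerivAt.restrictScalars ℝ).comp z hf.hasFDerivAt
  have h2 : fderiv ℝ (fun w => F (f w)) z = _ := h.fderiv
  rw [h2]; simp [mul_comm]

theorem del_comp_hol {F : ℂ → ℂ} {F' : ℂ} (hF : HasDerivAt F F' (f z))
    (hf : DifferentiableAt ℝ f z) : del (fun w => F (f w)) z = F' * del f z := by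
  simp only [del, fderiv_comp_hol hF hf]; ring

theorem delBar_comp_hol {F : ℂ → ℂ} {F' : ℂ} (hF : HasDerivAt F F' (f z))
    (hf : DifferentiableAt ℝ f z) : delBar (fun w => F (f w)) z = F' * delBar f z := by
  simp only [delBar, fderiv_comp_hol hF hf]; ring

theorem delBar_eq_zero_of_differentiableAt (hf : DifferentiableAt ℂ f z) : delBar f z = 0 := by
  have h := (hf.hasDerivAt.hasFDerivAt.restrictScalars ℝ).fderiv
  simp only [delBar, h]
  simp
  linear_combination deriv f z * Complex.I_mul_I

theorem del_div (hf : DifferentiableAt ℝ f z) (hg : DifferentiableAt ℝ g z) (h0 : g z ≠ 0) :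
    del (fun w => f w / g w) z = (del f z * g z - f z * del g z) / g z ^ 2 := by
  have h1 : DifferentiableAt ℝ (fun w => (g w)⁻¹) z := hg.inv h0
  simp only [div_eq_mul_inv]
  rw [del_mul hf h1, del_comp_hol (hasDerivAt_inv h0) hg]
  field_simp
  ring

theorem delBar_div (hf : DifferentiableAt ℝ f z) (hg : DifferentiableAt ℝ g z) (h0 : g z ≠ 0) :
    delBar (fun w => f w / g w) z = (delBar f z * g z - f z * delBar g z) / g z ^ 2 := by
  have h1 : DifferentiableAt ℝ (fun w => (g w)⁻¹) z := hg.inv h0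
  simp only [div_eq_mul_inv]
  rw [delBar_mul hf h1, delBar_comp_hol (hasDerivAt_inv h0) hg]
  field_simp
  ring

theorem _root_.ContDiffAt.del {n m : WithTop ℕ∞} (hf : ContDiffAt ℝ n f z) (h : m + 1 ≤ n) :
    ContDiffAt ℝ m (del f) z := by
  have h1 := hf.fderiv_right h
  unfold QuaternionicSpinor.del
  exact contDiffAt_const.mul ((h1.clm_apply contDiffAt_const).sub
    (contDiffAt_const.mul (h1.clm_apply contDiffAt_const)))

theorem _root_.ContDiffAt.delBar {n m : WithTop ℕ∞} (hf : ContDiffAt ℝ n f z) (h : m + 1 ≤ n) :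
    ContDiffAt ℝ m (delBar f) z := by
  have h1 := hf.fderiv_right h
  unfold QuaternionicSpinor.delBar
  exact contDiffAt_const.mul ((h1.clm_apply contDiffAt_const).add
    (contDiffAt_const.mul (h1.clm_apply contDiffAt_const)))

theorem _root_.ContDiff.del {n m : WithTop ℕ∞} (hf : ContDiff ℝ n f) (h : m + 1 ≤ n) :
    ContDiff ℝ m (del f) :=
  contDiff_iff_contDiffAt.2 fun _ => hf.contDiffAt.del h

theorem _root_.ContDiff.delBar {n m : WithTop ℕ∞} (hf : ContDiff ℝ n f) (h : m + 1 ≤ n) :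
    ContDiff ℝ m (delBar f) :=
  contDiff_iff_contDiffAt.2 fun _ => hf.contDiffAt.delBar h

theorem del_delBar_comm (hf : ContDiffAt ℝ 2 f z) : del (delBar f) z = delBar (del f) z := by
  have hs : IsSymmSndFDerivAt ℝ f z := hf.isSymmSndFDerivAt (by simp)
  have h1 : DifferentiableAt ℝ (fderiv ℝ f) z :=
    (hf.fderiv_right (m := 1) (by norm_num)).differentiableAt (by simp)
  have ha : ∀ v : ℂ, DifferentiableAt ℝ (fun w => fderiv ℝ f w v) z := fun v =>
    h1.clm_apply (differentiableAt_const _)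
  have hb : ∀ v w : ℂ, fderiv ℝ (fun w => fderiv ℝ f w v) z w = fderiv ℝ (fderiv ℝ f) z w v := by
    intro v w
    rw [fderiv_clm_apply h1 (differentiableAt_const _)]
    simp
  have e1 : ∀ w, fderiv ℝ (delBar f) z w = 1 / 2 * (fderiv ℝ (fderiv ℝ f) z w 1
      + I * fderiv ℝ (fderiv ℝ f) z w I) := by
    intro w
    unfold delBar
    have h3 : DifferentiableAt ℝ (fun w => fderiv ℝ f w 1
        + I * fderiv ℝ f w I) z := (ha 1).add ((ha I).const_mul _)
    rw [fderiv_const_mul h3, fderiv_fun_add (ha 1) ((ha I).const_mul _), fderiv_const_mul (ha I)]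
    simp [hb]
    ring
  have e2 : ∀ w, fderiv ℝ (del f) z w = 1 / 2 * (fderiv ℝ (fderiv ℝ f) z w 1
      - I * fderiv ℝ (fderiv ℝ f) z w I) := by
    intro w
    unfold del
    have h3 : DifferentiableAt ℝ (fun w => fderiv ℝ f w 1
        - I * fderiv ℝ f w I) z := (ha 1).sub ((ha I).const_mul _)
    rw [fderiv_const_mul h3, fderiv_fun_sub (ha 1) ((ha I).const_mul _), fderiv_const_mul (ha I)]
    simp [hb]
  rw [del, delBar, e1, e1, e2, e2, hs.eq I 1]
  ring

theorem tsupport_del_subset : tsupport (del f) ⊆ tsupport f := by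
  refine closure_minimal (fun x hx => ?_) (isClosed_tsupport f)
  by_contra h
  apply hx
  have : fderiv ℝ f x = 0 := by
    have := (notMem_tsupport_iff_eventuallyEq.1 h).fderiv_eq (𝕜 := ℝ)
    rw [this]; simp
  simp [del, this]

theorem tsupport_delBar_subset : tsupport (delBar f) ⊆ tsupport f := by
  refine closure_minimal (fun x hx => ?_) (isClosed_tsupport f)
  by_contra h
  apply hx
  have : fderiv ℝ f x = 0 := by
    have := (notMem_tsupport_iff_eventuallyEq.1 h).fderiv_eq (𝕜 := ℝ)
    rw [this]; simp
  simp [delBar, this]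

theorem _root_.HasCompactSupport.del (hf : HasCompactSupport f) : HasCompactSupport (del f) :=
  hf.mono' (subset_closure.trans tsupport_del_subset)

theorem _root_.HasCompactSupport.delBar (hf : HasCompactSupport f) :
    HasCompactSupport (delBar f) :=
  hf.mono' (subset_closure.trans tsupport_delBar_subset)

theorem integral_fderiv_apply_eq_zero (hf : ContDiff ℝ 1 f) (hc : HasCompactSupport f) (v : ℂ) :
    ∫ z, fderiv ℝ f z v = 0 := by
  have hcont : Continuous fun z => fderiv ℝ f z v := (hf.continuous_fderiv (by simp)).clm_apply
    continuous_const
  have hcs : HasCompactSupport fun z => fderiv ℝ f z v := hc.fderiv_apply (𝕜 := ℝ) v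
  have := integral_mul_fderiv_eq_neg_fderiv_mul_of_integrable (μ := (volume : Measure ℂ))
    (f := fun _ => (1 : ℂ)) (g := f) (v := v) (by simp)
    (by simpa using hcont.integrable_of_hasCompactSupport hcs)
    (by simpa using hf.continuous.integrable_of_hasCompactSupport hc)
    (by intros; fun_prop) (fun x _ => hf.differentiable (by simp) x)
  simpa using this

theorem integrable_fderiv_apply (hf : ContDiff ℝ 1 f) (hc : HasCompactSupport f) (v : ℂ) :
    Integrable fun z => fderiv ℝ f z v :=
  ((hf.continuous_fderiv (by simp)).clm_apply
    continuous_const).integrable_of_hasCompactSupport (hc.fderiv_apply (𝕜 := ℝ) v)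

theorem integral_delBar_eq_zero (hf : ContDiff ℝ 1 f) (hc : HasCompactSupport f) :
    ∫ z, delBar f z = 0 := by
  unfold delBar
  rw [integral_const_mul, integral_add (integrable_fderiv_apply hf hc _)
    ((integrable_fderiv_apply hf hc _).const_mul _), integral_const_mul,
    integral_fderiv_apply_eq_zero hf hc, integral_fderiv_apply_eq_zero hf hc]
  simp

end Wirtinger

/-! ### The Hardy-Littlewood-Sobolev inequality for the kernel `1 / |z|` on the plane -/

section HLS

theorem lintegral_radial {g : ℝ → ENNReal} (hg : Measurable g) :
    ∫⁻ z : ℂ, g ‖z‖ = ofReal (2 * π) *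
      ∫⁻ r in Ioi (0 : ℝ), ofReal r * g r := by
  rw [← Complex.lintegral_comp_polarCoord_symm, polarCoord_target, Measure.volume_eq_prod,
    ← Measure.prod_restrict]
  have h1 : ∀ p : ℝ × ℝ, ofReal p.1 • g ‖Complex.polarCoord.symm p‖
      = (fun r => ofReal r * g |r|) p.1 * (fun _ : ℝ => (1 : ENNReal)) p.2 := by
    intro p
    rw [Complex.norm_polarCoord_symm]; simp
  rw [lintegral_congr h1, lintegral_prod_mul (f := fun r => ofReal r * g |r|)
    (g := fun _ => 1) (by fun_prop) (by fun_prop), mul_comm]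
  congr 1
  · simp only [lintegral_const, Measure.restrict_apply_univ, Real.volume_Ioo, one_mul]
    ring_nf
  · refine setLIntegral_congr_fun measurableSet_Ioi fun r hr => ?_
    simp only [abs_of_pos (Set.mem_Ioi.1 hr)]

theorem lintegral_kernel_ball {a R : ℝ} (ha : a < 2) (hR : 0 < R) :
    ∫⁻ z in ball (0 : ℂ) R, (‖z‖ₑ⁻¹) ^ a
      = ofReal (2 * π * R ^ (2 - a) / (2 - a)) := by
  have h0 : ∫⁻ z in ball (0 : ℂ) R, (‖z‖ₑ⁻¹) ^ a
      = ∫⁻ z : ℂ, (Set.Iio R).indicator (fun r => ((ofReal r)⁻¹) ^ a) ‖z‖ := by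
    rw [← lintegral_indicator isOpen_ball.measurableSet]
    refine lintegral_congr fun z => ?_
    simp only [Set.indicator, mem_ball, dist_zero_right, Set.mem_Iio, ofReal_norm]
  rw [h0, lintegral_radial ((by fun_prop : Measurable fun r : ℝ =>
    ((ofReal r)⁻¹) ^ a).indicator measurableSet_Iio)]
  have h1 : ∫⁻ r in Ioi (0 : ℝ), ofReal r *
      (Set.Iio R).indicator (fun r => ((ofReal r)⁻¹) ^ a) r
      = ∫⁻ r in Set.Ioo 0 R, ofReal (r ^ (1 - a)) := by
    rw [← Set.Ioi_inter_Iio, Set.inter_comm, ← Measure.restrict_restrict measurableSet_Iio,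
      ← lintegral_indicator measurableSet_Iio]
    refine setLIntegral_congr_fun measurableSet_Ioi fun r hr => ?_
    rw [Set.mem_Ioi] at hr
    simp only [Set.indicator]
    split_ifs
    · rw [← ENNReal.ofReal_inv_of_pos hr, ofReal_rpow_of_pos (by positivity),
        ← ofReal_mul hr.le, Real.inv_rpow hr.le, Real.rpow_sub hr, Real.rpow_one,
        div_eq_mul_inv]
    · simp
  have hint : IntervalIntegrable (fun r : ℝ => r ^ (1 - a)) volume 0 R :=
    intervalIntegral.intervalIntegrable_rpow' (by linarith)
  rw [h1, ← ofReal_integral_eq_lintegral_ofReal, ← integral_Ioc_eq_integral_Ioo,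
    ← intervalIntegral.integral_of_le hR.le, integral_rpow (Or.inl (by linarith)),
    ← ofReal_mul (by positivity)]
  · congr 1
    rw [Real.zero_rpow (by linarith)]
    ring_nf
  · exact ((intervalIntegrable_iff_integrableOn_Ioc_of_le hR.le).1 hint).mono_set
      Set.Ioo_subset_Ioc_self
  · filter_upwards [ae_restrict_mem measurableSet_Ioo] with r hr
    exact Real.rpow_nonneg hr.1.le _

theorem lintegral_kernel_compl_ball {a R : ℝ} (ha : 2 < a) (hR : 0 < R) :
    ∫⁻ z in (ball (0 : ℂ) R)ᶜ, (‖z‖ₑ⁻¹) ^ a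
      = ofReal (2 * π * R ^ (2 - a) / (a - 2)) := by
  have h0 : ∫⁻ z in (ball (0 : ℂ) R)ᶜ, (‖z‖ₑ⁻¹) ^ a
      = ∫⁻ z : ℂ, (Set.Ici R).indicator (fun r => ((ofReal r)⁻¹) ^ a) ‖z‖ := by
    rw [← lintegral_indicator isOpen_ball.measurableSet.compl]
    refine lintegral_congr fun z => ?_
    simp only [Set.indicator, Set.mem_compl_iff, mem_ball, dist_zero_right, Set.mem_Ici,
      ofReal_norm, not_lt]
  rw [h0, lintegral_radial ((by fun_prop : Measurable fun r : ℝ =>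
    ((ofReal r)⁻¹) ^ a).indicator measurableSet_Ici)]
  have h1 : ∫⁻ r in Ioi (0 : ℝ), ofReal r *
      (Set.Ici R).indicator (fun r => ((ofReal r)⁻¹) ^ a) r
      = ∫⁻ r in Set.Ici R, ofReal (r ^ (1 - a)) := by
    have : Set.Ici R = Set.Ici R ∩ Ioi 0 :=
      (Set.inter_eq_left.2 fun x hx => hR.trans_le hx).symm
    rw [this, ← Measure.restrict_restrict measurableSet_Ici,
      ← lintegral_indicator measurableSet_Ici, ← this]
    refine setLIntegral_congr_fun measurableSet_Ioi fun r hr => ?_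
    rw [Set.mem_Ioi] at hr
    simp only [Set.indicator]
    split_ifs
    · rw [← ENNReal.ofReal_inv_of_pos hr, ofReal_rpow_of_pos (by positivity),
        ← ofReal_mul hr.le, Real.inv_rpow hr.le, Real.rpow_sub hr, Real.rpow_one,
        div_eq_mul_inv]
    · simp
  rw [h1, setLIntegral_congr Ioi_ae_eq_Ici.symm, ← ofReal_integral_eq_lintegral_ofReal,
    integral_Ioi_rpow_of_lt (by linarith) hR, ← ofReal_mul (by positivity)]
  · congr 1
    have e1 : (1 : ℝ) - a + 1 = -(a - 2) := by ring
    have e2 : (2 : ℝ) - a = -(a - 2) := by ring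
    rw [e1, e2, div_neg, neg_div, neg_neg]
    ring
  · exact integrableOn_Ioi_rpow_of_lt (by linarith) hR
  · filter_upwards [ae_restrict_mem measurableSet_Ioi] with r hr
    exact Real.rpow_nonneg (hR.trans hr).le _

/-- The kernel `1 / |x - y|`. -/
def rieszKernel (x y : ℂ) : ENNReal := ‖x - y‖ₑ⁻¹

theorem rieszKernel_comm (x y : ℂ) : rieszKernel x y = rieszKernel y x := by
  rw [rieszKernel, rieszKernel, ← enorm_neg, neg_sub]

@[fun_prop] theorem measurable_rieszKernel : Measurable fun p : ℂ × ℂ => rieszKernel p.1 p.2 := by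
  unfold rieszKernel; fun_prop

/-- The value `b`, cut off to `0` unless `b ^ σ ≤ t ^ s`. -/
def levelCut (s σ : ℝ) (t b : ENNReal) : ENNReal := if b ^ σ ≤ t ^ s then b else 0

theorem levelCut_le (s σ : ℝ) (t b : ENNReal) : levelCut s σ t b ≤ b := by
  unfold levelCut; split_ifs <;> simp

@[fun_prop] theorem measurable_levelCut (s σ : ℝ) :
    Measurable fun p : ENNReal × ENNReal => levelCut s σ p.1 p.2 := by
  unfold levelCut
  exact Measurable.ite (measurableSet_le (by fun_prop) (by fun_prop)) (by fun_prop) (by fun_prop)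

theorem lintegral_rieszKernel_mul_le {s σ : ℝ} (hs : 1 < s) (hσ : 1 < σ)
    (hsσ : 1 / s + 1 / σ = 3 / 2) : ∃ C : ENNReal, C ≠ ⊤ ∧ ∀ (g : ℂ → ENNReal), Measurable g →
      ∫⁻ y, g y ^ σ ≤ 1 → ∀ (t : ENNReal), t ≠ 0 → t ≠ ⊤ → ∀ x : ℂ,
      ∫⁻ y, levelCut s σ t (g y) * rieszKernel x y ≤ C * t ^ (s - 1) := by
  set σ' := σ / (σ - 1) with hσ'
  have hσ0 : (0 : ℝ) < σ := by linarith
  have hs0 : (0 : ℝ) < s := by linarith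
  have hσ2 : σ < 2 := by
    by_contra h
    have h1 : 1 / σ ≤ 1 / 2 := one_div_le_one_div_of_le (by norm_num) (not_lt.1 h)
    have h2 : 1 / s < 1 := by rw [div_lt_one hs0]; exact hs
    linarith
  have hσ'2 : 2 < σ' := by
    rw [hσ', lt_div_iff₀ (by linarith)]; linarith
  have hconj : σ.HolderConjugate σ' := Real.HolderConjugate.conjExponent hσ
  refine ⟨ofReal (2 * π) + ofReal ((2 * π / (σ' - 2)) ^ (1 / σ')),
    by finiteness, fun g hg hg1 t ht0 ht1 x => ?_⟩
  lift t to NNReal using ht1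
  have htp : (0 : ℝ) < t := by
    have : t ≠ 0 := by simpa using ht0
    positivity
  set R : ℝ := (t : ℝ) ^ (-s / 2) with hR
  have hRp : 0 < R := rpow_pos_of_pos htp _
  have ht' : (t : ENNReal) = ofReal t := by simp
  have hk : Measurable fun y => rieszKernel x y := by unfold rieszKernel; fun_prop
  have hshift : ∀ (S : Set ℂ) (a : ℝ), MeasurableSet S →
      ∫⁻ y, S.indicator (fun z => (‖z‖ₑ⁻¹) ^ a) (x - y) = ∫⁻ z in S, (‖z‖ₑ⁻¹) ^ a := by
    intro S a hS
    rw [lintegral_sub_left_eq_self (fun z => S.indicator (fun z => (‖z‖ₑ⁻¹) ^ a) z) x,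
      lintegral_indicator hS]
  have hb : MeasurableSet (ball (0 : ℂ) R) := isOpen_ball.measurableSet
  have hsum : ∀ y, levelCut s σ t (g y) * rieszKernel x y ≤
      (t : ENNReal) ^ (s / σ) * (ball (0 : ℂ) R).indicator (fun z => (‖z‖ₑ⁻¹) ^ (1 : ℝ)) (x - y)
      + g y * (ball (0 : ℂ) R)ᶜ.indicator (fun z => ‖z‖ₑ⁻¹) (x - y) := by
    intro y
    by_cases hy : x - y ∈ ball (0 : ℂ) R
    · refine le_add_right ?_
      rw [indicator_of_mem hy, ENNReal.rpow_one]
      refine mul_le_mul' ?_ le_rfl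
      by_cases h2 : g y ^ σ ≤ (t : ENNReal) ^ s
      · rw [levelCut, if_pos h2, div_eq_mul_inv, ENNReal.rpow_mul, ENNReal.le_rpow_inv_iff hσ0]
        exact h2
      · rw [levelCut, if_neg h2]; exact zero_le
    · refine le_add_left ?_
      rw [indicator_of_mem (s := (ball (0 : ℂ) R)ᶜ) hy]
      exact mul_le_mul' (levelCut_le _ _ _ _) le_rfl
  have hexp : (t : ENNReal) ^ (s - 1) = (t : ENNReal) ^ (s / σ) * ofReal R := by
    rw [ht', hR, ofReal_rpow_of_pos htp, ofReal_rpow_of_pos htp,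
      ← ofReal_mul (by positivity), ← Real.rpow_add htp]
    congr 2
    have : s * (1 / s + 1 / σ) = s * (3 / 2) := by rw [hsσ]
    rw [mul_add, mul_one_div_cancel hs0.ne'] at this
    have h3 : s / σ = s * (1 / σ) := by ring
    linarith
  have hexp2 : ofReal (R ^ (2 - σ')) ^ (1 / σ') = (t : ENNReal) ^ (s - 1) := by
    rw [ofReal_rpow_of_pos (by positivity), ht', ofReal_rpow_of_pos htp,
      ← Real.rpow_mul hRp.le, hR, ← Real.rpow_mul htp.le]
    congr 2
    have h1 : 1 / σ' = 1 - 1 / σ := by rw [hσ']; field_simp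
    have h2 : (2 - σ') * (1 / σ') = 2 * (1 / σ') - 1 := by
      have : σ' * (1 / σ') = 1 := mul_one_div_cancel (by linarith)
      linear_combination -this
    have h3 : 1 / σ = 3 / 2 - 1 / s := by linarith
    rw [h2, h1, h3]
    field_simp
    ring
  calc _ ≤ ∫⁻ y, ((t : ENNReal) ^ (s / σ) *
        (ball (0 : ℂ) R).indicator (fun z => (‖z‖ₑ⁻¹) ^ (1 : ℝ)) (x - y)
        + g y * (ball (0 : ℂ) R)ᶜ.indicator (fun z => ‖z‖ₑ⁻¹) (x - y)) :=
        lintegral_mono hsum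
    _ = (t : ENNReal) ^ (s / σ) * ofReal (2 * π * R)
        + ∫⁻ y, g y * (ball (0 : ℂ) R)ᶜ.indicator (fun z => ‖z‖ₑ⁻¹) (x - y) := by
        have hm : Measurable fun y =>
            (ball (0 : ℂ) R).indicator (fun z => (‖z‖ₑ⁻¹) ^ (1 : ℝ)) (x - y) :=
          ((by fun_prop : Measurable fun z : ℂ => (‖z‖ₑ⁻¹) ^ (1 : ℝ)).indicator hb).comp
            (by fun_prop)
        rw [lintegral_add_left (hm.const_mul _), lintegral_const_mul _ hm, hshift _ _ hb,
          lintegral_kernel_ball (by norm_num) hRp]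
        norm_num
    _ ≤ (t : ENNReal) ^ (s / σ) * ofReal (2 * π * R) +
        (∫⁻ y, g y ^ σ) ^ (1 / σ) * (∫⁻ y, ((ball (0 : ℂ) R)ᶜ.indicator
          (fun z => ‖z‖ₑ⁻¹) (x - y)) ^ σ') ^ (1 / σ') := by
        gcongr
        refine lintegral_mul_le_Lp_mul_Lq _ hconj hg.aemeasurable ?_
        exact (((by fun_prop : Measurable fun z : ℂ => ‖z‖ₑ⁻¹).indicator hb.compl).comp
            (by fun_prop)).aemeasurable
    _ ≤ (t : ENNReal) ^ (s / σ) * ofReal (2 * π * R) +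
        1 * (ofReal (2 * π * R ^ (2 - σ') / (σ' - 2))) ^ (1 / σ') := by
        gcongr
        · exact ENNReal.rpow_le_one hg1 (by positivity)
        · rw [← lintegral_kernel_compl_ball hσ'2 hRp, ← hshift _ _ hb.compl]
          refine lintegral_mono fun y => ?_
          by_cases hy : x - y ∈ (ball (0 : ℂ) R)ᶜ
          · rw [indicator_of_mem hy, indicator_of_mem hy]
          · rw [indicator_of_notMem hy, indicator_of_notMem hy, zero_rpow_of_pos
              (by linarith)]
    _ = _ := by
        have e1 : 2 * π * R ^ (2 - σ') / (σ' - 2) = 2 * π / (σ' - 2) * R ^ (2 - σ') := by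
          ring
        have hpos : 0 < 2 * π / (σ' - 2) := div_pos (by positivity) (by linarith)
        rw [e1, ofReal_mul hpos.le, mul_rpow_of_nonneg _ _ (by positivity), hexp2,
          ofReal_mul (by positivity), add_mul, hexp, ofReal_rpow_of_pos hpos]
        ring

theorem lintegral_lintegral_levelCut_le {s σ : ℝ} (hs : 1 < s) {C : ENNReal}
    (h : ∀ (g : ℂ → ENNReal), Measurable g → ∫⁻ y, g y ^ σ ≤ 1 → ∀ (t : ENNReal), t ≠ 0 → t ≠ ⊤ →
      ∀ x : ℂ, ∫⁻ y, levelCut s σ t (g y) * rieszKernel x y ≤ C * t ^ (s - 1))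
    {f g : ℂ → ENNReal} (hf : Measurable f) (hg : Measurable g) (hf1 : ∫⁻ x, f x ^ s ≤ 1)
    (hg1 : ∫⁻ y, g y ^ σ ≤ 1) :
    ∫⁻ x, ∫⁻ y, f x * (levelCut s σ (f x) (g y) * rieszKernel x y) ≤ C := by
  have hs0 : 0 < s := by linarith
  have hfin : ∀ᵐ x, f x ≠ ⊤ := by
    have := ae_lt_top (hf.pow_const s) (hf1.trans_lt ENNReal.one_lt_top).ne
    filter_upwards [this] with x hx h
    rw [h, ENNReal.top_rpow_of_pos hs0] at hx
    exact lt_irrefl _ hx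
  calc _ ≤ ∫⁻ x, C * f x ^ s := by
        refine lintegral_mono_ae ?_
        filter_upwards [hfin] with x hx
        have hm : Measurable fun y => levelCut s σ (f x) (g y) * rieszKernel x y :=
          ((measurable_levelCut s σ).comp (measurable_const.prodMk hg)).mul
            (by unfold rieszKernel; fun_prop)
        rw [lintegral_const_mul _ hm]
        by_cases h0 : f x = 0
        · simp [h0]
        calc _ ≤ f x * (C * f x ^ (s - 1)) := by gcongr; exact h g hg hg1 _ h0 hx x
          _ = C * (f x ^ (1 : ℝ) * f x ^ (s - 1)) := by rw [ENNReal.rpow_one]; ring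
          _ = C * f x ^ s := by rw [← ENNReal.rpow_add _ _ h0 hx]; congr 2; ring
    _ = C * ∫⁻ x, f x ^ s := lintegral_const_mul _ (hf.pow_const s)
    _ ≤ C := mul_le_of_le_one_right' hf1

theorem lintegral_lintegral_rieszKernel_le_of_le_one {s σ : ℝ} (hs : 1 < s) (hσ : 1 < σ)
    (hsσ : 1 / s + 1 / σ = 3 / 2) : ∃ C : ENNReal, C ≠ ⊤ ∧ ∀ (f g : ℂ → ENNReal), Measurable f →
      Measurable g → ∫⁻ x, f x ^ s ≤ 1 → ∫⁻ y, g y ^ σ ≤ 1 →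
      ∫⁻ x, ∫⁻ y, f x * g y * rieszKernel x y ≤ C := by
  obtain ⟨C₁, hC₁, h₁⟩ := lintegral_rieszKernel_mul_le hs hσ hsσ
  obtain ⟨C₂, hC₂, h₂⟩ := lintegral_rieszKernel_mul_le hσ hs (by rw [add_comm]; exact hsσ)
  refine ⟨C₁ + C₂, by finiteness, fun f g hf hg hf1 hg1 => ?_⟩
  let A : ℂ × ℂ → ENNReal := fun p => f p.1 * (levelCut s σ (f p.1) (g p.2) * rieszKernel p.1 p.2)
  let B : ℂ × ℂ → ENNReal := fun p => g p.1 * (levelCut σ s (g p.1) (f p.2) * rieszKernel p.1 p.2)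
  have hA : Measurable A := (hf.comp measurable_fst).mul (((measurable_levelCut s σ).comp
    ((hf.comp measurable_fst).prodMk (hg.comp measurable_snd))).mul measurable_rieszKernel)
  have hB : Measurable B := (hg.comp measurable_fst).mul (((measurable_levelCut σ s).comp
    ((hg.comp measurable_fst).prodMk (hf.comp measurable_snd))).mul measurable_rieszKernel)
  calc _ ≤ ∫⁻ x, ∫⁻ y, (A (x, y) + B (y, x)) := by
        refine lintegral_mono fun x => lintegral_mono fun y => ?_
        rcases le_total (g y ^ σ) (f x ^ s) with h | h
        · refine le_add_right ?_
          simp only [A, levelCut, if_pos h, mul_assoc, le_refl]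
        · refine le_add_left ?_
          simp only [B, levelCut, if_pos h, rieszKernel_comm y x]
          rw [← mul_assoc, mul_comm (g y)]
    _ = (∫⁻ x, ∫⁻ y, A (x, y)) + ∫⁻ y, ∫⁻ x, B (y, x) := by
        rw [lintegral_lintegral_swap (f := fun y x => B (y, x)) hB.aemeasurable,
          ← lintegral_add_left hA.lintegral_prod_right']
        refine lintegral_congr fun x => ?_
        rw [lintegral_add_left]
        exact hA.comp (measurable_const.prodMk measurable_id)
    _ ≤ _ := add_le_add (lintegral_lintegral_levelCut_le hs h₁ hf hg hf1 hg1)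
        (lintegral_lintegral_levelCut_le hσ h₂ hg hf hg1 hf1)

/-- The Hardy-Littlewood-Sobolev inequality. -/
theorem lintegral_lintegral_rieszKernel_le {s σ : ℝ} (hs : 1 < s) (hσ : 1 < σ)
    (hsσ : 1 / s + 1 / σ = 3 / 2) : ∃ C : ENNReal, C ≠ ⊤ ∧ ∀ (f g : ℂ → ENNReal), Measurable f →
      Measurable g → ∫⁻ x, ∫⁻ y, f x * g y * rieszKernel x y
        ≤ C * (∫⁻ x, f x ^ s) ^ (1 / s) * (∫⁻ y, g y ^ σ) ^ (1 / σ) := by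
  obtain ⟨C, hC, h⟩ := lintegral_lintegral_rieszKernel_le_of_le_one hs hσ hsσ
  refine ⟨C + 1, by finiteness, fun f g hf hg => ?_⟩
  have hs0 : 0 < s := by linarith
  have hσ0 : 0 < σ := by linarith
  have zero_ae : ∀ {s : ℝ}, 0 < s → ∀ f : ℂ → ENNReal, Measurable f →
      (∫⁻ x : ℂ, f x ^ s) ^ (1 / s) = 0 → ∀ᵐ x : ℂ, f x = 0 := by
    intro s hs f hf h0
    rw [ENNReal.rpow_eq_zero_iff_of_pos (by positivity), lintegral_eq_zero_iff (hf.pow_const s)]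
      at h0
    filter_upwards [h0] with x hx
    simpa [hs, hs.not_gt] using hx
  set A := (∫⁻ x, f x ^ s) ^ (1 / s) with hA
  set B := (∫⁻ y, g y ^ σ) ^ (1 / σ) with hB
  by_cases hA0 : A = 0
  · have : ∫⁻ x, ∫⁻ y, f x * g y * rieszKernel x y = ∫⁻ _ : ℂ, 0 := by
      refine lintegral_congr_ae ?_
      filter_upwards [zero_ae hs0 f hf hA0] with x hx
      simp [hx]
    rw [this]; simp
  by_cases hB0 : B = 0
  · have : ∫⁻ x, ∫⁻ y, f x * g y * rieszKernel x y = ∫⁻ _ : ℂ, 0 := by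
      refine lintegral_congr fun x => ?_
      rw [lintegral_congr_ae (g := fun _ => 0)]
      · simp
      filter_upwards [zero_ae hσ0 g hg hB0] with y hy
      simp [hy]
    rw [this]; simp
  by_cases hAt : A = ⊤
  · rw [hAt, ENNReal.mul_top (by simp), ENNReal.top_mul hB0]; exact le_top
  by_cases hBt : B = ⊤
  · rw [hBt, ENNReal.mul_top (by simp [hA0])]; exact le_top
  have norm_one : ∀ {s : ℝ}, 0 < s → ∀ f : ℂ → ENNReal, Measurable f → ∀ A : ENNReal, A ≠ 0 → A ≠ ⊤ →
      A = (∫⁻ x, f x ^ s) ^ (1 / s) → ∫⁻ x, (A⁻¹ * f x) ^ s ≤ 1 := by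
    intro s hs f hf A h0 ht h
    simp_rw [mul_rpow_of_nonneg _ _ hs.le]
    rw [lintegral_const_mul _ (hf.pow_const s)]
    have : ∫⁻ x, f x ^ s = A ^ s := by
      rw [h, ← ENNReal.rpow_mul, one_div_mul_cancel hs.ne', ENNReal.rpow_one]
    rw [this, ENNReal.inv_rpow, ENNReal.inv_mul_cancel]
    · simp [h0, ht]
    · simp [h0, ht]
  have key := h (fun x => A⁻¹ * f x) (fun y => B⁻¹ * g y) (hf.const_mul _) (hg.const_mul _)
    (norm_one hs0 f hf A hA0 hAt hA) (norm_one hσ0 g hg B hB0 hBt hB)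
  have e : ∫⁻ x, ∫⁻ y, (A⁻¹ * f x) * (B⁻¹ * g y) * rieszKernel x y
      = A⁻¹ * B⁻¹ * ∫⁻ x, ∫⁻ y, f x * g y * rieszKernel x y := by
    have hm : Measurable fun p : ℂ × ℂ => f p.1 * g p.2 * rieszKernel p.1 p.2 := by fun_prop
    rw [← lintegral_const_mul _ hm.lintegral_prod_right']
    refine lintegral_congr fun x => ?_
    rw [← lintegral_const_mul _ (f := fun y => f x * g y * rieszKernel x y)
      (hm.comp (measurable_const.prodMk measurable_id))]
    refine lintegral_congr fun y => ?_
    ring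
  rw [e] at key
  calc ∫⁻ x, ∫⁻ y, f x * g y * rieszKernel x y
      = (A * A⁻¹) * (B * B⁻¹) * ∫⁻ x, ∫⁻ y, f x * g y * rieszKernel x y := by
        rw [ENNReal.mul_inv_cancel hA0 hAt, ENNReal.mul_inv_cancel hB0 hBt]; simp
    _ = A * B * (A⁻¹ * B⁻¹ * ∫⁻ x, ∫⁻ y, f x * g y * rieszKernel x y) := by ring
    _ ≤ A * B * (C + 1) := by gcongr; exact key.trans le_self_add
    _ = _ := by ring

/-- The Riesz potential with kernel `1 / |x - y|`. -/
def rieszPotential (f : ℂ → ENNReal) (x : ℂ) : ENNReal := ∫⁻ y, f y * rieszKernel x y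

theorem measurable_rieszPotential {f : ℂ → ENNReal} (hf : Measurable f) :
    Measurable (rieszPotential f) := by
  unfold rieszPotential
  exact (by fun_prop : Measurable fun p : ℂ × ℂ => f p.2 * rieszKernel p.1 p.2).lintegral_prod_right'

theorem lintegral_rieszPotential_rpow_le {r s : ℝ} (hr : 2 < r) (hsr : 1 / s = 1 / r + 1 / 2) :
    ∃ C : ENNReal, C ≠ ⊤ ∧ ∀ f : ℂ → ENNReal, Measurable f →
      (∫⁻ x, rieszPotential f x ^ r) ^ (1 / r) ≤ C * (∫⁻ x, f x ^ s) ^ (1 / s) := by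
  have hr0 : 0 < r := by linarith
  have hs : 1 < s := by
    have h1 : 1 / r < 1 / 2 := one_div_lt_one_div_of_lt (by norm_num) hr
    have h2 : 0 < 1 / s := by rw [hsr]; positivity
    have h3 : 1 / s < 1 := by linarith
    rw [one_div_lt (one_div_pos.1 h2) one_pos] at h3
    simpa using h3
  set σ := r / (r - 1) with hσd
  have hσ : 1 < σ := by rw [hσd, lt_div_iff₀ (by linarith)]; linarith
  have hσi : 1 / σ = 1 - 1 / r := by rw [hσd]; field_simp
  obtain ⟨C, hC, h⟩ := lintegral_lintegral_rieszKernel_le hσ hs (by rw [hσi, hsr]; ring)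
  refine ⟨C, hC, fun f hf => ?_⟩
  have hIm := measurable_rieszPotential hf
  set D := C * (∫⁻ x, f x ^ s) ^ (1 / s) with hD
  let hn : ℕ → ℂ → ENNReal := fun n => (ball (0 : ℂ) n).indicator
    fun x => min (rieszPotential f x) n
  have hnm : ∀ n, Measurable (hn n) := fun n =>
    (hIm.min measurable_const).indicator isOpen_ball.measurableSet
  have hnle : ∀ n x, hn n x ≤ rieszPotential f x := fun n x =>
    (Set.indicator_le_self _ _ _).trans (min_le_left _ _)
  have hnle' : ∀ n x, hn n x ≤ n := fun n x =>
    (Set.indicator_le_self _ _ _).trans (min_le_right _ _)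
  have bound : ∀ n, (∫⁻ x, hn n x ^ r) ≤ D ^ r := by
    intro n
    set X := ∫⁻ x, hn n x ^ r with hX
    have hXt : X ≠ ⊤ := by
      refine (lt_of_le_of_lt (b := ∫⁻ x in ball (0 : ℂ) n, (n : ENNReal) ^ r) ?_ ?_).ne
      · rw [← lintegral_indicator isOpen_ball.measurableSet]
        refine lintegral_mono fun x => ?_
        by_cases hx : x ∈ ball (0 : ℂ) n
        · rw [indicator_of_mem hx]; gcongr; exact hnle' n x
        · rw [indicator_of_notMem hx]
          simp only [hn, indicator_of_notMem hx]
          rw [zero_rpow_of_pos hr0]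
      · rw [setLIntegral_const]
        exact ENNReal.mul_lt_top (ENNReal.rpow_lt_top_of_nonneg hr0.le (by simp))
          measure_ball_lt_top
    have step : X ≤ D * X ^ (1 / σ) := by
      calc X ≤ ∫⁻ x, hn n x ^ (r - 1) * rieszPotential f x := by
            refine lintegral_mono fun x => ?_
            by_cases h0 : hn n x = 0
            · simp only [h0, zero_rpow_of_pos hr0]; exact zero_le
            calc hn n x ^ r = hn n x ^ (r - 1) * hn n x ^ (1 : ℝ) := by
                  rw [← ENNReal.rpow_add _ _ h0 ((hnle' n x).trans_lt (by simp)).ne]; congr 1; ring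
              _ ≤ _ := by rw [ENNReal.rpow_one]; gcongr; exact hnle n x
        _ = ∫⁻ x, ∫⁻ y, hn n x ^ (r - 1) * f y * rieszKernel x y := by
            refine lintegral_congr fun x => ?_
            unfold rieszPotential
            rw [← lintegral_const_mul _ (by unfold rieszKernel; fun_prop)]
            refine lintegral_congr fun y => by ring
        _ ≤ C * (∫⁻ x, (hn n x ^ (r - 1)) ^ σ) ^ (1 / σ) * (∫⁻ y, f y ^ s) ^ (1 / s) :=
            h _ _ ((hnm n).pow_const _) hf
        _ = D * X ^ (1 / σ) := by
            have : (r - 1) * σ = r := by rw [hσd]; field_simp [show r - 1 ≠ 0 by linarith]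
            simp_rw [← ENNReal.rpow_mul, this]
            rw [hD]; ring
    by_cases hX0 : X = 0
    · rw [hX0]; exact zero_le
    have h2 : X ^ (1 / r) ≤ D := by
      have h3 : X ^ (1 / σ) ≠ 0 := by simp [hX0, hXt]
      have h4 : X ^ (1 / σ) ≠ ⊤ := rpow_ne_top_of_nonneg (by positivity) hXt
      have h5 : X = X ^ (1 / r) * X ^ (1 / σ) := by
        rw [← ENNReal.rpow_add _ _ hX0 hXt, hσi]
        simp
      rw [← ENNReal.mul_le_mul_iff_left h3 h4, ← h5]
      exact step
    calc X = (X ^ (1 / r)) ^ r := by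
          rw [← ENNReal.rpow_mul, one_div_mul_cancel hr0.ne', ENNReal.rpow_one]
      _ ≤ D ^ r := by gcongr
  have hlim : ∀ x, ⨆ n, hn n x ^ r = rieszPotential f x ^ r := by
    intro x
    refine le_antisymm (iSup_le fun n => by gcongr; exact hnle n x) ?_
    refine le_of_forall_lt fun c hc => ?_
    have hc' : c ^ (1 / r) < rieszPotential f x := by
      rw [one_div, ENNReal.rpow_inv_lt_iff hr0]; exact hc
    obtain ⟨n₁, hn₁⟩ := ENNReal.exists_nat_gt (hc'.trans_le le_top).ne
    obtain ⟨n₂, hn₂⟩ := exists_nat_gt ‖x‖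
    refine lt_of_lt_of_le ?_ (le_iSup _ (max n₁ n₂))
    rw [← ENNReal.rpow_inv_lt_iff hr0, ← one_div]
    have hx : x ∈ ball (0 : ℂ) ((max n₁ n₂ : ℕ) : ℝ) := by
      rw [mem_ball_zero_iff]
      exact hn₂.trans_le (by exact_mod_cast le_max_right _ _)
    simp only [hn, indicator_of_mem hx]
    refine lt_min hc' (hn₁.trans_le ?_)
    exact_mod_cast le_max_left _ _
  have hmono : Monotone fun n x => hn n x ^ r := by
    intro n m hnm x
    dsimp only
    gcongr
    have hsub : ball (0 : ℂ) n ⊆ ball (0 : ℂ) m :=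
      ball_subset_ball (by exact_mod_cast hnm)
    simp only [hn]
    by_cases hx : x ∈ ball (0 : ℂ) n
    · rw [indicator_of_mem hx, indicator_of_mem (hsub hx)]
      gcongr
    · rw [indicator_of_notMem hx]; exact zero_le
  have hfinal : ∫⁻ x, rieszPotential f x ^ r ≤ D ^ r := by
    simp_rw [← hlim]
    rw [lintegral_iSup (fun n => (hnm n).pow_const r) hmono]
    exact iSup_le bound
  calc _ ≤ (D ^ r) ^ (1 / r) := by gcongr
    _ = D := by rw [← ENNReal.rpow_mul, mul_one_div_cancel hr0.ne', ENNReal.rpow_one]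

end HLS

/-! ### The Cauchy transform -/

section CauchyTransform

variable {E : Type*} [NormedAddCommGroup E] [NormedSpace ℂ E]

/-- The Cauchy transform `f ↦ (1 / (π z)) ⋆ f`, a right inverse of `∂̄`. -/
def cauchyT (f : ℂ → E) (z : ℂ) : E := ∫ w, ((π : ℂ) * (z - w))⁻¹ • f w

theorem enorm_kernel_le (z w : ℂ) : ‖((π : ℂ) * (z - w))⁻¹‖ₑ ≤ rieszKernel z w := by
  rw [mul_inv, enorm_mul, rieszKernel]
  have h1 : ‖((π : ℂ))⁻¹‖ₑ ≤ 1 := by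
    have : ‖((π : ℂ))⁻¹‖ ≤ 1 := by
      rw [norm_inv, norm_real, norm_of_nonneg pi_pos.le]
      exact inv_le_one_of_one_le₀ (by linarith [pi_gt_three])
    rw [← ofReal_norm]
    exact ENNReal.ofReal_le_one.2 this
  have h2 : ‖(z - w)⁻¹‖ₑ ≤ ‖z - w‖ₑ⁻¹ := by
    by_cases h : z - w = 0
    · simp [h]
    · rw [enorm_inv h]
  calc _ ≤ 1 * ‖z - w‖ₑ⁻¹ := mul_le_mul' h1 h2
    _ = _ := one_mul _

theorem enorm_cauchyT_le (f : ℂ → E) (z : ℂ) :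
    ‖cauchyT f z‖ₑ ≤ rieszPotential (fun w => ‖f w‖ₑ) z := by
  refine (enorm_integral_le_lintegral_enorm _).trans (lintegral_mono fun w => ?_)
  rw [enorm_smul, mul_comm]
  gcongr
  exact enorm_kernel_le z w

theorem cauchyT_congr_ae {f g : ℂ → E} (h : f =ᵐ[volume] g) : cauchyT f = cauchyT g := by
  ext z
  refine integral_congr_ae ?_
  filter_upwards [h] with w hw
  rw [hw]

theorem measurable_cauchyKernel :
    Measurable fun p : ℂ × ℂ => ((π : ℂ) * (p.1 - p.2))⁻¹ := by fun_prop

theorem aestronglyMeasurable_cauchyT {f : ℂ → E} (hf : AEStronglyMeasurable f) :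
    AEStronglyMeasurable (cauchyT f) := by
  have h : AEStronglyMeasurable (fun p : ℂ × ℂ => ((π : ℂ) * (p.1 - p.2))⁻¹ • f p.2)
      (volume.prod volume) :=
    measurable_cauchyKernel.aestronglyMeasurable.smul hf.comp_snd
  exact h.integral_prod_right'

/-- The exponent `s` with `1 / s = 1 / r + 1 / 2`. -/
def sobExp (r : ENNReal) : ENNReal := (r⁻¹ + 2⁻¹)⁻¹

theorem holderTriple_sobExp' (r : ENNReal) : ENNReal.HolderTriple 2 r (sobExp r) :=
  ⟨by rw [sobExp, inv_inv, add_comm]⟩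

theorem sobExp_mono {r t : ENNReal} (h : r ≤ t) : sobExp r ≤ sobExp t := by
  unfold sobExp
  gcongr

theorem sobExp_le_two (r : ENNReal) : sobExp r ≤ 2 := by
  rw [sobExp, ENNReal.inv_le_iff_inv_le]
  exact le_add_self

theorem one_lt_sobExp {r : ENNReal} (hr : 2 < r) : 1 < sobExp r := by
  rw [sobExp, ENNReal.one_lt_inv]
  calc r⁻¹ + 2⁻¹ < 2⁻¹ + 2⁻¹ := by
        refine ENNReal.add_lt_add_right (by simp) ?_
        rwa [ENNReal.inv_lt_inv]
    _ = 1 := inv_two_add_inv_two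

theorem sobExp_ne_zero {r : ENNReal} (hr : 2 < r) : sobExp r ≠ 0 :=
  (one_pos.trans (one_lt_sobExp hr)).ne'

theorem sobExp_ne_top (r : ENNReal) : sobExp r ≠ ⊤ := ((sobExp_le_two r).trans_lt (by simp)).ne

theorem one_div_toReal_sobExp {r : ENNReal} (hr : 2 < r) :
    1 / (sobExp r).toReal = 1 / r.toReal + 1 / 2 := by
  rw [sobExp, ENNReal.toReal_inv, one_div, inv_inv, ENNReal.toReal_add, ENNReal.toReal_inv]
  · simp
  · simp [(zero_lt_two.trans hr).ne']
  · simp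

omit [NormedSpace ℂ E] in
theorem exists_eLpNorm_rieszPotential_le {r : ENNReal} (hr : 2 < r) (hr' : r < ⊤) :
    ∃ C : ENNReal, C ≠ ⊤ ∧ ∀ f : ℂ → E, AEStronglyMeasurable f →
      eLpNorm (rieszPotential fun w => ‖f w‖ₑ) r volume ≤ C * eLpNorm f (sobExp r) volume := by
  have h2 : 2 < r.toReal := by
    have := (toReal_lt_toReal (by simp) hr'.ne).2 hr
    simpa using this
  obtain ⟨C, hC, h⟩ := lintegral_rieszPotential_rpow_le h2 (one_div_toReal_sobExp hr)
  refine ⟨C, hC, fun f hf => ?_⟩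
  have hpot : (rieszPotential fun w => ‖f w‖ₑ) = rieszPotential fun w => ‖hf.mk f w‖ₑ := by
    ext z
    refine lintegral_congr_ae ?_
    filter_upwards [hf.ae_eq_mk] with w hw
    rw [hw]
  rw [eLpNorm_congr_ae hf.ae_eq_mk, hpot,
    eLpNorm_eq_lintegral_rpow_enorm_toReal (by rintro rfl; simp at hr) hr'.ne,
    eLpNorm_eq_lintegral_rpow_enorm_toReal (sobExp_ne_zero hr) (sobExp_ne_top r)]
  exact h _ hf.stronglyMeasurable_mk.enorm

/-- The norm of the Cauchy transform from `L^s` to `L^r`, where `1 / s = 1 / r + 1 / 2`. -/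
theorem exists_eLpNorm_cauchyT_le (E : Type*) [NormedAddCommGroup E] [NormedSpace ℂ E]
    {r : ENNReal} (hr : 2 < r) (hr' : r < ⊤) :
    ∃ C : ENNReal, C ≠ ⊤ ∧ ∀ f : ℂ → E, AEStronglyMeasurable f →
      eLpNorm (cauchyT f) r volume ≤ C * eLpNorm f (sobExp r) volume := by
  obtain ⟨C, hC, h⟩ := exists_eLpNorm_rieszPotential_le (E := E) hr hr'
  refine ⟨C, hC, fun f hf => le_trans ?_ (h f hf)⟩
  exact eLpNorm_mono_enorm fun z => enorm_cauchyT_le f z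

theorem memLp_cauchyT {r : ENNReal} (hr : 2 < r) (hr' : r < ⊤) {f : ℂ → E}
    (hf : MemLp f (sobExp r)) : MemLp (cauchyT f) r := by
  obtain ⟨C, hC, h⟩ := exists_eLpNorm_cauchyT_le E hr hr'
  exact ⟨aestronglyMeasurable_cauchyT hf.1, (h f hf.1).trans_lt
    (ENNReal.mul_lt_top hC.lt_top hf.2)⟩

omit [NormedSpace ℂ E] in
theorem rieszPotential_lt_top {r : ENNReal} (hr : 2 < r) (hr' : r < ⊤) {f : ℂ → E}
    (hf : MemLp f (sobExp r)) :
    ∀ᵐ z, rieszPotential (fun w => ‖f w‖ₑ) z < ⊤ := by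
  obtain ⟨C, hC, h⟩ := exists_eLpNorm_rieszPotential_le (E := E) hr hr'
  have h1 := (h f hf.1).trans_lt (ENNReal.mul_lt_top hC.lt_top hf.2)
  have h0 : r ≠ 0 := (zero_lt_two.trans hr).ne'
  have hmeas : AEMeasurable (rieszPotential fun w => ‖f w‖ₑ) := by
    have hpot : (rieszPotential fun w => ‖f w‖ₑ) = rieszPotential fun w => ‖hf.1.mk f w‖ₑ := by
      ext z
      refine lintegral_congr_ae ?_
      filter_upwards [hf.1.ae_eq_mk] with w hw
      rw [hw]
    rw [hpot]
    exact (measurable_rieszPotential hf.1.stronglyMeasurable_mk.enorm).aemeasurable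
  have h2 := (eLpNorm_lt_top_iff_lintegral_rpow_enorm_lt_top h0 hr'.ne).1 h1
  filter_upwards [ae_lt_top' (hmeas.enorm.pow_const _) h2.ne] with z hz
  by_contra h3
  rw [not_lt_top_iff] at h3
  simp only [h3, enorm_eq_self, ENNReal.top_rpow_of_pos (toReal_pos h0 hr'.ne)] at hz
  exact lt_irrefl _ hz

theorem integrable_cauchyT_integrand {r : ENNReal} (hr : 2 < r) (hr' : r < ⊤) {f : ℂ → E}
    (hf : MemLp f (sobExp r)) :
    ∀ᵐ z, Integrable fun w => ((π : ℂ) * (z - w))⁻¹ • f w := by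
  filter_upwards [rieszPotential_lt_top hr hr' hf] with z hz
  refine ⟨?_, lt_of_le_of_lt (lintegral_mono fun w => ?_) hz⟩
  · exact (by fun_prop : Measurable fun w : ℂ =>
      ((π : ℂ) * (z - w))⁻¹).aestronglyMeasurable.smul hf.1
  · dsimp only
    rw [enorm_smul, mul_comm]
    gcongr
    exact enorm_kernel_le z w

theorem cauchyT_add {r : ENNReal} (hr : 2 < r) (hr' : r < ⊤) {f g : ℂ → E}
    (hf : MemLp f (sobExp r)) (hg : MemLp g (sobExp r)) :
    cauchyT (fun w => f w + g w) =ᵐ[volume] fun z => cauchyT f z + cauchyT g z := by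
  filter_upwards [integrable_cauchyT_integrand hr hr' hf, integrable_cauchyT_integrand hr hr' hg]
    with z h1 h2
  simp only [cauchyT, smul_add]
  exact integral_add h1 h2

theorem cauchyT_sub {r : ENNReal} (hr : 2 < r) (hr' : r < ⊤) {f g : ℂ → E}
    (hf : MemLp f (sobExp r)) (hg : MemLp g (sobExp r)) :
    cauchyT (fun w => f w - g w) =ᵐ[volume] fun z => cauchyT f z - cauchyT g z := by
  filter_upwards [integrable_cauchyT_integrand hr hr' hf, integrable_cauchyT_integrand hr hr' hg]
    with z h1 h2
  simp only [cauchyT, smul_sub]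
  exact integral_sub h1 h2

/-- For `r > 2`, the Cauchy transform is bounded from `L^r ∩ L^1` to `L^∞`. -/
theorem exists_enorm_cauchyT_le (E : Type*) [NormedAddCommGroup E] [NormedSpace ℂ E]
    {r : ENNReal} (hr : 2 < r) (hr' : r < ⊤) :
    ∃ C : ENNReal, C ≠ ⊤ ∧ ∀ f : ℂ → E, AEStronglyMeasurable f → ∀ z,
      rieszPotential (fun w => ‖f w‖ₑ) z ≤ C * eLpNorm f r volume + eLpNorm f 1 volume := by
  have h0 : r ≠ 0 := (zero_lt_two.trans hr).ne'
  have h2 : 2 < r.toReal := by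
    have := (toReal_lt_toReal (by simp) hr'.ne).2 hr
    simpa using this
  set ρ := r.toReal with hρ
  have hconj : ρ.HolderConjugate (ρ / (ρ - 1)) := Real.HolderConjugate.conjExponent (by linarith)
  set ρ' := ρ / (ρ - 1) with hρ'
  have hρ'2 : ρ' < 2 := by rw [hρ', div_lt_iff₀ (by linarith)]; linarith
  have hρ'0 : 0 < ρ' := hconj.symm.pos
  refine ⟨(∫⁻ z in ball (0 : ℂ) 1, (‖z‖ₑ⁻¹) ^ ρ') ^ (1 / ρ'), ?_, fun f hf z => ?_⟩
  · rw [lintegral_kernel_ball hρ'2 one_pos]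
    exact rpow_ne_top_of_nonneg (by positivity) (by simp)
  have hb : MeasurableSet (ball (0 : ℂ) 1) := isOpen_ball.measurableSet
  have hm : Measurable fun w => (ball (0 : ℂ) 1).indicator (fun u => ‖u‖ₑ⁻¹) (z - w) :=
    ((by fun_prop : Measurable fun u : ℂ => ‖u‖ₑ⁻¹).indicator hb).comp (by fun_prop)
  calc rieszPotential (fun w => ‖f w‖ₑ) z
      ≤ ∫⁻ w, (‖f w‖ₑ * (ball (0 : ℂ) 1).indicator (fun u => ‖u‖ₑ⁻¹) (z - w) + ‖f w‖ₑ) := by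
        refine lintegral_mono fun w => ?_
        by_cases h : z - w ∈ ball (0 : ℂ) 1
        · rw [indicator_of_mem h]; exact le_self_add
        · rw [indicator_of_notMem h, mul_zero, zero_add]
          refine mul_le_of_le_one_right' ?_
          rw [rieszKernel, ENNReal.inv_le_one, ← ofReal_norm, ENNReal.one_le_ofReal]
          simpa using h
    _ = (∫⁻ w, ‖f w‖ₑ * (ball (0 : ℂ) 1).indicator (fun u => ‖u‖ₑ⁻¹) (z - w))
        + eLpNorm f 1 volume := by
        rw [lintegral_add_right' _ hf.enorm, eLpNorm_one_eq_lintegral_enorm]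
    _ ≤ _ := by
        gcongr
        refine (lintegral_mul_le_Lp_mul_Lq _ hconj hf.enorm hm.aemeasurable).trans_eq ?_
        rw [eLpNorm_eq_lintegral_rpow_enorm_toReal h0 hr'.ne, mul_comm]
        congr 2
        rw [← lintegral_indicator hb, ← lintegral_sub_left_eq_self _ z]
        refine lintegral_congr fun w => ?_
        rw [sub_sub_cancel]
        by_cases h : w ∈ ball (0 : ℂ) 1
        · rw [indicator_of_mem h, indicator_of_mem h]
        · rw [indicator_of_notMem h, indicator_of_notMem h, zero_rpow_of_pos hρ'0]

theorem lintegral_lintegral_enorm_rieszKernel_lt_top {r r' : ENNReal} (hr : 2 < r) (hrt : r < ⊤)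
    (hrr : r.HolderConjugate r') {f g : ℂ → ℂ} (hf : MemLp f (sobExp r))
    (hg : MemLp g r') : ∫⁻ x, ∫⁻ y, ‖f x‖ₑ * ‖g y‖ₑ * rieszKernel x y < ⊤ := by
  obtain ⟨C, hC, h⟩ := exists_eLpNorm_rieszPotential_le (E := ℂ) hr hrt
  have h1 : ∫⁻ x, ∫⁻ y, ‖f x‖ₑ * ‖g y‖ₑ * rieszKernel x y
      = ∫⁻ y, ‖g y‖ₑ * rieszPotential (fun x => ‖f x‖ₑ) y := by
    rw [lintegral_lintegral_swap]
    · refine lintegral_congr fun y => ?_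
      unfold rieszPotential
      have hk : AEMeasurable fun x => rieszKernel y x := by unfold rieszKernel; fun_prop
      have hm : AEMeasurable fun x => ‖f x‖ₑ * rieszKernel y x := hf.1.enorm.mul hk
      rw [← lintegral_const_mul'' _ hm]
      refine lintegral_congr fun x => ?_
      rw [rieszKernel_comm]; ring
    · exact (hf.1.enorm.comp_fst.mul hg.1.enorm.comp_snd).mul measurable_rieszKernel.aemeasurable
  rw [h1]
  have hpot : (rieszPotential fun w => ‖f w‖ₑ) = rieszPotential fun w => ‖hf.1.mk f w‖ₑ := by
    ext z
    refine lintegral_congr_ae ?_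
    filter_upwards [hf.1.ae_eq_mk] with w hw
    rw [hw]
  have hmeas : Measurable (rieszPotential fun w => ‖f w‖ₑ) := by
    rw [hpot]; exact measurable_rieszPotential hf.1.stronglyMeasurable_mk.enorm
  have h3 := (h f hf.1).trans_lt (ENNReal.mul_lt_top hC.lt_top hf.2)
  have h4 : eLpNorm (rieszPotential fun w => ‖f w‖ₑ) r volume ≠ ⊤ := h3.ne
  have h5 : eLpNorm g r' volume ≠ ⊤ := hg.2.ne
  have h0 : r ≠ 0 := (zero_lt_two.trans hr).ne'
  have hr1 : 1 < r.toReal := by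
    have := (toReal_lt_toReal (by simp) hrt.ne).2 hr
    simp at this; linarith
  have hr't : r' ≠ ⊤ := by
    rintro rfl
    have := hrr.inv_add_inv_eq_one
    simp at this
    rw [this] at hr1; simp at hr1
  have hr'0 : r' ≠ 0 := by
    rintro rfl
    have := hrr.inv_add_inv_eq_one
    simp at this
  have hconj : r'.toReal.HolderConjugate r.toReal :=
    (ENNReal.HolderConjugate.toReal_of_ne_top hrt.ne hr't).symm
  refine lt_of_le_of_lt (lintegral_mul_le_Lp_mul_Lq _ hconj hg.1.enorm hmeas.aemeasurable) ?_
  rw [eLpNorm_eq_lintegral_rpow_enorm_toReal h0 hrt.ne] at h4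
  rw [eLpNorm_eq_lintegral_rpow_enorm_toReal hr'0 hr't] at h5
  exact ENNReal.mul_lt_top h5.lt_top (by simpa using h4.lt_top)

/-- The Cauchy transform is antisymmetric. -/
theorem integral_mul_cauchyT {r r' : ENNReal} (hr : 2 < r) (hrt : r < ⊤)
    (hrr : r.HolderConjugate r') {f g : ℂ → ℂ} (hf : MemLp f (sobExp r))
    (hg : MemLp g r') : ∫ z, f z * cauchyT g z = -∫ z, cauchyT f z * g z := by
  have hfin := lintegral_lintegral_enorm_rieszKernel_lt_top hr hrt hrr hf hg
  have hmeas : AEStronglyMeasurable (fun p : ℂ × ℂ =>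
      f p.1 * (((π : ℂ) * (p.1 - p.2))⁻¹ * g p.2)) (volume.prod volume) :=
    hf.1.comp_fst.mul (measurable_cauchyKernel.aestronglyMeasurable.mul hg.1.comp_snd)
  have hint : Integrable (fun p : ℂ × ℂ =>
      f p.1 * (((π : ℂ) * (p.1 - p.2))⁻¹ * g p.2)) (volume.prod volume) := by
    refine ⟨hmeas, ?_⟩
    rw [HasFiniteIntegral, lintegral_prod _ hmeas.enorm]
    refine lt_of_le_of_lt (lintegral_mono fun x => lintegral_mono fun y => ?_) hfin
    dsimp only
    rw [enorm_mul, enorm_mul, mul_assoc, mul_comm ‖g y‖ₑ]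
    gcongr
    exact enorm_kernel_le x y
  have h1 : ∫ z, f z * cauchyT g z
      = ∫ z, ∫ w, f z * (((π : ℂ) * (z - w))⁻¹ * g w) := by
    refine integral_congr_ae (.of_forall fun z => ?_)
    simp only [cauchyT, smul_eq_mul]
    rw [integral_const_mul]
  rw [h1, integral_integral_swap (f := fun z w => f z * (((π : ℂ) * (z - w))⁻¹ * g w)) hint,
    ← integral_neg]
  refine integral_congr_ae (.of_forall fun w => ?_)
  simp only [cauchyT, smul_eq_mul]
  rw [← neg_mul, ← integral_neg, ← integral_mul_const]
  refine integral_congr_ae (.of_forall fun z => ?_)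
  dsimp only
  have : ((π : ℂ) * (w - z))⁻¹ = -((π : ℂ) * (z - w))⁻¹ := by
    rw [← inv_neg]; congr 1; ring
  rw [this]; ring

end CauchyTransform

/-! ### The Cauchy transform inverts `∂̄` -/

section Pompeiu

variable {E : Type*} [NormedAddCommGroup E] [NormedSpace ℂ E]

theorem integral_Ioi_deriv_radial {h : ℂ → ℂ} (hh : ContDiff ℝ 1 h) (hc : HasCompactSupport h)
    (e : ℂ) (he : ‖e‖ = 1) :
    ∫ r in Ioi (0 : ℝ), fderiv ℝ h (r * e) e = -h 0 := by
  have hd : ∀ r : ℝ, HasDerivAt (fun r : ℝ => h (r * e)) (fderiv ℝ h (r * e) e) r := by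
    intro r
    have h1 : HasDerivAt (fun r : ℝ => (r : ℂ) * e) e r := by
      simpa using (Complex.ofRealCLM.hasDerivAt (x := r)).mul_const e
    exact ((hh.differentiable (by simp)) _).hasFDerivAt.comp_hasDerivAt r h1
  have hcs : HasCompactSupport fun r : ℝ => h (r * e) := by
    obtain ⟨R, hR⟩ := hc.isCompact.isBounded.subset_closedBall 0
    refine HasCompactSupport.intro (isCompact_closedBall (0 : ℝ) R) fun r hr => ?_
    by_contra h0
    have := hR (subset_tsupport _ h0)
    rw [mem_closedBall_zero_iff, norm_mul, he, mul_one, norm_real] at this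
    exact hr (by simpa using this)
  have hcont : Continuous fun r : ℝ => fderiv ℝ h (r * e) e :=
    ((hh.continuous_fderiv (by simp)).comp (by fun_prop)).clm_apply continuous_const
  have hcs' : HasCompactSupport fun r : ℝ => fderiv ℝ h (r * e) e := by
    have : (fun r : ℝ => fderiv ℝ h (r * e) e) = deriv fun r : ℝ => h (r * e) := by
      ext r; exact (hd r).deriv.symm
    rw [this]; exact hcs.deriv
  have := integral_Ioi_of_hasDerivAt_of_tendsto' (a := (0 : ℝ)) (m := 0) (fun r _ => hd r)
    (hcont.integrable_of_hasCompactSupport hcs').integrableOn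
    (hcs.is_zero_at_infty.mono_left atTop_le_cocompact)
  rw [this]; simp

theorem integral_angular_deriv {h : ℂ → ℂ} (hh : ContDiff ℝ 1 h) {r : ℝ} (hr : 0 < r) :
    ∫ θ in Set.Ioo (-π) π, fderiv ℝ h (r * (cos θ + sin θ * I))
      (-sin θ + cos θ * I) = 0 := by
  have hd : ∀ θ : ℝ, HasDerivAt (fun θ : ℝ => h (r * (cos θ + sin θ * I)))
      (fderiv ℝ h (r * (cos θ + sin θ * I))
        (r * (-sin θ + cos θ * I))) θ := by
    intro θ
    have h1 : HasDerivAt (fun θ : ℝ => (r : ℂ) * (cos θ + sin θ * I))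
        (r * (-sin θ + cos θ * I)) θ := by
      have hc := (Real.hasDerivAt_cos θ).ofReal_comp
      have hs := ((Real.hasDerivAt_sin θ).ofReal_comp).mul_const I
      simpa using (hc.add hs).const_mul (r : ℂ)
    exact ((hh.differentiable (by simp)) _).hasFDerivAt.comp_hasDerivAt θ h1
  have hcont : Continuous fun θ : ℝ => fderiv ℝ h (r * (cos θ + sin θ * I))
        (r * (-sin θ + cos θ * I)) :=
    ((hh.continuous_fderiv (by simp)).comp (by fun_prop)).clm_apply (by fun_prop)
  have h2 := intervalIntegral.integral_eq_sub_of_hasDerivAt (a := -π) (b := π)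
    (fun θ _ => hd θ) (hcont.intervalIntegrable _ _)
  rw [intervalIntegral.integral_of_le (by linarith [pi_pos]),
    integral_Ioc_eq_integral_Ioo] at h2
  have h3 : ∀ θ : ℝ, fderiv ℝ h (r * (cos θ + sin θ * I))
        (r * (-sin θ + cos θ * I))
      = r • fderiv ℝ h (r * (cos θ + sin θ * I))
        (-sin θ + cos θ * I) := by
    intro θ
    rw [← map_smul, real_smul]
  simp_rw [h3] at h2
  rw [integral_smul] at h2
  simp only [Real.cos_pi, Real.sin_pi, Real.cos_neg, Real.sin_neg, neg_zero, sub_self,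
    smul_eq_zero] at h2
  exact h2.resolve_left hr.ne'

theorem integral_inv_mul_delBar {h : ℂ → ℂ} (hh : ContDiff ℝ 1 h) (hc : HasCompactSupport h) :
    ∫ u, ((π : ℂ) * u)⁻¹ * delBar h u = -h 0 := by
  let e : ℝ → ℂ := fun θ => cos θ + sin θ * I
  let e' : ℝ → ℂ := fun θ => -sin θ + cos θ * I
  have hpi : (π : ℂ) ≠ 0 := by exact_mod_cast Real.pi_ne_zero
  have hnorm : ∀ θ, ‖e θ‖ = 1 := by
    intro θ
    simp only [e]
    rw [show (cos θ : ℂ) + sin θ * I = Complex.exp (θ * I) by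
      rw [Complex.exp_mul_I]; push_cast; rfl]
    exact Complex.norm_exp_ofReal_mul_I θ
  have hee : ∀ θ, e θ * (cos θ - sin θ * I) = 1 := by
    intro θ
    have h1 : (cos θ : ℂ) ^ 2 + (sin θ : ℂ) ^ 2 = 1 := by
      exact_mod_cast Real.cos_sq_add_sin_sq θ
    simp only [e]
    linear_combination h1 - (sin θ : ℂ) ^ 2 * Complex.I_sq
  have he0 : ∀ θ, e θ ≠ 0 := fun θ h0 => by simpa [h0] using hee θ
  let F : ℝ × ℝ → ℂ := fun p => fderiv ℝ h (p.1 * e p.2) (e p.2)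
  let G : ℝ × ℝ → ℂ := fun p => fderiv ℝ h (p.1 * e p.2) (e' p.2)
  have hpt : ∀ p : ℝ × ℝ, p ∈ polarCoord.target → p.1 • (((π : ℂ) *
      Complex.polarCoord.symm p)⁻¹ * delBar h (Complex.polarCoord.symm p))
      = (2 * (π : ℂ))⁻¹ * (F p + I * G p) := by
    intro p hp
    have hr : (p.1 : ℂ) ≠ 0 := by
      have : 0 < p.1 := hp.1
      exact_mod_cast this.ne'
    rw [Complex.polarCoord_symm_apply]
    change p.1 • (((π : ℂ) * (p.1 * e p.2))⁻¹ * delBar h (p.1 * e p.2)) = _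
    have hL : ∀ x y : ℝ, fderiv ℝ h (p.1 * e p.2) (x + y * I)
        = x * fderiv ℝ h (p.1 * e p.2) 1 + y * fderiv ℝ h (p.1 * e p.2) I := by
      intro x y
      have : (x : ℂ) + y * I = x • (1 : ℂ) + y • I := by simp [real_smul]
      rw [this, map_add, map_smul, map_smul, real_smul, real_smul]
    have hF : F p = cos p.2 * fderiv ℝ h (p.1 * e p.2) 1
        + sin p.2 * fderiv ℝ h (p.1 * e p.2) I := hL _ _
    have hG : G p = -sin p.2 * fderiv ℝ h (p.1 * e p.2) 1
        + cos p.2 * fderiv ℝ h (p.1 * e p.2) I := by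
      have := hL (-sin p.2) (cos p.2)
      push_cast at this
      simpa [G, e'] using this
    rw [hF, hG, delBar, real_smul, mul_inv, mul_inv, mul_inv]
    set a := fderiv ℝ h (p.1 * e p.2) 1
    set b := fderiv ℝ h (p.1 * e p.2) I
    have h1 := hee p.2
    have h2 : (e p.2)⁻¹ = cos p.2 - sin p.2 * I :=
      (eq_inv_of_mul_eq_one_right h1).symm
    rw [h2]
    field_simp
    linear_combination (-(sin p.2 : ℂ) * b) * Complex.I_sq
  rw [← Complex.integral_comp_polarCoord_symm, setIntegral_congr_fun
    polarCoord.open_target.measurableSet hpt, polarCoord_target]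
  obtain ⟨R, hR⟩ := hc.isCompact.isBounded.subset_closedBall 0
  have hcontF : Continuous F := ((hh.continuous_fderiv (by simp)).comp (by fun_prop)).clm_apply
    (by fun_prop)
  have hcontG : Continuous G := ((hh.continuous_fderiv (by simp)).comp (by fun_prop)).clm_apply
    (by fun_prop)
  have hsupp : ∀ p : ℝ × ℝ, R < p.1 → fderiv ℝ h (p.1 * e p.2) = 0 := by
    intro p hp
    by_contra h0
    have h1 := hR (support_fderiv_subset ℝ h0)
    rw [mem_closedBall_zero_iff, norm_mul, hnorm, mul_one, norm_real] at h1
    exact absurd ((le_abs_self _).trans h1) (not_le.2 hp)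
  have hint : ∀ H : ℝ × ℝ → ℂ, Continuous H → (∀ p : ℝ × ℝ, R < p.1 → H p = 0) →
      IntegrableOn H (Ioi 0 ×ˢ Set.Ioo (-π) π) := by
    intro H hH h0
    have hK : IntegrableOn H (Icc 0 R ×ˢ Icc (-π) π) :=
      hH.continuousOn.integrableOn_compact (isCompact_Icc.prod isCompact_Icc)
    refine hK.of_forall_sdiff_eq_zero (measurableSet_Ioi.prod measurableSet_Ioo) ?_
    rintro p ⟨⟨h1, h2⟩, h3⟩
    refine h0 p ?_
    by_contra h4
    exact h3 ⟨⟨le_of_lt h1, not_lt.1 h4⟩, Set.Ioo_subset_Icc_self h2⟩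
  have hFi := hint F hcontF fun p hp => by simp [F, hsupp p hp]
  have hGi := hint G hcontG fun p hp => by simp [G, hsupp p hp]
  rw [integral_const_mul, integral_add hFi (hGi.const_mul _), integral_const_mul]
  have hFv : ∫ p in Ioi (0 : ℝ) ×ˢ Set.Ioo (-π) π, F p
      = -(2 * π : ℂ) * h 0 := by
    rw [Measure.volume_eq_prod, ← Measure.prod_restrict, integral_prod_symm _
      (by rw [Measure.prod_restrict]; exact hFi)]
    have : ∀ θ : ℝ, ∫ r in Ioi (0 : ℝ), F (r, θ) = -h 0 := fun θ =>
      integral_Ioi_deriv_radial hh hc (e θ) (hnorm θ)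
    simp_rw [this]
    rw [setIntegral_const, measureReal_def, Real.volume_Ioo, ENNReal.toReal_ofReal
      (by linarith [pi_pos]), real_smul]
    push_cast; ring
  have hGv : ∫ p in Ioi (0 : ℝ) ×ˢ Set.Ioo (-π) π, G p = 0 := by
    rw [Measure.volume_eq_prod, setIntegral_prod _ hGi]
    rw [setIntegral_congr_fun measurableSet_Ioi (g := fun _ => (0 : ℂ))]
    · simp
    · intro r hr
      exact integral_angular_deriv hh hr
  rw [hFv, hGv]
  field_simp
  ring

/-- The Cauchy-Pompeiu formula. -/
theorem cauchyT_delBar {f : ℂ → ℂ} (hf : ContDiff ℝ 1 f) (hc : HasCompactSupport f) :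
    cauchyT (delBar f) = f := by
  ext z
  have hh : ContDiff ℝ 1 fun u => f (z + u) := hf.comp (by fun_prop)
  have hhc : HasCompactSupport fun u => f (z + u) :=
    hc.comp_homeomorph (Homeomorph.addLeft z)
  have h1 := integral_inv_mul_delBar hh hhc
  have h2 : ∀ u, delBar (fun u => f (z + u)) u = delBar f (z + u) := by
    intro u
    simp only [delBar, fderiv_comp_add_left]
  simp_rw [h2] at h1
  unfold cauchyT
  rw [← integral_add_left_eq_self _ z]
  simp only [smul_eq_mul]
  have h3 : ∀ u, ((π : ℂ) * (z - (z + u)))⁻¹ * delBar f (z + u)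
      = -(((π : ℂ) * u)⁻¹ * delBar f (z + u)) := by
    intro u
    rw [sub_add_cancel_left, mul_neg, inv_neg, neg_mul]
  simp_rw [h3]
  rw [integral_neg, h1]; simp

theorem cauchyT_eq_convolution (f : ℂ → E) :
    cauchyT f = convolution (fun u : ℂ => ((π : ℂ) * u)⁻¹) f
      (ContinuousLinearMap.lsmul ℝ ℂ) volume := by
  ext z
  rw [convolution_eq_swap]
  rfl

theorem locallyIntegrable_cauchyKernel :
    LocallyIntegrable (fun u : ℂ => ((π : ℂ) * u)⁻¹) := by
  refine (locallyIntegrable_iff).2 fun K hK => ?_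
  obtain ⟨R, hR⟩ := hK.isBounded.subset_ball_lt 0 0
  refine IntegrableOn.mono_set ?_ hR.2
  refine ⟨(by fun_prop : Measurable fun u : ℂ => ((π : ℂ) * u)⁻¹).aestronglyMeasurable, ?_⟩
  refine lt_of_le_of_lt (lintegral_mono fun u => ?_)
    (b := ∫⁻ z in ball (0 : ℂ) R, (‖z‖ₑ⁻¹) ^ (1 : ℝ)) ?_
  · rw [ENNReal.rpow_one]
    simpa [rieszKernel] using enorm_kernel_le u 0
  · rw [lintegral_kernel_ball (by norm_num) hR.1]; simp

theorem contDiff_cauchyT {n : ℕ∞} {f : ℂ → E} (hf : ContDiff ℝ n f) (hc : HasCompactSupport f) :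
    ContDiff ℝ n (cauchyT f) := by
  rw [cauchyT_eq_convolution]
  exact hc.contDiff_convolution_right _ locallyIntegrable_cauchyKernel hf

theorem fderiv_cauchyT {f : ℂ → E} (hf : ContDiff ℝ 1 f) (hc : HasCompactSupport f) (z v : ℂ) :
    fderiv ℝ (cauchyT f) z v = cauchyT (fun w => fderiv ℝ f w v) z := by
  rw [cauchyT_eq_convolution, (hc.hasFDerivAt_convolution_right _ locallyIntegrable_cauchyKernel
    hf z).fderiv, convolution_precompR_apply _ locallyIntegrable_cauchyKernel (hc.fderiv (𝕜 := ℝ))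
    (hf.continuous_fderiv (by simp)), cauchyT_eq_convolution]

theorem delBar_cauchyT {f : ℂ → ℂ} (hf : ContDiff ℝ 1 f) (hc : HasCompactSupport f) :
    delBar (cauchyT f) = f := by
  have h : delBar (cauchyT f) = cauchyT (delBar f) := by
    ext z
    simp only [delBar, fderiv_cauchyT hf hc]
    have hint : ∀ v, Integrable fun w => ((π : ℂ) * (z - w))⁻¹ • fderiv ℝ f w v := by
      intro v
      have := (hc.fderiv_apply (𝕜 := ℝ) v).convolutionExists_right (ContinuousLinearMap.lsmul ℝ ℂ)
        locallyIntegrable_cauchyKernel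
        ((hf.continuous_fderiv (by simp)).clm_apply continuous_const) z
      exact this.integrable_swap
    unfold cauchyT
    have e : ∀ w, ((π : ℂ) * (z - w))⁻¹ • delBar f w = 1 / 2 * (((π : ℂ) * (z - w))⁻¹ •
          fderiv ℝ f w 1 + I * (((π : ℂ) * (z - w))⁻¹ • fderiv ℝ f w I)) := by
      intro w; simp only [smul_eq_mul, delBar]; ring
    simp_rw [e]
    rw [integral_const_mul, integral_add (hint 1) ((hint I).const_mul _),
      integral_const_mul]
  rw [h, cauchyT_delBar hf hc]

/-- The Cauchy transform is holomorphic off the support. -/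
theorem differentiableAt_cauchyT {f : ℂ → ℂ} (hf : Integrable f) {o : ℂ} {R : ℝ} (hR : 0 < R)
    (h0 : ∀ w ∈ ball o R, f w = 0) : DifferentiableAt ℂ (cauchyT f) o := by
  have hR2 : 0 < R / 2 := by positivity
  have hpi : (π : ℂ) ≠ 0 := by exact_mod_cast Real.pi_ne_zero
  have hdist : ∀ w ∉ ball o R, ∀ z ∈ ball o (R / 2), R / 2 ≤ ‖z - w‖ := by
    intro w hw z hz
    rw [mem_ball, not_lt, dist_eq_norm] at hw
    rw [mem_ball, dist_eq_norm] at hz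
    have : ‖w - o‖ ≤ ‖z - w‖ + ‖z - o‖ := by
      rw [← norm_sub_rev w z]
      calc ‖w - o‖ = ‖(w - z) + (z - o)‖ := by congr 1; ring
        _ ≤ _ := norm_add_le _ _
    linarith
  have key := hasDerivAt_integral_of_dominated_loc_of_deriv_le (μ := (volume : Measure ℂ))
    (F := fun z w => ((π : ℂ) * (z - w))⁻¹ • f w)
    (F' := fun z w => (-(π : ℂ) / ((π : ℂ) * (z - w)) ^ 2) • f w)
    (x₀ := o) (s := ball o (R / 2)) (bound := fun w => (R / 2)⁻¹ ^ 2 * ‖f w‖)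
    (ball_mem_nhds o hR2) ?_ ?_ ?_ ?_ (hf.norm.const_mul _) ?_
  · exact key.2.differentiableAt
  · exact .of_forall fun z => ((by fun_prop : Measurable fun w : ℂ =>
      ((π : ℂ) * (z - w))⁻¹).aestronglyMeasurable).smul hf.1
  · refine (hf.norm.const_mul (R / 2)⁻¹).mono' (((by fun_prop : Measurable fun w : ℂ =>
      ((π : ℂ) * (o - w))⁻¹).aestronglyMeasurable).smul hf.1)
      (.of_forall fun w => ?_)
    by_cases hw : w ∈ ball o R
    · simp [h0 w hw]
    · rw [norm_smul]
      gcongr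
      rw [norm_inv, norm_mul, norm_real, norm_of_nonneg pi_pos.le]
      have := hdist w hw o (mem_ball_self hR2)
      gcongr
      nlinarith [pi_gt_three]
  · exact ((by fun_prop : Measurable fun w : ℂ =>
      (-(π : ℂ) / ((π : ℂ) * (o - w)) ^ 2)).aestronglyMeasurable).smul hf.1
  · refine .of_forall fun w z hz => ?_
    by_cases hw : w ∈ ball o R
    · simp [h0 w hw]
    · rw [norm_smul]
      gcongr
      rw [norm_div, norm_neg, norm_pow, norm_mul, norm_real,
        norm_of_nonneg pi_pos.le, inv_pow]
      have h1 := hdist w hw z hz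
      have h2 : 0 < ‖z - w‖ := by linarith
      rw [div_le_iff₀ (by have := pi_pos; positivity), inv_mul_eq_div,
        le_div_iff₀ (by positivity)]
      have h3 : (R / 2) ^ 2 ≤ ‖z - w‖ ^ 2 := by gcongr
      have h4 : 0 ≤ ‖z - w‖ ^ 2 := by positivity
      have h5 := pi_gt_three
      calc π * (R / 2) ^ 2 ≤ π * ‖z - w‖ ^ 2 := by gcongr
        _ ≤ π * (π * ‖z - w‖ ^ 2) := by
          gcongr
          nlinarith
        _ = _ := by ring
  · refine .of_forall fun w z hz => ?_
    by_cases hw : w ∈ ball o R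
    · simpa [h0 w hw] using hasDerivAt_const z (0 : ℂ)
    · have h1 := hdist w hw z hz
      have h2 : (π : ℂ) * (z - w) ≠ 0 := by
        refine mul_ne_zero hpi fun h3 => ?_
        rw [h3, norm_zero] at h1; linarith
      have h3 : HasDerivAt (fun z : ℂ => (π : ℂ) * (z - w)) (π : ℂ) z := by
        simpa using ((hasDerivAt_id z).sub_const w).const_mul (π : ℂ)
      simpa using (h3.inv h2).mul_const (f w)

end Pompeiu

/-! ### Weak derivatives -/

section Weak

/-- A smooth cutoff function that is `1` on `closedBall o r` and is supported in
`closedBall o R`. -/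
theorem exists_cutoff (o : ℂ) {r R : ℝ} (hr : 0 < r) (hrR : r < R) :
    ∃ ρ : ℂ → ℝ, ContDiff ℝ ∞ ρ ∧ HasCompactSupport ρ ∧ tsupport ρ ⊆ closedBall o R ∧
      (∀ z ∈ closedBall o r, ρ z = 1) ∧ ∀ z, 0 ≤ ρ z ∧ ρ z ≤ 1 := by
  let b : ContDiffBump o := ⟨r, R, hr, hrR⟩
  exact ⟨b, b.contDiff, b.hasCompactSupport, b.tsupport_eq.subset,
    fun z hz => b.one_of_mem_closedBall hz, fun z => ⟨b.nonneg, b.le_one⟩⟩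

/-- `∂̄f = g` weakly on `S`. -/
def WeakDB (S : Set ℂ) (f g : ℂ → ℂ) : Prop :=
  ∀ η : ℂ → ℂ, ContDiff ℝ ∞ η → HasCompactSupport η → tsupport η ⊆ S →
    ∫ z, f z * delBar η z = -∫ z, g z * η z

variable {S : Set ℂ} {f g : ℂ → ℂ}

theorem WeakDB.mono {S' : Set ℂ} (h : WeakDB S f g) (hS : S' ⊆ S) :
    WeakDB S' f g := fun η h1 h2 h3 => h η h1 h2 (h3.trans hS)

theorem WeakDB.congr_ae {f' g' : ℂ → ℂ} (h : WeakDB S f g)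
    (hf : ∀ᵐ z, z ∈ S → f z = f' z) (hg : ∀ᵐ z, z ∈ S → g z = g' z) : WeakDB S f' g' := by
  intro η h1 h2 h3
  have e1 : ∫ z, f' z * delBar η z = ∫ z, f z * delBar η z := by
    refine integral_congr_ae ?_
    filter_upwards [hf] with z hz
    by_cases hzS : z ∈ tsupport η
    · rw [hz (h3 hzS)]
    · rw [off_tsupport fun h => hzS (tsupport_delBar_subset h)]; simp
  have e2 : ∫ z, g' z * η z = ∫ z, g z * η z := by
    refine integral_congr_ae ?_
    filter_upwards [hg] with z hz
    by_cases hzS : z ∈ tsupport η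
    · rw [hz (h3 hzS)]
    · rw [off_tsupport hzS]; simp
  rw [e1, e2, h η h1 h2 h3]

theorem integrable_mul_of_tsupport_subset {η : ℂ → ℂ} (hf : LocallyIntegrableOn f S)
    (hη : Continuous η) (hc : HasCompactSupport η) (hS : tsupport η ⊆ S) :
    Integrable fun z => f z * η z := by
  have h1 : IntegrableOn (fun z => f z * η z) (tsupport η) :=
    (hf.integrableOn_compact_subset hS hc).mul_continuousOn hη.continuousOn hc
  refine (integrableOn_iff_integrable_of_support_subset ?_).1 h1
  intro z hz
  refine subset_tsupport _ fun h0 => hz ?_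
  simp [h0]

theorem _root_.ContDiff.continuous_delBar {n : WithTop ℕ∞} (hf : ContDiff ℝ n f) (h : 1 ≤ n) :
    Continuous (delBar f) := by
  have : ContDiff ℝ 0 (delBar f) := hf.delBar (by simpa using h)
  exact this.continuous

theorem _root_.ContDiff.continuous_del {n : WithTop ℕ∞} (hf : ContDiff ℝ n f) (h : 1 ≤ n) :
    Continuous (del f) := by
  have : ContDiff ℝ 0 (del f) := hf.del (by simpa using h)
  exact this.continuous

theorem one_le_infty : (1 : WithTop ℕ∞) ≤ ((⊤ : ℕ∞) : WithTop ℕ∞) := by exact_mod_cast le_top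

theorem infty_ne_zero : ((⊤ : ℕ∞) : WithTop ℕ∞) ≠ 0 := by simp

theorem _root_.ContDiff.delBar_infty (hf : ContDiff ℝ ∞ f) : ContDiff ℝ ∞ (delBar f) :=
  hf.delBar (by exact_mod_cast le_rfl)

theorem _root_.ContDiff.del_infty (hf : ContDiff ℝ ∞ f) : ContDiff ℝ ∞ (del f) :=
  hf.del (by exact_mod_cast le_rfl)

/-- Cutting off a weak solution. -/
theorem WeakDB.cutoff (h : WeakDB S f g) (hf : LocallyIntegrableOn f S)
    (hg : LocallyIntegrableOn g S) {ρ : ℂ → ℂ} (hρ : ContDiff ℝ ∞ ρ) (hρc : HasCompactSupport ρ)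
    (hρS : tsupport ρ ⊆ S) :
    WeakDB Set.univ (fun z => ρ z * f z) (fun z => ρ z * g z + delBar ρ z * f z) := by
  intro η h1 h2 _
  have h3 := h (fun z => ρ z * η z) (hρ.mul h1) (hρc.mul_right)
    ((tsupport_mul_subset_left).trans hρS)
  have hd : ∀ z, delBar (fun z => ρ z * η z) z = delBar ρ z * η z + ρ z * delBar η z := fun z =>
    delBar_mul (hρ.differentiable infty_ne_zero z) (h1.differentiable infty_ne_zero z)
  have i1 : Integrable fun z => f z * (delBar ρ z * η z) :=
    integrable_mul_of_tsupport_subset hf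
      ((hρ.continuous_delBar one_le_infty).mul h1.continuous) hρc.delBar.mul_right
      ((tsupport_mul_subset_left).trans (tsupport_delBar_subset.trans hρS))
  have i2 : Integrable fun z => f z * (ρ z * delBar η z) :=
    integrable_mul_of_tsupport_subset hf
      (hρ.continuous.mul (h1.continuous_delBar one_le_infty)) hρc.mul_right
      ((tsupport_mul_subset_left).trans hρS)
  have i3 : Integrable fun z => g z * (ρ z * η z) :=
    integrable_mul_of_tsupport_subset hg
      (hρ.continuous.mul h1.continuous) hρc.mul_right
      ((tsupport_mul_subset_left).trans hρS)
  have e1 : ∀ z, f z * delBar (fun z => ρ z * η z) z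
      = f z * (delBar ρ z * η z) + f z * (ρ z * delBar η z) := fun z => by rw [hd]; ring
  simp_rw [e1] at h3
  rw [integral_add i1 i2] at h3
  have e2 : ∀ z, ρ z * f z * delBar η z = f z * (ρ z * delBar η z) := fun z => by ring
  have e3 : ∀ z, (ρ z * g z + delBar ρ z * f z) * η z
    = g z * (ρ z * η z) + f z * (delBar ρ z * η z) := fun z => by ring
  simp_rw [e2, e3]
  rw [integral_add i3 i1]
  linear_combination h3

theorem memLp_of_continuous_compact {η : ℂ → ℂ} (h : Continuous η) (hc : HasCompactSupport η)
    (p : ENNReal) : MemLp η p := h.memLp_of_hasCompactSupport hc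

/-- The Cauchy transform solves `∂̄u = g`. -/
theorem weakDB_cauchyT {r : ENNReal} (hr : 2 < r) (hrt : r < ⊤) (hg : MemLp g (sobExp r)) :
    WeakDB Set.univ (cauchyT g) g := by
  intro η h1 h2 _
  have hr1 : 1 ≤ r := (one_le_two.trans hr.le)
  have key := integral_mul_cauchyT hr hrt (ENNReal.HolderConjugate.conjExponent hr1) hg
    (memLp_of_continuous_compact (h1.continuous_delBar one_le_infty) h2.delBar r.conjExponent)
  rw [cauchyT_delBar (h1.of_le one_le_infty) h2] at key
  rw [key, neg_neg]

/-- A compactly supported weak solution of `∂̄u = g` is the Cauchy transform of `g`. -/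
theorem WeakDB.eq_cauchyT {r : ENNReal} (hr : 2 < r) (hrt : r < ⊤) (h : WeakDB Set.univ f g)
    (hf : LocallyIntegrable f) (hg : MemLp g (sobExp r)) {K : Set ℂ} (hK : IsCompact K)
    (hfK : ∀ z ∉ K, f z = 0) (hgK : ∀ z ∉ K, g z = 0) : f =ᵐ[volume] cauchyT g := by
  have hT := memLp_cauchyT hr hrt hg
  have hr1 : 1 ≤ r := (one_le_two.trans hr.le)
  refine ae_eq_of_integral_contDiff_smul_eq hf (hT.locallyIntegrable hr1) fun θ hθ hθc => ?_
  obtain ⟨R, hR, hKR⟩ := hK.isBounded.subset_closedBall_lt 0 0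
  obtain ⟨χ, hχ, hχc, -, hχ1, -⟩ := exists_cutoff 0 (show 0 < R + 1 by linarith) (lt_add_one (R + 1))
  let θ' : ℂ → ℂ := fun z => θ z
  have hθ' : ContDiff ℝ ∞ θ' := Complex.ofRealCLM.contDiff.comp hθ
  have hθ'c : HasCompactSupport θ' := hθc.comp_left (g := fun x : ℝ => (x : ℂ)) (by simp)
  have hχ' : ContDiff ℝ ∞ fun z => (χ z : ℂ) := Complex.ofRealCLM.contDiff.comp hχ
  have hχ'c : HasCompactSupport fun z => (χ z : ℂ) :=
    hχc.comp_left (g := fun x : ℝ => (x : ℂ)) (by simp)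
  have hTθ : ContDiff ℝ ∞ (cauchyT θ') := contDiff_cauchyT hθ' hθ'c
  have h1 := h (fun z => χ z * cauchyT θ' z) (hχ'.mul hTθ) hχ'c.mul_right (Set.subset_univ _)
  have hθ'D : delBar (cauchyT θ') = θ' := delBar_cauchyT (hθ'.of_le one_le_infty) hθ'c
  have hχD : ∀ z ∈ K, (χ z : ℂ) = 1 ∧ delBar (fun z => (χ z : ℂ)) z = 0 := by
    intro z hz
    refine ⟨by rw [hχ1 z (closedBall_subset_closedBall (by linarith) (hKR hz))]; simp, ?_⟩
    rw [delBar_congr (g := fun _ => (1 : ℂ)), delBar_const]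
    have : ball (0 : ℂ) (R + 1) ∈ 𝓝 z := by
      refine isOpen_ball.mem_nhds ?_
      have := hKR hz
      rw [mem_closedBall] at this
      rw [mem_ball]; linarith
    filter_upwards [this] with y hy
    rw [hχ1 y (ball_subset_closedBall hy)]; simp
  have e1 : ∀ z, f z * delBar (fun z => χ z * cauchyT θ' z) z = θ z • f z := by
    intro z
    by_cases hz : z ∈ K
    · rw [delBar_mul (hχ'.differentiable infty_ne_zero z) (hTθ.differentiable infty_ne_zero z),
        hθ'D, real_smul, (hχD z hz).1, (hχD z hz).2]
      simp only [θ']; ring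
    · rw [hfK z hz]; simp
  have e2 : ∀ z, g z * (χ z * cauchyT θ' z) = g z * cauchyT θ' z := by
    intro z
    by_cases hz : z ∈ K
    · rw [(hχD z hz).1, one_mul]
    · rw [hgK z hz]; simp
  simp_rw [e1, e2] at h1
  have key := integral_mul_cauchyT hr hrt (ENNReal.HolderConjugate.conjExponent hr1) hg
    (memLp_of_continuous_compact hθ'.continuous hθ'c r.conjExponent)
  rw [h1, key, neg_neg]
  refine integral_congr_ae (.of_forall fun z => ?_)
  simp only [θ', real_smul]; ring

end Weak

/-! ### Convergence and boundedness of sequences in `L^(1/θ)` -/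

section LpSequences

variable {E E' : Type*} [NormedAddCommGroup E] [NormedAddCommGroup E'] {μ ν : Measure ℂ}
  {θ θ' θ₁ θ₂ : ENNReal}

theorem one_le_inv_of_le (h : θ ≤ 1) : 1 ≤ θ⁻¹ := ENNReal.one_le_inv.2 h

theorem MemLp.mono_inv [IsFiniteMeasure μ] {f : ℂ → E} (hf : MemLp f θ⁻¹ μ) (h : θ ≤ θ') :
    MemLp f θ'⁻¹ μ := hf.mono_exponent (inv_le_inv.2 h)

instance holderTriple_inv : ENNReal.HolderTriple θ₁⁻¹ θ₂⁻¹ (θ₁ + θ₂)⁻¹ := ⟨by simp⟩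

theorem MemLp.mul_inv {f g : ℂ → ℂ} (hf : MemLp f θ₁⁻¹ μ) (hg : MemLp g θ₂⁻¹ μ) :
    MemLp (fun z => f z * g z) (θ₁ + θ₂)⁻¹ μ := hg.mul hf

theorem eLpNorm_mul_inv_le {f g : ℂ → ℂ} (hf : AEStronglyMeasurable f μ)
    (hg : AEStronglyMeasurable g μ) :
    eLpNorm (fun z => f z * g z) (θ₁ + θ₂)⁻¹ μ ≤ eLpNorm f θ₁⁻¹ μ * eLpNorm g θ₂⁻¹ μ :=
  eLpNorm_smul_le_mul_eLpNorm (f := g) (φ := f) hg hf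

/-- `f n → g` in `L^(1/θ)`. -/
structure LpTo (θ : ENNReal) (μ : Measure ℂ) (f : ℕ → ℂ → E) (g : ℂ → E) : Prop where
  memLp : ∀ n, MemLp (f n) θ⁻¹ μ
  memLp_lim : MemLp g θ⁻¹ μ
  tendsto : Tendsto (fun n => eLpNorm (fun z => f n z - g z) θ⁻¹ μ) atTop (𝓝 0)

/-- The sequence `f n` is bounded in `L^(1/θ)`. -/
structure LpBdd (θ : ENNReal) (μ : Measure ℂ) (f : ℕ → ℂ → E) : Prop where
  meas : ∀ n, AEStronglyMeasurable (f n) μ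
  bdd : ∃ C : ENNReal, C ≠ ⊤ ∧ ∀ n, eLpNorm (f n) θ⁻¹ μ ≤ C

variable {f f' : ℕ → ℂ → E} {g g' : ℂ → E}

theorem LpTo.of_le {f : ℕ → ℂ → E} {g : ℂ → E} (hf : ∀ n, MemLp (f n) θ⁻¹ μ)
    (hg : MemLp g θ⁻¹ μ) {b : ℕ → ENNReal} (hb : Tendsto b atTop (𝓝 0))
    (h : ∀ n, eLpNorm (fun z => f n z - g z) θ⁻¹ μ ≤ b n) : LpTo θ μ f g :=
  ⟨hf, hg, tendsto_of_tendsto_of_tendsto_of_le_of_le tendsto_const_nhds hb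
    (fun _ => zero_le) h⟩

theorem LpTo.const (hg : MemLp g θ⁻¹ μ) : LpTo θ μ (fun _ => g) g :=
  ⟨fun _ => hg, hg, by simp⟩

theorem LpTo.add (hθ : θ ≤ 1) (h : LpTo θ μ f g) (h' : LpTo θ μ f' g') :
    LpTo θ μ (fun n z => f n z + f' n z) (fun z => g z + g' z) := by
  refine LpTo.of_le (fun n => (h.memLp n).add (h'.memLp n)) (h.memLp_lim.add h'.memLp_lim)
    (by simpa using h.tendsto.add h'.tendsto) fun n => ?_
  have : (fun z => f n z + f' n z - (g z + g' z))
      = (fun z => f n z - g z) + fun z => f' n z - g' z := by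
    ext z; simp only [Pi.add_apply]; abel
  rw [this]
  exact eLpNorm_add_le ((h.memLp n).1.sub h.memLp_lim.1) ((h'.memLp n).1.sub h'.memLp_lim.1)
    (one_le_inv_of_le hθ)

theorem LpTo.of_norm_le {F : ℕ → ℂ → E'} {G : ℂ → E'} (h : LpTo θ μ f g)
    (hF : ∀ n, AEStronglyMeasurable (F n) μ) (hG : MemLp G θ⁻¹ μ) {c : ℝ}
    (hle : ∀ n, ∀ᵐ z ∂μ, ‖F n z - G z‖ ≤ c * ‖f n z - g z‖) : LpTo θ μ F G := by
  have h1 : ∀ n, MemLp (fun z => F n z - G z) θ⁻¹ μ := fun n =>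
    ((h.memLp n).sub h.memLp_lim).of_le_mul ((hF n).sub hG.1) (hle n)
  refine LpTo.of_le (b := fun n => ofReal c * eLpNorm (fun z => f n z - g z) θ⁻¹ μ)
    (fun n => ?_) hG ?_ fun n => eLpNorm_le_mul_eLpNorm_of_ae_le_mul (hle n) _
  · exact ((h1 n).add hG).ae_eq (ae_of_all _ fun z => by simp)
  · simpa using ENNReal.Tendsto.const_mul h.tendsto (Or.inr ofReal_ne_top)

theorem LpTo.neg (h : LpTo θ μ f g) : LpTo θ μ (fun n z => -f n z) (fun z => -g z) :=
  h.of_norm_le (fun n => (h.memLp n).1.neg) h.memLp_lim.neg (c := 1)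
    fun n => ae_of_all _ fun z => by rw [one_mul, ← norm_neg (f n z - g z)]; apply le_of_eq; congr 1; abel

theorem LpTo.sub (hθ : θ ≤ 1) (h : LpTo θ μ f g) (h' : LpTo θ μ f' g') :
    LpTo θ μ (fun n z => f n z - f' n z) (fun z => g z - g' z) := by
  simpa only [sub_eq_add_neg] using h.add hθ h'.neg

theorem LpTo.fst {f : ℕ → ℂ → ℂ × ℂ} {g : ℂ → ℂ × ℂ} (h : LpTo θ μ f g) :
    LpTo θ μ (fun n z => (f n z).1) (fun z => (g z).1) :=
  h.of_norm_le (fun n => (h.memLp n).1.fst) h.memLp_lim.fst (c := 1)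
    fun n => ae_of_all _ fun z => by rw [one_mul, ← Prod.fst_sub]; exact norm_fst_le _

theorem LpTo.snd {f : ℕ → ℂ → ℂ × ℂ} {g : ℂ → ℂ × ℂ} (h : LpTo θ μ f g) :
    LpTo θ μ (fun n z => (f n z).2) (fun z => (g z).2) :=
  h.of_norm_le (fun n => (h.memLp n).1.snd) h.memLp_lim.snd (c := 1)
    fun n => ae_of_all _ fun z => by rw [one_mul, ← Prod.snd_sub]; exact norm_snd_le _

theorem LpTo.mono [IsFiniteMeasure μ] (h : LpTo θ μ f g) (hθ : θ ≤ θ') : LpTo θ' μ f g := by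
  have hle : θ'⁻¹ ≤ θ⁻¹ := inv_le_inv.2 hθ
  rcases eq_or_ne θ'⁻¹ 0 with h0 | h0
  · refine ⟨fun n => (h.memLp n).mono_exponent hle, h.memLp_lim.mono_exponent hle, ?_⟩
    simp [h0]
  have hc : μ Set.univ ^ (1 / θ'⁻¹.toReal - 1 / θ⁻¹.toReal) ≠ ⊤ := by
    refine rpow_ne_top_of_nonneg ?_ (measure_ne_top _ _)
    rcases eq_or_ne θ⁻¹ ⊤ with h1 | h1
    · rw [h1]; simp
    · have := ENNReal.toReal_mono h1 hle
      have h2 : 0 < θ'⁻¹.toReal := toReal_pos h0 (ne_top_of_le_ne_top h1 hle)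
      rw [sub_nonneg]
      exact one_div_le_one_div_of_le h2 this
  refine LpTo.of_le (fun n => (h.memLp n).mono_exponent hle) (h.memLp_lim.mono_exponent hle)
    (b := fun n => eLpNorm (fun z => f n z - g z) θ⁻¹ μ *
      μ Set.univ ^ (1 / θ'⁻¹.toReal - 1 / θ⁻¹.toReal)) ?_
    fun n => eLpNorm_le_eLpNorm_mul_rpow_measure_univ hle ((h.memLp n).1.sub h.memLp_lim.1)
  simpa using ENNReal.Tendsto.mul_const h.tendsto (Or.inr hc)

theorem LpTo.mono_measure (h : LpTo θ μ f g) (hν : ν ≤ μ) : LpTo θ ν f g :=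
  LpTo.of_le (fun n => (h.memLp n).mono_measure hν) (h.memLp_lim.mono_measure hν) h.tendsto
    fun _ => eLpNorm_mono_measure _ hν

theorem LpTo.subseq (h : LpTo θ μ f g) {σ : ℕ → ℕ} (hσ : StrictMono σ) :
    LpTo θ μ (fun n => f (σ n)) g :=
  ⟨fun _ => h.memLp _, h.memLp_lim, h.tendsto.comp hσ.tendsto_atTop⟩

theorem LpTo.exists_ae_tendsto (hθ : θ ≠ ⊤) (h : LpTo θ μ f g) : ∃ σ : ℕ → ℕ, StrictMono σ ∧
    ∀ᵐ z ∂μ, Tendsto (fun n => f (σ n) z) atTop (𝓝 (g z)) :=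
  (tendstoInMeasure_of_tendsto_eLpNorm (ENNReal.inv_ne_zero.2 hθ) (fun n => (h.memLp n).1)
    h.memLp_lim.1 h.tendsto).exists_seq_tendsto_ae

theorem LpBdd.of_memLp (hg : MemLp g θ⁻¹ μ) : LpBdd θ μ fun _ => g :=
  ⟨fun _ => hg.1, _, hg.2.ne, fun _ => le_rfl⟩

theorem LpBdd.mono_measure (h : LpBdd θ μ f) (hν : ν ≤ μ) : LpBdd θ ν f := by
  obtain ⟨C, hC, h1⟩ := h.bdd
  exact ⟨fun n => (h.meas n).mono_measure hν, C, hC,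
    fun n => (eLpNorm_mono_measure _ hν).trans (h1 n)⟩

theorem LpBdd.memLp (h : LpBdd θ μ f) (n : ℕ) : MemLp (f n) θ⁻¹ μ := by
  obtain ⟨C, hC, h1⟩ := h.bdd
  exact ⟨h.meas n, (h1 n).trans_lt hC.lt_top⟩

theorem LpBdd.mono [IsFiniteMeasure μ] (h : LpBdd θ μ f) (hθ : θ ≤ θ') : LpBdd θ' μ f := by
  obtain ⟨C, hC, h1⟩ := h.bdd
  have hle : θ'⁻¹ ≤ θ⁻¹ := inv_le_inv.2 hθ
  rcases eq_or_ne θ'⁻¹ 0 with h0 | h0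
  · exact ⟨h.meas, 0, by simp, fun n => by simp [h0]⟩
  have hc : μ Set.univ ^ (1 / θ'⁻¹.toReal - 1 / θ⁻¹.toReal) ≠ ⊤ := by
    refine rpow_ne_top_of_nonneg ?_ (measure_ne_top _ _)
    rcases eq_or_ne θ⁻¹ ⊤ with h1 | h1
    · rw [h1]; simp
    · have := ENNReal.toReal_mono h1 hle
      have h2 : 0 < θ'⁻¹.toReal := toReal_pos h0 (ne_top_of_le_ne_top h1 hle)
      rw [sub_nonneg]
      exact one_div_le_one_div_of_le h2 this
  refine ⟨h.meas, _, ENNReal.mul_ne_top hC hc, fun n =>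
    (eLpNorm_le_eLpNorm_mul_rpow_measure_univ hle (h.meas n)).trans ?_⟩
  gcongr
  exact h1 n

theorem LpBdd.of_norm_le {F : ℕ → ℂ → E'} (h : LpBdd θ μ f)
    (hF : ∀ n, AEStronglyMeasurable (F n) μ) {c : ℝ}
    (hle : ∀ n, ∀ᵐ z ∂μ, ‖F n z‖ ≤ c * ‖f n z‖) : LpBdd θ μ F := by
  obtain ⟨C, hC, h1⟩ := h.bdd
  refine ⟨hF, ofReal c * C, ENNReal.mul_ne_top ofReal_ne_top hC, fun n =>
    (eLpNorm_le_mul_eLpNorm_of_ae_le_mul (hle n) _).trans ?_⟩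
  gcongr
  exact h1 n

theorem LpBdd.add (hθ : θ ≤ 1) (h : LpBdd θ μ f) (h' : LpBdd θ μ f') :
    LpBdd θ μ fun n z => f n z + f' n z := by
  obtain ⟨C, hC, h1⟩ := h.bdd
  obtain ⟨C', hC', h1'⟩ := h'.bdd
  exact ⟨fun n => (h.meas n).add (h'.meas n), C + C', ENNReal.add_ne_top.2 ⟨hC, hC'⟩, fun n =>
    (eLpNorm_add_le (h.meas n) (h'.meas n) (one_le_inv_of_le hθ)).trans
      (add_le_add (h1 n) (h1' n))⟩

theorem LpBdd.mul {f f' : ℕ → ℂ → ℂ} (h : LpBdd θ₁ μ f) (h' : LpBdd θ₂ μ f') :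
    LpBdd (θ₁ + θ₂) μ fun n z => f n z * f' n z := by
  obtain ⟨C, hC, h1⟩ := h.bdd
  obtain ⟨C', hC', h1'⟩ := h'.bdd
  exact ⟨fun n => (h.meas n).mul (h'.meas n), C * C', ENNReal.mul_ne_top hC hC', fun n =>
    (eLpNorm_mul_inv_le (h.meas n) (h'.meas n)).trans (mul_le_mul' (h1 n) (h1' n))⟩

theorem LpBdd.norm (h : LpBdd θ μ f) : LpBdd θ μ fun n z => (‖f n z‖ : ℂ) :=
  h.of_norm_le (fun n => continuous_ofReal.comp_aestronglyMeasurable (h.meas n).norm)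
    (c := 1) fun n => ae_of_all _ fun z => by simp

theorem LpTo.bdd (hθ : θ ≤ 1) (h : LpTo θ μ f g) : LpBdd θ μ f := by
  have h1 : ∀ n, eLpNorm (f n) θ⁻¹ μ
      ≤ eLpNorm (fun z => f n z - g z) θ⁻¹ μ + eLpNorm g θ⁻¹ μ := by
    intro n
    have : f n = (fun z => f n z - g z) + g := by ext z; simp
    conv_lhs => rw [this]
    exact eLpNorm_add_le ((h.memLp n).1.sub h.memLp_lim.1) h.memLp_lim.1 (one_le_inv_of_le hθ)
  have h2 : ∀ᶠ n in atTop, eLpNorm (fun z => f n z - g z) θ⁻¹ μ < 1 :=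
    h.tendsto.eventually_lt_const (by simp)
  obtain ⟨N, hN⟩ := eventually_atTop.1 h2
  refine ⟨fun n => (h.memLp n).1, (1 + eLpNorm g θ⁻¹ μ)
    + ∑ n ∈ Finset.range N, eLpNorm (f n) θ⁻¹ μ, ?_, fun n => ?_⟩
  · refine ENNReal.add_ne_top.2 ⟨ENNReal.add_ne_top.2 ⟨by simp, h.memLp_lim.2.ne⟩,
      (ENNReal.sum_lt_top.2 fun n _ => (h.memLp n).2).ne⟩
  · rcases lt_or_ge n N with hn | hn
    · exact (Finset.single_le_sum (f := fun n => eLpNorm (f n) θ⁻¹ μ) (fun _ _ => zero_le)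
        (Finset.mem_range.2 hn)).trans le_add_self
    · exact ((h1 n).trans (add_le_add (hN n hn).le le_rfl)).trans le_self_add

theorem LpTo.mul {f f' : ℕ → ℂ → ℂ} {g g' : ℂ → ℂ} (h1 : θ₁ ≤ 1) (h12 : θ₁ + θ₂ ≤ 1)
    (h : LpTo θ₁ μ f g) (h' : LpTo θ₂ μ f' g') :
    LpTo (θ₁ + θ₂) μ (fun n z => f n z * f' n z) (fun z => g z * g' z) := by
  obtain ⟨C, hC, hb⟩ := (h.bdd h1).bdd
  refine LpTo.of_le (fun n => MemLp.mul_inv (h.memLp n) (h'.memLp n))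
    (MemLp.mul_inv h.memLp_lim h'.memLp_lim)
    (b := fun n => C * eLpNorm (fun z => f' n z - g' z) θ₂⁻¹ μ
      + eLpNorm (fun z => f n z - g z) θ₁⁻¹ μ * eLpNorm g' θ₂⁻¹ μ) ?_ fun n => ?_
  · simpa using (ENNReal.Tendsto.const_mul h'.tendsto (Or.inr hC)).add
      (ENNReal.Tendsto.mul_const h.tendsto (Or.inr h'.memLp_lim.2.ne))
  · have : (fun z => f n z * f' n z - g z * g' z)
        = (fun z => f n z * (f' n z - g' z)) + fun z => (f n z - g z) * g' z := by
      ext z; simp only [Pi.add_apply]; ring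
    rw [this]
    have m1 := (h'.memLp n).1.sub h'.memLp_lim.1
    have m2 := (h.memLp n).1.sub h.memLp_lim.1
    refine (eLpNorm_add_le ((h.memLp n).1.mul m1) (m2.mul h'.memLp_lim.1)
      (one_le_inv_of_le h12)).trans (add_le_add ?_ ?_)
    · exact (eLpNorm_mul_inv_le (h.memLp n).1 m1).trans (mul_le_mul' (hb n) le_rfl)
    · exact eLpNorm_mul_inv_le m2 h'.memLp_lim.1

theorem LpTo.integral [NormedSpace ℝ E] [CompleteSpace E] (h : LpTo 1 μ f g) :
    Tendsto (fun n => ∫ z, f n z ∂μ) atTop (𝓝 (∫ z, g z ∂μ)) := by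
  have := h.tendsto
  rw [inv_one] at this
  have h1 := h.memLp_lim
  have h2 := h.memLp
  rw [inv_one, memLp_one_iff_integrable] at h1
  simp only [inv_one, memLp_one_iff_integrable] at h2
  exact tendsto_integral_of_L1' g h1.1 (.of_forall h2) this

/-- A sequence of test functions that converges to a given function in `L^(1/θ)`. -/
theorem exists_lpTo_contDiff [NormedSpace ℝ E] (h0 : θ ≠ 0) (h1 : θ ≤ 1)
    (hg : MemLp g θ⁻¹ (volume : Measure ℂ)) : ∃ f : ℕ → ℂ → E, (∀ n, ContDiff ℝ ∞ (f n)) ∧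
      (∀ n, HasCompactSupport (f n)) ∧ LpTo θ volume f g := by
  have : ∀ n : ℕ, ∃ f : ℂ → E, HasCompactSupport f ∧ ContDiff ℝ ∞ f ∧
      eLpNorm (g - f) θ⁻¹ volume ≤ ofReal (1 / ((n : ℝ) + 1)) := fun n =>
    hg.exist_eLpNorm_sub_le (ENNReal.inv_ne_top.2 h0) (one_le_inv_of_le h1) (by positivity)
  choose f hc hs hle using this
  refine ⟨f, hs, hc, LpTo.of_le (fun n => (hs n).continuous.memLp_of_hasCompactSupport (hc n)) hg
    (b := fun n => ofReal (1 / ((n : ℝ) + 1))) ?_ fun n => ?_⟩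
  · rw [← ENNReal.ofReal_zero]
    exact ENNReal.tendsto_ofReal tendsto_one_div_add_atTop_nhds_zero_nat
  · rw [show (fun z => f n z - g z) = f n - g from rfl, eLpNorm_sub_comm]
    exact hle n

end LpSequences

/-! ### Weakly holomorphic functions and the product rule -/

section Products

theorem contDiff_ofReal {ρ : ℂ → ℝ} {n : WithTop ℕ∞} (h : ContDiff ℝ n ρ) :
    ContDiff ℝ n fun z => (ρ z : ℂ) := Complex.ofRealCLM.contDiff.comp h

theorem hasCompactSupport_ofReal {ρ : ℂ → ℝ} (h : HasCompactSupport ρ) :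
    HasCompactSupport fun z => (ρ z : ℂ) := h.comp_left (g := fun x : ℝ => (x : ℂ)) (by simp)

theorem tsupport_ofReal {ρ : ℂ → ℝ} : tsupport (fun z => (ρ z : ℂ)) = tsupport ρ := by
  unfold tsupport
  congr 1
  ext z; simp

/-- The derivative of a cutoff function vanishes where the function is constant. -/
theorem delBar_eq_zero_of_eqOn_ball {f : ℂ → ℂ} {o z : ℂ} {r : ℝ} {c : ℂ}
    (h : ∀ w ∈ ball o r, f w = c) (hz : z ∈ ball o r) : delBar f z = 0 := by
  rw [delBar_congr (g := fun _ => c), delBar_const]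
  filter_upwards [isOpen_ball.mem_nhds hz] with w hw using h w hw

theorem memLp_mul_of_tsupport_subset {S : Set ℂ} (hS : MeasurableSet S) {f η : ℂ → ℂ} {p : ENNReal}
    (hf : MemLp f p (vol S)) (hη : Continuous η) (hc : HasCompactSupport η)
    (hηS : tsupport η ⊆ S) : MemLp (fun z => η z * f z) p := by
  have h1 : MemLp (fun z => η z * S.indicator f z) p :=
    ((memLp_indicator_iff_restrict hS).2 hf).mul' (p := ⊤) (q := p)
      (memLp_of_continuous_compact hη hc ⊤)
  refine h1.ae_eq (ae_of_all _ fun z => ?_)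
  by_cases hz : z ∈ S
  · simp [hz]
  · simp [off_tsupport fun h => hz (hηS h)]

theorem sobExp_le_of_two_le {p r : ENNReal} (h : 2 ≤ p) : sobExp r ≤ p := (sobExp_le_two r).trans h

theorem MemLp.locallyIntegrableOn' {S : Set ℂ} (hS : volume S ≠ ⊤) {f : ℂ → ℂ} {p : ENNReal}
    (hp : 1 ≤ p) (hf : MemLp f p (vol S)) : LocallyIntegrableOn f S := by
  have : IsFiniteMeasure (vol S) := ⟨by simpa using hS.lt_top⟩
  exact IntegrableOn.locallyIntegrableOn (hf.integrable hp)

theorem volume_ball_ne_top (o : ℂ) (r : ℝ) : volume (ball o r) ≠ ⊤ :=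
  measure_ball_lt_top.ne

instance (o : ℂ) (r : ℝ) : IsFiniteMeasure (vol (ball o r)) :=
  ⟨by simpa using (volume_ball_ne_top o r).lt_top⟩

/-- A compactly supported `L²` function lies in `L^s` for `s ≤ 2`. -/
theorem memLp_sobExp_of_tsupport {f : ℂ → ℂ} {r p : ENNReal} (hp : 2 ≤ p) (hf : MemLp f p)
    {K : Set ℂ} (hK : IsCompact K) (h0 : ∀ z ∉ K, f z = 0) : MemLp f (sobExp r) :=
  hf.mono_exponent_of_measure_support_ne_top h0 hK.measure_lt_top.ne (sobExp_le_of_two_le hp)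

/-- **Weyl's lemma** for holomorphic functions, with the mean value bound. -/
theorem exists_holRep (o : ℂ) {r R : ℝ} (hr : 0 < r) (hrR : r < R) : ∃ C : ℝ, 0 ≤ C ∧
    ∀ f : ℂ → ℂ, MemLp f 2 (vol (ball o R)) →
      WeakDB (ball o R) f 0 → ∃ h : ℂ → ℂ, DifferentiableOn ℂ h (ball o r) ∧
        (∀ᵐ z, z ∈ ball o r → f z = h z) ∧
        ∀ z ∈ ball o r, ‖h z‖ ≤ C * ∫ w in ball o R, ‖f w‖ := by
  obtain ⟨ρ, hρ, hρc, hρs, hρ1, -⟩ := exists_cutoff o (r := (2 * r + R) / 3)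
    (R := (r + 2 * R) / 3) (by linarith) (by linarith)
  set χ : ℂ → ℂ := fun z => (ρ z : ℂ) with hχ
  have hχd : ContDiff ℝ ∞ χ := contDiff_ofReal hρ
  have hχc : HasCompactSupport χ := hasCompactSupport_ofReal hρc
  have hχS : tsupport χ ⊆ ball o R := by
    rw [hχ, tsupport_ofReal]
    exact hρs.trans (closedBall_subset_ball (by linarith))
  have hκ0 : ∀ z ∈ ball o ((2 * r + R) / 3), delBar χ z = 0 := fun z hz =>
    delBar_eq_zero_of_eqOn_ball (c := 1)
      (fun w hw => by simp [hχ, hρ1 w (ball_subset_closedBall hw)]) hz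
  have hκcont : Continuous (delBar χ) := hχd.continuous_delBar one_le_infty
  obtain ⟨M, hM⟩ := hκcont.bounded_above_of_compact_support hχc.delBar
  have hM0 : 0 ≤ M := (norm_nonneg _).trans (hM 0)
  have hd : 0 < (R - r) / 3 := by linarith
  refine ⟨((R - r) / 3)⁻¹ * M, by positivity, fun f hf hw => ?_⟩
  have hloc := MemLp.locallyIntegrableOn' (volume_ball_ne_top o R) one_le_two hf
  have hcut := hw.cutoff hloc (locallyIntegrableOn_zero) hχd hχc hχS
  simp only [Pi.zero_apply, mul_zero, zero_add] at hcut
  have hκf2 : MemLp (fun z => delBar χ z * f z) 2 :=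
    memLp_mul_of_tsupport_subset measurableSet_ball hf hκcont hχc.delBar
      (tsupport_delBar_subset.trans hχS)
  have hκ0' : ∀ z ∉ tsupport χ, delBar χ z * f z = 0 := fun z hz => by
    rw [off_tsupport fun h => hz (tsupport_delBar_subset h), zero_mul]
  have hκf : MemLp (fun z => delBar χ z * f z) (sobExp 4) :=
    memLp_sobExp_of_tsupport le_rfl hκf2 hχc hκ0'
  have hκf1 : MemLp (fun z => delBar χ z * f z) 1 :=
    hκf2.mono_exponent_of_measure_support_ne_top hκ0' hχc.measure_lt_top.ne one_le_two
  have hρf2 : MemLp (fun z => χ z * f z) 2 :=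
    memLp_mul_of_tsupport_subset measurableSet_ball hf hχd.continuous hχc hχS
  have heq := hcut.eq_cauchyT (r := 4) (by norm_num) (by norm_num)
    (hρf2.locallyIntegrable one_le_two) hκf hχc
    (fun z hz => by rw [off_tsupport hz, zero_mul]) hκ0'
  have hsub : ball o r ⊆ ball o ((2 * r + R) / 3) :=
    ball_subset_ball (by linarith)
  refine ⟨cauchyT fun z => delBar χ z * f z, fun z hz => ?_, ?_, fun z hz => ?_⟩
  · refine (differentiableAt_cauchyT (memLp_one_iff_integrable.1 hκf1) hd fun w hw => ?_).differentiableWithinAt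
    rw [hκ0 w, zero_mul]
    rw [mem_ball] at hw hz ⊢
    have := dist_triangle w z o
    linarith
  · filter_upwards [heq] with z hz hzr
    rw [← hz]
    simp [hχ, hρ1 z (ball_subset_closedBall (hsub hzr))]
  · rw [← integral_indicator measurableSet_ball, ← integral_const_mul]
    have hint : Integrable ((ball o R).indicator fun w => ‖f w‖) :=
      (integrable_indicator_iff measurableSet_ball).2
        (hf.integrable one_le_two).norm
    refine norm_integral_le_of_norm_le (hint.const_mul _) (ae_of_all _ fun w => ?_)
    beta_reduce
    by_cases hw1 : w ∈ ball o ((2 * r + R) / 3)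
    · rw [hκ0 w hw1]
      simp only [zero_mul, smul_zero, norm_zero]
      refine mul_nonneg (by positivity) (Set.indicator_nonneg (fun _ _ => norm_nonneg _) _)
    by_cases hw2 : w ∈ tsupport χ
    · rw [indicator_of_mem (hχS hw2), norm_smul, norm_mul, norm_inv, norm_mul,
        norm_real, norm_of_nonneg pi_pos.le]
      have h1 : (R - r) / 3 ≤ ‖z - w‖ := by
        rw [mem_ball, not_lt] at hw1
        rw [mem_ball] at hz
        have := dist_triangle w z o
        rw [dist_comm w z] at this
        rw [← dist_eq_norm]; linarith
      have h2 : (π * ‖z - w‖)⁻¹ ≤ ((R - r) / 3)⁻¹ := by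
        refine inv_anti₀ hd ?_
        nlinarith [pi_gt_three]
      rw [mul_assoc]
      gcongr
      exact hM w
    · rw [hκ0' w hw2]
      simp only [smul_zero, norm_zero]
      refine mul_nonneg (by positivity) (Set.indicator_nonneg (fun _ _ => norm_nonneg _) _)

variable {E : Type*} [NormedAddCommGroup E] [NormedSpace ℂ E]

theorem LpTo.cauchyT {M : ENNReal} (hM : 2 < M) (hMt : M < ⊤) {f : ℕ → ℂ → E} {g : ℂ → E}
    (h : LpTo (M⁻¹ + 2⁻¹) volume f g) :
    LpTo M⁻¹ volume (fun n => cauchyT (f n)) (cauchyT g) := by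
  obtain ⟨C, hC, hb⟩ := exists_eLpNorm_cauchyT_le E hM hMt
  have m1 : ∀ n, MemLp (f n) (sobExp M) := h.memLp
  have m2 : MemLp g (sobExp M) := h.memLp_lim
  refine LpTo.of_le (b := fun n => C * eLpNorm (fun z => f n z - g z) (sobExp M) volume)
    (fun n => ?_) ?_ ?_ fun n => ?_
  · rw [inv_inv]; exact memLp_cauchyT hM hMt (m1 n)
  · rw [inv_inv]; exact memLp_cauchyT hM hMt m2
  · simpa [sobExp] using ENNReal.Tendsto.const_mul h.tendsto (Or.inr hC)
  · rw [inv_inv]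
    refine le_trans (le_of_eq (eLpNorm_congr_ae ?_)) (hb _ ((m1 n).sub m2).1)
    filter_upwards [cauchyT_sub hM hMt (m1 n) m2] with z hz
    exact hz.symm

theorem integral_eq_restrict_of_tsupport {S : Set ℂ} {f η : ℂ → ℂ}
    (hηS : tsupport η ⊆ S) : ∫ z, f z * η z = ∫ z in S, f z * η z :=
  (setIntegral_eq_integral_of_forall_compl_eq_zero fun z hz => by
    rw [off_tsupport fun h => hz (hηS h), mul_zero]).symm

theorem inv_le_quarter {M : ENNReal} (hM : 4 ≤ M) : M⁻¹ ≤ 4⁻¹ := inv_le_inv.2 hM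

theorem quarter_add_quarter : (4⁻¹ : ENNReal) + 4⁻¹ = 2⁻¹ := by
  rw [← ENNReal.toReal_eq_toReal_iff' (by simp) (by simp), ENNReal.toReal_add (by simp) (by simp)]
  norm_num

/-- The product rule for a weak solution and a Cauchy transform. -/
theorem WeakDB.mul_cauchyT {M : ENNReal} (hM : 4 ≤ M) (hMt : M < ⊤) {S : Set ℂ}
    (hS : volume S ≠ ⊤) {f₁ κ₁ κ₂ : ℂ → ℂ}
    (h : WeakDB S f₁ κ₁) (hf₁ : MemLp f₁ M (vol S))
    (hκ₁ : MemLp κ₁ (sobExp M) (vol S)) (hκ₂ : MemLp κ₂ (sobExp M)) :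
    WeakDB S (fun z => f₁ z * cauchyT κ₂ z) (fun z => κ₁ z * cauchyT κ₂ z + f₁ z * κ₂ z) := by
  have : IsFiniteMeasure (vol S) := ⟨by simpa using hS.lt_top⟩
  have hM2 : 2 < M := lt_of_lt_of_le (by norm_num) hM
  have hM4 := inv_le_quarter hM
  have e2 : (2⁻¹ : ENNReal) + 2⁻¹ = 1 := inv_two_add_inv_two
  have hM1 : M⁻¹ ≤ 1 := hM4.trans (by simp)
  have hMM : M⁻¹ + M⁻¹ ≤ 2⁻¹ := (add_le_add hM4 hM4).trans quarter_add_quarter.le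
  have hM3 : M⁻¹ + 2⁻¹ + M⁻¹ ≤ 1 := by
    calc M⁻¹ + 2⁻¹ + M⁻¹ = (M⁻¹ + M⁻¹) + 2⁻¹ := by ring
      _ ≤ 2⁻¹ + 2⁻¹ := by gcongr
      _ = 1 := e2
  have hMs : M⁻¹ + 2⁻¹ ≤ 1 := le_self_add.trans hM3
  have hr0 : M⁻¹ + 2⁻¹ ≠ 0 := by simp
  obtain ⟨k, hk, hkc, hkl⟩ := exists_lpTo_contDiff hr0 hMs hκ₂
  have hTk := (hkl.cauchyT hM2 hMt).mono_measure (ν := vol S) restrict_le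
  have hkl' := hkl.mono_measure (ν := vol S) restrict_le
  have c1 : LpTo M⁻¹ (vol S) (fun _ => f₁) f₁ :=
    LpTo.const (by rwa [inv_inv])
  have c2 : LpTo (M⁻¹ + 2⁻¹) (vol S) (fun _ => κ₁) κ₁ := LpTo.const hκ₁
  intro η hη hηc hηS
  have hDη : Continuous (delBar η) := hη.continuous_delBar one_le_infty
  have b1 : LpTo 0 (vol S) (fun _ => delBar η) (delBar η) := LpTo.const
    ((memLp_of_continuous_compact hDη hηc.delBar _).mono_measure restrict_le)
  have b2 : LpTo 0 (vol S) (fun _ => η) η := LpTo.const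
    ((memLp_of_continuous_compact hη.continuous hηc _).mono_measure restrict_le)
  have t1 := ((c1.mul hM1 (hMM.trans (by simp)) hTk).mul (hMM.trans (by simp))
    (by simpa using hMM.trans (by simp)) b1).mono (θ' := 1)
      (by simpa using hMM.trans (by simp)) |>.integral
  have t2 := ((c2.mul hMs hM3 hTk).mul hM3 (by simpa using hM3) b2).mono (θ' := 1)
      (by simpa using hM3)
  have hM3' : M⁻¹ + (M⁻¹ + 2⁻¹) ≤ 1 := by rwa [add_comm]
  have t3 := ((c1.mul hM1 hM3' hkl').mul hM3' (by simpa using hM3') b2).mono (θ' := 1)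
      (by simpa using hM3')
  have t23 := (t2.add le_rfl t3).integral.neg
  have hs1 : tsupport (delBar η) ⊆ S := tsupport_delBar_subset.trans hηS
  have hloc : LocallyIntegrableOn f₁ S :=
    MemLp.locallyIntegrableOn' hS ((by norm_num : (1 : ENNReal) ≤ 4).trans hM) hf₁
  have hlock : LocallyIntegrableOn κ₁ S :=
    MemLp.locallyIntegrableOn' hS (one_lt_sobExp hM2).le hκ₁
  have key : ∀ n, ∫ z in S, f₁ z * cauchyT (k n) z * delBar η z
      = -∫ z in S, (κ₁ z * cauchyT (k n) z * η z + f₁ z * k n z * η z) := by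
    intro n
    have hT : ContDiff ℝ ∞ (cauchyT (k n)) := contDiff_cauchyT (hk n) (hkc n)
    have h1 := h (fun z => cauchyT (k n) z * η z) (hT.mul hη) hηc.mul_left
      ((tsupport_mul_subset_right).trans hηS)
    have i1 : Integrable fun z => f₁ z * (k n z * η z) :=
      integrable_mul_of_tsupport_subset hloc ((hk n).continuous.mul hη.continuous) hηc.mul_left
        ((tsupport_mul_subset_right).trans hηS)
    have i2 : Integrable fun z => f₁ z * (cauchyT (k n) z * delBar η z) :=
      integrable_mul_of_tsupport_subset hloc (hT.continuous.mul hDη) hηc.delBar.mul_left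
        ((tsupport_mul_subset_right).trans hs1)
    have i3 : Integrable fun z => κ₁ z * (cauchyT (k n) z * η z) :=
      integrable_mul_of_tsupport_subset hlock (hT.continuous.mul hη.continuous) hηc.mul_left
        ((tsupport_mul_subset_right).trans hηS)
    have e : ∀ z, f₁ z * delBar (fun z => cauchyT (k n) z * η z) z
        = f₁ z * (k n z * η z) + f₁ z * (cauchyT (k n) z * delBar η z) := by
      intro z
      rw [delBar_mul (hT.differentiable infty_ne_zero z) (hη.differentiable infty_ne_zero z),
        delBar_cauchyT ((hk n).of_le one_le_infty) (hkc n)]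
      ring
    simp_rw [e] at h1
    rw [integral_add i1 i2] at h1
    rw [← integral_eq_restrict_of_tsupport hs1]
    have e' : ∀ z, κ₁ z * cauchyT (k n) z * η z + f₁ z * k n z * η z
      = (κ₁ z * cauchyT (k n) z + f₁ z * k n z) * η z := fun z => by ring
    simp_rw [e']
    rw [← integral_eq_restrict_of_tsupport hηS]
    simp_rw [← e']
    have e3 : ∀ z, κ₁ z * cauchyT (k n) z * η z = κ₁ z * (cauchyT (k n) z * η z) :=
      fun z => by ring
    have e4 : ∀ z, f₁ z * k n z * η z = f₁ z * (k n z * η z) := fun z => by ring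
    have e5 : ∀ z, f₁ z * cauchyT (k n) z * delBar η z = f₁ z * (cauchyT (k n) z * delBar η z) :=
      fun z => by ring
    simp_rw [e3, e4, e5]
    rw [integral_add i3 i1]
    linear_combination h1
  simp_rw [key] at t1
  have hlim := tendsto_nhds_unique t1 t23
  rw [integral_eq_restrict_of_tsupport hs1, integral_eq_restrict_of_tsupport hηS, hlim]
  simp_rw [add_mul]

end Products

/-! ### The integral equation `Z = T (k + L Z)` -/

section Solve

/-- Multiplication by the quaternion `j`. -/
def J : ℂ × ℂ →L[ℝ] ℂ × ℂ :=
  ((-(Complex.conjCLE : ℂ →L[ℝ] ℂ)).comp (ContinuousLinearMap.snd ℝ ℂ ℂ)).prod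
    ((Complex.conjCLE : ℂ →L[ℝ] ℂ).comp (ContinuousLinearMap.fst ℝ ℂ ℂ))

@[simp] theorem J_apply (x : ℂ × ℂ) : J x = (-conj x.2, conj x.1) := rfl

theorem norm_J (x : ℂ × ℂ) : ‖J x‖ = ‖x‖ := by
  simp only [J_apply, Prod.norm_def, norm_neg, RCLike.norm_conj]
  exact max_comm _ _

/-- A zeroth order perturbation of size `u`, as in `∂̄Z = k + L Z`. -/
structure IsPot (u : ℂ → ℂ) (L : ℂ → ℂ × ℂ → ℂ × ℂ) : Prop where
  meas : ∀ f : ℂ → ℂ × ℂ, AEStronglyMeasurable f → AEStronglyMeasurable fun z => L z (f z)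
  sub : ∀ z x y, L z (x - y) = L z x - L z y
  le : ∀ z x, ‖L z x‖ ≤ ‖u z‖ * ‖x‖

theorem isPot_smul_J {u : ℂ → ℂ} (hu : AEStronglyMeasurable u) :
    IsPot u fun z x => u z • J x where
  meas f hf := hu.smul (J.continuous.comp_aestronglyMeasurable hf)
  sub z x y := by rw [map_sub, smul_sub]
  le z x := by rw [norm_smul, norm_J]

/-- The norm of the Cauchy transform from `L^s` to `L^r`, `1/s = 1/r + 1/2`. -/
def sobConst (r : ENNReal) : ENNReal := by
  classical
  exact if h : 2 < r ∧ r < ⊤ then (exists_eLpNorm_cauchyT_le (ℂ × ℂ) h.1 h.2).choose else 0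

theorem sobConst_ne_top (r : ENNReal) : sobConst r ≠ ⊤ := by
  unfold sobConst
  split_ifs with h
  · exact (exists_eLpNorm_cauchyT_le (ℂ × ℂ) h.1 h.2).choose_spec.1
  · simp

theorem eLpNorm_cauchyT_le {r : ENNReal} (hr : 2 < r) (hrt : r < ⊤) {f : ℂ → ℂ × ℂ}
    (hf : AEStronglyMeasurable f) :
    eLpNorm (cauchyT f) r volume ≤ sobConst r * eLpNorm f (sobExp r) volume := by
  unfold sobConst
  rw [dif_pos ⟨hr, hrt⟩]
  exact (exists_eLpNorm_cauchyT_le (ℂ × ℂ) hr hrt).choose_spec.2 f hf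

/-- The potential `u` is so small that the integral equation can be solved in `L^r`. -/
def SmallPot (r : ENNReal) (u : ℂ → ℂ) : Prop := sobConst r * eLpNorm u 2 volume ≤ 2⁻¹

variable {u : ℂ → ℂ} {L : ℂ → ℂ × ℂ → ℂ × ℂ} {r : ENNReal} {f g k Z : ℂ → ℂ × ℂ}

theorem eLpNorm_fun_smul_le {E : Type*} [NormedAddCommGroup E] [NormedSpace ℂ E] {p q s : ENNReal}
    [ENNReal.HolderTriple p q s] {v : ℂ → ℂ} {f : ℂ → E} (hv : AEStronglyMeasurable v)
    (hf : AEStronglyMeasurable f) :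
    eLpNorm (fun z => v z • f z) s volume ≤ eLpNorm v p volume * eLpNorm f q volume :=
  eLpNorm_smul_le_mul_eLpNorm hf hv

theorem eLpNorm_smul_le_sobExp {E : Type*} [NormedAddCommGroup E] [NormedSpace ℂ E] {v : ℂ → ℂ}
    {f : ℂ → E} (hv : AEStronglyMeasurable v) (hf : AEStronglyMeasurable f) :
    eLpNorm (v • f) (sobExp r) volume ≤ eLpNorm v 2 volume * eLpNorm f r volume := by
  have := holderTriple_sobExp' r
  exact eLpNorm_smul_le_mul_eLpNorm hf hv

theorem IsPot.eLpNorm_le (hL : IsPot u L) (hu : AEStronglyMeasurable u)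
    (hf : AEStronglyMeasurable f) :
    eLpNorm (fun z => L z (f z)) (sobExp r) volume ≤ eLpNorm u 2 volume * eLpNorm f r volume := by
  refine le_trans (eLpNorm_mono fun z => ?_) (eLpNorm_smul_le_sobExp hu hf)
  rw [Pi.smul_apply', norm_smul]
  exact hL.le z _

theorem IsPot.memLp (hL : IsPot u L) (hu : MemLp u 2) (hf : MemLp f r) :
    MemLp (fun z => L z (f z)) (sobExp r) :=
  ⟨hL.meas f hf.1, (hL.eLpNorm_le hu.1 hf.1).trans_lt (ENNReal.mul_lt_top hu.2 hf.2)⟩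

theorem IsPot.eLpNorm_cauchyT_le (hL : IsPot u L) (hr : 2 < r) (hrt : r < ⊤)
    (hu : AEStronglyMeasurable u) (hs : SmallPot r u) (hf : AEStronglyMeasurable f) :
    eLpNorm (cauchyT fun z => L z (f z)) r volume ≤ 2⁻¹ * eLpNorm f r volume := by
  refine (QuaternionicSpinor.eLpNorm_cauchyT_le hr hrt (hL.meas f hf)).trans ?_
  calc sobConst r * eLpNorm (fun z => L z (f z)) (sobExp r) volume
      ≤ sobConst r * (eLpNorm u 2 volume * eLpNorm f r volume) := by
        gcongr; exact hL.eLpNorm_le hu hf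
    _ = sobConst r * eLpNorm u 2 volume * eLpNorm f r volume := by ring
    _ ≤ 2⁻¹ * eLpNorm f r volume := mul_le_mul' hs le_rfl

theorem le_two_mul_of_le_add_half {a b : ENNReal} (ha : a ≠ ⊤) (h : a ≤ b + 2⁻¹ * a) : a ≤ 2 * b := by
  rcases eq_or_ne b ⊤ with rfl | hb
  · simp
  lift a to NNReal using ha
  lift b to NNReal using hb
  have e : (2⁻¹ : ENNReal) = ((2⁻¹ : NNReal) : ENNReal) := by
    rw [ENNReal.coe_inv (by simp)]; simp
  rw [e] at h
  norm_cast at h ⊢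
  rw [← NNReal.coe_le_coe] at h ⊢
  push_cast at h ⊢
  linarith

/-- The a priori estimate. -/
theorem IsPot.apriori (hL : IsPot u L) (hr : 2 < r) (hrt : r < ⊤) (hu : MemLp u 2)
    (hs : SmallPot r u) (hZ : MemLp Z r) (hk : MemLp k (sobExp r))
    (h : Z =ᵐ[volume] cauchyT fun z => k z + L z (Z z)) :
    eLpNorm Z r volume ≤ 2 * (sobConst r * eLpNorm k (sobExp r) volume) := by
  refine le_two_mul_of_le_add_half hZ.2.ne ?_
  have h1 := cauchyT_add hr hrt hk (hL.memLp hu hZ)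
  calc eLpNorm Z r volume
      = eLpNorm (cauchyT k + cauchyT fun z => L z (Z z)) r volume :=
        eLpNorm_congr_ae (h.trans h1)
    _ ≤ _ := eLpNorm_add_le (aestronglyMeasurable_cauchyT hk.1)
        (aestronglyMeasurable_cauchyT (hL.meas _ hZ.1)) (one_le_two.trans hr.le)
    _ ≤ _ := add_le_add (QuaternionicSpinor.eLpNorm_cauchyT_le hr hrt hk.1)
        (hL.eLpNorm_cauchyT_le hr hrt hu.1 hs hZ.1)

theorem IsPot.solution_unique (hL : IsPot u L) (hr : 2 < r) (hrt : r < ⊤) (hu : MemLp u 2)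
    (hs : SmallPot r u) {Z' : ℂ → ℂ × ℂ} (hZ : MemLp Z r) (hZ' : MemLp Z' r)
    (hk : MemLp k (sobExp r))
    (h : Z =ᵐ[volume] cauchyT fun z => k z + L z (Z z))
    (h' : Z' =ᵐ[volume] cauchyT fun z => k z + L z (Z' z)) : Z =ᵐ[volume] Z' := by
  have h1 : Z - Z' =ᵐ[volume] cauchyT fun z => (0 : ℂ → ℂ × ℂ) z + L z ((Z - Z') z) := by
    have e : (fun z => (0 : ℂ → ℂ × ℂ) z + L z ((Z - Z') z))
        = fun z => (k z + L z (Z z)) - (k z + L z (Z' z)) := by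
      ext1 z; simp [hL.sub]
    rw [e]
    filter_upwards [h, h', cauchyT_sub hr hrt (hk.add (hL.memLp hu hZ))
      (hk.add (hL.memLp hu hZ'))] with z e1 e2 e3
    rw [Pi.sub_apply, e1, e2]
    exact e3.symm
  have h2 := hL.apriori hr hrt hu hs (hZ.sub hZ') MemLp.zero h1
  simp only [eLpNorm_zero, mul_zero, nonpos_iff_eq_zero] at h2
  rw [eLpNorm_eq_zero_iff (hZ.sub hZ').1 (zero_lt_two.trans hr).ne'] at h2
  filter_upwards [h2] with z hz
  exact sub_eq_zero.1 hz

theorem IsPot.exists_solution (hL : IsPot u L) (hr : 2 < r) (hrt : r < ⊤) (hu : MemLp u 2)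
    (hs : SmallPot r u) (hk : MemLp k (sobExp r)) :
    ∃ Z : ℂ → ℂ × ℂ, MemLp Z r ∧ Z = cauchyT fun z => k z + L z (Z z) := by
  have : Fact (1 ≤ r) := ⟨one_le_two.trans hr.le⟩
  have hm : ∀ Z : Lp (ℂ × ℂ) r (volume : Measure ℂ),
      MemLp (cauchyT fun z => k z + L z (Z z)) r := fun Z =>
    memLp_cauchyT hr hrt (hk.add (hL.memLp hu (Lp.memLp Z)))
  let Φ : Lp (ℂ × ℂ) r (volume : Measure ℂ) → Lp (ℂ × ℂ) r (volume : Measure ℂ) :=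
    fun Z => (hm Z).toLp _
  have hΦ : ContractingWith 2⁻¹ Φ := by
    refine ⟨by rw [← NNReal.coe_lt_coe]; norm_num, fun Z Z' => ?_⟩
    rw [Lp.edist_toLp_toLp, Lp.edist_def]
    have e : (2⁻¹ : ENNReal) = ((2⁻¹ : NNReal) : ENNReal) := by
      rw [ENNReal.coe_inv (by simp)]; simp
    rw [← e]
    refine le_trans (le_of_eq (eLpNorm_congr_ae ?_))
      (hL.eLpNorm_cauchyT_le hr hrt hu.1 hs ((Lp.memLp Z).sub (Lp.memLp Z')).1)
    have e2 : (fun z => L z ((⇑Z - ⇑Z') z))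
        = fun z => (k z + L z (Z z)) - (k z + L z (Z' z)) := by
      ext1 z; simp [hL.sub]
    rw [e2]
    exact (cauchyT_sub hr hrt (hk.add (hL.memLp hu (Lp.memLp Z)))
      (hk.add (hL.memLp hu (Lp.memLp Z')))).symm
  have hfix : Φ hΦ.fixedPoint = hΦ.fixedPoint := hΦ.fixedPoint_isFixedPt
  set Y := hΦ.fixedPoint
  have h1 : (Y : ℂ → ℂ × ℂ) =ᵐ[volume] cauchyT fun z => k z + L z (Y z) := by
    have := (hm Y).coeFn_toLp
    rw [show (hm Y).toLp _ = Y from hfix] at this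
    exact this
  refine ⟨cauchyT fun z => k z + L z (Y z), hm Y, cauchyT_congr_ae ?_⟩
  filter_upwards [h1] with z hz
  rw [← hz]

/-- Continuous dependence of the solution on the data. -/
theorem IsPot.lpTo (hr : 2 < r) (hrt : r < ⊤) {un : ℕ → ℂ → ℂ} {Ln : ℕ → ℂ → ℂ × ℂ → ℂ × ℂ}
    (hLn : ∀ n, IsPot (un n) (Ln n)) (hL : IsPot u L) (hun : ∀ n, MemLp (un n) 2)
    (hu : MemLp u 2) (hsn : ∀ n, SmallPot r (un n)) {Zn : ℕ → ℂ → ℂ × ℂ}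
    {kn : ℕ → ℂ → ℂ × ℂ} (hZn : ∀ n, MemLp (Zn n) r) (hZ : MemLp Z r)
    (hk : LpTo (r⁻¹ + 2⁻¹) volume kn k)
    (hLZ : LpTo (r⁻¹ + 2⁻¹) volume (fun n z => Ln n z (Z z)) fun z => L z (Z z))
    (hn : ∀ n, Zn n =ᵐ[volume] cauchyT fun z => kn n z + Ln n z (Zn n z))
    (h : Z =ᵐ[volume] cauchyT fun z => k z + L z (Z z)) : LpTo r⁻¹ volume Zn Z := by
  have hk1 : ∀ n, MemLp (kn n) (sobExp r) := hk.memLp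
  have hk2 : MemLp k (sobExp r) := hk.memLp_lim
  have hsum := hk.add ((one_lt_sobExp hr).le |> fun h => by
    rw [sobExp] at h; exact ENNReal.one_le_inv.1 h) hLZ
  refine LpTo.of_le (b := fun n => 2 * (sobConst r * eLpNorm (fun z => kn n z + Ln n z (Z z)
    - (k z + L z (Z z))) (sobExp r) volume)) (fun n => by rw [inv_inv]; exact hZn n)
    (by rwa [inv_inv]) ?_ fun n => ?_
  · have := ENNReal.Tendsto.const_mul (ENNReal.Tendsto.const_mul hsum.tendsto
      (Or.inr (sobConst_ne_top r))) (Or.inr (ENNReal.ofNat_ne_top (n := 2)))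
    simpa [sobExp] using this
  · rw [inv_inv]
    refine (hLn n).apriori hr hrt (hun n) (hsn n) ((hZn n).sub hZ)
      (((hk1 n).add ((hLn n).memLp (hun n) hZ)).sub (hk2.add (hL.memLp hu hZ))) ?_
    have e : (fun z => kn n z + Ln n z (Z z) - (k z + L z (Z z)) + Ln n z (Zn n z - Z z))
        = fun z => (kn n z + Ln n z (Zn n z)) - (k z + L z (Z z)) := by
      ext1 z; rw [(hLn n).sub]; abel
    have e' := cauchyT_sub hr hrt ((hk1 n).add ((hLn n).memLp (hun n) (hZn n)))
      (hk2.add (hL.memLp hu hZ))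
    simp only [Pi.add_apply] at e'
    change Zn n - Z =ᵐ[volume] cauchyT fun z => kn n z + Ln n z (Z z) - (k z + L z (Z z))
      + Ln n z (Zn n z - Z z)
    rw [e]
    filter_upwards [hn n, h, e'] with z e1 e2 e3
    rw [e3, Pi.sub_apply, e1, e2]
    rfl

theorem lpTo_smul_J {un : ℕ → ℂ → ℂ} (hun : LpTo 2⁻¹ volume un u)
    (hZ : MemLp Z r) :
    LpTo (r⁻¹ + 2⁻¹) volume (fun n z => un n z • J (Z z)) fun z => u z • J (Z z) := by
  have hu2 : ∀ n, MemLp (un n) 2 := by simpa using hun.memLp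
  have hu : MemLp u 2 := by simpa using hun.memLp_lim
  refine LpTo.of_le (b := fun n => eLpNorm (fun z => un n z - u z) 2 volume * eLpNorm Z r volume)
    (fun n => (isPot_smul_J (hu2 n).1).memLp (hu2 n) hZ) ((isPot_smul_J hu.1).memLp hu hZ) ?_
    fun n => ?_
  · have := hun.tendsto
    rw [inv_inv] at this
    simpa using ENNReal.Tendsto.mul_const this (Or.inr hZ.2.ne)
  · have e : (fun z => un n z • J (Z z) - u z • J (Z z)) = fun z => (un n z - u z) • J (Z z) := by
      ext1 z; rw [sub_smul]
    rw [e]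
    exact (isPot_smul_J ((hu2 n).sub hu).1).eLpNorm_le ((hu2 n).sub hu).1 hZ.1

end Solve

/-! ### Smoothness of solutions with smooth data -/

section Smooth

variable {r : ENNReal}

theorem integrable_cauchyT_integrand' {E : Type*} [NormedAddCommGroup E] [NormedSpace ℂ E]
    (hr : 2 < r) (hrt : r < ⊤) {f : ℂ → E} (hf : MemLp f r) (hf1 : MemLp f 1)
    (z : ℂ) : Integrable fun w => ((π : ℂ) * (z - w))⁻¹ • f w := by
  obtain ⟨C, hC, h⟩ := exists_enorm_cauchyT_le E hr hrt
  refine ⟨(by fun_prop : Measurable fun w : ℂ =>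
      ((π : ℂ) * (z - w))⁻¹).aestronglyMeasurable.smul hf.1,
      lt_of_le_of_lt (lintegral_mono fun w => ?_) ((h f hf.1 z).trans_lt
        (ENNReal.add_lt_top.2 ⟨ENNReal.mul_lt_top hC.lt_top hf.2, hf1.2⟩))⟩
  rw [enorm_smul, mul_comm]
  gcongr
  exact enorm_kernel_le z w

theorem tendsto_zero_of_le_half {e c : ℕ → ENNReal} (h0 : e 0 ≠ ⊤) (hct : ∀ n, c n ≠ ⊤)
    (h : ∀ n, e (n + 1) ≤ c n + 2⁻¹ * e n) (hc : Tendsto c atTop (𝓝 0)) :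
    Tendsto e atTop (𝓝 0) := by
  have het : ∀ n, e n ≠ ⊤ := by
    intro n
    induction n with
    | zero => exact h0
    | succ n ih =>
      exact ne_top_of_le_ne_top (ENNReal.add_ne_top.2 ⟨hct n, ENNReal.mul_ne_top (by simp) ih⟩) (h n)
  rw [ENNReal.tendsto_nhds_zero]
  intro ε hε
  have hε4 : 0 < ε / 4 := ENNReal.div_pos hε.ne' (by simp)
  obtain ⟨N, hN⟩ := eventually_atTop.1 ((ENNReal.tendsto_nhds_zero.1 hc) (ε / 4) hε4)
  have key : ∀ m, e (N + m) ≤ (2⁻¹) ^ m * e N + ε / 2 := by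
    intro m
    induction m with
    | zero => simp
    | succ m ih =>
      calc e (N + (m + 1)) ≤ c (N + m) + 2⁻¹ * e (N + m) := h _
        _ ≤ ε / 4 + 2⁻¹ * ((2⁻¹) ^ m * e N + ε / 2) := by
          gcongr
          exact hN _ (by omega)
        _ = (2⁻¹) ^ (m + 1) * e N + (ε / 4 + 2⁻¹ * (ε / 2)) := by ring
        _ = (2⁻¹) ^ (m + 1) * e N + ε / 2 := by
          congr 1
          have e1 : 2⁻¹ * (ε / 2) = ε / 4 := by
            rw [div_eq_mul_inv, div_eq_mul_inv, mul_left_comm, ← ENNReal.mul_inv (by simp) (by simp)]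
            norm_num
          have e2 : ε / 2 = ε / 4 + ε / 4 := by
            rw [div_eq_mul_inv, div_eq_mul_inv, ← mul_add, quarter_add_quarter]
          rw [e1, e2]
  have hp : Tendsto (fun m : ℕ => (2⁻¹ : ENNReal) ^ m * e N) atTop (𝓝 0) := by
    have := ENNReal.tendsto_pow_atTop_nhds_zero_of_lt_one (r := 2⁻¹) (by simp)
    simpa using ENNReal.Tendsto.mul_const this (Or.inr (het N))
  obtain ⟨m₀, hm₀⟩ := eventually_atTop.1 ((ENNReal.tendsto_nhds_zero.1 hp) (ε / 2)
    (ENNReal.half_pos hε.ne'))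
  filter_upwards [eventually_ge_atTop (N + m₀)] with n hn
  obtain ⟨m, rfl⟩ := Nat.exists_eq_add_of_le (show N ≤ n by omega)
  calc e (N + m) ≤ _ := key m
    _ ≤ ε / 2 + ε / 2 := by gcongr; exact hm₀ m (by omega)
    _ = ε := ENNReal.add_halves ε

/-- For a test function `v`, the map `Y ↦ T (v J Y)` is bounded from `L^r` to `L^∞`. -/
theorem exists_enorm_cauchyT_smul_J_le (hr : 2 < r) (hrt : r < ⊤) {v : ℂ → ℂ} (hv : Continuous v)
    (hvc : HasCompactSupport v) : ∃ C : ENNReal, C ≠ ⊤ ∧ ∀ Y : ℂ → ℂ × ℂ, MemLp Y r →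
      (∀ z, Integrable fun w => ((π : ℂ) * (z - w))⁻¹ • (v w • J (Y w))) ∧
      ∀ z, ‖cauchyT (fun w => v w • J (Y w)) z‖ₑ ≤ C * eLpNorm Y r volume := by
  obtain ⟨C, hC, h⟩ := exists_enorm_cauchyT_le (ℂ × ℂ) hr hrt
  have hr1 : 1 ≤ r := one_le_two.trans hr.le
  have hconj : r.conjExponent.HolderConjugate r :=
    (ENNReal.HolderConjugate.conjExponent hr1).symm
  have hvt := memLp_of_continuous_compact hv hvc ⊤
  have hv' := memLp_of_continuous_compact hv hvc r.conjExponent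
  refine ⟨C * eLpNorm v ⊤ volume + eLpNorm v r.conjExponent volume,
    ENNReal.add_ne_top.2 ⟨ENNReal.mul_ne_top hC hvt.2.ne, hv'.2.ne⟩, fun Y hY => ?_⟩
  have hJ : MemLp (fun z => J (Y z)) r :=
    hY.of_le (J.continuous.comp_aestronglyMeasurable hY.1) (ae_of_all _ fun z => (norm_J _).le)
  have hJn : eLpNorm (fun z => J (Y z)) r volume = eLpNorm Y r volume :=
    eLpNorm_congr_norm_ae (ae_of_all _ fun z => norm_J _)
  have b1 : eLpNorm (fun w => v w • J (Y w)) r volume ≤ eLpNorm v ⊤ volume * eLpNorm Y r volume := by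
    rw [← hJn]
    exact eLpNorm_fun_smul_le hvt.1 hJ.1
  have b2 : eLpNorm (fun w => v w • J (Y w)) 1 volume
      ≤ eLpNorm v r.conjExponent volume * eLpNorm Y r volume := by
    rw [← hJn]
    exact eLpNorm_fun_smul_le hvt.1 hJ.1
  have m : AEStronglyMeasurable fun z => v z • J (Y z) := hvt.1.smul hJ.1
  refine ⟨integrable_cauchyT_integrand' hr hrt
    ⟨m, b1.trans_lt (ENNReal.mul_lt_top hvt.2 hY.2)⟩
    ⟨m, b2.trans_lt (ENNReal.mul_lt_top hv'.2 hY.2)⟩, fun z => ?_⟩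
  refine ((enorm_cauchyT_le _ z).trans (h _ m z)).trans ?_
  rw [add_mul, mul_assoc]
  gcongr

theorem integrable_cauchyT_integrand_of_continuous {E : Type*} [NormedAddCommGroup E]
    [NormedSpace ℂ E] {f : ℂ → E} (hf : Continuous f) (hc : HasCompactSupport f) (z : ℂ) :
    Integrable fun w => ((π : ℂ) * (z - w))⁻¹ • f w :=
  integrable_cauchyT_integrand' (r := 4) (by norm_num) (by norm_num)
    (hf.memLp_of_hasCompactSupport hc) (hf.memLp_of_hasCompactSupport hc) z

theorem cauchyT_sub_apply {E : Type*} [NormedAddCommGroup E] [NormedSpace ℂ E] {f g : ℂ → E}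
    {z : ℂ} (hf : Integrable fun w => ((π : ℂ) * (z - w))⁻¹ • f w)
    (hg : Integrable fun w => ((π : ℂ) * (z - w))⁻¹ • g w) :
    cauchyT (fun w => f w - g w) z = cauchyT f z - cauchyT g z := by
  simp only [cauchyT, smul_sub]
  exact integral_sub hf hg

theorem cauchyT_add_apply {E : Type*} [NormedAddCommGroup E] [NormedSpace ℂ E] {f g : ℂ → E}
    {z : ℂ} (hf : Integrable fun w => ((π : ℂ) * (z - w))⁻¹ • f w)
    (hg : Integrable fun w => ((π : ℂ) * (z - w))⁻¹ • g w) :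
    cauchyT (fun w => f w + g w) z = cauchyT f z + cauchyT g z := by
  simp only [cauchyT, smul_add]
  exact integral_add hf hg

/-- The approximants to the solution of `Z = T (f + u J Z)`. -/
def neumann (u : ℂ → ℂ) (f : ℂ → ℂ × ℂ) : ℕ → ℂ → ℂ × ℂ
  | 0 => 0
  | n + 1 => cauchyT fun z => f z + u z • J (neumann u f n z)

variable {u : ℂ → ℂ} (hr : 2 < r) (hrt : r < ⊤) (hu : ContDiff ℝ ∞ u) (huc : HasCompactSupport u)
  (hs : SmallPot r u)

theorem contDiff_smul_J {m : ℕ∞} {v : ℂ → ℂ} {X : ℂ → ℂ × ℂ} (hv : ContDiff ℝ m v)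
    (hX : ContDiff ℝ m X) : ContDiff ℝ m fun z => v z • J (X z) :=
  hv.smul (J.contDiff.comp hX)

theorem contDiff_neumann (hu : ContDiff ℝ ∞ u) (huc : HasCompactSupport u) {m : ℕ∞}
    {f : ℂ → ℂ × ℂ} (hf : ContDiff ℝ m f) (hfc : HasCompactSupport f) (n : ℕ) :
    ContDiff ℝ m (neumann u f n) := by
  induction n with
  | zero => exact contDiff_const
  | succ n ih =>
    exact contDiff_cauchyT (hf.add (contDiff_smul_J (hu.of_le (by exact_mod_cast le_top)) ih))
      (hfc.add huc.smul_right)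

include hr hrt hu huc hs

/-- If `e_{n+1} = T (c_n + u J e_n)` and `c_n → 0` suitably then `e_n → 0` uniformly. -/
theorem tendsto_of_recursion {e c : ℕ → ℂ → ℂ × ℂ} (he : MemLp (e 0) r)
    (hc : ∀ n, MemLp (c n) r)
    (hc0 : Tendsto (fun n => eLpNorm (c n) r volume) atTop (𝓝 0))
    (hcu : ∃ b : ℕ → ENNReal, Tendsto b atTop (𝓝 0) ∧ ∀ n z, ‖c n z‖ₑ ≤ b n)
    (h : ∀ n z, e (n + 1) z = c n z + cauchyT (fun w => u w • J (e n w)) z) :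
    (∀ n, MemLp (e n) r) ∧ Tendsto (fun n => eLpNorm (e n) r volume) atTop (𝓝 0) ∧
    ∃ b : ℕ → ENNReal, Tendsto b atTop (𝓝 0) ∧ ∀ n z, ‖e (n + 1) z‖ₑ ≤ b n := by
  have hu2 : MemLp u 2 := memLp_of_continuous_compact hu.continuous huc 2
  have hpot := isPot_smul_J hu2.1
  have hm : ∀ n, MemLp (e n) r := by
    intro n
    induction n with
    | zero => exact he
    | succ n ih =>
      rw [show e (n + 1) = _ from funext (h n)]
      exact (hc n).add (memLp_cauchyT hr hrt (hpot.memLp hu2 ih))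
  have ht : Tendsto (fun n => eLpNorm (e n) r volume) atTop (𝓝 0) := by
    refine tendsto_zero_of_le_half he.2.ne (fun n => (hc n).2.ne) (fun n => ?_) hc0
    rw [show e (n + 1) = c n + cauchyT (fun w => u w • J (e n w)) from funext (h n)]
    exact (eLpNorm_add_le (hc n).1 (aestronglyMeasurable_cauchyT (hpot.meas _ (hm n).1))
      (one_le_two.trans hr.le)).trans
      (add_le_add le_rfl (hpot.eLpNorm_cauchyT_le hr hrt hu2.1 hs (hm n).1))
  refine ⟨hm, ht, ?_⟩
  obtain ⟨b, hb, hcb⟩ := hcu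
  obtain ⟨C, hC, hCb⟩ := exists_enorm_cauchyT_smul_J_le hr hrt hu.continuous huc
  refine ⟨fun n => b n + C * eLpNorm (e n) r volume, ?_, fun n z => ?_⟩
  · simpa using hb.add (ENNReal.Tendsto.const_mul ht (Or.inr hC))
  · rw [h]
    exact (enorm_add_le _ _).trans (add_le_add (hcb n z) ((hCb _ (hm n)).2 z))

theorem neumann_sub {f Z : ℂ → ℂ × ℂ} (hf : Continuous f) (hfc : HasCompactSupport f)
    (hZ : MemLp Z r) (hZe : Z = cauchyT fun z => f z + u z • J (Z z)) :
    (∀ n, MemLp (fun z => neumann u f n z - Z z) r) ∧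
    Tendsto (fun n => eLpNorm (fun z => neumann u f n z - Z z) r volume) atTop (𝓝 0) ∧
    ∃ b : ℕ → ENNReal, Tendsto b atTop (𝓝 0) ∧ ∀ n z, ‖neumann u f (n + 1) z - Z z‖ₑ ≤ b n := by
  obtain ⟨C, hC, hCb⟩ := exists_enorm_cauchyT_smul_J_le hr hrt hu.continuous huc
  refine tendsto_of_recursion hr hrt hu huc hs (e := fun n z => neumann u f n z - Z z)
    (c := fun _ _ => 0) ?_ (fun _ => MemLp.zero') (by simp) ⟨0, tendsto_const_nhds, by simp⟩ ?_
  · exact (hZ.neg).ae_eq (ae_of_all _ fun z => by simp [neumann])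
  · intro n z
    have hcont : Continuous (neumann u f n) :=
      (contDiff_neumann (m := 0) hu huc (contDiff_zero.2 hf) hfc n).continuous
    have hd : ∀ w, u w • J (neumann u f n w - Z w)
        = (f w + u w • J (neumann u f n w)) - (f w + u w • J (Z w)) := fun w => by
      rw [map_sub, smul_sub]; abel
    simp_rw [hd]
    have i1 : Integrable fun w => ((π : ℂ) * (z - w))⁻¹ •
        (f w + u w • J (neumann u f n w)) := integrable_cauchyT_integrand_of_continuous
      (hf.add (hu.continuous.smul (J.continuous.comp hcont))) (hfc.add huc.smul_right) z
    have i2 : Integrable fun w => ((π : ℂ) * (z - w))⁻¹ • (f w + u w • J (Z w)) := by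
      simp_rw [smul_add]
      exact (integrable_cauchyT_integrand_of_continuous hf hfc z).add ((hCb Z hZ).1 z)
    rw [zero_add, cauchyT_sub_apply i1 i2, ← hZe]
    rfl

omit hr hrt hu huc hs in
theorem tendstoUniformly_of_enorm_le {E : Type*} [NormedAddCommGroup E] {F : ℕ → ℂ → E} {G : ℂ → E}
    {b : ℕ → ENNReal} (hb : Tendsto b atTop (𝓝 0)) (h : ∀ n z, ‖F n z - G z‖ₑ ≤ b n) :
    TendstoUniformly F G atTop := by
  rw [EMetric.tendstoUniformly_iff]
  intro ε hε
  filter_upwards [hb.eventually_lt_const hε] with n hn z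
  rw [edist_comm, edist_eq_enorm_sub]
  exact (h n z).trans_lt hn

omit hr hrt hu huc hs in
theorem enorm_clm_le {E : Type*} [NormedAddCommGroup E] [NormedSpace ℝ E] (A : ℂ →L[ℝ] E) :
    ‖A‖ₑ ≤ ‖A 1‖ₑ + ‖A I‖ₑ := by
  have : ‖A‖ ≤ ‖A 1‖ + ‖A I‖ := by
    refine A.opNorm_le_bound (by positivity) fun v => ?_
    have e : A v = v.re • A 1 + v.im • A I := by
      rw [← map_smul, ← map_smul, ← map_add]
      congr 1
      apply Complex.ext <;> simp
    rw [e, add_mul]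
    refine (norm_add_le _ _).trans (add_le_add ?_ ?_) <;> rw [norm_smul, mul_comm] <;> gcongr
    · exact Complex.abs_re_le_norm v
    · exact Complex.abs_im_le_norm v
  rw [← ofReal_norm, ← ofReal_norm, ← ofReal_norm, ← ENNReal.ofReal_add (by positivity)
    (by positivity)]
  exact ofReal_le_ofReal this

/-- The derivatives of the approximants converge to the solution of the differentiated equation. -/
theorem fderiv_neumann_sub {f Z V : ℂ → ℂ × ℂ} (hf : ContDiff ℝ 1 f) (hfc : HasCompactSupport f)
    (hZ : MemLp Z r) (hZe : Z = cauchyT fun z => f z + u z • J (Z z)) (hZc : Continuous Z)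
    (v : ℂ) (hV : MemLp V r) (hVc : Continuous V)
    (hVe : V = cauchyT fun z => (fderiv ℝ f z v + fderiv ℝ u z v • J (Z z)) + u z • J (V z)) :
    ∃ b : ℕ → ENNReal, Tendsto b atTop (𝓝 0) ∧
      ∀ n z, ‖fderiv ℝ (neumann u f (n + 1)) z v - V z‖ₑ ≤ b n := by
  obtain ⟨hm, ht, -⟩ := neumann_sub hr hrt hu huc hs hf.continuous hfc hZ hZe
  have hX : ∀ n, ContDiff ℝ 1 (neumann u f n) := fun n =>
    contDiff_neumann (m := 1) hu huc hf hfc n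
  have hu1 : ContDiff ℝ 1 u := hu.of_le one_le_infty
  set v' : ℂ → ℂ := fun z => fderiv ℝ u z v with hv'
  have hv'c : Continuous v' := (hu1.continuous_fderiv (by simp)).clm_apply continuous_const
  have hv's : HasCompactSupport v' := huc.fderiv_apply (𝕜 := ℝ) v
  have hf'c : Continuous fun z => fderiv ℝ f z v :=
    (hf.continuous_fderiv (by simp)).clm_apply continuous_const
  have hf's : HasCompactSupport fun z => fderiv ℝ f z v := hfc.fderiv_apply (𝕜 := ℝ) v
  have hv'2 : MemLp v' 2 := memLp_of_continuous_compact hv'c hv's 2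
  have hpot := isPot_smul_J hv'2.1
  obtain ⟨C, hC, hCb⟩ := exists_enorm_cauchyT_smul_J_le hr hrt hv'c hv's
  refine (tendsto_of_recursion hr hrt hu huc hs
    (e := fun n z => fderiv ℝ (neumann u f n) z v - V z)
    (c := fun n => cauchyT fun z => v' z • J (neumann u f n z - Z z)) ?_
    (fun n => memLp_cauchyT hr hrt (hpot.memLp hv'2 (hm n))) ?_
    ⟨fun n => C * eLpNorm (fun z => neumann u f n z - Z z) r volume, ?_,
      fun n z => (hCb _ (hm n)).2 z⟩ ?_).2.2
  · refine (hV.neg).ae_eq (ae_of_all _ fun z => ?_)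
    rw [show neumann u f 0 = fun _ => 0 from rfl]
    simp
  · refine tendsto_of_tendsto_of_tendsto_of_le_of_le tendsto_const_nhds (h := fun n =>
      sobConst r * (eLpNorm v' 2 volume * eLpNorm (fun z => neumann u f n z - Z z) r volume)) ?_
      (fun _ => zero_le) fun n => ?_
    · simpa using ENNReal.Tendsto.const_mul (ENNReal.Tendsto.const_mul ht (Or.inr hv'2.2.ne))
        (Or.inr (sobConst_ne_top r))
    · refine (eLpNorm_cauchyT_le hr hrt (hpot.meas _ (hm n).1)).trans ?_
      exact mul_le_mul' le_rfl (hpot.eLpNorm_le hv'2.1 (hm n).1)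
  · simpa using ENNReal.Tendsto.const_mul ht (Or.inr hC)
  · intro n z
    have hXc := (hX n).continuous
    have hX'c : Continuous fun z => fderiv ℝ (neumann u f n) z v :=
      ((hX n).continuous_fderiv (by simp)).clm_apply continuous_const
    have hd : ∀ w, fderiv ℝ (fun z => f z + u z • J (neumann u f n z)) w v
        = fderiv ℝ f w v + v' w • J (neumann u f n w) + u w • J (fderiv ℝ (neumann u f n) w v) := by
      intro w
      have d1 : DifferentiableAt ℝ (neumann u f n) w := (hX n).differentiable (by simp) w
      have d2 : HasFDerivAt (fun z => J (neumann u f n z)) (J.comp (fderiv ℝ (neumann u f n) w)) w :=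
        J.hasFDerivAt.comp w d1.hasFDerivAt
      have d3 := (hu1.differentiable (by simp) w).hasFDerivAt
      have d4 := ((hf.differentiable (by simp) w).hasFDerivAt.add (d3.smul d2)).fderiv
      rw [show (fun z => f z + u z • J (neumann u f n z)) = f + u • fun z => J (neumann u f n z)
        from rfl, d4]
      simp only [add_apply, smul_apply,
        ContinuousLinearMap.comp_apply, ContinuousLinearMap.smulRight_apply, hv']
      abel
    have e1 : fderiv ℝ (neumann u f (n + 1)) z v = cauchyT (fun w => fderiv ℝ f w v
        + v' w • J (neumann u f n w) + u w • J (fderiv ℝ (neumann u f n) w v)) z := by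
      rw [show neumann u f (n + 1) = cauchyT fun z => f z + u z • J (neumann u f n z) from rfl,
        fderiv_cauchyT (f := fun z => f z + u z • J (neumann u f n z))
          (hf.add (hu1.smul (J.contDiff.comp (hX n)))) (hfc.add huc.smul_right)]
      simp_rw [hd]
    rw [e1]
    conv_lhs => rw [hVe]
    rw [← cauchyT_sub_apply, ← cauchyT_add_apply]
    · congr 1
      ext1 w
      simp only [map_sub, smul_sub]
      abel
    · exact (hCb _ (hm n)).1 z
    · exact integrable_cauchyT_integrand_of_continuous
        (f := fun w => u w • J (fderiv ℝ (neumann u f n) w v - V w))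
        (hu.continuous.smul (J.continuous.comp (hX'c.sub hVc))) huc.smul_right z
    · exact integrable_cauchyT_integrand_of_continuous
        (f := fun w => fderiv ℝ f w v
          + v' w • J (neumann u f n w) + u w • J (fderiv ℝ (neumann u f n) w v))
        ((hf'c.add (hv'c.smul (J.continuous.comp hXc))).add
          (hu.continuous.smul (J.continuous.comp hX'c)))
        ((hf's.add hv's.smul_right).add huc.smul_right) z
    · exact integrable_cauchyT_integrand_of_continuous
        (f := fun w => fderiv ℝ f w v + v' w • J (Z w) + u w • J (V w))
        ((hf'c.add (hv'c.smul (J.continuous.comp hZc))).add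
          (hu.continuous.smul (J.continuous.comp hVc)))
        ((hf's.add hv's.smul_right).add huc.smul_right) z

/-- The solution of the integral equation with smooth data is smooth. -/
theorem contDiff_solution_nat (m : ℕ) : ∀ f Z : ℂ → ℂ × ℂ, ContDiff ℝ m f → HasCompactSupport f →
    MemLp Z r → Z = (cauchyT fun z => f z + u z • J (Z z)) → ContDiff ℝ m Z := by
  have hu2 : MemLp u 2 := memLp_of_continuous_compact hu.continuous huc 2
  have hpot := isPot_smul_J hu2.1
  induction m with
  | zero =>
    intro f Z hf hfc hZ hZe
    obtain ⟨-, -, b, hb, hle⟩ := neumann_sub hr hrt hu huc hs hf.continuous hfc hZ hZe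
    refine contDiff_zero.2 ((tendstoUniformly_of_enorm_le (F := fun n => neumann u f (n + 1))
      hb hle).continuous (Frequently.of_forall fun n => ?_))
    exact (contDiff_neumann (m := 0) hu huc (contDiff_zero.2 hf.continuous) hfc _).continuous
  | succ m ih =>
    intro f Z hf hfc hZ hZe
    have hf1 : ContDiff ℝ 1 f := hf.of_le (by exact_mod_cast Nat.le_add_left 1 m)
    have hZm : ContDiff ℝ m Z := ih f Z (hf.of_le (by exact_mod_cast Nat.le_succ m)) hfc hZ hZe
    have hV : ∀ v : ℂ, ∃ V : ℂ → ℂ × ℂ, ContDiff ℝ m V ∧ ∃ b : ℕ → ENNReal, Tendsto b atTop (𝓝 0) ∧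
        ∀ n z, ‖fderiv ℝ (neumann u f (n + 1)) z v - V z‖ₑ ≤ b n := by
      intro v
      have hk : ContDiff ℝ m fun z => fderiv ℝ f z v + fderiv ℝ u z v • J (Z z) := by
        refine ContDiff.add ?_ (contDiff_smul_J (m := m) ?_ hZm)
        · exact (hf.fderiv_right (m := m) (by exact_mod_cast le_rfl)).clm_apply contDiff_const
        · exact (hu.fderiv_right (m := m) (by exact_mod_cast le_top)).clm_apply contDiff_const
      have hkc : HasCompactSupport fun z => fderiv ℝ f z v + fderiv ℝ u z v • J (Z z) :=
        (hfc.fderiv_apply (𝕜 := ℝ) v).add (huc.fderiv_apply (𝕜 := ℝ) v).smul_right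
      obtain ⟨V, hV1, hV2⟩ := hpot.exists_solution hr hrt hu2 hs
        (hk.continuous.memLp_of_hasCompactSupport hkc)
      have hVm := ih _ V hk hkc hV1 hV2
      exact ⟨V, hVm, fderiv_neumann_sub hr hrt hu huc hs hf1 hfc hZ hZe hZm.continuous v hV1
        hVm.continuous hV2⟩
    obtain ⟨V₁, hV₁, b₁, hb₁, hle₁⟩ := hV 1
    obtain ⟨V₂, hV₂, b₂, hb₂, hle₂⟩ := hV I
    let G : ℂ → ℂ →L[ℝ] ℂ × ℂ := fun z =>
      Complex.reCLM.smulRight (V₁ z) + Complex.imCLM.smulRight (V₂ z)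
    obtain ⟨-, -, b, hb, hle⟩ := neumann_sub hr hrt hu huc hs hf.continuous hfc hZ hZe
    have hder : ∀ z, HasFDerivAt Z (G z) z := by
      refine hasFDerivAt_of_tendstoUniformly (l := atTop) (f := fun n => neumann u f (n + 1))
        (f' := fun n => fderiv ℝ (neumann u f (n + 1))) (tendstoUniformly_of_enorm_le
          (b := fun n => b₁ n + b₂ n) (by simpa using hb₁.add hb₂) fun n z => ?_)
        (fun n z => ?_)
        fun z => (tendstoUniformly_of_enorm_le (F := fun n => neumann u f (n + 1))
          hb hle).tendsto_at z
      · refine (enorm_clm_le _).trans (add_le_add ?_ ?_)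
        · simpa [G] using hle₁ n z
        · simpa [G] using hle₂ n z
      · exact ((contDiff_neumann (m := 1) hu huc hf1 hfc (n + 1)).differentiable
          (by simp) z).hasFDerivAt
    push_cast
    refine contDiff_succ_iff_hasFDerivAt.2 ⟨G, ?_, hder⟩
    refine contDiff_clm_apply_iff.2 fun y => ?_
    simp only [G, add_apply, ContinuousLinearMap.smulRight_apply]
    exact (hV₁.const_smul _).add (hV₂.const_smul _)

theorem contDiff_solution {f Z : ℂ → ℂ × ℂ} (hf : ContDiff ℝ ∞ f) (hfc : HasCompactSupport f)
    (hZ : MemLp Z r) (hZe : Z = cauchyT fun z => f z + u z • J (Z z)) : ContDiff ℝ ∞ Z :=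
  contDiff_infty.2 fun m => contDiff_solution_nat hr hrt hu huc hs m f Z
    (hf.of_le (by exact_mod_cast le_top)) hfc hZ hZe

end Smooth

/-! ### Spinors that solve `∂̄F = u J F` weakly: localization and regularity -/

section Localize

/-- `∂̄F = G` weakly on `S`, for pairs of functions. -/
def WeakDBV (S : Set ℂ) (F G : ℂ → ℂ × ℂ) : Prop :=
  WeakDB S (fun z => (F z).1) (fun z => (G z).1) ∧ WeakDB S (fun z => (F z).2) fun z => (G z).2

theorem WeakDBV.mono {S S' : Set ℂ} {F G : ℂ → ℂ × ℂ} (h : WeakDBV S F G) (hS : S' ⊆ S) :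
    WeakDBV S' F G := ⟨h.1.mono hS, h.2.mono hS⟩

theorem WeakDBV.congr_ae {S : Set ℂ} {F G F' G' : ℂ → ℂ × ℂ} (h : WeakDBV S F G)
    (hF : ∀ᵐ z, z ∈ S → F z = F' z) (hG : ∀ᵐ z, z ∈ S → G z = G' z) : WeakDBV S F' G' := by
  constructor
  · refine h.1.congr_ae ?_ ?_
    · filter_upwards [hF] with z hz hzS using by rw [hz hzS]
    · filter_upwards [hG] with z hz hzS using by rw [hz hzS]
  · refine h.2.congr_ae ?_ ?_
    · filter_upwards [hF] with z hz hzS using by rw [hz hzS]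
    · filter_upwards [hG] with z hz hzS using by rw [hz hzS]

variable {r q m : ENNReal}

theorem cauchyT_fst (hr : 2 < r) (hrt : r < ⊤) {f : ℂ → ℂ × ℂ} (hf : MemLp f (sobExp r)) :
    (fun z => (cauchyT f z).1) =ᵐ[volume] cauchyT fun w => (f w).1 := by
  filter_upwards [integrable_cauchyT_integrand hr hrt hf] with z hz
  exact fst_integral hz

theorem cauchyT_snd (hr : 2 < r) (hrt : r < ⊤) {f : ℂ → ℂ × ℂ} (hf : MemLp f (sobExp r)) :
    (fun z => (cauchyT f z).2) =ᵐ[volume] cauchyT fun w => (f w).2 := by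
  filter_upwards [integrable_cauchyT_integrand hr hrt hf] with z hz
  exact snd_integral hz

theorem weakDBV_cauchyT (hr : 2 < r) (hrt : r < ⊤) {g : ℂ → ℂ × ℂ}
    (hg : MemLp g (sobExp r)) : WeakDBV Set.univ (cauchyT g) g := by
  constructor
  · refine (weakDB_cauchyT hr hrt hg.fst).congr_ae ?_ (ae_of_all _ fun _ _ => rfl)
    filter_upwards [cauchyT_fst hr hrt hg] with z hz _ using hz.symm
  · refine (weakDB_cauchyT hr hrt hg.snd).congr_ae ?_ (ae_of_all _ fun _ _ => rfl)
    filter_upwards [cauchyT_snd hr hrt hg] with z hz _ using hz.symm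

theorem WeakDBV.eq_cauchyT (hr : 2 < r) (hrt : r < ⊤) {F G : ℂ → ℂ × ℂ}
    (h : WeakDBV Set.univ F G) (hF : LocallyIntegrable F) (hG : MemLp G (sobExp r))
    {K : Set ℂ} (hK : IsCompact K) (hFK : ∀ z ∉ K, F z = 0) (hGK : ∀ z ∉ K, G z = 0) :
    F =ᵐ[volume] cauchyT G := by
  have h1 := h.1.eq_cauchyT hr hrt (fun x => (hF x).imp fun _ hs => ⟨hs.1, hs.2.fst⟩) hG.fst hK
    (fun z hz => by rw [hFK z hz]; rfl) (fun z hz => by rw [hGK z hz]; rfl)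
  have h2 := h.2.eq_cauchyT hr hrt (fun x => (hF x).imp fun _ hs => ⟨hs.1, hs.2.snd⟩) hG.snd hK
    (fun z hz => by rw [hFK z hz]; rfl) (fun z hz => by rw [hGK z hz]; rfl)
  filter_upwards [h1, h2, cauchyT_fst hr hrt hG, cauchyT_snd hr hrt hG] with z e1 e2 e3 e4
  exact Prod.ext (e1.trans e3.symm) (e2.trans e4.symm)

theorem memLp_solution_of_le (hq : 2 < q) (hqm : q ≤ m) (hmt : m < ⊤) {u : ℂ → ℂ}
    {k Z : ℂ → ℂ × ℂ} (hu : MemLp u 2) {K : Set ℂ} (hK : IsCompact K)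
    (huK : ∀ z ∉ K, u z = 0) (hk : MemLp k (sobExp m)) (hkK : ∀ z ∉ K, k z = 0)
    (hZ : MemLp Z m) (hZe : Z = cauchyT fun z => k z + u z • J (Z z)) :
    MemLp Z q := by
  rw [hZe]
  refine memLp_cauchyT hq (hqm.trans_lt hmt) ?_
  refine (hk.add ((isPot_smul_J hu.1).memLp hu hZ)).mono_exponent_of_measure_support_ne_top
    (s := K) (fun z hz => ?_) hK.measure_lt_top.ne (sobExp_mono hqm)
  simp [hkK z hz, huK z hz]

theorem J_ofReal_smul (c : ℝ) (x : ℂ × ℂ) : J ((c : ℂ) • x) = (c : ℂ) • J x := by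
  ext <;> simp

theorem memLp_smul_of_tsupport_subset {S : Set ℂ} (hS : MeasurableSet S) {f : ℂ → ℂ × ℂ}
    {η : ℂ → ℂ} {p : ENNReal}
    (hf : MemLp f p (vol S)) (hη : Continuous η) (hc : HasCompactSupport η)
    (hηS : tsupport η ⊆ S) : MemLp (fun z => η z • f z) p := by
  refine (memLp_prod_iff).2 ⟨?_, ?_⟩
  · exact memLp_mul_of_tsupport_subset hS hf.fst hη hc hηS
  · exact memLp_mul_of_tsupport_subset hS hf.snd hη hc hηS

/-- A spinor in the `L^q`-kernel, `q > 2`, agrees near `o` with the solution in `L^m` of an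
integral equation, for every `m ≥ q` for which the potential is small. -/
theorem WeakDBV.exists_solution {o : ℂ} {R : ℝ} (hR : 0 < R) {U : ℂ → ℂ} {Φ : ℂ → ℂ × ℂ}
    (hq : 2 < q) (hqm : q ≤ m) (hmt : m < ⊤)
    (hU : MemLp U 2 (vol (ball o R)))
    (hΦ : MemLp Φ q (vol (ball o R)))
    (h : WeakDBV (ball o R) Φ fun z => U z • J (Φ z))
    (hsq : SmallPot q ((ball o R).indicator U))
    (hsm : SmallPot m ((ball o R).indicator U)) :
    ∃ F k : ℂ → ℂ × ℂ, MemLp F m ∧ MemLp k q ∧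
      (∀ z ∈ ball o (R / 2), k z = 0) ∧ (∀ z ∉ ball o R, k z = 0) ∧
      (∀ᵐ z, z ∈ ball o (R / 2) → F z = Φ z) ∧
      F = cauchyT fun z => k z + (ball o R).indicator U z • J (F z) := by
  obtain ⟨ρ, hρ, hρc, hρs, hρ1, -⟩ := exists_cutoff o (r := R / 2)
    (R := 3 * R / 4) (by linarith) (by linarith)
  have hqt := hqm.trans_lt hmt
  have hm := hq.trans_le hqm
  set χ : ℂ → ℂ := fun z => (ρ z : ℂ) with hχ
  set u := (ball o R).indicator U with hu
  have hχd : ContDiff ℝ ∞ χ := contDiff_ofReal hρ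
  have hχc : HasCompactSupport χ := hasCompactSupport_ofReal hρc
  have hχS : tsupport χ ⊆ ball o R := by
    rw [hχ, tsupport_ofReal]
    exact hρs.trans (closedBall_subset_ball (by linarith))
  have hDχS : tsupport (delBar χ) ⊆ ball o R := tsupport_delBar_subset.trans hχS
  have hDχc : Continuous (delBar χ) := hχd.continuous_delBar one_le_infty
  have hu2 : MemLp u 2 := (memLp_indicator_iff_restrict measurableSet_ball).2 hU
  have hpot := isPot_smul_J hu2.1
  have hq1 : 1 ≤ q := one_le_two.trans hq.le
  have hfin := volume_ball_ne_top o R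
  have hUJ : MemLp (fun z => U z • J (Φ z)) (sobExp q) (vol (ball o R)) := by
    have hJ : MemLp (fun z => J (Φ z)) q (vol (ball o R)) :=
      hΦ.of_le (J.continuous.comp_aestronglyMeasurable hΦ.1) (ae_of_all _ fun z => (norm_J _).le)
    have := holderTriple_sobExp' q
    exact memLp_prod_iff.2 ⟨hJ.fst.mul' hU, hJ.snd.mul' hU⟩
  have hs1 : 1 ≤ sobExp q := (one_lt_sobExp hq).le
  set F₀ : ℂ → ℂ × ℂ := fun z => χ z • Φ z with hF₀
  set k : ℂ → ℂ × ℂ := fun z => delBar χ z • Φ z with hk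
  have hF₀q : MemLp F₀ q :=
    memLp_smul_of_tsupport_subset measurableSet_ball hΦ hχd.continuous hχc hχS
  have hkq : MemLp k q :=
    memLp_smul_of_tsupport_subset measurableSet_ball hΦ hDχc hχc.delBar hDχS
  have hχ0 : ∀ z ∉ ball o R, χ z = 0 := fun z hz =>
    off_tsupport fun h => hz (hχS h)
  have hDχ0 : ∀ z ∉ ball o R, delBar χ z = 0 := fun z hz =>
    off_tsupport fun h => hz (hDχS h)
  have hK : IsCompact (closedBall o R) := isCompact_closedBall o R
  have hsub : ∀ z ∉ closedBall o R, z ∉ ball o R := fun z hz h =>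
    hz (ball_subset_closedBall h)
  have hkK : ∀ z ∉ closedBall o R, k z = 0 := fun z hz => by
    simp [hk, hDχ0 z (hsub z hz)]
  have huK : ∀ z ∉ closedBall o R, u z = 0 := fun z hz =>
    indicator_of_notMem (hsub z hz) _
  have hks : ∀ p, MemLp k (sobExp p) := fun p =>
    hkq.mono_exponent_of_measure_support_ne_top hkK hK.measure_lt_top.ne
      (sobExp_le_of_two_le hq.le)
  have hsrc : ∀ z, k z + u z • J (F₀ z) = χ z • (U z • J (Φ z)) + delBar χ z • Φ z := by
    intro z
    by_cases hz : z ∈ ball o R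
    · rw [hu, indicator_of_mem hz, hF₀, hk]
      simp only [hχ]
      rw [J_ofReal_smul, add_comm, smul_comm (U z)]
    · simp [hk, hu, hz, hχ0 z hz]
  have hF₀e : F₀ =ᵐ[volume] cauchyT fun z => k z + u z • J (F₀ z) := by
    refine WeakDBV.eq_cauchyT hq hqt ⟨?_, ?_⟩ (hF₀q.locallyIntegrable hq1)
      ((hks q).add (hpot.memLp hu2 hF₀q)) hK (fun z hz => ?_) fun z hz => ?_
    · simp_rw [hsrc]
      exact h.1.cutoff (MemLp.locallyIntegrableOn' hfin hq1 hΦ.fst)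
        (MemLp.locallyIntegrableOn' hfin hs1 hUJ.fst) hχd hχc hχS
    · simp_rw [hsrc]
      exact h.2.cutoff (MemLp.locallyIntegrableOn' hfin hq1 hΦ.snd)
        (MemLp.locallyIntegrableOn' hfin hs1 hUJ.snd) hχd hχc hχS
    · simp [hF₀, hχ0 z (hsub z hz)]
    · simp [hkK z hz, huK z hz]
  obtain ⟨Z, hZ, hZe⟩ := hpot.exists_solution hm hmt hu2 hsm (hks m)
  have hZq := memLp_solution_of_le hq hqm hmt hu2 hK huK (hks m) hkK hZ hZe
  have hZF : Z =ᵐ[volume] F₀ :=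
    hpot.solution_unique hq hqt hu2 hsq hZq hF₀q (hks q) hZe.eventuallyEq hF₀e
  refine ⟨Z, k, hZ, hkq, fun z hz => ?_, fun z hz => ?_, ?_, hZe⟩
  · simp only [hk]
    rw [delBar_eq_zero_of_eqOn_ball (o := o) (r := R / 2) (c := 1) (fun w hw => by
      simp [hχ, hρ1 w (ball_subset_closedBall hw)]) hz, zero_smul]
  · simp [hk, hDχ0 z hz]
  · filter_upwards [hZF] with z hz hzR
    rw [hz, hF₀]
    simp [hχ, hρ1 z (ball_subset_closedBall hzR)]

/-- The potential is small on small balls. -/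
theorem exists_ball_small {o : ℂ} {R : ℝ} {U : ℂ → ℂ} (hR : 0 < R)
    (hU : MemLp U 2 (vol (ball o R))) {ε : ENNReal} (hε : ε ≠ 0) :
    ∃ R' > 0, R' ≤ R ∧ ∀ r ≤ R', eLpNorm ((ball o r).indicator U) 2 volume ≤ ε := by
  set V := (ball o R).indicator U
  have hV : MemLp V 2 := (memLp_indicator_iff_restrict measurableSet_ball).2 hU
  obtain ⟨e, he, hee⟩ : ∃ e : ℝ, 0 < e ∧ ofReal e ≤ ε := by
    rcases eq_or_ne ε ⊤ with rfl | ht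
    · exact ⟨1, one_pos, le_top⟩
    · exact ⟨ε.toReal, toReal_pos hε ht, by rw [ENNReal.ofReal_toReal ht]⟩
  obtain ⟨δ, hδ, h⟩ := hV.eLpNorm_indicator_le one_le_two (by simp) he
  refine ⟨min R (Real.sqrt (δ / π)), lt_min hR (Real.sqrt_pos.2 (by positivity)),
    min_le_left _ _, fun r hr => ?_⟩
  have e1 : (ball o r).indicator V = (ball o r).indicator U := by
    rw [Set.indicator_indicator, Set.inter_eq_left.2
      (ball_subset_ball (hr.trans (min_le_left _ _)))]
  rw [← e1]
  refine (h _ measurableSet_ball ?_).trans hee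
  rcases le_or_gt r 0 with h0 | h0
  · simp [ball_eq_empty.2 h0]
  · rw [Complex.volume_ball]
    have h1 : r ^ 2 ≤ δ / π := by
      rw [← Real.sq_sqrt (show 0 ≤ δ / π by positivity)]
      have := hr.trans (min_le_right R (Real.sqrt (δ / π)))
      gcongr
    rw [← ENNReal.ofReal_pow h0.le, ← ENNReal.ofReal_coe_nnreal, NNReal.coe_real_pi,
      ← ofReal_mul (by positivity)]
    refine ofReal_le_ofReal ?_
    rwa [le_div_iff₀ pi_pos] at h1

end Localize

/-! ### The gauge transformation -/

section Gauge

/-- The hermitian product. -/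
def herm (x y : ℂ × ℂ) : ℂ := x.1 * conj y.1 + x.2 * conj y.2

/-- The square of the hermitian norm. -/
def nsq (x : ℂ × ℂ) : ℝ := ‖x.1‖ ^ 2 + ‖x.2‖ ^ 2

/-- The determinant. -/
def det2 (x y : ℂ × ℂ) : ℂ := x.1 * y.2 - x.2 * y.1

theorem nsq_nonneg (x : ℂ × ℂ) : 0 ≤ nsq x := by unfold nsq; positivity

theorem nsq_eq_zero {x : ℂ × ℂ} : nsq x = 0 ↔ x = 0 := by
  unfold nsq
  constructor
  · intro h
    have h1 : ‖x.1‖ ^ 2 = 0 := by nlinarith [sq_nonneg ‖x.1‖, sq_nonneg ‖x.2‖]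
    have h2 : ‖x.2‖ ^ 2 = 0 := by nlinarith [sq_nonneg ‖x.1‖, sq_nonneg ‖x.2‖]
    exact Prod.ext (by simpa using h1) (by simpa using h2)
  · rintro rfl; simp

theorem nsq_pos {x : ℂ × ℂ} (h : x ≠ 0) : 0 < nsq x :=
  lt_of_le_of_ne (nsq_nonneg x) fun h0 => h (nsq_eq_zero.1 h0.symm)

theorem herm_self (x : ℂ × ℂ) : herm x x = nsq x := by
  unfold herm nsq
  rw [Complex.mul_conj, Complex.mul_conj, normSq_eq_norm_sq, normSq_eq_norm_sq]
  push_cast; rfl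

theorem sq_norm_le_nsq (x : ℂ × ℂ) : ‖x‖ ^ 2 ≤ nsq x := by
  unfold nsq
  rw [Prod.norm_def]
  rcases max_cases ‖x.1‖ ‖x.2‖ with h | h <;> rw [h.1] <;> nlinarith [sq_nonneg ‖x.1‖, sq_nonneg ‖x.2‖]

theorem nsq_le (x : ℂ × ℂ) : nsq x ≤ 2 * ‖x‖ ^ 2 := by
  unfold nsq
  have h1 : ‖x.1‖ ^ 2 ≤ ‖x‖ ^ 2 := by gcongr; exact norm_fst_le x
  have h2 : ‖x.2‖ ^ 2 ≤ ‖x‖ ^ 2 := by gcongr; exact norm_snd_le x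
  linarith

theorem norm_herm_le (x y : ℂ × ℂ) : ‖herm x y‖ ≤ 2 * (‖x‖ * ‖y‖) := by
  unfold herm
  refine (norm_add_le _ _).trans ?_
  rw [norm_mul, norm_mul, RCLike.norm_conj, RCLike.norm_conj, two_mul]
  gcongr
  · exact norm_fst_le x
  · exact norm_fst_le y
  · exact norm_snd_le x
  · exact norm_snd_le y

theorem norm_det2_le (x y : ℂ × ℂ) : ‖det2 x y‖ ≤ 2 * (‖x‖ * ‖y‖) := by
  unfold det2
  refine (norm_sub_le _ _).trans ?_
  rw [norm_mul, norm_mul, two_mul]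
  gcongr
  · exact norm_fst_le x
  · exact norm_snd_le y
  · exact norm_snd_le x
  · exact norm_fst_le y

/-- The complex linear potential that agrees with `u J` along `F`. -/
def gaugePot (S : Set ℂ) (u : ℂ → ℂ) (F : ℂ → ℂ × ℂ) (z : ℂ) (x : ℂ × ℂ) : ℂ × ℂ :=
  (S.indicator u z * (herm x (F z) / nsq (F z))) • J (F z)

theorem gaugePot_self {S : Set ℂ} {u : ℂ → ℂ} {F : ℂ → ℂ × ℂ} {z : ℂ} (hz : z ∈ S) :
    gaugePot S u F z (F z) = u z • J (F z) := by
  rcases eq_or_ne (F z) 0 with h | h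
  · simp [gaugePot, h]
  · rw [gaugePot, herm_self, div_self (by exact_mod_cast (nsq_pos h).ne'), mul_one,
      indicator_of_mem hz]

theorem gaugePot_trace (S : Set ℂ) (u : ℂ → ℂ) (F : ℂ → ℂ × ℂ) (z : ℂ) (x y : ℂ × ℂ) :
    det2 (gaugePot S u F z x) y + det2 x (gaugePot S u F z y) = 0 := by
  simp only [gaugePot, det2, herm, J_apply, Prod.smul_mk, smul_eq_mul]
  ring

theorem norm_gauge_factor_le (x y : ℂ × ℂ) : ‖(herm x y / nsq y) • J y‖ ≤ 2 * ‖x‖ := by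
  rcases eq_or_ne y 0 with rfl | hy
  · simp
  · rw [norm_smul, norm_J, norm_div, norm_real, norm_of_nonneg (nsq_nonneg y),
      div_mul_eq_mul_div, div_le_iff₀ (nsq_pos hy)]
    calc ‖herm x y‖ * ‖y‖ ≤ 2 * (‖x‖ * ‖y‖) * ‖y‖ := by gcongr; exact norm_herm_le x y
      _ = 2 * ‖x‖ * ‖y‖ ^ 2 := by ring
      _ ≤ _ := by gcongr; exact sq_norm_le_nsq y

theorem continuous_herm : Continuous fun p : (ℂ × ℂ) × (ℂ × ℂ) => herm p.1 p.2 := by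
  unfold herm
  have := continuous_conj
  fun_prop

theorem continuous_nsq : Continuous nsq := by
  unfold nsq
  fun_prop

theorem isPot_gaugePot {S : Set ℂ} (hS : MeasurableSet S) {u : ℂ → ℂ} {F : ℂ → ℂ × ℂ}
    (hu : AEStronglyMeasurable u) (hF : AEStronglyMeasurable F) :
    IsPot (fun z => 2 * S.indicator u z) (gaugePot S u F) where
  meas f hf := by
    refine AEStronglyMeasurable.smul ((hu.indicator hS).mul (AEMeasurable.aestronglyMeasurable ?_))
      (J.continuous.comp_aestronglyMeasurable hF)
    exact (continuous_herm.comp_aestronglyMeasurable (hf.prodMk hF)).aemeasurable.div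
      (Complex.measurable_ofReal.comp_aemeasurable
        (continuous_nsq.comp_aestronglyMeasurable hF).aemeasurable)
  sub z x y := by
    simp only [gaugePot, herm, Prod.fst_sub, Prod.snd_sub, ← sub_smul]
    congr 1
    ring
  le z x := by
    rw [gaugePot, mul_smul, norm_smul, norm_mul]
    calc _ ≤ ‖S.indicator u z‖ * (2 * ‖x‖) := by gcongr; exact norm_gauge_factor_le x (F z)
      _ = _ := by rw [RCLike.norm_ofNat]; ring

theorem WeakDB.sub {S : Set ℂ} {f g f' g' : ℂ → ℂ} (h : WeakDB S f g) (h' : WeakDB S f' g')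
    (hf : LocallyIntegrableOn f S) (hg : LocallyIntegrableOn g S)
    (hf' : LocallyIntegrableOn f' S) (hg' : LocallyIntegrableOn g' S) :
    WeakDB S (fun z => f z - f' z) fun z => g z - g' z := by
  intro η h1 h2 h3
  have hD := h1.continuous_delBar one_le_infty
  have hs := tsupport_delBar_subset.trans h3
  simp_rw [sub_mul]
  rw [integral_sub (integrable_mul_of_tsupport_subset hf hD h2.delBar hs)
    (integrable_mul_of_tsupport_subset hf' hD h2.delBar hs),
    integral_sub (integrable_mul_of_tsupport_subset hg h1.continuous h2 h3)
    (integrable_mul_of_tsupport_subset hg' h1.continuous h2 h3), h η h1 h2 h3, h' η h1 h2 h3]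
  ring

theorem WeakDB.add_const {S : Set ℂ} {f g : ℂ → ℂ} (h : WeakDB S f g)
    (hf : LocallyIntegrableOn f S) (c : ℂ) : WeakDB S (fun z => c + f z) g := by
  intro η h1 h2 h3
  have hD := h1.continuous_delBar one_le_infty
  have hs := tsupport_delBar_subset.trans h3
  simp_rw [add_mul]
  rw [integral_add (integrable_mul_of_tsupport_subset (locallyIntegrableOn_const c) hD h2.delBar hs)
    (integrable_mul_of_tsupport_subset hf hD h2.delBar hs), h η h1 h2 h3, integral_const_mul,
    integral_delBar_eq_zero (h1.of_le one_le_infty) h2]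
  ring

variable {M : ENNReal}

theorem inv_add_inv_le_half (hM : 4 ≤ M) : M⁻¹ + M⁻¹ ≤ 2⁻¹ :=
  (add_le_add (inv_le_quarter hM) (inv_le_quarter hM)).trans quarter_add_quarter.le

theorem inv_add_half_add_inv_le_one (hM : 4 ≤ M) : M⁻¹ + 2⁻¹ + M⁻¹ ≤ 1 :=
  calc M⁻¹ + 2⁻¹ + M⁻¹ = (M⁻¹ + M⁻¹) + 2⁻¹ := by ring
    _ ≤ 2⁻¹ + 2⁻¹ := by gcongr; exact inv_add_inv_le_half hM
    _ = 1 := inv_two_add_inv_two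

theorem two_lt_of_four_le (hM : 4 ≤ M) : 2 < M := lt_of_lt_of_le (by norm_num) hM

theorem MemLp.mul_memLp_two {μ : Measure ℂ} [IsFiniteMeasure μ] (hM : 4 ≤ M) {f g : ℂ → ℂ}
    (hf : MemLp f M μ) (hg : MemLp g M μ) : MemLp (fun z => f z * g z) 2 μ := by
  rw [← inv_inv M] at hf hg
  have := MemLp.mono_inv (MemLp.mul_inv hf hg) (inv_add_inv_le_half hM)
  rwa [inv_inv] at this

theorem MemLp.mul_memLp_one {μ : Measure ℂ} [IsFiniteMeasure μ] (hM : 4 ≤ M) {f g : ℂ → ℂ}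
    (hf : MemLp f (sobExp M) μ) (hg : MemLp g M μ) : MemLp (fun z => f z * g z) 1 μ := by
  rw [← inv_inv M] at hg
  have := MemLp.mono_inv (MemLp.mul_inv (θ₁ := M⁻¹ + 2⁻¹) hf hg) (inv_add_half_add_inv_le_one hM)
  rwa [inv_one] at this

theorem LocallyIntegrableOn.of_memLp_one {S : Set ℂ} {f : ℂ → ℂ}
    (hf : MemLp f 1 (vol S)) : LocallyIntegrableOn f S :=
  IntegrableOn.locallyIntegrableOn (memLp_one_iff_integrable.1 hf)

theorem WeakDB.mul_add_cauchyT (hM : 4 ≤ M) (hMt : M < ⊤) {S : Set ℂ} (hS : volume S ≠ ⊤)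
    {f₁ κ₁ κ₂ g : ℂ → ℂ} (h : WeakDB S f₁ κ₁) (hf₁ : MemLp f₁ M (vol S))
    (hκ₁ : MemLp κ₁ (sobExp M) (vol S)) (hκ₂ : MemLp κ₂ (sobExp M)) (c : ℂ)
    (hg : g =ᵐ[volume] fun z => c + cauchyT κ₂ z) :
    WeakDB S (fun z => f₁ z * g z) (fun z => κ₁ z * g z + f₁ z * κ₂ z) := by
  have : IsFiniteMeasure (vol S) := ⟨by simpa using hS.lt_top⟩
  have hM2 := two_lt_of_four_le hM
  have h1 := h.mul_cauchyT hM hMt hS hf₁ hκ₁ hκ₂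
  have hT : MemLp (cauchyT κ₂) M (vol S) :=
    (memLp_cauchyT hM2 hMt hκ₂).mono_measure restrict_le
  have l1 : LocallyIntegrableOn f₁ S := MemLp.locallyIntegrableOn' hS (one_le_two.trans hM2.le) hf₁
  have l2 : LocallyIntegrableOn κ₁ S := MemLp.locallyIntegrableOn' hS (one_lt_sobExp hM2).le hκ₁
  have l3 := MemLp.locallyIntegrableOn' hS one_le_two (MemLp.mul_memLp_two hM hf₁ hT)
  have hκ₂' := hκ₂.mono_measure (restrict_le (μ := volume) (s := S))
  have l4 := LocallyIntegrableOn.of_memLp_one ((MemLp.mul_memLp_one hM hκ₁ hT).add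
    ((MemLp.mul_memLp_one hM hκ₂' hf₁).ae_eq (ae_of_all _ fun z => mul_comm _ _)))
  intro η hη hηc hηS
  have hD := hη.continuous_delBar one_le_infty
  have hs := tsupport_delBar_subset.trans hηS
  have e1 : (fun z => f₁ z * g z * delBar η z) =ᵐ[volume]
      fun z => c * (f₁ z * delBar η z) + f₁ z * cauchyT κ₂ z * delBar η z := by
    filter_upwards [hg] with z hz; rw [hz]; ring
  have e2 : (fun z => (κ₁ z * g z + f₁ z * κ₂ z) * η z) =ᵐ[volume]
      fun z => c * (κ₁ z * η z) + (κ₁ z * cauchyT κ₂ z + f₁ z * κ₂ z) * η z := by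
    filter_upwards [hg] with z hz; rw [hz]; ring
  rw [integral_congr_ae e1, integral_congr_ae e2, integral_add, integral_add, integral_const_mul,
    integral_const_mul, h η hη hηc hηS, h1 η hη hηc hηS]
  · ring
  · exact (integrable_mul_of_tsupport_subset l2 hη.continuous hηc hηS).const_mul c
  · exact integrable_mul_of_tsupport_subset l4 hη.continuous hηc hηS
  · exact (integrable_mul_of_tsupport_subset l1 hD hηc.delBar hs).const_mul c
  · exact integrable_mul_of_tsupport_subset l3 hD hηc.delBar hs

/-- The product rule for the determinant of a weak solution and a Cauchy transform. -/
theorem weakDB_det2 (hM : 4 ≤ M) (hMt : M < ⊤) {S : Set ℂ} (hS : volume S ≠ ⊤)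
    {X κ κ' v : ℂ → ℂ × ℂ} {e : ℂ × ℂ} (hX : WeakDBV S X κ) (hXM : MemLp X M (vol S))
    (hκ : MemLp κ (sobExp M) (vol S)) (hκ' : MemLp κ' (sobExp M))
    (hv : v = cauchyT κ') (hv0 : ∀ᵐ z, z ∈ S → det2 (κ z) (e + v z) + det2 (X z) (κ' z) = 0) :
    WeakDB S (fun z => det2 (X z) (e + v z)) 0 ∧
      MemLp (fun z => det2 (X z) (e + v z)) 2 (vol S) := by
  have : IsFiniteMeasure (vol S) := ⟨by simpa using hS.lt_top⟩
  have hM2 := two_lt_of_four_le hM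
  have hvM : MemLp v M (vol S) := by
    rw [hv]; exact (memLp_cauchyT hM2 hMt hκ').mono_measure restrict_le
  have hg : MemLp (fun z => e + v z) M (vol S) := (memLp_const e).add hvM
  have g1 : (fun z => (e + v z).1) =ᵐ[volume] fun z => e.1 + cauchyT (fun w => (κ' w).1) z := by
    filter_upwards [cauchyT_fst hM2 hMt hκ'] with z hz
    rw [← hz, hv]; rfl
  have g2 : (fun z => (e + v z).2) =ᵐ[volume] fun z => e.2 + cauchyT (fun w => (κ' w).2) z := by
    filter_upwards [cauchyT_snd hM2 hMt hκ'] with z hz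
    rw [← hz, hv]; rfl
  have w1 := hX.1.mul_add_cauchyT hM hMt hS hXM.fst hκ.fst hκ'.snd e.2 g2
  have w2 := hX.2.mul_add_cauchyT hM hMt hS hXM.snd hκ.snd hκ'.fst e.1 g1
  have m1 := MemLp.mul_memLp_two hM hXM.fst hg.snd
  have m2 := MemLp.mul_memLp_two hM hXM.snd hg.fst
  have hκr := hκ'.mono_measure (restrict_le (μ := volume) (s := S))
  have n1 := (MemLp.mul_memLp_one hM hκ.fst hg.snd).add
    ((MemLp.mul_memLp_one hM hκr.snd hXM.fst).ae_eq (ae_of_all _ fun z => mul_comm _ _))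
  have n2 := (MemLp.mul_memLp_one hM hκ.snd hg.fst).add
    ((MemLp.mul_memLp_one hM hκr.fst hXM.snd).ae_eq (ae_of_all _ fun z => mul_comm _ _))
  refine ⟨(w1.sub w2 (MemLp.locallyIntegrableOn' hS one_le_two m1)
    (LocallyIntegrableOn.of_memLp_one n1) (MemLp.locallyIntegrableOn' hS one_le_two m2)
    (LocallyIntegrableOn.of_memLp_one n2)).congr_ae (ae_of_all _ fun _ _ => rfl) ?_, m1.sub m2⟩
  filter_upwards [hv0] with z hz hzS
  have := hz hzS
  simp only [det2] at this
  rw [Pi.zero_apply, ← this]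
  ring

end Gauge

section Gauge

variable {M q : ENNReal}

theorem LpTo.integral_norm {E : Type*} [NormedAddCommGroup E] {μ : Measure ℂ} {f : ℕ → ℂ → E}
    (h : LpTo 1 μ f fun _ => 0) : Tendsto (fun n => ∫ z, ‖f n z‖ ∂μ) atTop (𝓝 0) := by
  have h1 : LpTo 1 μ (fun n z => ‖f n z‖) fun _ => (0 : ℝ) :=
    h.of_norm_le (c := 1) (fun n => (h.memLp n).1.norm) MemLp.zero' fun n => ae_of_all _ fun z => by
      simp
  simpa using h1.integral

theorem gaugePot_const {o : ℂ} {r : ℝ} (hr1 : r ≤ 1) (u : ℂ → ℂ) (F : ℂ → ℂ × ℂ) (e : ℂ × ℂ) (z : ℂ) :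
    gaugePot (ball o r) u F z ((ball o 1).indicator (fun _ => e) z)
      = gaugePot (ball o r) u F z e := by
  by_cases hz : z ∈ ball o r
  · rw [indicator_of_mem (ball_subset_ball hr1 hz)]
  · simp [gaugePot, hz]

theorem gaugePot_add (S : Set ℂ) (u : ℂ → ℂ) (F : ℂ → ℂ × ℂ) (z : ℂ) (x y : ℂ × ℂ) :
    gaugePot S u F z (x + y) = gaugePot S u F z x + gaugePot S u F z y := by
  simp only [gaugePot, herm, Prod.fst_add, Prod.snd_add, ← add_smul]
  congr 1
  ring

theorem memLp_indicator_ball (o : ℂ) (e : ℂ × ℂ) : MemLp ((ball o 1).indicator fun _ => e) M :=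
  memLp_indicator_const M measurableSet_ball e (Or.inr (volume_ball_ne_top o 1))

/-- Solutions of the gauge equation with a small potential are close to constants. -/
theorem gauge_estimate (hM : 2 < M) (hMt : M < ⊤) {o : ℂ} {r : ℝ} (hr1 : r ≤ 1) {u : ℂ → ℂ}
    {F v : ℂ → ℂ × ℂ} (hu : MemLp u 2) (hF : AEStronglyMeasurable F)
    (hs : SmallPot M fun z => 2 * (ball o r).indicator u z) {e : ℂ × ℂ}
    (hv : MemLp v M)
    (hve : v = cauchyT fun z => gaugePot (ball o r) u F z e
      + gaugePot (ball o r) u F z (v z)) :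
    eLpNorm v M volume ≤ 2 * (sobConst M * (eLpNorm (fun z => 2 * (ball o r).indicator u z) 2
      volume * eLpNorm ((ball o 1).indicator fun _ => e) M volume)) := by
  have hpot := isPot_gaugePot (measurableSet_ball (x := o) (ε := r)) hu.1 hF
  have hu2 : MemLp (fun z => 2 * (ball o r).indicator u z) 2 :=
    (hu.indicator measurableSet_ball).const_mul 2
  have hind := memLp_indicator_ball (M := M) o e
  have hkm := hpot.memLp hu2 hind
  simp only [gaugePot_const hr1] at hkm
  refine (hpot.apriori hM hMt hu2 hs hv hkm hve.eventuallyEq).trans ?_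
  have h := hpot.eLpNorm_le (r := M) hu2.1 hind.1
  simp only [gaugePot_const hr1] at h
  exact mul_le_mul' le_rfl (mul_le_mul' le_rfl h)

theorem exists_gauge_solution (hM : 2 < M) (hMt : M < ⊤) {o : ℂ} {r : ℝ} (hr1 : r ≤ 1)
    {u : ℂ → ℂ} {F : ℂ → ℂ × ℂ} (hu : MemLp u 2) (hF : AEStronglyMeasurable F)
    (hs : SmallPot M fun z => 2 * (ball o r).indicator u z) (e : ℂ × ℂ) :
    MemLp (fun z => gaugePot (ball o r) u F z e) (sobExp M) ∧
    ∃ v : ℂ → ℂ × ℂ, MemLp v M ∧ v = cauchyT fun z => gaugePot (ball o r) u F z e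
      + gaugePot (ball o r) u F z (v z) := by
  have hpot := isPot_gaugePot (measurableSet_ball (x := o) (ε := r)) hu.1 hF
  have hu2 : MemLp (fun z => 2 * (ball o r).indicator u z) 2 :=
    (hu.indicator measurableSet_ball).const_mul 2
  have hind := memLp_indicator_ball (M := M) o e
  have hkm := hpot.memLp hu2 hind
  simp only [gaugePot_const hr1] at hkm
  exact ⟨hkm, hpot.exists_solution hM hMt hu2 hs hkm⟩

/-- For the gauge solutions the determinant with a solution of `∂̄F = u J F` is holomorphic. -/
theorem gauge_det (hM : 4 ≤ M) (hMt : M < ⊤) {o : ℂ} {r : ℝ} (hr1 : r ≤ 1)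
    {u : ℂ → ℂ} {F v : ℂ → ℂ × ℂ} (hu : MemLp u 2) (hF : MemLp F M)
    (hs : SmallPot M fun z => 2 * (ball o r).indicator u z) {e : ℂ × ℂ}
    (hw : WeakDBV (ball o r) F fun z => u z • J (F z)) (hv : MemLp v M)
    (hve : v = cauchyT fun z => gaugePot (ball o r) u F z e
      + gaugePot (ball o r) u F z (v z)) :
    WeakDB (ball o r) (fun z => det2 (F z) (e + v z)) 0 ∧
      MemLp (fun z => det2 (F z) (e + v z)) 2 (vol (ball o r)) := by
  have hM2 := two_lt_of_four_le hM
  have hpot := isPot_gaugePot (measurableSet_ball (x := o) (ε := r)) hu.1 hF.1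
  have hu2 : MemLp (fun z => 2 * (ball o r).indicator u z) 2 :=
    (hu.indicator measurableSet_ball).const_mul 2
  have hk := (exists_gauge_solution hM2 hMt hr1 hu hF.1 hs e).1
  refine weakDB_det2 hM hMt (volume_ball_ne_top o r) hw
    (hF.mono_measure restrict_le)
    (((isPot_smul_J hu.1).memLp hu hF).mono_measure restrict_le)
    (hk.add (hpot.memLp hu2 hv)) hve (ae_of_all _ fun z hz => ?_)
  have h1 := gaugePot_trace (ball o r) u F z (F z) (e + v z)
  rw [gaugePot_self hz] at h1
  rwa [gaugePot_add] at h1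

theorem exists_norm_le_of_zero {H : ℂ → ℂ} {o : ℂ} (h : DifferentiableAt ℂ H o) (h0 : H o = 0) :
    ∃ C : ℝ, ∃ R > 0, 0 ≤ C ∧ ∀ z ∈ ball o R, ‖H z‖ ≤ C * ‖z - o‖ := by
  obtain ⟨C, hC, hb⟩ := h.isBigO_sub.exists_pos
  obtain ⟨R, hR, hb'⟩ := eventually_nhds_iff_ball.1 hb.bound
  exact ⟨C, R, hR, hC.le, fun z hz => by simpa [h0] using hb' z hz⟩

/-- Near a point where the spinor `F` has no zero there is a solution of the gauge equation whose
determinant with `F` is holomorphic and does not vanish at the point. -/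
theorem exists_gauge (hM : 4 ≤ M) (hMt : M < ⊤) (hqM : q ≤ M) {o : ℂ} {R₀ : ℝ} (hR₀ : 0 < R₀)
    {u : ℂ → ℂ} {F : ℂ → ℂ × ℂ} (hu : MemLp u 2) (hF : MemLp F M)
    (hw : WeakDBV (ball o R₀) F fun z => u z • J (F z))
    (hnz : ∀ R > 0, ¬ MemLp (fun z => (z - o)⁻¹ • F z) q (vol (ball o R))) :
    ∃ r > 0, r ≤ R₀ ∧ r ≤ 1 ∧ SmallPot M (fun z => 2 * (ball o r).indicator u z) ∧
    ∃ e : ℂ × ℂ, ∃ v : ℂ → ℂ × ℂ, MemLp v M ∧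
      (v = cauchyT fun z => gaugePot (ball o r) u F z e
        + gaugePot (ball o r) u F z (v z)) ∧
      ∃ H : ℂ → ℂ, DifferentiableOn ℂ H (ball o (r / 2)) ∧
        (∀ᵐ z, z ∈ ball o (r / 2) → det2 (F z) (e + v z) = H z) ∧ H o ≠ 0 := by
  have hM2 := two_lt_of_four_le hM
  have hM1 : M⁻¹ ≤ 1 := (inv_le_quarter hM).trans (by simp)
  set e₁ : ℂ × ℂ := (1, 0) with he₁
  set e₂ : ℂ × ℂ := (0, 1) with he₂
  have hb : ∀ n : ℕ, ∃ r > 0, r ≤ R₀ ∧ r ≤ 1 ∧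
      sobConst M * eLpNorm (fun z => 2 * (ball o r).indicator u z) 2 volume
        ≤ 2⁻¹ * ((n : ENNReal) + 1)⁻¹ := by
    intro n
    have hε : (4 * (sobConst M + 1) * ((n : ENNReal) + 1))⁻¹ ≠ 0 :=
      ENNReal.inv_ne_zero.2 (ENNReal.mul_ne_top (ENNReal.mul_ne_top (by simp)
        (by simp [sobConst_ne_top])) (by simp))
    obtain ⟨R, hR, hRR, h⟩ := exists_ball_small (o := o) hR₀
      (hu.mono_measure restrict_le) hε
    refine ⟨min R 1, lt_min hR one_pos, (min_le_left _ _).trans hRR, min_le_right _ _, ?_⟩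
    have e1 : eLpNorm (fun z => 2 * (ball o (min R 1)).indicator u z) 2 volume
        = 2 * eLpNorm ((ball o (min R 1)).indicator u) 2 volume := by
      have := eLpNorm_const_smul (2 : ℂ) ((ball o (min R 1)).indicator u) 2 volume
      rw [show (2 : ℂ) • (ball o (min R 1)).indicator u
        = fun z => 2 * (ball o (min R 1)).indicator u z from rfl] at this
      rw [this]
      congr 1
      rw [← ofReal_norm]; simp
    rw [e1]
    have hC1 : sobConst M + 1 ≠ 0 := by simp
    have hC2 : sobConst M + 1 ≠ ⊤ := by simp [sobConst_ne_top]
    calc sobConst M * (2 * eLpNorm ((ball o (min R 1)).indicator u) 2 volume)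
        ≤ (sobConst M + 1) * (2 * (4 * (sobConst M + 1) * ((n : ENNReal) + 1))⁻¹) := by
          gcongr
          · exact le_self_add
          · exact h _ (min_le_left _ _)
      _ = ((sobConst M + 1) * (sobConst M + 1)⁻¹) * (2 * 4⁻¹) * ((n : ENNReal) + 1)⁻¹ := by
          rw [ENNReal.mul_inv (Or.inr (by simp)) (Or.inr (by simp)),
            ENNReal.mul_inv (Or.inl (by simp)) (Or.inl (by simp))]
          ring
      _ = 2⁻¹ * ((n : ENNReal) + 1)⁻¹ := by
          rw [ENNReal.mul_inv_cancel hC1 hC2, one_mul, ← quarter_add_quarter, two_mul]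
  choose ρ hρ hρR hρ1 hρs using hb
  have hsm : ∀ n, SmallPot M fun z => 2 * (ball o (ρ n)).indicator u z := fun n =>
    (hρs n).trans (by
      conv_rhs => rw [← mul_one (2⁻¹ : ENNReal)]
      gcongr
      rw [ENNReal.inv_le_one]; simp)
  have hsol := fun n e => (exists_gauge_solution hM2 hMt (hρ1 n) hu hF.1 (hsm n) e).2
  choose w hwM hwe using hsol
  have hto : ∀ e, LpTo M⁻¹ volume (fun n => w n e) fun _ => 0 := by
    intro e
    refine LpTo.of_le (b := fun n => 2 * (2⁻¹ * ((n : ENNReal) + 1)⁻¹ *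
      eLpNorm ((ball o 1).indicator fun _ => e) M volume))
      (fun n => by rw [inv_inv]; exact hwM n e) MemLp.zero' ?_ fun n => ?_
    · have h1 : Tendsto (fun n : ℕ => ((n : ENNReal) + 1)⁻¹) atTop (𝓝 0) := by
        have := (tendsto_add_atTop_iff_nat 1).2 ENNReal.tendsto_inv_nat_nhds_zero
        simpa using this
      have h2 := ENNReal.Tendsto.const_mul (ENNReal.Tendsto.mul_const
        (ENNReal.Tendsto.const_mul h1 (Or.inr (show (2⁻¹ : ENNReal) ≠ ⊤ by simp)))
        (Or.inr (memLp_indicator_ball (M := M) o e).2.ne)) (Or.inr (show (2 : ENNReal) ≠ ⊤ by simp))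
      simpa using h2
    · rw [inv_inv]
      simp only [sub_zero]
      refine (gauge_estimate hM2 hMt (hρ1 n) hu hF.1 (hsm n) (hwM n e) (hwe n e)).trans ?_
      rw [← mul_assoc (sobConst M)]
      exact mul_le_mul' le_rfl (mul_le_mul' (hρs n) le_rfl)
  obtain ⟨C, hC, hrep⟩ := exists_holRep o one_pos (one_lt_two)
  set μ : Measure ℂ := vol (ball o 2) with hμ
  have hμf : IsFiniteMeasure μ := ⟨by simpa [hμ] using (volume_ball_ne_top o 2).lt_top⟩
  set D : ℕ → ℂ → ℂ := fun n z => det2 (e₁ + w n e₁ z) (e₂ + w n e₂ z) - 1 with hD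
  have hDw : ∀ n, WeakDB (ball o 2) (D n) 0 ∧ MemLp (D n) 2 μ := by
    intro n
    have hpot := isPot_gaugePot (measurableSet_ball (x := o) (ε := ρ n)) hu.1 hF.1
    have hu2 : MemLp (fun z => 2 * (ball o (ρ n)).indicator u z) 2 :=
      (hu.indicator measurableSet_ball).const_mul 2
    have hk := fun e => ((exists_gauge_solution hM2 hMt (hρ1 n) hu hF.1 (hsm n) e).1).add
      (hpot.memLp hu2 (hwM n e))
    have hX : WeakDBV (ball o 2) (fun z => e₁ + w n e₁ z) fun z =>
        gaugePot (ball o (ρ n)) u F z e₁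
          + gaugePot (ball o (ρ n)) u F z (w n e₁ z) := by
      have h1 := (weakDBV_cauchyT hM2 hMt (hk e₁)).mono (Set.subset_univ (ball o 2))
      have h2 := MemLp.locallyIntegrableOn' (volume_ball_ne_top o 2) (one_le_two.trans hM2.le)
        ((hwM n e₁).mono_measure (restrict_le (s := ball o 2))).fst
      have h3 := MemLp.locallyIntegrableOn' (volume_ball_ne_top o 2) (one_le_two.trans hM2.le)
        ((hwM n e₁).mono_measure (restrict_le (s := ball o 2))).snd
      replace h1 : WeakDBV (ball o 2) (w n e₁) fun z =>
        gaugePot (ball o (ρ n)) u F z e₁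
          + gaugePot (ball o (ρ n)) u F z (w n e₁ z) :=
        h1.congr_ae (ae_of_all _ fun z _ => (congrFun (hwe n e₁) z).symm)
          (ae_of_all _ fun _ _ => rfl)
      exact ⟨h1.1.add_const h2 e₁.1, h1.2.add_const h3 e₁.2⟩
    have hdet := weakDB_det2 hM hMt (volume_ball_ne_top o 2) hX
      ((memLp_const e₁).add ((hwM n e₁).mono_measure restrict_le))
      ((hk e₁).mono_measure restrict_le) (hk e₂) (hwe n e₂) (e := e₂)
      (ae_of_all _ fun z _ => by
        have := gaugePot_trace (ball o (ρ n)) u F z (e₁ + w n e₁ z) (e₂ + w n e₂ z)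
        rwa [gaugePot_add, gaugePot_add] at this)
    refine ⟨?_, hdet.2.sub (memLp_const 1)⟩
    have h4 := MemLp.locallyIntegrableOn' (volume_ball_ne_top o 2) one_le_two hdet.2
    have h5 := hdet.1.add_const h4 (-1)
    refine h5.congr_ae (ae_of_all _ fun z _ => ?_) (ae_of_all _ fun z _ => rfl)
    rw [hD]; ring
  have hDto : LpTo 1 μ D fun _ => 0 := by
    have hMM : M⁻¹ + M⁻¹ ≤ 1 := (inv_add_inv_le_half hM).trans (by simp)
    have a := fun e => (hto e).mono_measure (ν := μ) restrict_le
    have b1 := (((a e₁).fst.add hM1 (a e₂).snd).mono hM1).add le_rfl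
      ((((a e₁).fst.mul hM1 hMM (a e₂).snd).sub hMM ((a e₁).snd.mul hM1 hMM (a e₂).fst)).mono hMM)
    have b2 : (fun n z => (w n e₁ z).1 + (w n e₂ z).2 + ((w n e₁ z).1 * (w n e₂ z).2
        - (w n e₁ z).2 * (w n e₂ z).1)) = D := by
      ext n z
      simp only [hD, det2, he₁, he₂, Prod.fst_add, Prod.snd_add]
      ring
    rw [b2] at b1
    simpa using b1
  have hlim := (hDto.integral_norm).const_mul C
  rw [mul_zero] at hlim
  obtain ⟨n, hn⟩ := (hlim.eventually_lt_const (show (0 : ℝ) < 1 / 2 by norm_num)).exists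
  obtain ⟨D', -, hDD', hD'⟩ := hrep (D n) (hDw n).2 (hDw n).1
  have hdlow : ∀ᵐ z, z ∈ ball o 1 →
      1 / 2 ≤ ‖det2 (e₁ + w n e₁ z) (e₂ + w n e₂ z)‖ := by
    filter_upwards [hDD'] with z hz hz1
    have h1 := hD' z hz1
    rw [← hz hz1] at h1
    have h2 : det2 (e₁ + w n e₁ z) (e₂ + w n e₂ z) = 1 - -(D n z) := by rw [hD]; ring
    have h3 := norm_sub_norm_le (1 : ℂ) (-(D n z))
    rw [← h2, norm_one, norm_neg] at h3
    linarith [hn.le]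
  refine ⟨ρ n, hρ n, hρR n, hρ1 n, hsm n, ?_⟩
  obtain ⟨C', -, hrep'⟩ := exists_holRep o (half_pos (hρ n)) (half_lt_self (hρ n))
  have hdet := fun e => gauge_det hM hMt (hρ1 n) hu hF (hsm n)
    (hw.mono (ball_subset_ball (hρR n))) (hwM n e) (hwe n e)
  obtain ⟨H₁, hH₁, hae₁, -⟩ := hrep' _ (hdet e₁).2 (hdet e₁).1
  obtain ⟨H₂, hH₂, hae₂, -⟩ := hrep' _ (hdet e₂).2 (hdet e₂).1
  by_cases h1 : H₁ o = 0
  swap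
  · exact ⟨e₁, w n e₁, hwM n e₁, hwe n e₁, H₁, hH₁, hae₁, h1⟩
  by_cases h2 : H₂ o = 0
  swap
  · exact ⟨e₂, w n e₂, hwM n e₂, hwe n e₂, H₂, hH₂, hae₂, h2⟩
  exfalso
  have hz₀ : ball o (ρ n / 2) ∈ 𝓝 o := ball_mem_nhds o (half_pos (hρ n))
  obtain ⟨C₁, r₁, hr₁, hC₁, hb₁⟩ := exists_norm_le_of_zero (hH₁.differentiableAt hz₀) h1
  obtain ⟨C₂, r₂, hr₂, hC₂, hb₂⟩ := exists_norm_le_of_zero (hH₂.differentiableAt hz₀) h2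
  set R := min (min r₁ r₂) (ρ n / 2) with hR
  have hRpos : 0 < R := lt_min (lt_min hr₁ hr₂) (half_pos (hρ n))
  refine hnz R hRpos ?_
  have hg : ∀ e, MemLp (fun z => e + w n e z) M (vol (ball o R)) := fun e =>
    (memLp_const e).add ((hwM n e).mono_measure restrict_le)
  have hsum : MemLp (fun z => 2 * (C₁ * ‖e₂ + w n e₂ z‖ + C₂ * ‖e₁ + w n e₁ z‖)) q
      (vol (ball o R)) :=
    ((((hg e₂).norm.const_mul C₁).add ((hg e₁).norm.const_mul C₂)).const_mul 2).mono_exponent hqM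
  refine hsum.of_le ?_ ?_
  · exact ((by fun_prop : Measurable fun z : ℂ => (z - o)⁻¹).aestronglyMeasurable).smul
      (hF.1.mono_measure restrict_le)
  rw [ae_restrict_iff' measurableSet_ball]
  filter_upwards [hdlow, hae₁, hae₂] with z d1 a1 a2 hz
  have hzr : z ∈ ball o (ρ n / 2) := ball_subset_ball (min_le_right _ _) hz
  have hz1 : z ∈ ball o 1 := ball_subset_ball (by linarith [hρ1 n, hρ n]) hzr
  have hd := d1 hz1
  have k1 := hb₁ z (ball_subset_ball ((min_le_left _ _).trans (min_le_left _ _)) hz)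
  have k2 := hb₂ z (ball_subset_ball ((min_le_left _ _).trans (min_le_right _ _)) hz)
  rw [← a1 hzr] at k1
  rw [← a2 hzr] at k2
  set g₁ := e₁ + w n e₁ z
  set g₂ := e₂ + w n e₂ z
  have hid : det2 g₁ g₂ • F z = det2 (F z) g₂ • g₁ - det2 (F z) g₁ • g₂ := by
    ext <;> simp [det2] <;> ring
  have hle : 1 / 2 * ‖F z‖ ≤ (C₁ * ‖g₂‖ + C₂ * ‖g₁‖) * ‖z - o‖ := by
    calc 1 / 2 * ‖F z‖ ≤ ‖det2 g₁ g₂‖ * ‖F z‖ := by gcongr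
      _ = ‖det2 (F z) g₂ • g₁ - det2 (F z) g₁ • g₂‖ := by rw [← norm_smul, hid]
      _ ≤ ‖det2 (F z) g₂‖ * ‖g₁‖ + ‖det2 (F z) g₁‖ * ‖g₂‖ := by
        rw [← norm_smul, ← norm_smul]; exact norm_sub_le _ _
      _ ≤ (C₂ * ‖z - o‖) * ‖g₁‖ + (C₁ * ‖z - o‖) * ‖g₂‖ := by gcongr
      _ = _ := by ring
  have hnn : 0 ≤ 2 * (C₁ * ‖g₂‖ + C₂ * ‖g₁‖) := by positivity
  rw [norm_of_nonneg hnn, norm_smul, norm_inv]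
  rcases eq_or_ne z o with rfl | hne
  · simpa using hnn
  · have hpos : 0 < ‖z - o‖ := norm_pos_iff.2 (sub_ne_zero.2 hne)
    rw [inv_mul_le_iff₀ hpos]
    linarith

end Gauge

/-! ### Smooth approximation -/

section Approximation

variable {M q : ENNReal}

theorem tendsto_eLpNorm_of_dominated {E : Type*} [NormedAddCommGroup E] {μ : Measure ℂ} {p : ENNReal}
    (hp0 : p ≠ 0) (hpt : p ≠ ⊤) {f : ℕ → ℂ → E} {G : ℂ → ℝ} (hf : ∀ n, AEStronglyMeasurable (f n) μ)
    (hG : MemLp G p μ) (hle : ∀ n, ∀ᵐ z ∂μ, ‖f n z‖ ≤ G z)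
    (hlim : ∀ᵐ z ∂μ, Tendsto (fun n => f n z) atTop (𝓝 0)) :
    Tendsto (fun n => eLpNorm (f n) p μ) atTop (𝓝 0) := by
  have hp : 0 < p.toReal := toReal_pos hp0 hpt
  have h1 : Tendsto (fun n => ∫⁻ z, ‖f n z‖ₑ ^ p.toReal ∂μ) atTop (𝓝 (∫⁻ _, 0 ∂μ)) := by
    refine tendsto_lintegral_of_dominated_convergence' (fun z => ‖G z‖ₑ ^ p.toReal)
      (fun n => (hf n).enorm.pow_const _) (fun n => ?_) ?_ ?_
    · filter_upwards [hle n] with z hz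
      gcongr
      rw [← ofReal_norm, ← ofReal_norm]
      exact ofReal_le_ofReal (hz.trans (le_abs_self _))
    · exact (lintegral_rpow_enorm_lt_top_of_eLpNorm_lt_top hp0 hpt hG.2).ne
    · filter_upwards [hlim] with z hz
      have := (ENNReal.continuous_rpow_const (y := p.toReal)).tendsto 0 |>.comp
        ((continuous_enorm.tendsto (0 : E)).comp hz |> fun h => by simpa using h)
      simpa [zero_rpow_of_pos hp, Function.comp_def] using this
  rw [lintegral_zero] at h1
  have h2 := ((ENNReal.continuous_rpow_const (y := 1 / p.toReal)).tendsto 0).comp h1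
  rw [zero_rpow_of_pos (by positivity)] at h2
  refine h2.congr fun n => ?_
  rw [eLpNorm_eq_lintegral_rpow_enorm_toReal hp0 hpt]
  rfl

theorem gaugePot_eq_smul (S : Set ℂ) (u : ℂ → ℂ) (F : ℂ → ℂ × ℂ) (z : ℂ) (x : ℂ × ℂ) :
    gaugePot S u F z x = S.indicator u z • ((herm x (F z) / nsq (F z)) • J (F z)) := by
  rw [gaugePot, mul_smul]

theorem tendsto_gauge_factor {Fn : ℕ → ℂ × ℂ} {F : ℂ × ℂ} (x : ℂ × ℂ)
    (h : Tendsto Fn atTop (𝓝 F)) (hF : F ≠ 0) :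
    Tendsto (fun n => (herm x (Fn n) / nsq (Fn n)) • J (Fn n)) atTop
      (𝓝 ((herm x F / nsq F) • J F)) := by
  have c1 : Tendsto (fun n => herm x (Fn n)) atTop (𝓝 (herm x F)) :=
    ((continuous_herm.comp (Continuous.prodMk_right x)).tendsto F).comp h
  have c2 : Tendsto (fun n => (nsq (Fn n) : ℂ)) atTop (𝓝 (nsq F : ℂ)) :=
    ((continuous_ofReal.comp continuous_nsq).tendsto F).comp h
  have c3 : Tendsto (fun n => J (Fn n)) atTop (𝓝 (J F)) := (J.continuous.tendsto F).comp h
  exact (c1.div c2 (by exact_mod_cast (nsq_pos hF).ne')).smul c3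

theorem lpTo_gaugePot (hM : 2 < M) {S : Set ℂ} (hS : MeasurableSet S) {un : ℕ → ℂ → ℂ}
    {u : ℂ → ℂ} {Fn : ℕ → ℂ → ℂ × ℂ} {F X : ℂ → ℂ × ℂ} (hun : LpTo 2⁻¹ volume un u)
    (hFn : ∀ n, AEStronglyMeasurable (Fn n)) (hF : AEStronglyMeasurable F)
    (hlim : ∀ᵐ z, Tendsto (fun n => Fn n z) atTop (𝓝 (F z)))
    (hF0 : ∀ᵐ z, z ∈ S → F z ≠ 0) (hX : MemLp X M) :
    LpTo (M⁻¹ + 2⁻¹) volume (fun n z => gaugePot S (un n) (Fn n) z (X z))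
      fun z => gaugePot S u F z (X z) := by
  have hu2 : ∀ n, MemLp (un n) 2 := by simpa using hun.memLp
  have hu : MemLp u 2 := by simpa using hun.memLp_lim
  have hs : M⁻¹ + 2⁻¹ ≤ 1 := by
    have := (one_lt_sobExp hM).le
    rw [sobExp] at this
    exact ENNReal.one_le_inv.1 this
  have hind : ∀ v : ℂ → ℂ, MemLp v 2 → MemLp (fun z => 2 * S.indicator v z) 2 :=
    fun v hv => (hv.indicator hS).const_mul 2
  have mem : ∀ (v : ℂ → ℂ) (G : ℂ → ℂ × ℂ), MemLp v 2 → AEStronglyMeasurable G →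
      MemLp (fun z => gaugePot S v G z (X z)) (sobExp M) := fun v G hv hG =>
    (isPot_gaugePot hS hv.1 hG).memLp (hind v hv) hX
  have h1 : LpTo (M⁻¹ + 2⁻¹) volume (fun n z => gaugePot S (fun w => un n w - u w) (Fn n) z (X z))
      fun _ => 0 := by
    refine LpTo.of_le (b := fun n => 2 * eLpNorm (fun z => un n z - u z) 2 volume *
      eLpNorm X M volume) (fun n => mem _ _ ((hu2 n).sub hu) (hFn n)) MemLp.zero' ?_ fun n => ?_
    · have := hun.tendsto
      rw [inv_inv] at this
      simpa using ENNReal.Tendsto.mul_const (ENNReal.Tendsto.const_mul this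
        (Or.inr (show (2 : ENNReal) ≠ ⊤ by simp))) (Or.inr hX.2.ne)
    · simp only [sub_zero]
      refine ((isPot_gaugePot hS ((hu2 n).sub hu).1 (hFn n)).eLpNorm_le
        (hind _ ((hu2 n).sub hu)).1 hX.1).trans ?_
      gcongr
      refine (eLpNorm_le_mul_eLpNorm_of_ae_le_mul (c := 2) (g := fun z => un n z - u z)
        (ae_of_all _ fun z => ?_) 2).trans (by simp)
      rw [norm_mul, RCLike.norm_ofNat]
      gcongr
      exact norm_indicator_le_norm_self (fun w => un n w - u w) z
  have h2 : LpTo (M⁻¹ + 2⁻¹) volume (fun n z => gaugePot S u (Fn n) z (X z))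
      fun z => gaugePot S u F z (X z) := by
    refine ⟨fun n => mem u _ hu (hFn n), mem u F hu hF, ?_⟩
    have hG : MemLp (fun z => 4 * ‖S.indicator u z • X z‖) (sobExp M) := by
      have : MemLp (fun z => S.indicator u z • X z) (sobExp M) :=
        ⟨(hu.indicator hS).1.smul hX.1, (eLpNorm_smul_le_sobExp (hu.indicator hS).1 hX.1).trans_lt
          (ENNReal.mul_lt_top (hu.indicator hS).2 hX.2)⟩
      exact this.norm.const_mul 4
    refine tendsto_eLpNorm_of_dominated (p := sobExp M)
      (by have := one_lt_sobExp hM; exact (zero_lt_one.trans this).ne')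
      (ne_top_of_le_ne_top (by simp) (sobExp_le_two M))
      (fun n => (mem u _ hu (hFn n)).1.sub (mem u F hu hF).1) hG (fun n => ae_of_all _ fun z => ?_) ?_
    · simp only [gaugePot_eq_smul, ← smul_sub]
      rw [norm_smul, norm_smul]
      have b1 := norm_gauge_factor_le (X z) (Fn n z)
      have b2 := norm_gauge_factor_le (X z) (F z)
      calc _ ≤ ‖S.indicator u z‖ * (2 * ‖X z‖ + 2 * ‖X z‖) := by
            gcongr
            exact (norm_sub_le _ _).trans (add_le_add b1 b2)
        _ = _ := by ring
    · filter_upwards [hlim, hF0] with z hz h0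
      by_cases hzS : z ∈ S
      · have c1 := tendsto_gauge_factor (X z) hz (h0 hzS)
        have c2 := (tendsto_const_nhds (x := S.indicator u z)).smul c1
        simp only [gaugePot_eq_smul]
        exact tendsto_sub_nhds_zero_iff.2 c2
      · simp [gaugePot, hzS]
  have := h1.add hs h2
  simp only [zero_add] at this
  refine ⟨fun n => mem _ _ (hu2 n) (hFn n), mem u F hu hF, this.tendsto.congr fun n => ?_⟩
  congr 1
  ext1 z
  simp only [gaugePot_eq_smul, ← add_smul]
  congr 2
  by_cases hz : z ∈ S <;> simp [hz]

/-- Approximation of the data by test functions. -/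
theorem exists_approx_data (hM : 2 < M) {o : ℂ} {R : ℝ} (hR : 0 < R) {u : ℂ → ℂ}
    {k : ℂ → ℂ × ℂ} (hu : MemLp u 2) (hk : MemLp k (sobExp M))
    (hk0 : ∀ z ∈ ball o R, k z = 0) :
    ∃ (un : ℕ → ℂ → ℂ) (kn : ℕ → ℂ → ℂ × ℂ), (∀ n, ContDiff ℝ ∞ (un n)) ∧
      (∀ n, HasCompactSupport (un n)) ∧ LpTo 2⁻¹ volume un u ∧ (∀ n, ContDiff ℝ ∞ (kn n)) ∧
      (∀ n, HasCompactSupport (kn n)) ∧ LpTo (M⁻¹ + 2⁻¹) volume kn k ∧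
      ∀ n, ∀ z ∈ ball o (R / 2), kn n z = 0 := by
  have hs : M⁻¹ + 2⁻¹ ≤ 1 := by
    have := (one_lt_sobExp hM).le
    rw [sobExp] at this
    exact ENNReal.one_le_inv.1 this
  obtain ⟨un, h1, h2, h3⟩ := exists_lpTo_contDiff (θ := 2⁻¹) (by simp) (by simp)
    (g := u) (by rwa [inv_inv])
  obtain ⟨kn, g1, g2, g3⟩ := exists_lpTo_contDiff (θ := M⁻¹ + 2⁻¹) (by simp) hs hk
  obtain ⟨χ, hχ, hχc, hχs, hχ1, hχ01⟩ := exists_cutoff o (r := R / 2) (R := 3 * R / 4)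
    (by linarith) (by linarith)
  have hsm : ∀ n, ContDiff ℝ ∞ fun z => (1 - χ z) • kn n z := fun n =>
    (contDiff_const.sub hχ).smul (g1 n)
  have hle : ∀ n z, ‖(1 - χ z) • kn n z - k z‖ ≤ 1 * ‖kn n z - k z‖ := by
    intro n z
    have e : (1 - χ z) • kn n z - k z = (1 - χ z) • (kn n z - k z) := by
      by_cases hz : z ∈ ball o R
      · rw [hk0 z hz, sub_zero, sub_zero]
      · have : χ z = 0 := off_tsupport fun h =>
          hz (closedBall_subset_ball (by linarith) (hχs h))
        rw [this, sub_zero, one_smul, one_smul]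
    rw [e, norm_smul]
    gcongr
    rw [Real.norm_eq_abs, abs_le]
    have := hχ01 z
    constructor <;> linarith
  have hcs : ∀ n, HasCompactSupport fun z => (1 - χ z) • kn n z := fun n =>
    (g2 n).smul_left (f := fun z => 1 - χ z)
  have hmeas : ∀ n, AEStronglyMeasurable (fun z => (1 - χ z) • kn n z) := fun n =>
    (hsm n).continuous.aestronglyMeasurable
  have hto : LpTo (M⁻¹ + 2⁻¹) volume (fun n z => (1 - χ z) • kn n z) k :=
    g3.of_norm_le (c := 1) hmeas g3.memLp_lim fun n => ae_of_all _ fun z => hle n z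
  have hz0 : ∀ n, ∀ z ∈ ball o (R / 2), (1 - χ z) • kn n z = 0 := fun n z hz => by
    rw [hχ1 z (ball_subset_closedBall hz), sub_self, zero_smul]
  exact ⟨un, fun n z => (1 - χ z) • kn n z, h1, h2, h3, hsm, hcs, hto, hz0⟩

theorem fst_cauchyT_apply {f : ℂ → ℂ × ℂ} (hf : Continuous f) (hc : HasCompactSupport f) (z : ℂ) :
    (cauchyT f z).1 = cauchyT (fun w => (f w).1) z :=
  fst_integral (integrable_cauchyT_integrand_of_continuous hf hc z)

theorem snd_cauchyT_apply {f : ℂ → ℂ × ℂ} (hf : Continuous f) (hc : HasCompactSupport f) (z : ℂ) :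
    (cauchyT f z).2 = cauchyT (fun w => (f w).2) z :=
  snd_integral (integrable_cauchyT_integrand_of_continuous hf hc z)

/-- `∂` of a pair of functions. -/
def delV (F : ℂ → ℂ × ℂ) (z : ℂ) : ℂ × ℂ := (del (fun w => (F w).1) z, del (fun w => (F w).2) z)

/-- `∂̄` of a pair of functions. -/
def delBarV (F : ℂ → ℂ × ℂ) (z : ℂ) : ℂ × ℂ :=
  (delBar (fun w => (F w).1) z, delBar (fun w => (F w).2) z)

theorem delBarV_cauchyT {f : ℂ → ℂ × ℂ} (hf : ContDiff ℝ 1 f) (hc : HasCompactSupport f) :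
    delBarV (cauchyT f) = f := by
  ext1 z
  refine Prod.ext ?_ ?_
  · simp only [delBarV, fst_cauchyT_apply hf.continuous hc]
    exact congrFun (delBar_cauchyT hf.fst (hc.comp_left (g := Prod.fst) rfl)) z
  · simp only [delBarV, snd_cauchyT_apply hf.continuous hc]
    exact congrFun (delBar_cauchyT hf.snd (hc.comp_left (g := Prod.snd) rfl)) z

/-- Smooth approximations, without zeros and with controlled inverses, of a spinor `F` with
`∂̄F = u J F` on the ball of radius `R` around `o`. -/
structure Approx (M : ENNReal) (o : ℂ) (R : ℝ) (u : ℂ → ℂ) (F : ℂ → ℂ × ℂ) (un : ℕ → ℂ → ℂ)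
    (Fn : ℕ → ℂ → ℂ × ℂ) : Prop where
  contDiff_u : ∀ n, ContDiff ℝ ∞ (un n)
  hasCompactSupport_u : ∀ n, HasCompactSupport (un n)
  lpTo_u : LpTo 2⁻¹ volume un u
  small_u : ∀ n, SmallPot M (un n)
  contDiff_F : ∀ n, ContDiff ℝ ∞ (Fn n)
  lpTo_F : LpTo M⁻¹ volume Fn F
  delBar_F : ∀ n, ∀ z ∈ ball o R, delBarV (Fn n) z = un n z • J (Fn n z)
  ne_zero : ∀ n, ∀ z ∈ ball o R, Fn n z ≠ 0
  inv_bdd : LpBdd M⁻¹ (vol (ball o R)) fun n z => ((‖Fn n z‖ : ℂ))⁻¹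

theorem eventually_smallPot {M : ENNReal} {un : ℕ → ℂ → ℂ} {u : ℂ → ℂ} (h : LpTo 2⁻¹ volume un u)
    (hu : sobConst M * eLpNorm u 2 volume ≤ 8⁻¹) :
    ∀ᶠ n in atTop, sobConst M * eLpNorm (un n) 2 volume ≤ 4⁻¹ := by
  have h1 := ENNReal.Tendsto.const_mul h.tendsto (Or.inr (sobConst_ne_top M))
  rw [mul_zero, inv_inv] at h1
  filter_upwards [h1.eventually_lt_const (show (0 : ENNReal) < 8⁻¹ by simp)] with n hn
  have h2 : ∀ n, MemLp (un n) 2 := by simpa using h.memLp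
  have h3 : MemLp u 2 := by simpa using h.memLp_lim
  have e : un n = (fun z => un n z - u z) + u := by ext z; simp
  have h8 : (8⁻¹ : ENNReal) + 8⁻¹ = 4⁻¹ := by
    rw [← ENNReal.toReal_eq_toReal_iff' (by simp) (by simp), ENNReal.toReal_add (by simp) (by simp)]
    norm_num
  calc sobConst M * eLpNorm (un n) 2 volume
      ≤ sobConst M * (eLpNorm (fun z => un n z - u z) 2 volume + eLpNorm u 2 volume) := by
        gcongr
        conv_lhs => rw [e]
        exact eLpNorm_add_le ((h2 n).sub h3).1 h3.1 one_le_two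
    _ ≤ 8⁻¹ + 8⁻¹ := by rw [mul_add]; exact add_le_add hn.le hu
    _ = 4⁻¹ := h8

theorem smallPot_of_le_quarter {M : ENNReal} {u v : ℂ → ℂ}
    (hu : sobConst M * eLpNorm u 2 volume ≤ 4⁻¹) (h : ∀ z, ‖v z‖ ≤ 2 * ‖u z‖) : SmallPot M v := by
  have h1 : eLpNorm v 2 volume ≤ 2 * eLpNorm u 2 volume :=
    (eLpNorm_le_mul_eLpNorm_of_ae_le_mul (ae_of_all _ h) 2).trans (by simp)
  calc sobConst M * eLpNorm v 2 volume ≤ sobConst M * (2 * eLpNorm u 2 volume) := by gcongr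
    _ = sobConst M * eLpNorm u 2 volume + sobConst M * eLpNorm u 2 volume := by ring
    _ ≤ 4⁻¹ + 4⁻¹ := add_le_add hu hu
    _ = 2⁻¹ := quarter_add_quarter

end Approximation

section Approximation

variable {M q : ENNReal}

theorem Approx.shift {o : ℂ} {R R' : ℝ} {u : ℂ → ℂ} {F : ℂ → ℂ × ℂ} {un : ℕ → ℂ → ℂ}
    {Fn : ℕ → ℂ → ℂ × ℂ} (h : Approx M o R u F un Fn) (hR : R' ≤ R) {σ : ℕ → ℕ}
    (hσ : StrictMono σ) : Approx M o R' u F (fun n => un (σ n)) fun n => Fn (σ n) where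
  contDiff_u n := h.contDiff_u _
  hasCompactSupport_u n := h.hasCompactSupport_u _
  lpTo_u := h.lpTo_u.subseq hσ
  small_u n := h.small_u _
  contDiff_F n := h.contDiff_F _
  lpTo_F := h.lpTo_F.subseq hσ
  delBar_F n z hz := h.delBar_F _ z (ball_subset_ball hR hz)
  ne_zero n z hz := h.ne_zero _ z (ball_subset_ball hR hz)
  inv_bdd := by
    obtain ⟨C, hC, hb⟩ := (h.inv_bdd.mono_measure
      (Measure.restrict_mono_set _ (ball_subset_ball (x := o) hR))).bdd
    exact ⟨fun n => (h.inv_bdd.mono_measure (Measure.restrict_mono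
      (ball_subset_ball (x := o) hR) le_rfl)).meas _, C, hC, fun n => hb _⟩

theorem weakDBV_of_solution (hM : 2 < M) (hMt : M < ⊤) {S : Set ℂ} {u : ℂ → ℂ} {F k : ℂ → ℂ × ℂ}
    (hu : MemLp u 2) (hF : MemLp F M) (hk : MemLp k (sobExp M))
    (hk0 : ∀ z ∈ S, k z = 0) (hFe : F = cauchyT fun z => k z + u z • J (F z)) :
    WeakDBV S F fun z => u z • J (F z) := by
  refine ((weakDBV_cauchyT hM hMt (hk.add ((isPot_smul_J hu.1).memLp hu hF))).mono
    (Set.subset_univ S)).congr_ae (ae_of_all _ fun z _ => (congrFun hFe z).symm)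
    (ae_of_all _ fun z hz => ?_)
  simp [hk0 z hz]

theorem exists_lower_bound {H : ℂ → ℂ} {o : ℂ} {r : ℝ} (hr : 0 < r)
    (hH : DifferentiableOn ℂ H (ball o r)) (h0 : H o ≠ 0) :
    ∃ ρ > 0, ρ ≤ r ∧ ∃ c > 0, ∀ z ∈ ball o ρ, c ≤ ‖H z‖ := by
  have hc : ContinuousAt H o :=
    (hH.differentiableAt (ball_mem_nhds o hr)).continuousAt
  have hp : 0 < ‖H o‖ := norm_pos_iff.2 h0
  obtain ⟨ρ, hρ, h⟩ := eventually_nhds_iff_ball.1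
    (hc.norm.eventually_const_lt (half_lt_self hp))
  exact ⟨min ρ r, lt_min hρ hr, min_le_right _ _, ‖H o‖ / 2, half_pos hp, fun z hz =>
    (h z (ball_subset_ball (min_le_left _ _) hz)).le⟩

/-- Solutions of the gauge equation with bounded potential are bounded. -/
theorem exists_bound_gauge (hM : 2 < M) (hMt : M < ⊤) {o : ℂ} {r : ℝ} {u : ℂ → ℂ}
    {F v : ℂ → ℂ × ℂ} (hu : Continuous u) (huc : HasCompactSupport u) (hF : AEStronglyMeasurable F)
    {e : ℂ × ℂ} (hv : MemLp v M)
    (hve : v = cauchyT fun z => gaugePot (ball o r) u F z e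
      + gaugePot (ball o r) u F z (v z)) : ∃ K : ℝ, ∀ z, ‖v z‖ ≤ K := by
  have hpot := isPot_gaugePot (measurableSet_ball (x := o) (ε := r)) hu.aestronglyMeasurable hF
  obtain ⟨B, hB⟩ := hu.bounded_above_of_compact_support huc
  have hv' : MemLp (fun z => ‖v z‖) M (vol (ball o r)) :=
    (hv.mono_measure restrict_le).norm
  have hc : MemLp (fun _ : ℂ => ‖e‖) M (vol (ball o r)) := memLp_const ‖e‖
  have hG0 : MemLp (fun z => ‖e‖ + ‖v z‖) M (vol (ball o r)) := hc.add hv'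
  have hG : MemLp ((ball o r).indicator fun z => ‖e‖ + ‖v z‖) M :=
    (memLp_indicator_iff_restrict measurableSet_ball).2 hG0
  have hG1 : MemLp ((ball o r).indicator fun z => ‖e‖ + ‖v z‖) 1 :=
    (memLp_indicator_iff_restrict measurableSet_ball).2
      (hG0.mono_exponent (one_le_two.trans hM.le))
  obtain ⟨s, hs⟩ : ∃ s : ℂ → ℂ × ℂ, s = fun z => gaugePot (ball o r) u F z e
      + gaugePot (ball o r) u F z (v z) := ⟨_, rfl⟩
  rw [← hs] at hve
  have hA : AEStronglyMeasurable fun z => gaugePot (ball o r) u F z e :=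
    hpot.meas (fun _ => e) aestronglyMeasurable_const
  have hA' : AEStronglyMeasurable fun z => gaugePot (ball o r) u F z (v z) :=
    hpot.meas v hv.1
  have hsm : AEStronglyMeasurable s := by rw [hs]; exact hA.add hA'
  have hle : ∀ z, ‖s z‖ ≤ 2 * B * ‖(ball o r).indicator (fun z => ‖e‖ + ‖v z‖) z‖ := by
    intro z
    by_cases hz : z ∈ ball o r
    · rw [indicator_of_mem hz, norm_of_nonneg (by positivity), hs]
      refine (norm_add_le _ _).trans ((add_le_add (hpot.le z e) (hpot.le z (v z))).trans ?_)
      rw [indicator_of_mem hz, norm_mul, RCLike.norm_ofNat, ← mul_add]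
      gcongr
      exact hB z
    · simp [hs, gaugePot, hz]
  have m1 := hG.of_le_mul hsm (ae_of_all _ hle)
  have m2 := hG1.of_le_mul hsm (ae_of_all _ hle)
  obtain ⟨C, hC, hb⟩ := exists_enorm_cauchyT_le (ℂ × ℂ) hM hMt
  have hfin' : C * eLpNorm s M volume + eLpNorm s 1 volume ≠ ⊤ :=
    ENNReal.add_ne_top.2 ⟨ENNReal.mul_ne_top hC m1.2.ne, m2.2.ne⟩
  refine ⟨(C * eLpNorm s M volume + eLpNorm s 1 volume).toReal, fun z => ?_⟩
  have hvs : v z = cauchyT s z := congrFun hve z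
  have h1 : ‖v z‖ₑ ≤ C * eLpNorm s M volume + eLpNorm s 1 volume := by
    rw [hvs]; exact (enorm_cauchyT_le s z).trans (hb s hsm z)
  rw [← toReal_enorm]
  exact ENNReal.toReal_mono hfin' h1

/-- A spinor without zero at `o` is approximated by smooth spinors near `o`. -/
theorem exists_approx (hM : 4 ≤ M) (hMt : M < ⊤) (hqM : q ≤ M) {o : ℂ} {R : ℝ} (hR : 0 < R)
    {u : ℂ → ℂ} {F k : ℂ → ℂ × ℂ} (hu : MemLp u 2)
    (hus : sobConst M * eLpNorm u 2 volume ≤ 8⁻¹) (hF : MemLp F M)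
    (hk : MemLp k (sobExp M)) (hk0 : ∀ z ∈ ball o R, k z = 0)
    (hFe : F = cauchyT fun z => k z + u z • J (F z))
    (hnz : ∀ R > 0, ¬ MemLp (fun z => (z - o)⁻¹ • F z) q (vol (ball o R))) :
    ∃ R' > 0, R' ≤ R ∧ ∃ (un : ℕ → ℂ → ℂ) (Fn : ℕ → ℂ → ℂ × ℂ), Approx M o R' u F un Fn := by
  have hM2 := two_lt_of_four_le hM
  have hM1 : M⁻¹ ≤ 1 := (inv_le_quarter hM).trans (by simp)
  have hw := weakDBV_of_solution hM2 hMt hu hF hk hk0 hFe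
  obtain ⟨ρ₁, hρ₁, hF0⟩ : ∃ ρ₁ > 0, ∀ᵐ z, z ∈ ball o ρ₁ → F z ≠ 0 := by
    obtain ⟨r, hr, -, -, -, e, v, -, -, H, hH, hHae, hH0⟩ :=
      exists_gauge hM hMt hqM hR hu hF hw hnz
    obtain ⟨ρ, hρ, hρr, c, hc, hcH⟩ := exists_lower_bound (half_pos hr) hH hH0
    refine ⟨ρ, hρ, ?_⟩
    filter_upwards [hHae] with z hz hzρ h0
    have h1 := hz (ball_subset_ball hρr hzρ)
    have h2 := hcH z hzρ
    rw [← h1, h0] at h2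
    simp [det2] at h2
    linarith
  obtain ⟨r, hr, hrR, hr1, -, e, v, hv, hve, H, hH, hHae, hH0⟩ :=
    exists_gauge hM hMt hqM (lt_min hρ₁ (half_pos hR)) hu hF
      (hw.mono (ball_subset_ball ((min_le_right _ _).trans (half_le_self hR.le)))) hnz
  obtain ⟨ρ, hρ, hρr, c, hc, hcH⟩ := exists_lower_bound (half_pos hr) hH hH0
  have hF0r : ∀ᵐ z, z ∈ ball o r → F z ≠ 0 := by
    filter_upwards [hF0] with z hz hzr
    exact hz (ball_subset_ball (hrR.trans (min_le_left _ _)) hzr)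
  obtain ⟨un, kn, hun, hunc, hunl, hkn, hknc, hknl, hkn0⟩ := exists_approx_data hM2 hR hu hk hk0
  obtain ⟨N, hN⟩ := eventually_atTop.1 (eventually_smallPot hunl hus)
  have hshift : StrictMono fun n : ℕ => n + N := fun a b h => by simpa using h
  -- the approximating spinors
  have hun2 : ∀ n, MemLp (un n) 2 := by simpa using hunl.memLp
  have hsm : ∀ n, SmallPot M (un (n + N)) := fun n =>
    smallPot_of_le_quarter (hN (n + N) (by omega)) fun z => by linarith [norm_nonneg (un (n + N) z)]
  have hex : ∀ n, ∃ Z : ℂ → ℂ × ℂ, MemLp Z M ∧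
      Z = cauchyT fun z => kn (n + N) z + un (n + N) z • J (Z z) := fun n =>
    (isPot_smul_J (hun2 (n + N)).1).exists_solution hM2 hMt (hun2 _) (hsm n)
      ((hkn _).continuous.memLp_of_hasCompactSupport (hknc _))
  choose G hGM hGe using hex
  have hGsm : ∀ n, ContDiff ℝ ∞ (G n) := fun n =>
    contDiff_solution hM2 hMt (hun _) (hunc _) (hsm n) (hkn _) (hknc _) (hGM n) (hGe n)
  have hGl : LpTo M⁻¹ volume G F :=
    IsPot.lpTo hM2 hMt (fun n => isPot_smul_J (hun2 (n + N)).1) (isPot_smul_J hu.1)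
      (fun n => hun2 (n + N)) hu hsm hGM hF (hknl.subseq hshift)
      (lpTo_smul_J (hunl.subseq hshift) hF) (fun n => (hGe n).eventuallyEq) hFe.eventuallyEq
  obtain ⟨σ, hσ, hae⟩ := hGl.exists_ae_tendsto (ne_top_of_le_ne_top ENNReal.one_ne_top hM1)
  set τ : ℕ → ℕ := fun n => σ n + N with hτ
  have hτm : StrictMono τ := fun a b h => by simpa [hτ] using hσ h
  have hGw : ∀ n, WeakDBV (ball o r) (G (σ n)) fun z => un (τ n) z • J (G (σ n) z) :=
    fun n => weakDBV_of_solution hM2 hMt (hun2 _) (hGM _)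
      ((hkn _).continuous.memLp_of_hasCompactSupport (hknc _))
      (fun z hz => hkn0 _ z (ball_subset_ball (hrR.trans (min_le_right _ _)) hz)) (hGe _)
  have hGd : ∀ n, ∀ z ∈ ball o r, delBarV (G (σ n)) z = un (τ n) z • J (G (σ n) z) := by
    intro n z hz
    have h1 : ContDiff ℝ 1 fun z => kn (τ n) z + un (τ n) z • J (G (σ n) z) :=
      ((hkn (τ n)).add (contDiff_smul_J (m := ⊤) (hun (τ n)) (hGsm (σ n)))).of_le one_le_infty
    have h2 := congrFun (delBarV_cauchyT h1 ((hknc (τ n)).add (hunc (τ n)).smul_right)) z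
    rw [show (cauchyT fun z => kn (τ n) z + un (τ n) z • J (G (σ n) z)) = G (σ n) from
      (hGe (σ n)).symm] at h2
    rw [h2, hkn0 _ z (ball_subset_ball (hrR.trans (min_le_right _ _)) hz), zero_add]
  -- the approximating gauge transformations
  have hsmg : ∀ n, SmallPot M fun z => 2 * (ball o r).indicator (un (τ n)) z := fun n =>
    smallPot_of_le_quarter (hN (τ n) (Nat.le_add_left N (σ n))) fun z => by
      rw [norm_mul, RCLike.norm_ofNat]
      gcongr
      exact norm_indicator_le_norm_self _ _
  have hsol := fun n => exists_gauge_solution hM2 hMt hr1 (hun2 (τ n)) (hGM (σ n)).1 (hsmg n) e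
  choose hkg w hwM hwe using hsol
  have hgl := fun X hX => lpTo_gaugePot hM2 (measurableSet_ball (x := o) (ε := r))
    (hunl.subseq hτm) (fun n => (hGM (σ n)).1) hF.1 hae hF0r (X := X) hX
  have hkl := hgl _ (memLp_indicator_ball o e)
  simp only [gaugePot_const hr1] at hkl
  have hind2 : ∀ f : ℂ → ℂ, MemLp f 2 →
      MemLp (fun z => 2 * (ball o r).indicator f z) 2 :=
    fun f hf => (hf.indicator measurableSet_ball).const_mul 2
  have hwl : LpTo M⁻¹ volume w v :=
    IsPot.lpTo hM2 hMt (fun n => isPot_gaugePot measurableSet_ball (hun2 (τ n)).1 (hGM (σ n)).1)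
      (isPot_gaugePot measurableSet_ball hu.1 hF.1) (fun n => hind2 _ (hun2 (τ n))) (hind2 _ hu)
      hsmg hwM hv hkl (hgl v hv) (fun n => (hwe n).eventuallyEq) hve.eventuallyEq
  -- the determinants
  have husm : SmallPot M fun z => 2 * (ball o r).indicator u z :=
    smallPot_of_le_quarter (hus.trans (inv_le_inv.2 (by norm_num))) fun z => by
      rw [norm_mul, RCLike.norm_ofNat]
      gcongr
      exact norm_indicator_le_norm_self _ _
  have hrR' : r ≤ R := hrR.trans ((min_le_right _ _).trans (half_le_self hR.le))
  have hdet := gauge_det hM hMt hr1 hu hF husm (hw.mono (ball_subset_ball hrR')) hv hve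
  have hdetn := fun n => gauge_det hM hMt hr1 (hun2 (τ n)) (hGM (σ n)) (hsmg n) (hGw n) (hwM n)
    (hwe n)
  set μ : Measure ℂ := vol (ball o r) with hμ
  have hμf : IsFiniteMeasure μ := ⟨by simpa [hμ] using (volume_ball_ne_top o r).lt_top⟩
  have hMM : M⁻¹ + M⁻¹ ≤ 1 := (inv_add_inv_le_half hM).trans (by simp)
  have hgw : LpTo M⁻¹ μ (fun n z => e + w n z) fun z => e + v z :=
    (LpTo.const (memLp_const e)).add hM1 (hwl.mono_measure restrict_le)
  have hGσ := (hGl.subseq hσ).mono_measure (restrict_le (μ := volume)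
    (s := ball o r))
  have hdl : LpTo 1 μ (fun n z => det2 (G (σ n) z) (e + w n z)) fun z => det2 (F z) (e + v z) :=
    ((hGσ.fst.mul hM1 hMM hgw.snd).sub hMM (hGσ.snd.mul hM1 hMM hgw.fst)).mono hMM
  have hdl0 : LpTo 1 μ (fun n z => det2 (G (σ n) z) (e + w n z) - det2 (F z) (e + v z))
      fun _ => 0 := by
    simpa using hdl.sub le_rfl (LpTo.const hdl.memLp_lim)
  obtain ⟨C, hC, hrep⟩ := exists_holRep o (half_pos hr) (half_lt_self hr)
  have hlim := hdl0.integral_norm.const_mul C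
  rw [mul_zero] at hlim
  obtain ⟨N', hN'⟩ := eventually_atTop.1 (hlim.eventually_lt_const (half_pos hc))
  have hlow : ∀ n, ∀ᵐ z, z ∈ ball o ρ →
      c / 2 ≤ 2 * (‖G (σ (n + N')) z‖ * ‖e + w (n + N') z‖) := by
    intro n
    have l1 := MemLp.locallyIntegrableOn' (volume_ball_ne_top o r) one_le_two hdet.2
    have l2 := MemLp.locallyIntegrableOn' (volume_ball_ne_top o r) one_le_two (hdetn (n + N')).2
    have l0 : LocallyIntegrableOn (0 : ℂ → ℂ) (ball o r) := locallyIntegrableOn_zero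
    have hsub := (hdetn (n + N')).1.sub hdet.1 l2 l0 l1 l0
    obtain ⟨D, -, hDae, hDle⟩ := hrep _ ((hdetn (n + N')).2.sub hdet.2)
      (hsub.congr_ae (ae_of_all _ fun _ _ => rfl) (ae_of_all _ fun _ _ => by simp))
    filter_upwards [hDae, hHae] with z h1 h2 hz
    have hz2 : z ∈ ball o (r / 2) := ball_subset_ball hρr hz
    have h3 := hDle z hz2
    rw [← h1 hz2] at h3
    have h4 := hcH z hz
    rw [← h2 hz2] at h4
    have h5 := (hN' (n + N') (by omega)).le
    have h6 := norm_det2_le (G (σ (n + N')) z) (e + w (n + N') z)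
    have h7 := norm_sub_norm_le (det2 (F z) (e + v z)) (det2 (G (σ (n + N')) z) (e + w (n + N') z))
    rw [norm_sub_rev] at h7
    simp only [Pi.sub_apply] at h3
    linarith [h3.trans h5]
  have hρr' : ρ ≤ r := hρr.trans (half_le_self hr.le)
  have hσ' : StrictMono fun n => σ (n + N') := fun a b h => hσ (by simpa using h)
  have hτ' : StrictMono fun n => τ (n + N') := fun a b h => hτm (by simpa using h)
  refine ⟨ρ, hρ, hρr'.trans hrR', fun n => un (τ (n + N')), fun n => G (σ (n + N')), ?_⟩
  refine ⟨fun n => hun _, fun n => hunc _, hunl.subseq hτ', fun n => hsm _, fun n => hGsm _,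
    hGl.subseq hσ', fun n z hz => hGd _ z (ball_subset_ball hρr' hz), fun n z hz h0 => ?_, ?_⟩
  · obtain ⟨K, hK⟩ := exists_bound_gauge hM2 hMt (hun _).continuous (hunc _) (hGM _).1
      (hwM (n + N')) (hwe (n + N'))
    have hK0 : 0 ≤ ‖e‖ + K := add_nonneg (norm_nonneg _) ((norm_nonneg _).trans (hK 0))
    have hopen : IsOpen {y | 2 * (‖G (σ (n + N')) y‖ * (‖e‖ + K)) < c / 2} :=
      isOpen_lt (continuous_const.mul ((hGsm _).continuous.norm.mul continuous_const))
        continuous_const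
    obtain ⟨y, ⟨hy1, hy2⟩, hy3⟩ := (Measure.dense_of_ae (hlow n)).inter_open_nonempty _
      (hopen.inter (isOpen_ball (x := o) (ε := ρ))) ⟨z, by simp [h0, hc], hz⟩
    have h1 := hy3 hy2
    have h2 : ‖e + w (n + N') y‖ ≤ ‖e‖ + K := (norm_add_le _ _).trans (by gcongr; exact hK y)
    have h3 : 2 * (‖G (σ (n + N')) y‖ * ‖e + w (n + N') y‖)
        ≤ 2 * (‖G (σ (n + N')) y‖ * (‖e‖ + K)) := by gcongr
    simp only [Set.mem_ofPred_eq] at hy1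
    linarith
  · have hbd : LpBdd M⁻¹ (vol (ball o ρ)) fun n z => e + w (n + N') z := by
      have := (hgw.subseq (σ := fun n => n + N') (fun a b h => by simpa using h)).bdd hM1
      exact this.mono_measure (Measure.restrict_mono_set _ (ball_subset_ball hρr'))
    refine hbd.of_norm_le (c := 4 / c) (fun n => ?_) fun n => ?_
    · exact ((continuous_ofReal.comp
        (hGsm (σ (n + N'))).continuous.norm).measurable.inv).aestronglyMeasurable
    · rw [ae_restrict_iff' measurableSet_ball]
      filter_upwards [hlow n] with z h1 hz
      have h2 := h1 hz
      rw [norm_inv, norm_real, norm_norm]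
      rcases eq_or_lt_of_le (norm_nonneg (G (σ (n + N')) z)) with h0 | h0
      · rw [← h0]; simp; positivity
      · rw [inv_le_iff_one_le_mul₀ h0]
        have : c ≤ 4 * (‖e + w (n + N') z‖ * ‖G (σ (n + N')) z‖) := by linarith
        rw [mul_assoc, div_mul_eq_mul_div, le_div_iff₀ hc]
        linarith

end Approximation

/-! ### Calculus of spinors -/

section SpinorCalculus

variable {X Y : ℂ → ℂ × ℂ} {f g : ℂ → ℂ} {z : ℂ}

theorem differentiableAt_conj (hf : DifferentiableAt ℝ f z) :
    DifferentiableAt ℝ (fun w => conj (f w)) z :=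
  Complex.conjCLE.differentiableAt.comp z hf

theorem contDiffAt_conj {n : WithTop ℕ∞} (hf : ContDiffAt ℝ n f z) :
    ContDiffAt ℝ n (fun w => conj (f w)) z :=
  Complex.conjCLE.contDiff.contDiffAt.comp z hf

theorem del_herm (hX : DifferentiableAt ℝ X z) (hY : DifferentiableAt ℝ Y z) :
    del (fun w => herm (X w) (Y w)) z = herm (delV X z) (Y z) + herm (X z) (delBarV Y z) := by
  have c1 := differentiableAt_conj hY.fst
  have c2 := differentiableAt_conj hY.snd
  simp only [herm]
  rw [del_add (hX.fst.fun_mul c1) (hX.snd.fun_mul c2), del_mul hX.fst c1, del_mul hX.snd c2,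
    del_conj hY.fst, del_conj hY.snd]
  simp only [delV, delBarV]
  ring

theorem delBar_herm (hX : DifferentiableAt ℝ X z) (hY : DifferentiableAt ℝ Y z) :
    delBar (fun w => herm (X w) (Y w)) z = herm (delBarV X z) (Y z) + herm (X z) (delV Y z) := by
  have c1 := differentiableAt_conj hY.fst
  have c2 := differentiableAt_conj hY.snd
  simp only [herm]
  rw [delBar_add (hX.fst.fun_mul c1) (hX.snd.fun_mul c2), delBar_mul hX.fst c1, delBar_mul hX.snd c2,
    delBar_conj hY.fst, delBar_conj hY.snd]
  simp only [delV, delBarV]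
  ring

theorem delV_J (hX : DifferentiableAt ℝ X z) : delV (fun w => J (X w)) z = J (delBarV X z) := by
  simp only [delV, J_apply, delBarV, del_neg, del_conj hX.fst, del_conj hX.snd]

theorem delBarV_J (hX : DifferentiableAt ℝ X z) : delBarV (fun w => J (X w)) z = J (delV X z) := by
  simp only [delV, J_apply, delBarV, delBar_neg, delBar_conj hX.fst, delBar_conj hX.snd]

theorem delV_smul (hf : DifferentiableAt ℝ f z) (hX : DifferentiableAt ℝ X z) :
    delV (fun w => f w • X w) z = del f z • X z + f z • delV X z := by
  simp only [delV, Prod.smul_fst, Prod.smul_snd, smul_eq_mul, del_mul hf hX.fst, del_mul hf hX.snd]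
  ext <;> simp

theorem delBarV_smul (hf : DifferentiableAt ℝ f z) (hX : DifferentiableAt ℝ X z) :
    delBarV (fun w => f w • X w) z = delBar f z • X z + f z • delBarV X z := by
  simp only [delBarV, Prod.smul_fst, Prod.smul_snd, smul_eq_mul, delBar_mul hf hX.fst,
    delBar_mul hf hX.snd]
  ext <;> simp

theorem contDiffAt_delV {m n : WithTop ℕ∞} (hX : ContDiffAt ℝ n X z) (h : m + 1 ≤ n) :
    ContDiffAt ℝ m (delV X) z :=
  (ContDiffAt.del hX.fst h).prodMk (ContDiffAt.del hX.snd h)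

theorem contDiffAt_delBarV {m n : WithTop ℕ∞} (hX : ContDiffAt ℝ n X z) (h : m + 1 ≤ n) :
    ContDiffAt ℝ m (delBarV X) z :=
  (ContDiffAt.delBar hX.fst h).prodMk (ContDiffAt.delBar hX.snd h)

theorem infty_add_one_le : ((⊤ : ℕ∞) : WithTop ℕ∞) + 1 ≤ (⊤ : ℕ∞) := le_rfl

theorem two_le_infty : (2 : WithTop ℕ∞) ≤ ((⊤ : ℕ∞) : WithTop ℕ∞) :=
  WithTop.coe_le_coe.2 le_top

theorem contDiff_delV (hX : ContDiff ℝ ∞ X) : ContDiff ℝ ∞ (delV X) :=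
  contDiff_iff_contDiffAt.2 fun _ => contDiffAt_delV hX.contDiffAt infty_add_one_le

theorem contDiff_delBarV (hX : ContDiff ℝ ∞ X) : ContDiff ℝ ∞ (delBarV X) :=
  contDiff_iff_contDiffAt.2 fun _ => contDiffAt_delBarV hX.contDiffAt infty_add_one_le

theorem delV_delBarV_comm (hX : ContDiffAt ℝ 2 X z) :
    delV (delBarV X) z = delBarV (delV X) z := by
  simp only [delV, delBarV]
  exact Prod.ext (del_delBar_comm hX.fst) (del_delBar_comm hX.snd)

theorem contDiffAt_herm {n : WithTop ℕ∞} (hX : ContDiffAt ℝ n X z) (hY : ContDiffAt ℝ n Y z) :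
    ContDiffAt ℝ n (fun w => herm (X w) (Y w)) z :=
  (hX.fst.mul (contDiffAt_conj hY.fst)).add (hX.snd.mul (contDiffAt_conj hY.snd))

theorem herm_J_self (x : ℂ × ℂ) : herm (J x) x = 0 := by simp [herm]; ring

theorem herm_self_J (x : ℂ × ℂ) : herm x (J x) = 0 := by simp [herm]; ring

theorem conj_herm (x y : ℂ × ℂ) : conj (herm x y) = herm y x := by simp [herm]; ring

theorem herm_smul_left (c : ℂ) (x y : ℂ × ℂ) : herm (c • x) y = c * herm x y := by
  simp [herm]; ring

theorem herm_smul_right (c : ℂ) (x y : ℂ × ℂ) : herm x (c • y) = conj c * herm x y := by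
  simp [herm]; ring

theorem herm_add_left (x x' y : ℂ × ℂ) : herm (x + x') y = herm x y + herm x' y := by
  simp [herm]; ring

theorem herm_add_right (x y y' : ℂ × ℂ) : herm x (y + y') = herm x y + herm x y' := by
  simp [herm]; ring

theorem J_smul (c : ℂ) (x : ℂ × ℂ) : J (c • x) = conj c • J x := by ext <;> simp

theorem J_J (x : ℂ × ℂ) : J (J x) = -x := by ext <;> simp

theorem nsq_J (x : ℂ × ℂ) : nsq (J x) = nsq x := by simp [nsq, add_comm]

theorem nsq_smul (c : ℂ) (x : ℂ × ℂ) : nsq (c • x) = ‖c‖ ^ 2 * nsq x := by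
  simp [nsq]; ring

/-- `F` and `J F` form an orthogonal basis. -/
theorem nsq_smul_eq (F x : ℂ × ℂ) : (nsq F : ℂ) • x = herm x F • F + herm x (J F) • J F := by
  rw [← herm_self]
  ext <;> simp [herm] <;> ring

theorem nsq_mul_nsq (F x : ℂ × ℂ) :
    nsq F * nsq x = ‖herm x F‖ ^ 2 + ‖herm x (J F)‖ ^ 2 := by
  have h : (nsq F : ℂ) * nsq x = herm x F * conj (herm x F)
      + herm x (J F) * conj (herm x (J F)) := by
    rw [← herm_self, ← herm_self]; simp [herm]; ring
  rw [Complex.mul_conj, Complex.mul_conj, normSq_eq_norm_sq, normSq_eq_norm_sq] at h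
  exact_mod_cast h

theorem sq_norm_herm_le (F x : ℂ × ℂ) : ‖herm x F‖ ^ 2 ≤ nsq F * nsq x := by
  rw [nsq_mul_nsq]; nlinarith [sq_nonneg ‖herm x (J F)‖]

/-- Integration by parts against a function that is differentiable on an open set. -/
theorem integral_mul_delBar {S : Set ℂ} (hS : IsOpen S) (hf : ∀ z ∈ S, ContDiffAt ℝ 1 f z)
    {η : ℂ → ℂ} (hη : ContDiff ℝ ∞ η) (hc : HasCompactSupport η) (hs : tsupport η ⊆ S) :
    Integrable (fun z => delBar f z * η z) ∧
      ∫ z, delBar f z * η z = -∫ z, f z * delBar η z := by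
  have hd : ∀ z, ContDiffAt ℝ 1 (fun w => η w * f w) z ∧
      delBar (fun w => η w * f w) z = delBar η z * f z + η z * delBar f z := by
    intro z
    by_cases hz : z ∈ tsupport η
    · exact ⟨(hη.contDiffAt.of_le one_le_infty).mul (hf z (hs hz)),
        delBar_mul (hη.differentiable (by simp) z) ((hf z (hs hz)).differentiableAt one_ne_zero)⟩
    · have h1 : (fun w => η w * f w) =ᶠ[nhds z] fun _ => 0 := by
        filter_upwards [notMem_tsupport_iff_eventuallyEq.1 hz] with w hw
        simp [hw]
      have h2 : delBar η z = 0 := off_tsupport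
        fun h => hz (tsupport_delBar_subset h)
      refine ⟨contDiffAt_const.congr_of_eventuallyEq h1, ?_⟩
      rw [delBar_congr h1, delBar_const, h2, off_tsupport hz]; simp
  have hfc : ContinuousOn f S := fun z hz => (hf z hz).continuousAt.continuousWithinAt
  have hDc : ContinuousOn (delBar f) S := fun z hz =>
    (ContDiffAt.delBar (m := 0) (hf z hz) (by simp)).continuousAt.continuousWithinAt
  have i1 := integrable_mul_of_tsupport_subset (hDc.locallyIntegrableOn hS.measurableSet)
    hη.continuous hc hs
  have i2 := integrable_mul_of_tsupport_subset (hfc.locallyIntegrableOn hS.measurableSet)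
    (hη.continuous_delBar one_le_infty) hc.delBar (tsupport_delBar_subset.trans hs)
  have h0 := integral_delBar_eq_zero (contDiff_iff_contDiffAt.2 fun z => (hd z).1) hc.mul_right
  refine ⟨i1, ?_⟩
  rw [eq_neg_iff_add_eq_zero, ← integral_add i1 i2, ← h0]
  refine integral_congr_ae (ae_of_all _ fun z => ?_)
  simp only [(hd z).2]; ring

theorem integral_mul_del {S : Set ℂ} (hS : IsOpen S) (hf : ∀ z ∈ S, ContDiffAt ℝ 1 f z)
    {η : ℂ → ℂ} (hη : ContDiff ℝ ∞ η) (hc : HasCompactSupport η) (hs : tsupport η ⊆ S) :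
    Integrable (fun z => del f z * η z) ∧
      ∫ z, del f z * η z = -∫ z, f z * del η z := by
  have hη' : ContDiff ℝ ∞ fun z => conj (η z) := Complex.conjCLE.contDiff.comp hη
  have ht : tsupport (fun z => conj (η z)) = tsupport η := by
    unfold tsupport; congr 1; ext z; simp
  obtain ⟨h1, h2⟩ := integral_mul_delBar hS (fun z hz => contDiffAt_conj (hf z hz)) hη'
    (hc.comp_left (g := conj) (map_zero _)) (ht ▸ hs)
  have hd : ∀ z, delBar (fun w => conj (f w)) z * conj (η z) = conj (del f z * η z) := by
    intro z
    by_cases hz : z ∈ tsupport η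
    · rw [delBar_conj ((hf z (hs hz)).differentiableAt one_ne_zero), map_mul]
    · simp [off_tsupport hz]
  have hd' : ∀ z, conj (f z) * delBar (fun w => conj (η w)) z = conj (f z * del η z) := by
    intro z
    rw [delBar_conj (hη.differentiable (by simp) z), map_mul]
  simp_rw [hd, hd'] at h1 h2
  rw [integral_conj, integral_conj, ← map_neg] at h2
  refine ⟨?_, star_injective h2⟩
  simpa using (Complex.conjCLE : ℂ →L[ℝ] ℂ).integrable_comp h1

end SpinorCalculus

/-! ### The degree identity -/

section Degree

/-- The curvature density of the direction `X` at the point `Z`, with `N = c + |Z|²`. -/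
def curv (c : ℝ) (X Z : ℂ × ℂ) : ℝ :=
  nsq X / (c + nsq Z) - ‖herm X Z / ((c + nsq Z : ℝ) : ℂ)‖ ^ 2

theorem curv_eq (c : ℝ) (X Z : ℂ × ℂ) : ((curv c X Z : ℝ) : ℂ) = herm X X / (c + herm Z Z)
    - herm X Z / (c + herm Z Z) * conj (herm X Z / (c + herm Z Z)) := by
  rw [Complex.mul_conj, normSq_eq_norm_sq, herm_self, herm_self, curv]
  push_cast
  rfl

variable {S : Set ℂ} {c : ℝ} {Z : ℂ → ℂ × ℂ} {ρ : ℂ → ℂ}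

theorem degree_identity (hS : IsOpen S) (hZ : ContDiff ℝ ∞ Z)
    (hN : ∀ z ∈ S, 0 < c + nsq (Z z)) (hρ : ContDiff ℝ ∞ ρ) (hc : HasCompactSupport ρ)
    (hs : tsupport ρ ⊆ S) :
    Integrable (fun z => (curv c (delV Z z) (Z z) : ℂ) * ρ z) ∧
    Integrable (fun z => (curv c (delBarV Z z) (Z z) : ℂ) * ρ z) ∧
    Integrable (fun z => (log (c + nsq (Z z)) : ℂ) * del (delBar ρ) z) ∧
    ∫ z, (curv c (delV Z z) (Z z) : ℂ) * ρ z = (∫ z, (curv c (delBarV Z z) (Z z) : ℂ) * ρ z)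
      + (∫ z, (log (c + nsq (Z z)) : ℂ) * del (delBar ρ) z)
      + ((∫ z, conj (herm (delBarV Z z) (Z z) / ((c + nsq (Z z) : ℝ) : ℂ)) * delBar ρ z)
        + ∫ z, (herm (delBarV Z z) (Z z) / ((c + nsq (Z z) : ℝ) : ℂ)) * del ρ z) := by
  have hdV := contDiff_delV hZ
  have hDV := contDiff_delBarV hZ
  have hZd : ∀ z, DifferentiableAt ℝ Z z := fun z => hZ.differentiable (by simp) z
  have hdVd : ∀ z, DifferentiableAt ℝ (delV Z) z := fun z => hdV.differentiable (by simp) z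
  have hDVd : ∀ z, DifferentiableAt ℝ (delBarV Z) z := fun z => hDV.differentiable (by simp) z
  set Nc : ℂ → ℂ := fun w => c + herm (Z w) (Z w) with hNc
  have hNe : ∀ w, ((c + nsq (Z w) : ℝ) : ℂ) = Nc w := fun w => by
    simp only [hNc, herm_self, Complex.ofReal_add]
  have hN0 : ∀ z ∈ S, Nc z ≠ 0 := fun z hz => by
    rw [← hNe]; exact_mod_cast (hN z hz).ne'
  have hNcd : ∀ z, ContDiffAt ℝ ∞ Nc z := fun z =>
    contDiffAt_const.add (contDiffAt_herm hZ.contDiffAt hZ.contDiffAt)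
  have hNd : ∀ z, DifferentiableAt ℝ Nc z := fun z => (hNcd z).differentiableAt (by simp)
  have hherm : ∀ {X : ℂ → ℂ × ℂ}, ContDiff ℝ ∞ X → ∀ z, DifferentiableAt ℝ (fun w => herm (X w) (Z w)) z :=
    fun hX z => (contDiffAt_herm hX.contDiffAt hZ.contDiffAt).differentiableAt (by simp)
  set a : ℂ → ℂ := fun w => herm (delV Z w) (Z w) / Nc w with ha
  set a' : ℂ → ℂ := fun w => herm (delBarV Z w) (Z w) / Nc w with ha'
  have dN : ∀ z, del Nc z = herm (delV Z z) (Z z) + herm (Z z) (delBarV Z z) := fun z => by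
    rw [← del_herm (hZd z) (hZd z), hNc, del_add (differentiableAt_const _)
      ((contDiffAt_herm hZ.contDiffAt hZ.contDiffAt).differentiableAt (n := ∞) (by simp)), del_const,
      zero_add]
  have DN : ∀ z, delBar Nc z = herm (delBarV Z z) (Z z) + herm (Z z) (delV Z z) := fun z => by
    rw [← delBar_herm (hZd z) (hZd z), hNc, delBar_add (differentiableAt_const _)
      ((contDiffAt_herm hZ.contDiffAt hZ.contDiffAt).differentiableAt (n := ∞) (by simp)),
      delBar_const, zero_add]
  have cN : ∀ z, conj (Nc z) = Nc z := fun z => by rw [← hNe, conj_ofReal]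
  have hcd : ∀ {X : ℂ → ℂ × ℂ}, ContDiff ℝ ∞ X → ∀ z ∈ S,
      ContDiffAt ℝ ∞ (fun w => herm (X w) (Z w) / Nc w) z := fun hX z hz => by
    simp only [div_eq_mul_inv]
    exact (contDiffAt_herm hX.contDiffAt hZ.contDiffAt).mul ((hNcd z).inv (hN0 z hz))
  have key : ∀ z ∈ S, delBar a z - del a' z
      = (curv c (delV Z z) (Z z) : ℂ) - curv c (delBarV Z z) (Z z) := by
    intro z hz
    have h0 := hN0 z hz
    rw [curv_eq, curv_eq, ha, ha', delBar_div (hherm hdV z) (hNd z) h0,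
      del_div (hherm hDV z) (hNd z) h0, delBar_herm (hdVd z) (hZd z), del_herm (hDVd z) (hZd z),
      dN, DN, delV_delBarV_comm (hZ.contDiffAt.of_le two_le_infty)]
    change _ = herm (delV Z z) (delV Z z) / Nc z - herm (delV Z z) (Z z) / Nc z *
        conj (herm (delV Z z) (Z z) / Nc z) - (herm (delBarV Z z) (delBarV Z z) / Nc z -
        herm (delBarV Z z) (Z z) / Nc z * conj (herm (delBarV Z z) (Z z) / Nc z))
    rw [map_div₀, map_div₀, cN, conj_herm, conj_herm]
    field_simp
    ring
  have hlogd : ∀ z ∈ S, ContDiffAt ℝ 1 (fun w => (log (c + nsq (Z w)) : ℂ)) z ∧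
      del (fun w => (log (c + nsq (Z w)) : ℂ)) z = a z + conj (a' z) := by
    intro z hz
    have hev : (fun w => (log (c + nsq (Z w)) : ℂ)) =ᶠ[nhds z] fun w => Complex.log (Nc w) := by
      filter_upwards [hS.mem_nhds hz] with w hw
      rw [← hNe, Complex.ofReal_log (hN w hw).le]
    have hsl : Nc z ∈ Complex.slitPlane := by
      rw [← hNe]; exact Complex.ofReal_mem_slitPlane.2 (hN z hz)
    refine ⟨ContDiffAt.congr_of_eventuallyEq ?_ hev, ?_⟩
    · exact ((Complex.contDiffAt_log (n := 1) hsl).restrict_scalars ℝ).comp z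
        ((hNcd z).of_le one_le_infty)
    · rw [del_congr hev, del_comp_hol (Complex.hasDerivAt_log hsl) (hNd z), dN]
      simp only [ha, ha', map_div₀, cN, conj_herm]
      field_simp
  obtain ⟨i1, e1⟩ := integral_mul_delBar hS (fun z hz => (hcd hdV z hz).of_le one_le_infty) hρ hc hs
  obtain ⟨i2, e2⟩ := integral_mul_del hS (fun z hz => (hcd hDV z hz).of_le one_le_infty) hρ hc hs
  have hρD : ContDiff ℝ ∞ (delBar ρ) := hρ.delBar_infty
  have hsD : tsupport (delBar ρ) ⊆ S := tsupport_delBar_subset.trans hs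
  obtain ⟨i3, e3⟩ := integral_mul_del hS (fun z hz => (hlogd z hz).1) hρD hc.delBar hsD
  have ca' : ContinuousOn a' S := fun z hz => (hcd hDV z hz).continuousAt.continuousWithinAt
  have cX : ∀ {X : ℂ → ℂ × ℂ}, ContDiff ℝ ∞ X →
      ContinuousOn (fun z => (curv c (X z) (Z z) : ℂ)) S := fun {X} hX => by
    have h1 : (fun z => (curv c (X z) (Z z) : ℂ)) = fun z => herm (X z) (X z) / Nc z
        - herm (X z) (Z z) / Nc z * conj (herm (X z) (Z z) / Nc z) := by
      ext z; rw [curv_eq]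
    rw [h1]
    intro z hz
    have h2 : ContinuousAt (fun z => herm (X z) (X z) / Nc z) z :=
      (contDiffAt_herm (hX.contDiffAt (x := z)) hX.contDiffAt).continuousAt.div
        (hNcd z).continuousAt (hN0 z hz)
    have h3 := (hcd hX z hz).continuousAt
    exact (h2.sub (h3.mul (continuous_conj.continuousAt.comp h3))).continuousWithinAt
  have iC : ∀ {g η : ℂ → ℂ}, ContinuousOn g S → Continuous η → HasCompactSupport η →
      tsupport η ⊆ S → Integrable fun z => g z * η z := fun hg h1 h2 h3 =>
    integrable_mul_of_tsupport_subset (hg.locallyIntegrableOn hS.measurableSet) h1 h2 h3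
  have j1 := iC (cX hdV) hρ.continuous hc hs
  have j2 := iC (cX hDV) hρ.continuous hc hs
  have j3 : Integrable fun z => conj (a' z) * delBar ρ z :=
    iC (continuous_conj.comp_continuousOn ca') hρD.continuous hc.delBar hsD
  have j4 : Integrable fun z => (log (c + nsq (Z z)) : ℂ) * del (delBar ρ) z :=
    iC (fun z hz => (hlogd z hz).1.continuousAt.continuousWithinAt)
      hρD.del_infty.continuous hc.delBar.del (tsupport_del_subset.trans hsD)
  refine ⟨j1, j2, j4, ?_⟩
  simp only [hNe]
  change _ = _ + _ + ((∫ z, conj (a' z) * delBar ρ z) + ∫ z, a' z * del ρ z)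
  have hf : ∀ {g g' : ℂ → ℂ} {η : ℂ → ℂ}, tsupport η ⊆ S → (∀ z ∈ S, g z = g' z) →
      ∀ z, g z * η z = g' z * η z := fun {g g' η} h1 h2 z => by
    by_cases hz : z ∈ tsupport η
    · rw [h2 z (h1 hz)]
    · simp [off_tsupport hz]
  have k1 : (∫ z, (curv c (delV Z z) (Z z) : ℂ) * ρ z) - ∫ z, (curv c (delBarV Z z) (Z z) : ℂ) * ρ z
      = (∫ z, delBar a z * ρ z) - ∫ z, del a' z * ρ z := by
    rw [← integral_sub j1 j2, ← integral_sub i1 i2]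
    refine integral_congr_ae (ae_of_all _ fun z => ?_)
    simp only [← sub_mul]
    exact (hf (g := fun z => delBar a z - del a' z) hs key z).symm
  have k2 : ∫ z, a z * delBar ρ z = (∫ z, del (fun w => (log (c + nsq (Z w)) : ℂ)) z
      * delBar ρ z) - ∫ z, conj (a' z) * delBar ρ z := by
    rw [← integral_sub i3 j3]
    refine integral_congr_ae (ae_of_all _ fun z => ?_)
    simp only [← sub_mul]
    refine hf (g' := fun z => del (fun w => (log (c + nsq (Z w)) : ℂ)) z - conj (a' z)) hsD
      (fun w hw => ?_) z
    simp only [(hlogd w hw).2]; ring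
  rw [e1, e2, k2, e3] at k1
  linear_combination k1

end Degree

section DegreeEstimates

variable {E : Type*} [NormedAddCommGroup E]

theorem integral_sq_norm_eq {μ : Measure ℂ} {f : ℂ → E} (hf : MemLp f 2 μ) :
    ofReal (∫ z, ‖f z‖ ^ 2 ∂μ) = eLpNorm f 2 μ ^ 2 := by
  rw [hf.eLpNorm_eq_integral_rpow_norm (by simp) (by simp), ← ENNReal.ofReal_pow (by positivity)]
  congr 1
  rw [← Real.rpow_natCast, ← Real.rpow_mul (by positivity)]
  simp

theorem LpBdd.integral_sq_le {μ : Measure ℂ} {f : ℕ → ℂ → E} (h : LpBdd 2⁻¹ μ f) :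
    ∃ C : ℝ, ∀ n, Integrable (fun z => ‖f n z‖ ^ 2) μ ∧ ∫ z, ‖f n z‖ ^ 2 ∂μ ≤ C := by
  have h1 := h.memLp
  obtain ⟨C, hC, hb⟩ := h.bdd
  simp only [inv_inv] at h1 hb
  refine ⟨(C ^ 2).toReal, fun n => ⟨(h1 n).integrable_norm_pow (by simp), ?_⟩⟩
  refine (ENNReal.ofReal_le_iff_le_toReal (by finiteness)).1 ?_
  rw [integral_sq_norm_eq (h1 n)]
  gcongr
  exact hb n

theorem eLpNorm_two_sq_restrict_le {B : Set ℂ} (hB : MeasurableSet B) {ρ h : ℂ → ℝ} {f : ℂ → E}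
    (h0 : ∀ z, 0 ≤ h z * ρ z) (hρ : ∀ z ∈ B, ρ z = 1) (hf : ∀ z ∈ B, ‖f z‖ ^ 2 ≤ h z)
    (hi : Integrable fun z => h z * ρ z) :
    eLpNorm f 2 (vol B) ^ 2 ≤ ofReal (∫ z, h z * ρ z) := by
  rw [ofReal_integral_eq_lintegral_ofReal hi (ae_of_all _ h0),
    eLpNorm_eq_lintegral_rpow_enorm_toReal (by simp) (by simp), ← ENNReal.rpow_natCast,
    ← ENNReal.rpow_mul]
  simp only [ENNReal.toReal_ofNat, one_div, Nat.cast_ofNat, inv_mul_cancel₀ (two_ne_zero (α := ℝ)),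
    ENNReal.rpow_one]
  refine (setLIntegral_mono' hB fun z hz => ?_).trans (setLIntegral_le_lintegral B _)
  rw [hρ z hz, mul_one, ← ofReal_norm, ENNReal.ofReal_rpow_of_nonneg (norm_nonneg _) (by norm_num)]
  exact ofReal_le_ofReal (by exact_mod_cast hf z hz)

variable {S : Set ℂ} {c : ℝ} {Z : ℂ → ℂ × ℂ} {ρ : ℂ → ℝ}

theorem degree_le (hS : IsOpen S) (hZ : ContDiff ℝ ∞ Z)
    (hN : ∀ z ∈ S, 0 < c + nsq (Z z)) (hρ : ContDiff ℝ ∞ ρ) (hc : HasCompactSupport ρ)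
    (hs : tsupport ρ ⊆ S) :
    Integrable (fun z => curv c (delV Z z) (Z z) * ρ z) ∧
    Integrable (fun z => curv c (delBarV Z z) (Z z) * ρ z) ∧
    ∫ z, curv c (delV Z z) (Z z) * ρ z ≤ (∫ z, curv c (delBarV Z z) (Z z) * ρ z)
      + (∫ z, |log (c + nsq (Z z))| * ‖del (delBar fun w => (ρ w : ℂ)) z‖)
      + ((∫ z, ‖herm (delBarV Z z) (Z z) / ((c + nsq (Z z) : ℝ) : ℂ)‖ * ‖delBar (fun w => (ρ w : ℂ)) z‖)
        + ∫ z, ‖herm (delBarV Z z) (Z z) / ((c + nsq (Z z) : ℝ) : ℂ)‖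
          * ‖del (fun w => (ρ w : ℂ)) z‖) := by
  obtain ⟨h1, h2, h3, h4⟩ := degree_identity hS hZ hN (contDiff_ofReal hρ)
    (hasCompactSupport_ofReal hc) (by rwa [tsupport_ofReal])
  simp only [← Complex.ofReal_mul] at h1 h2 h4
  have i1 : Integrable (fun z => curv c (delV Z z) (Z z) * ρ z) := by simpa using h1.re
  have i2 : Integrable (fun z => curv c (delBarV Z z) (Z z) * ρ z) := by simpa using h2.re
  refine ⟨i1, i2, ?_⟩
  rw [integral_complex_ofReal, integral_complex_ofReal] at h4
  have h5 := congrArg Complex.re h4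
  simp only [Complex.ofReal_re, Complex.add_re] at h5
  rw [h5]
  have hn : ∀ f : ℂ → ℂ, (∫ z, f z).re ≤ ∫ z, ‖f z‖ := fun f =>
    (Complex.re_le_norm _).trans (norm_integral_le_integral_norm f)
  refine add_le_add (add_le_add le_rfl ((hn _).trans_eq ?_)) (add_le_add ((hn _).trans_eq ?_)
    ((hn _).trans_eq ?_))
  · simp
  · simp only [norm_mul, RCLike.norm_conj]
  · simp only [norm_mul]

theorem curv_le (X Z : ℂ × ℂ) : curv c X Z ≤ nsq X / (c + nsq Z) := by
  unfold curv; nlinarith [sq_nonneg ‖herm X Z / ((c + nsq Z : ℝ) : ℂ)‖]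

theorem nsq_div_sq_le_curv_one (X Z : ℂ × ℂ) : nsq X / (1 + nsq Z) ^ 2 ≤ curv 1 X Z := by
  have hp : 0 < 1 + nsq Z := by linarith [nsq_nonneg Z]
  rw [curv, norm_div, norm_real, norm_of_nonneg hp.le, div_pow, div_sub_div _ _ hp.ne'
    (by positivity), div_le_div_iff₀ (by positivity) (by positivity)]
  have := sq_norm_herm_le Z X
  nlinarith [mul_le_mul_of_nonneg_left this (by positivity : 0 ≤ (1 + nsq Z) * (1 + nsq Z) ^ 2)]

theorem curv_one_nonneg (X Z : ℂ × ℂ) : 0 ≤ curv 1 X Z :=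
  (by have := nsq_nonneg X; positivity : 0 ≤ nsq X / (1 + nsq Z) ^ 2).trans
    (nsq_div_sq_le_curv_one X Z)

theorem curv_zero_eq {X Z : ℂ × ℂ} (hZ : Z ≠ 0) :
    curv 0 X Z = ‖herm X (J Z) / (nsq Z : ℂ)‖ ^ 2 := by
  have hp := nsq_pos hZ
  have h := nsq_mul_nsq Z X
  rw [curv, zero_add, norm_div, norm_div, norm_real, norm_of_nonneg hp.le]
  field_simp
  linarith

theorem curv_one_le (u : ℂ) (k Z : ℂ × ℂ) :
    curv 1 (k + u • J Z) Z ≤ 4 * ‖u‖ ^ 2 + 4 * ‖k‖ ^ 2 := by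
  refine (curv_le _ _).trans ?_
  have hn := nsq_nonneg Z
  rw [div_le_iff₀ (by linarith)]
  have h1 : ‖k + u • J Z‖ ≤ ‖k‖ + ‖u‖ * ‖Z‖ := by
    refine (norm_add_le _ _).trans ?_
    rw [norm_smul, norm_J]
  have h2 : ‖k + u • J Z‖ ^ 2 ≤ (‖k‖ + ‖u‖ * ‖Z‖) ^ 2 := by gcongr
  have h3 := nsq_le (k + u • J Z)
  have h4 := sq_norm_le_nsq Z
  nlinarith [sq_nonneg (‖k‖ - ‖u‖ * ‖Z‖), mul_le_mul_of_nonneg_left h4 (sq_nonneg ‖u‖),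
    mul_nonneg (sq_nonneg ‖k‖) hn, sq_nonneg ‖u‖]

theorem norm_herm_div_le (u : ℂ) (k Z : ℂ × ℂ) :
    ‖herm (k + u • J Z) Z / ((1 + nsq Z : ℝ) : ℂ)‖ ≤ 2 * ‖k‖ := by
  have hn := nsq_nonneg Z
  rw [herm_add_left, herm_smul_left, herm_J_self, mul_zero, add_zero, norm_div, norm_real,
    norm_of_nonneg (by linarith), div_le_iff₀ (by linarith)]
  have h1 := norm_herm_le k Z
  have h2 := sq_norm_le_nsq Z
  nlinarith [norm_nonneg k, norm_nonneg Z, mul_nonneg (norm_nonneg k) (sq_nonneg (‖Z‖ - 1))]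

theorem log_one_add_nsq_le (Z : ℂ × ℂ) : |log (1 + nsq Z)| ≤ 2 * ‖Z‖ ^ 2 := by
  have hn := nsq_nonneg Z
  rw [abs_of_nonneg (Real.log_nonneg (by linarith))]
  linarith [log_le_sub_one_of_pos (by linarith : 0 < 1 + nsq Z), nsq_le Z]

/-- Solutions of `∂̄Z = k + u J Z` have locally square integrable `∂Z / (1 + |Z|²)`. -/
theorem lpBdd_delV_div {o : ℂ} {r R : ℝ} (hr : 0 < r) (hrR : r < R) {k : ℂ → ℂ × ℂ}
    (hk : Continuous k) (hkc : HasCompactSupport k) {un : ℕ → ℂ → ℂ} {Zn : ℕ → ℂ → ℂ × ℂ}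
    (hu : LpBdd 2⁻¹ volume un) (hZ : ∀ n, ContDiff ℝ ∞ (Zn n))
    (hZb : LpBdd 2⁻¹ (vol (ball o R)) Zn)
    (he : ∀ n, ∀ z ∈ ball o R, delBarV (Zn n) z = k z + un n z • J (Zn n z)) :
    LpBdd 2⁻¹ (vol (ball o r)) fun n z =>
      ‖delV (Zn n) z‖ / (1 + nsq (Zn n z)) := by
  obtain ⟨R', hR1, hR2⟩ := exists_between hrR
  obtain ⟨ρ, hρ, hρc, hρs, hρ1, hρ0⟩ := exists_cutoff o hr hR1
  have hρC := contDiff_ofReal hρ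
  have hρCc := hasCompactSupport_ofReal hρc
  obtain ⟨C₁, hC₁⟩ := hu.integral_sq_le
  obtain ⟨C₂, hC₂⟩ := hZb.integral_sq_le
  have hi2 : Integrable fun z => ‖k z‖ ^ 2 := by
    have h : MemLp k (2 : ℕ) := hk.memLp_of_hasCompactSupport hkc
    exact h.integrable_norm_pow (by simp)
  have hi1 : Integrable fun z => ‖k z‖ := by
    exact (hk.integrable_of_hasCompactSupport hkc).norm
  obtain ⟨K₀, hK₀⟩ := (hρC.delBar_infty.del_infty).continuous.bounded_above_of_compact_support
    hρCc.delBar.del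
  obtain ⟨K₁, hK₁⟩ := (hρC.delBar_infty).continuous.bounded_above_of_compact_support hρCc.delBar
  obtain ⟨K₂, hK₂⟩ := (hρC.del_infty).continuous.bounded_above_of_compact_support hρCc.del
  have hK₀0 : 0 ≤ K₀ := (norm_nonneg _).trans (hK₀ 0)
  have ht0 : ∀ {z}, z ∈ tsupport (fun w => (ρ w : ℂ)) → z ∈ ball o R := fun hz =>
    closedBall_subset_ball hR2 (hρs (tsupport_ofReal (ρ := ρ) ▸ hz))
  have hsupp : ∀ z, z ∉ ball o R → del (delBar fun w => (ρ w : ℂ)) z = 0 := fun z hz =>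
    off_tsupport fun h =>
      hz (ht0 (tsupport_delBar_subset (tsupport_del_subset h)))
  have hρz : ∀ z, z ∉ ball o R → ρ z = 0 := fun z hz =>
    off_tsupport fun h =>
      hz (closedBall_subset_ball hR2 (hρs h))
  set C : ℝ := (∫ z, 4 * ‖k z‖ ^ 2) + 4 * C₁ + K₀ * (2 * C₂) + ((∫ z, 2 * ‖k z‖ * K₁)
    + ∫ z, 2 * ‖k z‖ * K₂) with hC
  refine ⟨fun n => ?_, ofReal C ^ (1 / 2 : ℝ),
    rpow_ne_top_of_nonneg (by norm_num) ofReal_ne_top, fun n => ?_⟩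
  · refine Continuous.aestronglyMeasurable ?_
    refine (contDiff_delV (hZ n)).continuous.norm.div (continuous_const.add
      (continuous_nsq.comp (hZ n).continuous)) fun z => ?_
    linarith [nsq_nonneg (Zn n z)]
  rw [inv_inv, one_div, ENNReal.le_rpow_inv_iff (by norm_num)]
  obtain ⟨i1, i2, hle⟩ := degree_le isOpen_ball (hZ n) (c := 1)
    (fun z _ => by linarith [nsq_nonneg (Zn n z)]) hρ hρc
    (hρs.trans (closedBall_subset_ball hR2))
  have h1 := eLpNorm_two_sq_restrict_le (B := ball o r) measurableSet_ball
    (f := fun z => ‖delV (Zn n) z‖ / (1 + nsq (Zn n z)))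
    (fun z => mul_nonneg (curv_one_nonneg _ _) (hρ0 z).1)
    (fun z hz => hρ1 z (ball_subset_closedBall hz)) (fun z hz => ?_) i1
  · rw [ENNReal.rpow_two]
    refine h1.trans (ofReal_le_ofReal (hle.trans ?_))
    rw [hC]
    have b1 : ∫ z, curv 1 (delBarV (Zn n) z) (Zn n z) * ρ z
        ≤ (∫ z, 4 * ‖k z‖ ^ 2) + 4 * C₁ := by
      calc ∫ z, curv 1 (delBarV (Zn n) z) (Zn n z) * ρ z
          ≤ ∫ z, (4 * ‖k z‖ ^ 2 + 4 * ‖un n z‖ ^ 2) := by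
            refine integral_mono i2 ((hi2.const_mul 4).add ((hC₁ n).1.const_mul 4)) fun z => ?_
            by_cases hz : z ∈ ball o R
            · have h2 := curv_one_le (un n z) (k z) (Zn n z)
              have h3 := curv_one_nonneg (k z + un n z • J (Zn n z)) (Zn n z)
              simp only [he n z hz]
              nlinarith [(hρ0 z).1, (hρ0 z).2]
            · simp only [hρz z hz, mul_zero]; positivity
        _ = (∫ z, 4 * ‖k z‖ ^ 2) + 4 * ∫ z, ‖un n z‖ ^ 2 := by
            rw [integral_add (hi2.const_mul 4) ((hC₁ n).1.const_mul 4),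
              integral_const_mul 4 fun z => ‖un n z‖ ^ 2]
        _ ≤ _ := by gcongr; exact (hC₁ n).2
    have b2 : ∫ z, |log (1 + nsq (Zn n z))| * ‖del (delBar fun w => (ρ w : ℂ)) z‖
        ≤ K₀ * (2 * C₂) := by
      rw [← setIntegral_eq_integral_of_forall_compl_eq_zero (s := ball o R)
        (fun z hz => by rw [hsupp z hz]; simp)]
      calc ∫ z in ball o R, |log (1 + nsq (Zn n z))|
            * ‖del (delBar fun w => (ρ w : ℂ)) z‖
          ≤ ∫ z in ball o R, K₀ * (2 * ‖Zn n z‖ ^ 2) := by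
            refine integral_mono_of_nonneg (ae_of_all _ fun z => by positivity)
              (((hC₂ n).1.const_mul 2).const_mul K₀) (ae_of_all _ fun z => ?_)
            have h2 := log_one_add_nsq_le (Zn n z)
            have h3 := hK₀ z
            refine (mul_le_mul h2 h3 (norm_nonneg _) (by positivity)).trans_eq ?_
            ring
        _ = K₀ * (2 * ∫ z in ball o R, ‖Zn n z‖ ^ 2) := by
            rw [integral_const_mul, integral_const_mul]
        _ ≤ _ := by gcongr; exact (hC₂ n).2
    have b3 : ∀ {g : ℂ → ℂ} {K : ℝ}, (∀ z, ‖g z‖ ≤ K) → (∀ z, z ∉ ball o R → g z = 0) →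
        ∫ z, ‖herm (delBarV (Zn n) z) (Zn n z) / ((1 + nsq (Zn n z) : ℝ) : ℂ)‖ * ‖g z‖
          ≤ ∫ z, 2 * ‖k z‖ * K := fun {g K} hg hg0 => by
      refine integral_mono_of_nonneg (ae_of_all _ fun z => by positivity)
        ((hi1.const_mul 2).mul_const K) (ae_of_all _ fun z => ?_)
      by_cases hz : z ∈ ball o R
      · have h2 := norm_herm_div_le (un n z) (k z) (Zn n z)
        simp only [he n z hz]
        gcongr
        exact hg z
      · simp only [hg0 z hz, norm_zero, mul_zero]
        have := (norm_nonneg _).trans (hg z)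
        positivity
    exact add_le_add (add_le_add b1 b2) (add_le_add
      (b3 hK₁ fun z hz => off_tsupport fun h => hz (ht0 (tsupport_delBar_subset h)))
      (b3 hK₂ fun z hz => off_tsupport fun h => hz (ht0 (tsupport_del_subset h))))
  · have hp : 0 < 1 + nsq (Zn n z) := by linarith [nsq_nonneg (Zn n z)]
    refine le_trans ?_ (nsq_div_sq_le_curv_one _ _)
    rw [norm_of_nonneg (by positivity), div_pow]
    gcongr
    exact sq_norm_le_nsq _

end DegreeEstimates

/-! ### Logarithmic cutoff functions -/

section LogCutoff

theorem hasFDerivAt_ofReal_comp {θ : ℝ → ℝ} {θ' : ℝ} {g : ℂ → ℝ} {z : ℂ}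
    (hθ : HasDerivAt θ θ' (g z)) (hg : DifferentiableAt ℝ g z) (v : ℂ) :
    fderiv ℝ (fun w => (θ (g w) : ℂ)) z v = θ' * fderiv ℝ (fun w => (g w : ℂ)) z v := by
  have h1 := Complex.ofRealCLM.hasFDerivAt.comp z (hθ.hasFDerivAt.comp z hg.hasFDerivAt)
  have h2 := Complex.ofRealCLM.hasFDerivAt.comp z hg.hasFDerivAt
  have e1 : fderiv ℝ (fun w => (θ (g w) : ℂ)) z = _ := h1.fderiv
  have e2 : fderiv ℝ (fun w => (g w : ℂ)) z = _ := h2.fderiv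
  rw [e1, e2]
  simp [mul_comm]

theorem del_ofReal_comp {θ : ℝ → ℝ} {θ' : ℝ} {g : ℂ → ℝ} {z : ℂ}
    (hθ : HasDerivAt θ θ' (g z)) (hg : DifferentiableAt ℝ g z) :
    del (fun w => (θ (g w) : ℂ)) z = θ' * del (fun w => (g w : ℂ)) z := by
  simp only [del, hasFDerivAt_ofReal_comp hθ hg]; ring

theorem delBar_ofReal_comp {θ : ℝ → ℝ} {θ' : ℝ} {g : ℂ → ℝ} {z : ℂ}
    (hθ : HasDerivAt θ θ' (g z)) (hg : DifferentiableAt ℝ g z) :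
    delBar (fun w => (θ (g w) : ℂ)) z = θ' * delBar (fun w => (g w : ℂ)) z := by
  simp only [delBar, hasFDerivAt_ofReal_comp hθ hg]; ring

variable {o z : ℂ} {L : ℝ}

theorem contDiffAt_logNormSq (hz : z ≠ o) (L : ℝ) :
    ContDiffAt ℝ ∞ (fun w => log (normSq (w - o)) / L) z := by
  have h1 : ContDiffAt ℝ ∞ (fun w : ℂ => normSq (w - o)) z := by
    simp only [normSq_eq_norm_sq]
    exact (contDiff_norm_sq ℝ).contDiffAt.comp z (contDiffAt_id.sub contDiffAt_const)
  simp only [div_eq_mul_inv]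
  exact (h1.log (by simpa [sub_eq_zero] using hz)).mul contDiffAt_const

theorem del_delBar_logNormSq (hz : z ≠ o) (L : ℝ) :
    del (fun w => ((log (normSq (w - o)) / L : ℝ) : ℂ)) z = (L * (z - o))⁻¹ ∧
    delBar (fun w => ((log (normSq (w - o)) / L : ℝ) : ℂ)) z
      = (L * conj (z - o))⁻¹ := by
  have h0 : z - o ≠ 0 := sub_ne_zero.2 hz
  have h0' : conj (z - o) ≠ 0 := (map_ne_zero _).2 h0
  have e : (fun w => ((log (normSq (w - o)) / L : ℝ) : ℂ))
      = fun w => Complex.log ((w - o) * conj (w - o)) * (L : ℂ)⁻¹ := by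
    ext w
    rw [Complex.mul_conj, Complex.ofReal_div, Complex.ofReal_log (Complex.normSq_nonneg _),
      div_eq_mul_inv]
  have hd : DifferentiableAt ℝ (fun w : ℂ => w - o) z := differentiableAt_id.sub_const _
  have hdc : DifferentiableAt ℝ (fun w : ℂ => conj (w - o)) z := differentiableAt_conj hd
  have d1 : delBar (fun w : ℂ => w - o) z = 0 :=
    delBar_eq_zero_of_differentiableAt (differentiableAt_id.sub_const _)
  have d2 : del (fun w : ℂ => w - o) z = 1 := by
    simp only [del, fderiv_sub_const]
    simp
    ring
  have hm : HasDerivAt (fun x : ℂ => Complex.log x * (L : ℂ)⁻¹)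
      (((z - o) * conj (z - o))⁻¹ * (L : ℂ)⁻¹) ((z - o) * conj (z - o)) := by
    refine (Complex.hasDerivAt_log ?_).mul_const _
    rw [Complex.mul_conj]
    exact Complex.ofReal_mem_slitPlane.2 (by simpa [Complex.normSq_pos] using h0)
  have hm' : DifferentiableAt ℝ (fun w : ℂ => (w - o) * conj (w - o)) z := hd.fun_mul hdc
  rw [e, del_comp_hol (f := fun w => (w - o) * conj (w - o)) hm hm',
    delBar_comp_hol (f := fun w => (w - o) * conj (w - o)) hm hm', del_mul hd hdc,
    delBar_mul hd hdc, del_conj hd, delBar_conj hd, d1, d2]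
  constructor <;> simp only [map_zero, map_one, mul_inv] <;> field_simp <;> ring

/-- The square of the inverse distance on an annulus. -/
def annulusWeight (o : ℂ) (L : ℝ) : ℂ → ℝ :=
  {z : ℂ | ‖z - o‖ ∈ Icc (exp (-L)) (exp (-L / 2))}.indicator
    fun z => (‖z - o‖ ^ 2)⁻¹

theorem annulusWeight_nonneg (o : ℂ) (L : ℝ) (z : ℂ) : 0 ≤ annulusWeight o L z :=
  Set.indicator_nonneg (fun _ _ => by positivity) _

theorem integral_annulusWeight_le (o : ℂ) (hL : 0 < L) :
    Integrable (annulusWeight o L) ∧ ∫ z, annulusWeight o L z ≤ π * L := by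
  have hm : Measurable (annulusWeight o L) := by
    unfold annulusWeight
    exact (by fun_prop : Measurable fun z : ℂ => (‖z - o‖ ^ 2)⁻¹).indicator
      (measurableSet_Icc.preimage (by fun_prop : Measurable fun z : ℂ => ‖z - o‖))
  have hab : exp (-L) ≤ exp (-L / 2) := Real.exp_le_exp.2 (by linarith)
  have h0 : ∫⁻ z, ofReal (annulusWeight o L z) = ofReal (π * L) := by
    have e1 : ∀ z, ofReal (annulusWeight o L z) =
        (fun w : ℂ => (Icc (exp (-L)) (exp (-L / 2))).indicator
          (fun r => ofReal ((r ^ 2)⁻¹)) ‖w‖) (z - o) := fun z => by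
      by_cases h : ‖z - o‖ ∈ Icc (exp (-L)) (exp (-L / 2))
      · simp only [annulusWeight]
        rw [indicator_of_mem h, indicator_of_mem (by exact h)]
      · simp only [annulusWeight]
        rw [indicator_of_notMem h, indicator_of_notMem (by exact h), ENNReal.ofReal_zero]
    rw [lintegral_congr e1, lintegral_sub_right_eq_self (fun w : ℂ =>
      (Icc (exp (-L)) (exp (-L / 2))).indicator
          (fun r => ofReal ((r ^ 2)⁻¹)) ‖w‖) o,
      lintegral_radial ((by fun_prop : Measurable fun r : ℝ =>
        ofReal ((r ^ 2)⁻¹)).indicator measurableSet_Icc)]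
    have e2 : ∀ r : ℝ, ofReal r * (Icc (exp (-L)) (exp (-L / 2))).indicator
        (fun r => ofReal ((r ^ 2)⁻¹)) r
        = (Icc (exp (-L)) (exp (-L / 2))).indicator
          (fun r => ofReal r⁻¹) r := fun r => by
      by_cases h : r ∈ Icc (exp (-L)) (exp (-L / 2))
      · have hr : 0 < r := (exp_pos _).trans_le h.1
        rw [indicator_of_mem h, indicator_of_mem h, ← ofReal_mul hr.le]
        congr 1
        field_simp
      · simp [h]
    rw [lintegral_congr e2, setLIntegral_indicator measurableSet_Icc,
      Set.inter_eq_left.2 (show Icc (exp (-L)) (exp (-L / 2)) ⊆ Ioi 0 from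
        fun r h => (exp_pos _).trans_le h.1),
      ← ofReal_integral_eq_lintegral_ofReal, ← ofReal_mul (by positivity),
      integral_Icc_eq_integral_Ioc, ← intervalIntegral.integral_of_le hab,
      integral_inv_of_pos (exp_pos _) (exp_pos _), ← Real.exp_sub, Real.log_exp]
    · congr 1; ring
    · refine (ContinuousOn.inv₀ continuousOn_id fun r h => ?_).integrableOn_Icc
      exact ((exp_pos _).trans_le h.1).ne'
    · exact (ae_restrict_iff' measurableSet_Icc).2 (ae_of_all _ fun r h =>
        inv_nonneg.2 ((exp_pos _).trans_le h.1).le)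
  have hi : Integrable (annulusWeight o L) := by
    refine ⟨hm.aestronglyMeasurable, ?_⟩
    rw [hasFiniteIntegral_iff_ofReal (ae_of_all _ (annulusWeight_nonneg o L)), h0]
    exact ofReal_lt_top
  refine ⟨hi, ?_⟩
  rw [← ENNReal.ofReal_le_ofReal_iff (by positivity), ofReal_integral_eq_lintegral_ofReal hi
    (ae_of_all _ (annulusWeight_nonneg o L)), h0]

theorem exists_logCutoff : ∃ K : ℝ, 0 < K ∧ ∀ (o : ℂ) (L : ℝ), 0 < L → ∃ ρ : ℂ → ℝ,
    ContDiff ℝ ∞ ρ ∧ HasCompactSupport ρ ∧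
    tsupport ρ ⊆ closedBall o (exp (-L / 2)) ∧
    (∀ z ∈ ball o (exp (-L)), ρ z = 1) ∧ (∀ z, 0 ≤ ρ z ∧ ρ z ≤ 1) ∧
    ∀ z, ‖del (delBar fun w => (ρ w : ℂ)) z‖ ≤ K / L ^ 2 * annulusWeight o L z := by
  set θ : ℝ → ℝ := fun s => Real.smoothTransition (-1 - s) with hθdef
  have hθ : ContDiff ℝ ∞ θ := Real.smoothTransition.contDiff.comp (contDiff_const.sub contDiff_id)
  have hθ1 : ∀ s, s ≤ -2 → θ s = 1 := fun s hs =>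
    Real.smoothTransition.one_of_one_le (by linarith)
  have hθ0 : ∀ s, -1 ≤ s → θ s = 0 := fun s hs =>
    Real.smoothTransition.zero_of_nonpos (by linarith)
  have hθ' : ContDiff ℝ ∞ (deriv θ) := (contDiff_infty_iff_deriv.1 hθ).2
  have hθ'' : ContDiff ℝ ∞ (deriv (deriv θ)) := (contDiff_infty_iff_deriv.1 hθ').2
  have hz : ∀ s, s ∉ Icc (-2 : ℝ) (-1) → θ =ᶠ[nhds s] fun _ => θ s := by
    intro s hs
    rcases lt_or_ge s (-2) with h | h
    · filter_upwards [Iio_mem_nhds h] with t ht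
      rw [hθ1 t (le_of_lt ht), hθ1 s h.le]
    · have h1 : -1 < s := by by_contra h2; exact hs ⟨h, not_lt.1 h2⟩
      filter_upwards [Ioi_mem_nhds h1] with t ht
      rw [hθ0 t (le_of_lt ht), hθ0 s h1.le]
  have hθ''0 : ∀ s, s ∉ Icc (-2 : ℝ) (-1) → deriv (deriv θ) s = 0 := fun s hs => by
    have h1 : deriv θ =ᶠ[nhds s] fun _ => 0 := by
      have h2 := (hz s hs).eventually_nhds
      filter_upwards [h2] with t ht
      rw [Filter.EventuallyEq.deriv_eq ht, deriv_const]
    rw [h1.deriv_eq, deriv_const]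
  obtain ⟨K, hK⟩ := isCompact_Icc.exists_bound_of_continuousOn (s := Icc (-2 : ℝ) (-1))
    hθ''.continuous.continuousOn
  have hKn : ∀ s, ‖deriv (deriv θ) s‖ ≤ max K 1 := fun s => by
    by_cases hs : s ∈ Icc (-2 : ℝ) (-1)
    · exact (hK s hs).trans (le_max_left _ _)
    · rw [hθ''0 s hs, norm_zero]; positivity
  refine ⟨max K 1, by positivity, fun o L hL => ?_⟩
  set g : ℂ → ℝ := fun w => log (normSq (w - o)) / L with hg
  have hgn : ∀ w, w ≠ o → g w = 2 * log ‖w - o‖ / L := fun w hw => by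
    rw [hg]; simp only [normSq_eq_norm_sq, Real.log_pow]; norm_num
  have hpos : ∀ w, w ≠ o → 0 < ‖w - o‖ := fun w hw => norm_pos_iff.2 (sub_ne_zero.2 hw)
  set ρ : ℂ → ℝ := fun w => if w = o then 1 else θ (g w) with hρdef
  have hρ1 : ∀ z ∈ ball o (exp (-L)), ρ z = 1 := by
    intro z hz
    by_cases h : z = o
    · simp [hρdef, h]
    · simp only [hρdef, h, if_false]
      refine hθ1 _ ?_
      rw [hgn z h, div_le_iff₀ hL]
      have := (Real.log_lt_iff_lt_exp (hpos z h)).2 (mem_ball_iff_norm.1 hz)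
      linarith
  have hev1 : ρ =ᶠ[nhds o] fun _ => 1 := by
    filter_upwards [ball_mem_nhds o (exp_pos (-L))] with z hz using hρ1 z hz
  have hev : ∀ z, z ≠ o → ρ =ᶠ[nhds z] fun w => θ (g w) := fun z hz => by
    filter_upwards [isOpen_ne.mem_nhds hz] with w hw
    simp [hρdef, show w ≠ o from hw]
  have hρs : ∀ z, z ∉ closedBall o (exp (-L / 2)) → ρ z = 0 := by
    intro z hz
    rw [mem_closedBall_iff_norm, not_le] at hz
    have h : z ≠ o := fun h => by
      rw [h, sub_self, norm_zero] at hz; exact absurd hz (exp_pos _).le.not_gt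
    simp only [hρdef, h, if_false]
    refine hθ0 _ ?_
    rw [hgn z h, le_div_iff₀ hL]
    have := (Real.lt_log_iff_exp_lt (hpos z h)).2 hz
    linarith
  have hts : tsupport ρ ⊆ closedBall o (exp (-L / 2)) :=
    closure_minimal (fun z hz => by_contra fun h => hz (hρs z h)) isClosed_closedBall
  have hρC : ContDiff ℝ ∞ ρ := contDiff_iff_contDiffAt.2 fun z => by
    by_cases h : z = o
    · rw [h]; exact contDiffAt_const.congr_of_eventuallyEq hev1
    · exact (hθ.contDiffAt.comp z (contDiffAt_logNormSq h L)).congr_of_eventuallyEq (hev z h)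
  refine ⟨ρ, hρC, HasCompactSupport.of_support_subset_isCompact (isCompact_closedBall o _)
    ((subset_tsupport _).trans hts), hts, hρ1, fun z => ?_, fun z => ?_⟩
  · by_cases h : z = o
    · simp [hρdef, h]
    · simp only [hρdef, h, if_false]
      exact ⟨Real.smoothTransition.nonneg _, Real.smoothTransition.le_one _⟩
  by_cases h : z = o
  · have h1 : (fun w => (ρ w : ℂ)) =ᶠ[nhds z] fun _ => 1 := by
      rw [h]; filter_upwards [hev1] with w hw; simp [hw]
    have h2 : delBar (fun w => (ρ w : ℂ)) =ᶠ[nhds z] fun _ => 0 := by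
      filter_upwards [h1.eventually_nhds] with w hw
      rw [delBar_congr hw, delBar_const]
    rw [del_congr h2, del_const, norm_zero]
    have := annulusWeight_nonneg o L z
    positivity
  have hgd : ∀ w, w ≠ o → DifferentiableAt ℝ g w := fun w hw =>
    (contDiffAt_logNormSq hw L).differentiableAt (by simp)
  have h2 : delBar (fun w => (ρ w : ℂ)) =ᶠ[nhds z]
      fun w => ((deriv θ (g w) : ℝ) : ℂ) * conj ((L * (w - o))⁻¹) := by
    filter_upwards [isOpen_ne.mem_nhds h] with w hw
    have h3 : (fun w => (ρ w : ℂ)) =ᶠ[nhds w] fun w => (θ (g w) : ℂ) := by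
      filter_upwards [hev w hw] with v hv; rw [hv]
    rw [delBar_congr h3, delBar_ofReal_comp (hθ.differentiable (by simp) _).hasDerivAt (hgd w hw),
      (del_delBar_logNormSq hw L).2]
    simp
  have hz0 : z - o ≠ 0 := sub_ne_zero.2 h
  have hinv : DifferentiableAt ℂ (fun w : ℂ => (L * (w - o))⁻¹) z := by
    refine DifferentiableAt.inv (by fun_prop) ?_
    exact mul_ne_zero (by exact_mod_cast hL.ne') hz0
  have hinvR : DifferentiableAt ℝ (fun w : ℂ => (L * (w - o))⁻¹) z := hinv.restrictScalars ℝ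
  have hdθ : DifferentiableAt ℝ (fun w => ((deriv θ (g w) : ℝ) : ℂ)) z :=
    Complex.ofRealCLM.differentiableAt.comp z
      ((hθ'.differentiable (by simp) _).comp z (hgd z h))
  rw [del_congr h2, del_mul hdθ (differentiableAt_conj hinvR), del_conj hinvR,
    delBar_eq_zero_of_differentiableAt hinv, map_zero, mul_zero, add_zero,
    del_ofReal_comp (hθ'.differentiable (by simp) _).hasDerivAt (hgd z h),
    (del_delBar_logNormSq h L).1]
  have hn : ‖((L : ℂ) * (z - o))⁻¹‖ = (L * ‖z - o‖)⁻¹ := by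
    rw [norm_inv, norm_mul, norm_real, norm_of_nonneg hL.le]
  rw [norm_mul, norm_mul, RCLike.norm_conj, hn, norm_real]
  by_cases hs : g z ∈ Icc (-2 : ℝ) (-1)
  · have hmem : ‖z - o‖ ∈ Icc (exp (-L)) (exp (-L / 2)) := by
      rw [hgn z h, Set.mem_Icc, le_div_iff₀ hL, div_le_iff₀ hL] at hs
      exact ⟨(Real.le_log_iff_exp_le (hpos z h)).1 (by linarith),
        (Real.log_le_iff_le_exp (hpos z h)).1 (by linarith)⟩
    rw [annulusWeight, indicator_of_mem (by exact hmem)]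
    have := hpos z h
    calc _ ≤ max K 1 * (L * ‖z - o‖)⁻¹ * (L * ‖z - o‖)⁻¹ := by gcongr; exact hKn _
      _ = _ := by field_simp
  · rw [hθ''0 _ hs, norm_zero, zero_mul, zero_mul]
    have := annulusWeight_nonneg o L z
    positivity

end LogCutoff

section SecondFundamentalForm

/-- The second fundamental form of the line spanned by `F`. -/
def sff (F : ℂ → ℂ × ℂ) (z : ℂ) : ℂ := herm (delV F z) (J (F z)) / (nsq (F z) : ℂ)

/-- The connection form of the line spanned by `F`. -/
def conn (F : ℂ → ℂ × ℂ) (z : ℂ) : ℂ := herm (delV F z) (F z) / (nsq (F z) : ℂ)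

theorem LpBdd.integral_rpow_le {E : Type*} [NormedAddCommGroup E] {M : ENNReal} (h0 : M ≠ 0)
    (hM : M ≠ ⊤) {μ : Measure ℂ} {f : ℕ → ℂ → E} (h : LpBdd M⁻¹ μ f) :
    ∃ C : ℝ, ∀ n, Integrable (fun z => ‖f n z‖ ^ M.toReal) μ ∧ ∫ z, ‖f n z‖ ^ M.toReal ∂μ ≤ C := by
  have h1 := h.memLp
  obtain ⟨C, hC, hb⟩ := h.bdd
  simp only [inv_inv] at h1 hb
  have hp := toReal_pos h0 hM
  refine ⟨(C ^ M.toReal).toReal, fun n => ⟨(h1 n).integrable_norm_rpow h0 hM, ?_⟩⟩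
  refine (ENNReal.ofReal_le_iff_le_toReal (rpow_ne_top_of_nonneg hp.le hC)).1 ?_
  have h2 : ofReal (∫ z, ‖f n z‖ ^ M.toReal ∂μ) = eLpNorm (f n) M μ ^ M.toReal := by
    rw [(h1 n).eLpNorm_eq_integral_rpow_norm h0 hM, ENNReal.ofReal_rpow_of_nonneg (by positivity)
      hp.le, ← Real.rpow_mul (by positivity), inv_mul_cancel₀ hp.ne', Real.rpow_one]
  rw [h2]
  gcongr
  exact hb n

theorem abs_log_sq_le {s t m : ℝ} (hs : 0 < s) (ht : 0 < t) (hm : 0 < m) :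
    |log (s ^ 2)| ≤ 2 / m * (-log t + t * (s ^ m + s⁻¹ ^ m)) := by
  have h1 : 0 < s ^ m := rpow_pos_of_pos hs m
  have h2 : 0 < s⁻¹ ^ m := rpow_pos_of_pos (inv_pos.2 hs) m
  have e1 : m * log s = log (s ^ m) := (Real.log_rpow hs m).symm
  have e2 : -(m * log s) = log (s⁻¹ ^ m) := by
    rw [Real.log_rpow (inv_pos.2 hs), Real.log_inv]; ring
  have b1 : m * log s ≤ -log t + t * s ^ m := by
    have := log_le_sub_one_of_pos (mul_pos ht h1)
    rw [Real.log_mul ht.ne' h1.ne'] at this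
    linarith
  have b2 : -(m * log s) ≤ -log t + t * s⁻¹ ^ m := by
    have := log_le_sub_one_of_pos (mul_pos ht h2)
    rw [Real.log_mul ht.ne' h2.ne'] at this
    linarith
  have h3 : m * |log (s ^ 2)| ≤ 2 * (-log t + t * (s ^ m + s⁻¹ ^ m)) := by
    rw [Real.log_pow, abs_mul]
    push_cast
    rw [abs_two]
    have h5 : m * |log s| ≤ -log t + t * (s ^ m + s⁻¹ ^ m) := by
      rcases abs_cases (log s) with h | h <;> rw [h.1] <;> nlinarith [mul_pos ht h1, mul_pos ht h2]
    linarith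
  rw [div_mul_eq_mul_div, le_div_iff₀ hm]
  linarith

variable {M : ENNReal} {o : ℂ} {R : ℝ} {u : ℂ → ℂ} {F : ℂ → ℂ × ℂ} {un : ℕ → ℂ → ℂ}
  {Fn : ℕ → ℂ → ℂ × ℂ}

theorem sqrt_nsq_le (x : ℂ × ℂ) : √(nsq x) ≤ 2 * ‖x‖ := by
  rw [Real.sqrt_le_left (by positivity)]
  nlinarith [nsq_le x, norm_nonneg x]

theorem norm_le_sqrt_nsq (x : ℂ × ℂ) : ‖x‖ ≤ √(nsq x) :=
  Real.le_sqrt_of_sq_le (sq_norm_le_nsq x)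

theorem Approx.lpBdd_sqrt (hM : 4 ≤ M) (h : Approx M o R u F un Fn) :
    LpBdd M⁻¹ (vol (ball o R)) (fun n z => √(nsq (Fn n z))) ∧
    LpBdd M⁻¹ (vol (ball o R)) (fun n z => (√(nsq (Fn n z)))⁻¹) := by
  have hm : ∀ n, Measurable fun z => √(nsq (Fn n z)) := fun n =>
    (Real.continuous_sqrt.comp (continuous_nsq.comp (h.contDiff_F n).continuous)).measurable
  constructor
  · refine ((h.lpTo_F.bdd ((inv_le_quarter hM).trans (by simp))).mono_measure
      restrict_le).of_norm_le (fun n => (hm n).aestronglyMeasurable) (c := 2)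
      fun n => ae_of_all _ fun z => ?_
    rw [norm_of_nonneg (by positivity)]
    exact sqrt_nsq_le _
  · refine h.inv_bdd.of_norm_le (fun n => (hm n).inv.aestronglyMeasurable) (c := 1)
      fun n => (ae_restrict_iff' measurableSet_ball).2 (ae_of_all _ fun z hz => ?_)
    have := norm_pos_iff.2 (h.ne_zero n z hz)
    rw [norm_of_nonneg (by positivity), norm_inv, one_mul, norm_real, norm_norm]
    gcongr
    exact norm_le_sqrt_nsq _

/-- The second fundamental forms of approximations are uniformly small near a point. -/
theorem exists_sff_le : ∃ K₀ : ℝ, 0 < K₀ ∧ ∀ {M : ENNReal} {o : ℂ} {R : ℝ} {u : ℂ → ℂ}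
    {F : ℂ → ℂ × ℂ} {un : ℕ → ℂ → ℂ} {Fn : ℕ → ℂ → ℂ × ℂ}, 4 ≤ M → M < ⊤ → 0 < R →
    Approx M o R u F un Fn → ∃ R' > 0, R' ≤ R ∧ ∀ n,
      eLpNorm (sff (Fn n)) 2 (vol (ball o R')) ^ 2
        ≤ eLpNorm (un n) 2 volume ^ 2 + ofReal (K₀ / M.toReal) := by
  obtain ⟨K, hK, hcut⟩ := exists_logCutoff
  refine ⟨K * (4 * π + 2), by positivity, fun {M o R u F un Fn} hM hMt hR h => ?_⟩
  have hM0 : M ≠ 0 := (lt_of_lt_of_le (by simp) hM).ne'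
  set m := M.toReal with hm
  have hm0 : 0 < m := toReal_pos hM0 hMt.ne
  obtain ⟨C₁, hC₁⟩ := ((h.lpBdd_sqrt hM).1).integral_rpow_le hM0 hMt.ne
  obtain ⟨C₂, hC₂⟩ := ((h.lpBdd_sqrt hM).2).integral_rpow_le hM0 hMt.ne
  have hC₁0 : 0 ≤ C₁ := (integral_nonneg fun z => by positivity).trans (hC₁ 0).2
  have hC₂0 : 0 ≤ C₂ := (integral_nonneg fun z => by positivity).trans (hC₂ 0).2
  set L : ℝ := 1 + (C₁ + C₂) + 2 * |log R| with hL
  have hLC : C₁ + C₂ ≤ L := by rw [hL]; linarith [abs_nonneg (log R)]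
  have hL1 : 1 ≤ L := by rw [hL]; linarith [abs_nonneg (log R)]
  have hL0 : 0 < L := by linarith
  have hexp : exp (-L / 2) < R := by
    rw [← Real.lt_log_iff_exp_lt hR]
    have := neg_abs_le (log R)
    rw [hL]; linarith
  obtain ⟨ρ, hρ, hρc, hρs, hρ1, hρ0, hρK⟩ := hcut o L hL0
  have hexp' : exp (-L) ≤ exp (-L / 2) := Real.exp_le_exp.2 (by linarith)
  have hS : tsupport ρ ⊆ ball o R := hρs.trans (closedBall_subset_ball hexp)
  refine ⟨exp (-L), exp_pos _, hexp'.trans hexp.le, fun n => ?_⟩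
  obtain ⟨i1, i2, hle⟩ := degree_le (c := 0) isOpen_ball (h.contDiff_F n)
    (fun z hz => by rw [zero_add]; exact nsq_pos (h.ne_zero n z hz)) hρ hρc hS
  have hρz : ∀ z, z ∉ ball o R → ρ z = 0 := fun z hz =>
    off_tsupport fun h => hz (hS h)
  have hcurv : ∀ (X : ℂ → ℂ × ℂ) z, 0 ≤ curv 0 (X z) (Fn n z) * ρ z := fun X z => by
    by_cases hz : z ∈ ball o R
    · rw [curv_zero_eq (h.ne_zero n z hz)]
      exact mul_nonneg (by positivity) (hρ0 z).1
    · rw [hρz z hz, mul_zero]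
  have hu2 : MemLp (un n) 2 := by simpa using h.lpTo_u.memLp n
  have hu2i : Integrable fun z => ‖un n z‖ ^ 2 := by
    have : MemLp (un n) (2 : ℕ) := hu2
    exact this.integrable_norm_pow (by simp)
  have hherm : ∀ z ∈ ball o R, herm (delBarV (Fn n) z) (Fn n z) = 0 := fun z hz => by
    rw [h.delBar_F n z hz, herm_smul_left, herm_J_self, mul_zero]
  have b1 : ∫ z, curv 0 (delBarV (Fn n) z) (Fn n z) * ρ z ≤ ∫ z, ‖un n z‖ ^ 2 := by
    refine integral_mono i2 hu2i fun z => ?_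
    by_cases hz : z ∈ ball o R
    · have hp := nsq_pos (h.ne_zero n z hz)
      have h1 : curv 0 (delBarV (Fn n) z) (Fn n z) = ‖un n z‖ ^ 2 := by
        rw [curv, hherm z hz, h.delBar_F n z hz, nsq_smul, nsq_J, zero_add]
        field_simp
        simp
      simp only [h1]
      nlinarith [(hρ0 z).2, sq_nonneg ‖un n z‖]
    · simp only [hρz z hz, mul_zero]; positivity
  have b2 : ∀ g : ℂ → ℂ, (∀ z, z ∉ ball o R → g z = 0) →
      ∫ z, ‖herm (delBarV (Fn n) z) (Fn n z) / ((0 + nsq (Fn n z) : ℝ) : ℂ)‖ * ‖g z‖ = 0 := by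
    intro g hg
    refine integral_eq_zero_of_ae (ae_of_all _ fun z => ?_)
    by_cases hz : z ∈ ball o R
    · simp [hherm z hz]
    · simp [hg z hz]
  have ht0 : ∀ {z}, z ∈ tsupport (fun w => (ρ w : ℂ)) → z ∈ ball o R := fun hz =>
    hS (tsupport_ofReal (ρ := ρ) ▸ hz)
  rw [b2 _ fun z hz => off_tsupport fun h1 =>
      hz (ht0 (tsupport_delBar_subset h1)),
    b2 _ fun z hz => off_tsupport fun h1 =>
      hz (ht0 (tsupport_del_subset h1)), add_zero, add_zero] at hle
  obtain ⟨iA, hA⟩ := integral_annulusWeight_le o hL0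
  set G : ℂ → ℝ := (ball o R).indicator fun z =>
    ‖√(nsq (Fn n z))‖ ^ m + ‖(√(nsq (Fn n z)))⁻¹‖ ^ m with hG
  have iG : Integrable G := (integrable_indicator_iff measurableSet_ball).2 ((hC₁ n).1.add (hC₂ n).1)
  have hGi : ∫ z, G z ≤ C₁ + C₂ := by
    rw [hG, integral_indicator measurableSet_ball, integral_add (hC₁ n).1 (hC₂ n).1]
    exact add_le_add (hC₁ n).2 (hC₂ n).2
  have hG0 : ∀ z, 0 ≤ G z := fun z => Set.indicator_nonneg (fun _ _ => by positivity) _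
  have b3 : ∫ z, |log (0 + nsq (Fn n z))| * ‖del (delBar fun w => (ρ w : ℂ)) z‖
      ≤ K * (4 * π + 2) / m := by
    calc ∫ z, |log (0 + nsq (Fn n z))| * ‖del (delBar fun w => (ρ w : ℂ)) z‖
        ≤ ∫ z, (2 / m * (K / L ^ 2)) * (2 * L * annulusWeight o L z + G z) := by
          refine integral_mono_of_nonneg (ae_of_all _ fun z => by positivity)
            (((iA.const_mul (2 * L)).add iG).const_mul _) (ae_of_all _ fun z => ?_)
          refine (mul_le_mul_of_nonneg_left (hρK z) (abs_nonneg _)).trans ?_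
          by_cases hz : ‖z - o‖ ∈ Icc (exp (-L)) (exp (-L / 2))
          · have hzb : z ∈ ball o R := mem_ball_iff_norm.2 (hz.2.trans_lt hexp)
            have hp : 0 < ‖z - o‖ := (exp_pos _).trans_le hz.1
            have hs : 0 < √(nsq (Fn n z)) := Real.sqrt_pos.2 (nsq_pos (h.ne_zero n z hzb))
            have h1 := abs_log_sq_le hs (t := ‖z - o‖ ^ 2) (by positivity) hm0
            rw [Real.sq_sqrt (nsq_nonneg _)] at h1
            have h2 : -log (‖z - o‖ ^ 2) ≤ 2 * L := by
              rw [Real.log_pow]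
              have := (Real.le_log_iff_exp_le hp).2 hz.1
              push_cast
              linarith
            have hGz : G z = √(nsq (Fn n z)) ^ m + (√(nsq (Fn n z)))⁻¹ ^ m := by
              rw [hG, indicator_of_mem hzb, norm_of_nonneg hs.le,
                norm_of_nonneg (inv_nonneg.2 hs.le)]
            rw [← hGz] at h1
            have hAz : annulusWeight o L z = (‖z - o‖ ^ 2)⁻¹ :=
              indicator_of_mem (a := z) (by exact hz) _
            rw [zero_add, hAz]
            calc _ ≤ 2 / m * (2 * L + ‖z - o‖ ^ 2 * G z) * (K / L ^ 2 * (‖z - o‖ ^ 2)⁻¹) := by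
                  gcongr
                  exact h1.trans (by gcongr)
              _ = _ := by
                  simp only [hAz]
                  field_simp
          · have hAz : annulusWeight o L z = 0 :=
              indicator_of_notMem (a := z) (by exact hz) _
            simp only [hAz, mul_zero, zero_add]
            have := hG0 z
            positivity
      _ = (2 / m * (K / L ^ 2)) * (2 * L * (∫ z, annulusWeight o L z) + ∫ z, G z) := by
          rw [integral_const_mul, integral_add (iA.const_mul (2 * L)) iG, integral_const_mul]
      _ ≤ (2 / m * (K / L ^ 2)) * (2 * L * (π * L) + L ^ 2) := by
          gcongr
          nlinarith
      _ = _ := by field_simp; ring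
  have h1 := eLpNorm_two_sq_restrict_le (B := ball o (exp (-L))) measurableSet_ball
    (f := sff (Fn n)) (hcurv _) (fun z hz => hρ1 z hz) (fun z hz => ?_) i1
  · refine h1.trans ((ofReal_le_ofReal (hle.trans (add_le_add b1 b3))).trans ?_)
    rw [ENNReal.ofReal_add (integral_nonneg fun z => by positivity) (by positivity),
      integral_sq_norm_eq hu2]
  · rw [curv_zero_eq (h.ne_zero n z (ball_subset_ball (hexp'.trans hexp.le) hz))]
    rfl

end SecondFundamentalForm

/-! ### The dual frame -/

section DualFrame

/-- The function `Y` with `⟨Y, F⟩ = conj Z₂` and `⟨Y, J F⟩ = Z₁`. -/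
def dualFrame (F Z : ℂ → ℂ × ℂ) (z : ℂ) : ℂ × ℂ :=
  ((nsq (F z) : ℂ))⁻¹ • (conj (Z z).2 • F z + (Z z).1 • J (F z))

/-- The covariant derivative of `Z`. -/
def covDer (F Z : ℂ → ℂ × ℂ) (z : ℂ) : ℂ × ℂ :=
  delV Z z - conn F z • Z z - sff F z • J (Z z)

variable {S : Set ℂ} {u : ℂ → ℂ} {F Z k : ℂ → ℂ × ℂ} {z : ℂ}

theorem herm_dualFrame (h : F z ≠ 0) : herm (dualFrame F Z z) (F z) = conj (Z z).2 := by
  have h0 : (nsq (F z) : ℂ) ≠ 0 := by exact_mod_cast (nsq_pos h).ne'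
  rw [dualFrame, herm_smul_left, herm_add_left, herm_smul_left, herm_smul_left, herm_J_self,
    herm_self, mul_zero, add_zero]
  field_simp

theorem herm_dualFrame_J (h : F z ≠ 0) : herm (dualFrame F Z z) (J (F z)) = (Z z).1 := by
  have h0 : (nsq (F z) : ℂ) ≠ 0 := by exact_mod_cast (nsq_pos h).ne'
  rw [dualFrame, herm_smul_left, herm_add_left, herm_smul_left, herm_smul_left, herm_self_J,
    herm_self, nsq_J, mul_zero, zero_add]
  field_simp

theorem contDiffAt_nsq {n : WithTop ℕ∞} (hF : ContDiffAt ℝ n F z) :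
    ContDiffAt ℝ n (fun w => (nsq (F w) : ℂ)) z := by
  have := contDiffAt_herm hF hF
  simpa only [herm_self] using this

theorem contDiffAt_J {n : WithTop ℕ∞} (hF : ContDiffAt ℝ n F z) :
    ContDiffAt ℝ n (fun w => J (F w)) z := J.contDiff.contDiffAt.comp z hF

theorem contDiffAt_dualFrame (hF : ContDiffAt ℝ ∞ F z) (hZ : ContDiffAt ℝ ∞ Z z) (h : F z ≠ 0) :
    ContDiffAt ℝ ∞ (dualFrame F Z) z := by
  have h0 : (nsq (F z) : ℂ) ≠ 0 := by exact_mod_cast (nsq_pos h).ne'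
  exact ((contDiffAt_nsq hF).inv h0).smul
    (((contDiffAt_conj hZ.snd).smul hF).add (hZ.fst.smul (contDiffAt_J hF)))

theorem contDiffAt_conn (hF : ContDiffAt ℝ ∞ F z) (h : F z ≠ 0) : ContDiffAt ℝ ∞ (conn F) z := by
  have h0 : (nsq (F z) : ℂ) ≠ 0 := by exact_mod_cast (nsq_pos h).ne'
  have h1 := (contDiffAt_herm (contDiffAt_delV hF infty_add_one_le) hF).mul
    ((contDiffAt_nsq hF).inv h0)
  exact h1.congr_of_eventuallyEq (.of_forall fun w => by
    simp only [conn, div_eq_mul_inv]; rfl)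

theorem contDiffAt_sff (hF : ContDiffAt ℝ ∞ F z) (h : F z ≠ 0) : ContDiffAt ℝ ∞ (sff F) z := by
  have h0 : (nsq (F z) : ℂ) ≠ 0 := by exact_mod_cast (nsq_pos h).ne'
  have h1 := (contDiffAt_herm (contDiffAt_delV hF infty_add_one_le) (contDiffAt_J hF)).mul
    ((contDiffAt_nsq hF).inv h0)
  exact h1.congr_of_eventuallyEq (.of_forall fun w => by
    simp only [sff, div_eq_mul_inv]; rfl)

theorem contDiffAt_covDer (hF : ContDiffAt ℝ ∞ F z) (hZ : ContDiffAt ℝ ∞ Z z) (h : F z ≠ 0) :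
    ContDiffAt ℝ ∞ (covDer F Z) z :=
  ((contDiffAt_delV hZ infty_add_one_le).sub ((contDiffAt_conn hF h).smul hZ)).sub
    ((contDiffAt_sff hF h).smul (contDiffAt_J hZ))

theorem delV_eq_conn_sff (h : F z ≠ 0) :
    delV F z = conn F z • F z + sff F z • J (F z) := by
  have h0 : (nsq (F z) : ℂ) ≠ 0 := by exact_mod_cast (nsq_pos h).ne'
  have h1 := nsq_smul_eq (F z) (delV F z)
  rw [conn, sff, div_eq_inv_mul, div_eq_inv_mul, mul_smul, mul_smul, ← smul_add, ← h1,
    inv_smul_smul₀ h0]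

/-- `F` is a spinor without zeros with `∂̄F = u J F` on `S`, and `∂̄Z = k + u J Z` on `S`. -/
structure SpinorPair (S : Set ℂ) (u : ℂ → ℂ) (F k Z : ℂ → ℂ × ℂ) : Prop where
  isOpen : IsOpen S
  contDiff_F : ContDiff ℝ ∞ F
  ne_zero : ∀ z ∈ S, F z ≠ 0
  delBar_F : ∀ z ∈ S, delBarV F z = u z • J (F z)
  contDiff_Z : ContDiff ℝ ∞ Z
  delBar_Z : ∀ z ∈ S, delBarV Z z = k z + u z • J (Z z)

theorem herm_delV_dualFrame (h : SpinorPair S u F k Z) (hz : z ∈ S) : herm (delV (dualFrame F Z) z) (F z) = conj (k z).2 := by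
  obtain ⟨hS, hF, hF0, hFe, hZ, hZe⟩ := id h
  have hY := (contDiffAt_dualFrame hF.contDiffAt hZ.contDiffAt (hF0 z hz)).differentiableAt
    (by simp)
  have hev : (fun w => herm (dualFrame F Z w) (F w)) =ᶠ[nhds z] fun w => conj (Z w).2 := by
    filter_upwards [hS.mem_nhds hz] with w hw using herm_dualFrame (hF0 w hw)
  have hZd := hZ.differentiable (by simp) z
  have h1 := del_herm hY (hF.differentiable (by simp) z)
  have h2 := congrArg Prod.snd (hZe z hz)
  rw [del_congr hev, del_conj hZd.snd, hFe z hz, herm_smul_right, herm_dualFrame_J (hF0 z hz)] at h1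
  simp only [delBarV, Prod.snd_add, Prod.smul_snd, J_apply, smul_eq_mul] at h2
  rw [h2, map_add, map_mul, Complex.conj_conj] at h1
  linear_combination -h1

theorem herm_delBarV_dualFrame (h : SpinorPair S u F k Z) (hz : z ∈ S) :
    herm (delBarV (dualFrame F Z) z) (J (F z)) = (k z).1 := by
  obtain ⟨hS, hF, hF0, hFe, hZ, hZe⟩ := id h
  have hY := (contDiffAt_dualFrame hF.contDiffAt hZ.contDiffAt (hF0 z hz)).differentiableAt
    (by simp)
  have hev : (fun w => herm (dualFrame F Z w) (J (F w))) =ᶠ[nhds z] fun w => (Z w).1 := by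
    filter_upwards [hS.mem_nhds hz] with w hw using herm_dualFrame_J (hF0 w hw)
  have hFd := hF.differentiable (by simp) z
  have h1 := delBar_herm hY (J.differentiableAt.comp z hFd)
  have h2 := congrArg Prod.fst (hZe z hz)
  change delBar (fun w => herm (dualFrame F Z w) (J (F w))) z = _ +
    herm _ (delV (fun w => J (F w)) z) at h1
  rw [delBar_congr hev, delV_J hFd, hFe z hz, J_smul, J_J, smul_neg, ← neg_smul, herm_smul_right,
    herm_dualFrame (hF0 z hz)] at h1
  simp only [delBarV, Prod.fst_add, Prod.smul_fst, J_apply, smul_eq_mul] at h2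
  rw [h2] at h1
  simp only [map_neg, Complex.conj_conj, Function.comp_apply] at h1
  linear_combination -h1

theorem herm_delV_dualFrame_J (h : SpinorPair S u F k Z) (hz : z ∈ S) :
    herm (delV (dualFrame F Z) z) (J (F z)) = (covDer F Z z).1 := by
  obtain ⟨hS, hF, hF0, hFe, hZ, hZe⟩ := id h
  have hY := (contDiffAt_dualFrame hF.contDiffAt hZ.contDiffAt (hF0 z hz)).differentiableAt
    (by simp)
  have hev : (fun w => herm (dualFrame F Z w) (J (F w))) =ᶠ[nhds z] fun w => (Z w).1 := by
    filter_upwards [hS.mem_nhds hz] with w hw using herm_dualFrame_J (hF0 w hw)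
  have hFd := hF.differentiable (by simp) z
  have h1 := del_herm hY (J.differentiableAt.comp z hFd)
  change del (fun w => herm (dualFrame F Z w) (J (F w))) z = _ +
    herm _ (delBarV (fun w => J (F w)) z) at h1
  rw [del_congr hev, delBarV_J hFd, delV_eq_conn_sff (hF0 z hz), map_add, J_smul, J_smul, J_J,
    smul_neg, ← neg_smul, herm_add_right, herm_smul_right, herm_smul_right,
    herm_dualFrame (hF0 z hz), herm_dualFrame_J (hF0 z hz)] at h1
  simp only [map_neg, Complex.conj_conj, Function.comp_apply] at h1
  have e : (covDer F Z z).1 = del (fun w => (Z w).1) z - conn F z * (Z z).1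
      + sff F z * conj (Z z).2 := by simp [covDer, delV]
  rw [e]
  linear_combination -h1

theorem herm_delBarV_dualFrame_F (h : SpinorPair S u F k Z) (hz : z ∈ S) :
    herm (delBarV (dualFrame F Z) z) (F z) = conj (covDer F Z z).2 := by
  obtain ⟨hS, hF, hF0, hFe, hZ, hZe⟩ := id h
  have hY := (contDiffAt_dualFrame hF.contDiffAt hZ.contDiffAt (hF0 z hz)).differentiableAt
    (by simp)
  have hev : (fun w => herm (dualFrame F Z w) (F w)) =ᶠ[nhds z] fun w => conj (Z w).2 := by
    filter_upwards [hS.mem_nhds hz] with w hw using herm_dualFrame (hF0 w hw)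
  have hZd := hZ.differentiable (by simp) z
  have h1 := delBar_herm hY (hF.differentiable (by simp) z)
  rw [delBar_congr hev, delBar_conj hZd.snd, delV_eq_conn_sff (hF0 z hz), herm_add_right,
    herm_smul_right, herm_smul_right, herm_dualFrame (hF0 z hz),
    herm_dualFrame_J (hF0 z hz)] at h1
  simp only [covDer, delV, Prod.snd_sub, Prod.smul_snd, J_apply, smul_eq_mul, map_sub, map_mul,
    Complex.conj_conj]
  linear_combination -h1

/-- The equation satisfied by the covariant derivative of a solution. -/
theorem delBarV_covDer (hk : ContDiff ℝ ∞ k) (h : SpinorPair S u F k Z) (hz : z ∈ S) :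
    delBarV (covDer F Z) z = delV k z - conn F z • k z + u z • J (k z)
      - sff F z • J (covDer F Z z) := by
  obtain ⟨hS, hF, hF0, hFe, hZ, hZe⟩ := id h
  set Y := dualFrame F Z with hYdef
  have hYc := contDiffAt_dualFrame hF.contDiffAt hZ.contDiffAt (hF0 z hz)
  have hdY : DifferentiableAt ℝ (delV Y) z :=
    (contDiffAt_delV hYc infty_add_one_le).differentiableAt (by simp)
  have hDY : DifferentiableAt ℝ (delBarV Y) z :=
    (contDiffAt_delBarV hYc infty_add_one_le).differentiableAt (by simp)
  have hFd := hF.differentiable (by simp) z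
  have hkd := hk.differentiable (by simp) z
  have hcd : DifferentiableAt ℝ (covDer F Z) z :=
    (contDiffAt_covDer hF.contDiffAt hZ.contDiffAt (hF0 z hz)).differentiableAt (by simp)
  have hcomm : delV (delBarV Y) z = delBarV (delV Y) z :=
    delV_delBarV_comm (hYc.of_le two_le_infty)
  have ev1 : (fun w => herm (delV Y w) (F w)) =ᶠ[nhds z] fun w => conj (k w).2 := by
    filter_upwards [hS.mem_nhds hz] with w hw using
      herm_delV_dualFrame h hw
  have ev2 : (fun w => herm (delBarV Y w) (J (F w))) =ᶠ[nhds z] fun w => (k w).1 := by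
    filter_upwards [hS.mem_nhds hz] with w hw using
      herm_delBarV_dualFrame h hw
  have ev3 : (fun w => herm (delV Y w) (J (F w))) =ᶠ[nhds z] fun w => (covDer F Z w).1 := by
    filter_upwards [hS.mem_nhds hz] with w hw using
      herm_delV_dualFrame_J h hw
  have ev4 : (fun w => herm (delBarV Y w) (F w)) =ᶠ[nhds z] fun w => conj (covDer F Z w).2 := by
    filter_upwards [hS.mem_nhds hz] with w hw using
      herm_delBarV_dualFrame_F h hw
  have hJFd : DifferentiableAt ℝ (fun w => J (F w)) z := J.differentiableAt.comp z hFd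
  have dJF : delV (fun w => J (F w)) z = -(conj (u z)) • F z := by
    rw [delV_J hFd, hFe z hz, J_smul, J_J, smul_neg, neg_smul]
  have DJF : delBarV (fun w => J (F w)) z = conj (conn F z) • J (F z) + -(conj (sff F z)) • F z := by
    rw [delBarV_J hFd, delV_eq_conn_sff (hF0 z hz), map_add, J_smul, J_smul, J_J, smul_neg,
      neg_smul]
  have q1 := delBar_herm hdY hJFd
  have q2 := del_herm hDY hJFd
  have q3 := del_herm hDY hFd
  have q4 := delBar_herm hdY hFd
  rw [delBar_congr ev3, dJF, herm_smul_right, herm_delV_dualFrame h hz] at q1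
  rw [del_congr ev2, DJF, herm_add_right, herm_smul_right, herm_smul_right, herm_delBarV_dualFrame h hz,
    herm_delBarV_dualFrame_F h hz, hcomm] at q2
  rw [del_congr ev4, del_conj hcd.snd, hFe z hz, herm_smul_right, herm_delBarV_dualFrame h hz, hcomm] at q3
  rw [delBar_congr ev1, delBar_conj hkd.snd, delV_eq_conn_sff (hF0 z hz), herm_add_right,
    herm_smul_right, herm_smul_right, herm_delV_dualFrame h hz, herm_delV_dualFrame_J h hz] at q4
  simp only [map_neg, Complex.conj_conj] at q1 q2
  refine Prod.ext ?_ ?_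
  · simp only [delBarV, delV, Prod.fst_sub, Prod.fst_add, Prod.smul_fst, J_apply, smul_eq_mul]
    linear_combination q1 - q2
  · have h5 : conj (delBar (fun w => (covDer F Z w).2) z) = conj (del (fun w => (k w).2) z
        - conn F z * (k z).2 + u z * conj (k z).1 - sff F z * conj (covDer F Z z).1) := by
      simp only [map_sub, map_add, map_mul, Complex.conj_conj]
      linear_combination q3 - q4
    simpa only [delBarV, delV, Prod.snd_sub, Prod.snd_add, Prod.smul_snd, J_apply, smul_eq_mul]
      using star_injective h5

end DualFrame

section CovariantEstimate

theorem LpBdd.of_norm_le_mul {E₁ E₂ E₃ : Type*} [NormedAddCommGroup E₁] [NormedAddCommGroup E₂]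
    [NormedAddCommGroup E₃] {θ₁ θ₂ : ENNReal} {μ : Measure ℂ} {f : ℕ → ℂ → E₁} {g : ℕ → ℂ → E₂}
    {h : ℕ → ℂ → E₃} (hf : LpBdd θ₁ μ f) (hg : LpBdd θ₂ μ g)
    (hh : ∀ n, AEStronglyMeasurable (h n) μ) {c : ℝ}
    (hle : ∀ n, ∀ᵐ z ∂μ, ‖h n z‖ ≤ c * (‖f n z‖ * ‖g n z‖)) : LpBdd (θ₁ + θ₂) μ h :=
  (hf.norm.mul hg.norm).of_norm_le hh fun n => by
    filter_upwards [hle n] with z hz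
    simpa using hz

theorem LpBdd.of_norm_le_add {E₁ E₂ E₃ : Type*} [NormedAddCommGroup E₁] [NormedAddCommGroup E₂]
    [NormedAddCommGroup E₃] {θ : ENNReal} (hθ : θ ≤ 1) {μ : Measure ℂ} {f : ℕ → ℂ → E₁}
    {g : ℕ → ℂ → E₂} {h : ℕ → ℂ → E₃} (hf : LpBdd θ μ f) (hg : LpBdd θ μ g)
    (hh : ∀ n, AEStronglyMeasurable (h n) μ) {c : ℝ}
    (hle : ∀ n, ∀ᵐ z ∂μ, ‖h n z‖ ≤ c * (‖f n z‖ + ‖g n z‖)) : LpBdd θ μ h :=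
  (hf.norm.add hθ hg.norm).of_norm_le hh fun n => by
    filter_upwards [hle n] with z hz
    refine hz.trans_eq ?_
    rw [← Complex.ofReal_add, norm_real, norm_of_nonneg (by positivity)]

theorem cauchyT_delBarV {X : ℂ → ℂ × ℂ} (hX : ContDiff ℝ 1 X) (hc : HasCompactSupport X)
    (hDc : Continuous (delBarV X)) (hD : HasCompactSupport (delBarV X)) :
    cauchyT (delBarV X) = X := by
  ext1 z
  refine Prod.ext ?_ ?_
  · rw [fst_cauchyT_apply hDc hD]
    exact congrFun (cauchyT_delBar hX.fst (hc.comp_left (g := Prod.fst) rfl)) z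
  · rw [snd_cauchyT_apply hDc hD]
    exact congrFun (cauchyT_delBar hX.snd (hc.comp_left (g := Prod.snd) rfl)) z

variable {M σ : ENNReal} {o : ℂ} {r R : ℝ} {u : ℂ → ℂ} {F k : ℂ → ℂ × ℂ} {un : ℕ → ℂ → ℂ}
  {Fn Zn : ℕ → ℂ → ℂ × ℂ}

/-- Solutions of `∂̄Z = k + u J Z` have derivatives that are almost square integrable. -/
theorem lpBdd_delV (hM : 4 ≤ M) (hr : 0 < r) (hrR : r < R) (hk : Continuous k)
    (hkc : HasCompactSupport k) (hu : LpBdd 2⁻¹ volume un) (hZ : ∀ n, ContDiff ℝ ∞ (Zn n))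
    (hZb : LpBdd M⁻¹ (vol (ball o R)) Zn)
    (he : ∀ n, ∀ z ∈ ball o R, delBarV (Zn n) z = k z + un n z • J (Zn n z)) :
    LpBdd (2⁻¹ + (M⁻¹ + M⁻¹)) (vol (ball o r)) fun n => delV (Zn n) := by
  have hM2 : M⁻¹ + M⁻¹ ≤ 2⁻¹ := inv_add_inv_le_half hM
  have hZr := hZb.mono_measure (ν := vol (ball o r))
    (Measure.restrict_mono_set _ (ball_subset_ball hrR.le))
  have h1 := lpBdd_delV_div hr hrR hk hkc hu hZ (hZb.mono ((self_le_add_right _ _).trans hM2)) he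
  have hZ2 : LpBdd (M⁻¹ + M⁻¹) (vol (ball o r))
      fun n z => ‖Zn n z‖ * ‖Zn n z‖ :=
    hZr.of_norm_le_mul hZr (fun n => ((hZ n).continuous.norm.mul
      (hZ n).continuous.norm).aestronglyMeasurable) (c := 1) fun n => ae_of_all _ fun z => by simp
  have hc1 : LpBdd (M⁻¹ + M⁻¹) (vol (ball o r)) fun (_ : ℕ) (_ : ℂ) => (1 : ℝ) :=
    LpBdd.of_memLp (memLp_const 1)
  have h2 : LpBdd (M⁻¹ + M⁻¹) (vol (ball o r)) fun n z => 1 + nsq (Zn n z) := by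
    refine LpBdd.of_norm_le_add (hM2.trans (by simp)) hc1 hZ2 (fun n => (continuous_const.add
      (continuous_nsq.comp (hZ n).continuous)).aestronglyMeasurable) (c := 2)
      fun n => ae_of_all _ fun z => ?_
    have := nsq_nonneg (Zn n z)
    have := nsq_le (Zn n z)
    rw [norm_of_nonneg (by positivity), norm_one, norm_of_nonneg (by positivity)]
    nlinarith
  refine h1.of_norm_le_mul h2 (fun n => (contDiff_delV (hZ n)).continuous.aestronglyMeasurable)
    (c := 1) fun n => ae_of_all _ fun z => ?_
  have hp : 0 < 1 + nsq (Zn n z) := by linarith [nsq_nonneg (Zn n z)]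
  rw [norm_of_nonneg (by positivity), norm_of_nonneg hp.le, one_mul,
    div_mul_cancel₀ _ hp.ne']

theorem norm_div_nsq_le {F : ℂ × ℂ} (hF : F ≠ 0) : ‖F‖ / nsq F ≤ ‖F‖⁻¹ := by
  have h1 := norm_pos_iff.2 hF
  rw [inv_eq_one_div, div_le_div_iff₀ (nsq_pos hF) h1]
  nlinarith [sq_norm_le_nsq F]

theorem norm_conn_le {F : ℂ → ℂ × ℂ} {z : ℂ} (hF : F z ≠ 0) :
    ‖conn F z‖ ≤ 2 * (‖delV F z‖ * ‖((‖F z‖ : ℂ))⁻¹‖) ∧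
    ‖sff F z‖ ≤ 2 * (‖delV F z‖ * ‖((‖F z‖ : ℂ))⁻¹‖) := by
  have hp := nsq_pos hF
  have h1 := norm_div_nsq_le hF
  have h2 : ∀ x : ℂ × ℂ, ‖x‖ = ‖F z‖ → ‖herm (delV F z) x / (nsq (F z) : ℂ)‖
      ≤ 2 * (‖delV F z‖ * ‖((‖F z‖ : ℂ))⁻¹‖) := fun x hx => by
    rw [norm_div, norm_real, norm_of_nonneg hp.le, norm_inv, norm_real,
      norm_norm]
    calc _ ≤ 2 * (‖delV F z‖ * ‖x‖) / nsq (F z) := by gcongr; exact norm_herm_le _ _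
      _ = 2 * (‖delV F z‖ * (‖F z‖ / nsq (F z))) := by rw [hx]; ring
      _ ≤ _ := by gcongr
  exact ⟨h2 _ rfl, h2 _ (norm_J _)⟩

theorem norm_le_of_herm {F : ℂ × ℂ} (hF : F ≠ 0) (x : ℂ × ℂ) :
    ‖x‖ ≤ 1 * ((‖herm x F‖ + ‖herm x (J F)‖) * ‖((‖F‖ : ℂ))⁻¹‖) := by
  have hp := nsq_pos hF
  have h0 : (nsq F : ℂ) ≠ 0 := by exact_mod_cast hp.ne'
  have h1 : x = (nsq F : ℂ)⁻¹ • (herm x F • F + herm x (J F) • J F) := by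
    rw [← nsq_smul_eq, inv_smul_smul₀ h0]
  have h2 : ‖herm x F • F + herm x (J F) • J F‖ ≤ (‖herm x F‖ + ‖herm x (J F)‖) * ‖F‖ := by
    refine (norm_add_le _ _).trans_eq ?_
    rw [norm_smul, norm_smul, norm_J]; ring
  conv_lhs => rw [h1]
  rw [norm_smul, norm_inv, norm_real, norm_of_nonneg hp.le, norm_inv,
    norm_real, norm_norm, one_mul]
  calc _ ≤ (nsq F)⁻¹ * ((‖herm x F‖ + ‖herm x (J F)‖) * ‖F‖) := by gcongr
    _ = (‖herm x F‖ + ‖herm x (J F)‖) * (‖F‖ / nsq F) := by ring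
    _ ≤ _ := by gcongr; exact norm_div_nsq_le hF

theorem Approx.spinorPair (h : Approx M o R u F un Fn) (hZ : ∀ n, ContDiff ℝ ∞ (Zn n))
    (he : ∀ n z, delBarV (Zn n) z = k z + un n z • J (Zn n z)) (n : ℕ) :
    SpinorPair (ball o R) (un n) (Fn n) k (Zn n) :=
  ⟨isOpen_ball, h.contDiff_F n, h.ne_zero n, h.delBar_F n, hZ n, fun z _ => he n z⟩

/-- A cut off covariant derivative is controlled by its equation. -/
theorem eLpNorm_covDer_le (hσ0 : σ ≠ 0) (hσ : σ < 2⁻¹) {S : Set ℂ}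
    {ρ : ℂ → ℝ} (hρ : ContDiff ℝ ∞ ρ) (hρc : HasCompactSupport ρ)
    (hS : tsupport ρ ⊆ S) {F Z : ℂ → ℂ × ℂ}
    (h : SpinorPair S u F k Z) (hk : ContDiff ℝ ∞ k)
    (hb : SmallPot σ⁻¹ (S.indicator (sff F))) (hb2 : MemLp (S.indicator (sff F)) 2) :
    eLpNorm (fun z => (ρ z : ℂ) • covDer F Z z) σ⁻¹ volume ≤ 2 * (sobConst σ⁻¹ *
      eLpNorm (fun z => delBar (fun w => (ρ w : ℂ)) z • covDer F Z z + (ρ z : ℂ) •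
        (delV k z - conn F z • k z + u z • J (k z))) (sobExp σ⁻¹) volume) := by
  have hr2 : 2 < σ⁻¹ := by rwa [ENNReal.lt_inv_iff_lt_inv]
  have hrt : σ⁻¹ < ⊤ := by simpa [lt_top_iff_ne_top] using hσ0
  have hρC := contDiff_ofReal hρ
  set X : ℂ → ℂ × ℂ := fun z => (ρ z : ℂ) • covDer F Z z with hX
  have hz0 : ∀ z, z ∉ tsupport ρ → (fun w => (ρ w : ℂ)) =ᶠ[nhds z] fun _ => 0 := fun z hz => by
    filter_upwards [notMem_tsupport_iff_eventuallyEq.1 hz] with w hw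
    simp [hw]
  have hD : ∀ z, ContDiffAt ℝ ∞ X z ∧ delBarV X z =
      (delBar (fun w => (ρ w : ℂ)) z • covDer F Z z + (ρ z : ℂ) •
        (delV k z - conn F z • k z + u z • J (k z))) + (-(S.indicator (sff F) z)) • J (X z) := by
    intro z
    by_cases hz : z ∈ tsupport ρ
    · have hc := contDiffAt_covDer h.contDiff_F.contDiffAt h.contDiff_Z.contDiffAt
        (h.ne_zero z (hS hz))
      refine ⟨hρC.contDiffAt.smul hc, ?_⟩
      rw [hX, delBarV_smul (hρC.differentiable (by simp) z) (hc.differentiableAt (by simp)),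
        delBarV_covDer hk h (hS hz), indicator_of_mem (hS hz), J_smul, conj_ofReal]
      module
    · have h1 : X =ᶠ[nhds z] fun _ => 0 := by
        filter_upwards [hz0 z hz] with w hw
        simp only [hX, hw, zero_smul]
      refine ⟨contDiffAt_const.congr_of_eventuallyEq h1, ?_⟩
      have h2 : delBarV X z = 0 := by
        have e1 : (fun w => (X w).1) =ᶠ[nhds z] fun _ => 0 := h1.mono fun w hw => by simp [hw]
        have e2 : (fun w => (X w).2) =ᶠ[nhds z] fun _ => 0 := h1.mono fun w hw => by simp [hw]
        simp only [delBarV, delBar_congr e1, delBar_congr e2, delBar_const]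
        exact Prod.mk_zero_zero
      have h3 : X z = 0 := h1.self_of_nhds
      rw [h2, delBar_congr (hz0 z hz), delBar_const, h3, off_tsupport hz]
      simp
      rfl
  have hXc : HasCompactSupport X := (hasCompactSupport_ofReal hρc).smul_right
  have hXs : ContDiff ℝ ∞ X := contDiff_iff_contDiffAt.2 fun z => (hD z).1
  have hDs := (contDiff_delBarV hXs).continuous
  have hDc : HasCompactSupport (delBarV X) :=
    hXc.mono' fun z hz => by
      by_contra h1
      have h2 := notMem_tsupport_iff_eventuallyEq.1 h1
      have e1 : (fun w => (X w).1) =ᶠ[nhds z] fun _ => 0 := h2.mono fun w hw => by simp [hw]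
      have e2 : (fun w => (X w).2) =ᶠ[nhds z] fun _ => 0 := h2.mono fun w hw => by simp [hw]
      exact hz (by
        simp only [delBarV, delBar_congr e1, delBar_congr e2, delBar_const]
        exact Prod.mk_zero_zero)
  have hm : MemLp (fun z => -(S.indicator (sff F) z)) 2 := hb2.neg
  have hsp : SmallPot σ⁻¹ fun z => -(S.indicator (sff F) z) := by
    have : eLpNorm (fun z => -(S.indicator (sff F) z)) 2 volume
        = eLpNorm (S.indicator (sff F)) 2 volume := eLpNorm_neg _ _ _
    unfold SmallPot at hb ⊢
    rwa [this]
  have hpot := isPot_smul_J hm.1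
  have hXM : MemLp X σ⁻¹ := hXs.continuous.memLp_of_hasCompactSupport hXc
  have hDM : MemLp (delBarV X) (sobExp σ⁻¹) := hDs.memLp_of_hasCompactSupport hDc
  refine hpot.apriori hr2 hrt hm hsp hXM ?_ (ae_of_all _ fun z => ?_)
  · refine (hDM.sub (hpot.memLp hm hXM)).ae_eq (ae_of_all _ fun z => ?_)
    simp only [Pi.sub_apply, (hD z).2]
    exact add_sub_cancel_right _ _
  · rw [← funext fun z => (hD z).2]
    exact (congrFun (cauchyT_delBarV (hXs.of_le one_le_infty) hXc hDs hDc) z).symm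

theorem exists_lpBdd_dualFrame (hM : 4 ≤ M) (hσ : σ < 2⁻¹) (hσM : 4 * M⁻¹ ≤ σ) (hMt : M < ⊤)
    (hr : 0 < r) (hrR : r < R) (h : Approx M o R u F un Fn)
    (hb : ∀ n, SmallPot σ⁻¹ ((ball o R).indicator (sff (Fn n))))
    (hb2 : ∀ n, MemLp ((ball o R).indicator (sff (Fn n))) 2)
    (hk : ContDiff ℝ ∞ k) (hkc : HasCompactSupport k) (hZ : ∀ n, ContDiff ℝ ∞ (Zn n))
    (hZb : LpBdd M⁻¹ volume Zn) (he : ∀ n z, delBarV (Zn n) z = k z + un n z • J (Zn n z)) :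
    LpBdd (σ + σ) (vol (ball o r)) (fun n => dualFrame (Fn n) (Zn n)) ∧
    LpBdd (σ + σ) (vol (ball o r)) (fun n => delV (dualFrame (Fn n) (Zn n))) ∧
    LpBdd (σ + σ) (vol (ball o r))
      fun n => delBarV (dualFrame (Fn n) (Zn n)) := by
  obtain ⟨R₁, hrR₁, hR₁⟩ := exists_between hrR
  obtain ⟨r₁, hr₁, hrR₁'⟩ := exists_between hrR₁
  have hM0 : M⁻¹ ≠ 0 := by simpa using hMt.ne
  have hσ0 : σ ≠ 0 := fun h0 => by
    rw [h0, nonpos_iff_eq_zero, mul_eq_zero] at hσM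
    exact hσM.elim (by norm_num) hM0
  have hσ1 : 2⁻¹ + σ ≤ 1 := by
    rw [← inv_two_add_inv_two]; gcongr
  set μ := M⁻¹ with hμ
  have h4 : μ + μ + (μ + μ) ≤ σ := (by ring : μ + μ + (μ + μ) = 4 * μ).trans_le hσM
  have hμσ : μ ≤ σ := (self_le_add_right μ _).trans ((self_le_add_right _ _).trans h4)
  set B := ball o R₁ with hB
  have hBR : B ⊆ ball o R := ball_subset_ball hR₁.le
  have hFb : LpBdd μ volume Fn := h.lpTo_F.bdd ((inv_le_quarter hM).trans (by simp))
  have hub : LpBdd 2⁻¹ volume un := h.lpTo_u.bdd (by simp)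
  have hsp := h.spinorPair hZ he
  have hcm : ∀ {E : Type} [NormedAddCommGroup E] {f : ℂ → E} {s : ℝ}, s ≤ R →
      (∀ z ∈ ball o R, ContinuousAt f z) →
      AEStronglyMeasurable f (vol (ball o s)) := fun {E _ f s} hs hf =>
    ContinuousOn.aestronglyMeasurable (fun z hz =>
      (hf z (ball_subset_ball hs hz)).continuousWithinAt) measurableSet_ball
  have cF : ∀ n z, ContDiffAt ℝ ∞ (Fn n) z := fun n _ => (h.contDiff_F n).contDiffAt
  have cZ : ∀ n z, ContDiffAt ℝ ∞ (Zn n) z := fun n _ => (hZ n).contDiffAt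
  have cconn : ∀ n, ∀ z ∈ ball o R, ContinuousAt (conn (Fn n)) z := fun n z hz =>
    (contDiffAt_conn (cF n z) (h.ne_zero n z hz)).continuousAt
  have csff : ∀ n, ∀ z ∈ ball o R, ContinuousAt (sff (Fn n)) z := fun n z hz =>
    (contDiffAt_sff (cF n z) (h.ne_zero n z hz)).continuousAt
  have cW : ∀ n, ∀ z ∈ ball o R, ContinuousAt (covDer (Fn n) (Zn n)) z := fun n z hz =>
    (contDiffAt_covDer (cF n z) (cZ n z) (h.ne_zero n z hz)).continuousAt
  have hinv : LpBdd μ (vol B) fun n z => ((‖Fn n z‖ : ℂ))⁻¹ :=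
    h.inv_bdd.mono_measure (Measure.restrict_mono_set _ hBR)
  have hBae : ∀ {p : ℂ → Prop}, (∀ z ∈ ball o R, p z) → ∀ᵐ z ∂(vol B), p z :=
    fun hp => (ae_restrict_iff' measurableSet_ball).2 (ae_of_all _ fun z hz => hp z (hBR hz))
  have hdF := lpBdd_delV hM (hr.trans hrR₁) hR₁ (k := fun _ => (0 : ℂ × ℂ)) continuous_const
    HasCompactSupport.zero hub h.contDiff_F (hFb.mono_measure restrict_le)
    fun n z hz => by rw [h.delBar_F n z hz, zero_add]
  have hdZ := lpBdd_delV (o := o) hM (hr.trans hrR₁) hR₁ hk.continuous hkc hub hZ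
    (hZb.mono_measure restrict_le) fun n z _ => he n z
  have hconn : LpBdd (2⁻¹ + (μ + μ) + μ) (vol B) fun n z => -conn (Fn n) z :=
    hdF.of_norm_le_mul hinv (fun n => (hcm hR₁.le (cconn n)).neg) (c := 2) fun n =>
      hBae fun z hz => by rw [norm_neg]; exact (norm_conn_le (h.ne_zero n z hz)).1
  have hsff : LpBdd (2⁻¹ + (μ + μ) + μ) (vol B) fun n z => -sff (Fn n) z :=
    hdF.of_norm_le_mul hinv (fun n => (hcm hR₁.le (csff n)).neg) (c := 2) fun n =>
      hBae fun z hz => by rw [norm_neg]; exact (norm_conn_le (h.ne_zero n z hz)).2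
  have hτ4 : 2⁻¹ + (μ + μ) + μ + μ ≤ σ + 2⁻¹ := by
    rw [show 2⁻¹ + (μ + μ) + μ + μ = (μ + μ + (μ + μ)) + 2⁻¹ by ring]; gcongr
  have hτ3 : 2⁻¹ + (μ + μ) + μ ≤ σ + 2⁻¹ := (self_le_add_right _ _).trans hτ4
  have hτ2 : 2⁻¹ + (μ + μ) ≤ σ + 2⁻¹ := (self_le_add_right _ _).trans hτ3
  have hτ1 : σ + 2⁻¹ ≤ 1 := by rwa [add_comm]
  have hZB : LpBdd μ (vol B) Zn := hZb.mono_measure restrict_le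
  have hW : LpBdd (σ + 2⁻¹) (vol B) fun n => covDer (Fn n) (Zn n) := by
    have h1 : LpBdd (2⁻¹ + (μ + μ) + μ + μ) (vol B)
        fun n z => (-conn (Fn n) z) • Zn n z :=
      hconn.of_norm_le_mul hZB (fun n => (hconn.meas n).smul (hZB.meas n)) (c := 1)
        fun n => ae_of_all _ fun z => by rw [norm_smul, one_mul]
    have h2 : LpBdd (2⁻¹ + (μ + μ) + μ + μ) (vol B)
        fun n z => (-sff (Fn n) z) • J (Zn n z) :=
      hsff.of_norm_le_mul hZB (fun n => (hsff.meas n).smul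
        (J.continuous.comp_aestronglyMeasurable (hZB.meas n))) (c := 1)
        fun n => ae_of_all _ fun z => by rw [norm_smul, norm_J, one_mul]
    have h3 := (hdZ.mono hτ2).add hτ1 ((h1.mono hτ4).add hτ1 (h2.mono hτ4))
    refine h3.of_norm_le (fun n => hcm hR₁.le (cW n)) (c := 1) fun n => ae_of_all _ fun z => ?_
    rw [one_mul]
    refine le_of_eq (congrArg _ ?_)
    rw [covDer]; module
  obtain ⟨Ck, hCk⟩ := hk.continuous.bounded_above_of_compact_support hkc
  have hf : LpBdd (σ + 2⁻¹) (vol B)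
      fun n z => delV k z - conn (Fn n) z • k z + un n z • J (k z) := by
    have h0 : LpBdd (σ + 2⁻¹) (vol B) fun _ : ℕ => delV k := by
      refine LpBdd.of_memLp (MemLp.mono_measure restrict_le ?_)
      refine (contDiff_delV hk).continuous.memLp_of_hasCompactSupport (hkc.mono' fun z hz => ?_)
      by_contra h1
      have h2 := notMem_tsupport_iff_eventuallyEq.1 h1
      have e1 : (fun w => (k w).1) =ᶠ[nhds z] fun _ => 0 := h2.mono fun w hw => by simp [hw]
      have e2 : (fun w => (k w).2) =ᶠ[nhds z] fun _ => 0 := h2.mono fun w hw => by simp [hw]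
      exact hz (by
        simp only [delV, del_congr e1, del_congr e2, del_const]
        exact Prod.mk_zero_zero)
    have h1 : LpBdd (2⁻¹ + (μ + μ) + μ) (vol B)
        fun n z => (-conn (Fn n) z) • k z :=
      hconn.of_norm_le (fun n => (hconn.meas n).smul hk.continuous.aestronglyMeasurable) (c := Ck)
        fun n => ae_of_all _ fun z => by
          rw [norm_smul, mul_comm]; gcongr; exact hCk z
    have hub' : LpBdd 2⁻¹ (vol B) un := hub.mono_measure restrict_le
    have h2 : LpBdd 2⁻¹ (vol B) fun n z => un n z • J (k z) :=
      hub'.of_norm_le (fun n => (hub'.meas n).smul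
        (J.continuous.comp hk.continuous).aestronglyMeasurable) (c := Ck)
        fun n => ae_of_all _ fun z => by
          rw [norm_smul, norm_J, mul_comm]; gcongr; exact hCk z
    have h3 := (h0.add hτ1 (h1.mono hτ3)).add hτ1
      (h2.mono ((self_le_add_right _ _).trans hτ2))
    refine h3.of_norm_le (fun n => hcm hR₁.le fun z hz => ?_) (c := 1)
      fun n => ae_of_all _ fun z => ?_
    · exact (((contDiff_delV hk).continuous.continuousAt).sub ((cconn n z hz).smul
        hk.continuous.continuousAt)).add ((h.contDiff_u n).continuous.continuousAt.smul
          (J.continuous.comp hk.continuous).continuousAt)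
    · rw [one_mul]
      refine le_of_eq (congrArg _ ?_)
      module
  obtain ⟨ρ, hρ, hρc, hρs, hρ1, hρ0⟩ := exists_cutoff o hr hr₁
  have hρB : tsupport ρ ⊆ B := hρs.trans (closedBall_subset_ball hrR₁')
  have hρC := contDiff_ofReal hρ
  obtain ⟨K₁, hK₁⟩ := (hρC.delBar_infty).continuous.bounded_above_of_compact_support
    (hasCompactSupport_ofReal hρc).delBar
  have hG : LpBdd (σ + 2⁻¹) (vol B) fun n z =>
      delBar (fun w => (ρ w : ℂ)) z • covDer (Fn n) (Zn n) z + (ρ z : ℂ) •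
        (delV k z - conn (Fn n) z • k z + un n z • J (k z)) := by
    refine hW.of_norm_le_add hτ1 hf (fun n => ((hρC.delBar_infty).continuous.aestronglyMeasurable.smul
      (hW.meas n)).add (hρC.continuous.aestronglyMeasurable.smul (hf.meas n)))
      (c := max K₁ 1) fun n => ae_of_all _ fun z => ?_
    refine (norm_add_le _ _).trans ?_
    rw [norm_smul, norm_smul, mul_add, norm_real, norm_of_nonneg (hρ0 z).1]
    gcongr
    · exact (hK₁ z).trans (le_max_left _ _)
    · exact (hρ0 z).2.trans (le_max_right _ _)
  obtain ⟨C, hC, hGb⟩ := hG.bdd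
  have hWr : LpBdd σ (vol (ball o r)) fun n => covDer (Fn n) (Zn n) := by
    refine ⟨fun n => hcm hrR.le (cW n), 2 * (sobConst σ⁻¹ * C),
      ENNReal.mul_ne_top (by simp) (ENNReal.mul_ne_top (sobConst_ne_top _) hC), fun n => ?_⟩
    have h1 := eLpNorm_covDer_le hσ0 hσ hρ hρc (hρB.trans hBR) (hsp n) hk (hb n) (hb2 n)
    have h2 : eLpNorm (covDer (Fn n) (Zn n)) σ⁻¹ (vol (ball o r))
        = eLpNorm (fun z => (ρ z : ℂ) • covDer (Fn n) (Zn n) z) σ⁻¹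
          (vol (ball o r)) :=
      eLpNorm_congr_ae ((ae_restrict_iff' measurableSet_ball).2 (ae_of_all _ fun z hz => by
        simp [hρ1 z (ball_subset_closedBall hz)]))
    rw [h2]
    refine (eLpNorm_mono_measure _ restrict_le).trans (h1.trans ?_)
    gcongr
    refine le_trans (le_of_eq ?_) (hGb n)
    rw [show sobExp σ⁻¹ = (σ + 2⁻¹)⁻¹ by rw [sobExp, inv_inv]]
    refine (eLpNorm_restrict_eq_of_support_subset fun z hz => ?_).symm
    by_contra hzB
    have h3 : z ∉ tsupport (fun w => (ρ w : ℂ)) := fun h4 =>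
      hzB (hρB (tsupport_ofReal (ρ := ρ) ▸ h4))
    refine hz ?_
    have h5 : (ρ z : ℂ) = 0 := off_tsupport (f := fun w => (ρ w : ℂ)) h3
    simp only
    rw [h5, off_tsupport fun h4 => h3 (tsupport_delBar_subset h4), zero_smul,
      zero_smul, add_zero]
  have hinv' : LpBdd μ (vol (ball o r)) fun n z => ((‖Fn n z‖ : ℂ))⁻¹ :=
    h.inv_bdd.mono_measure (Measure.restrict_mono_set _ (ball_subset_ball hrR.le))
  have hrae : ∀ {p : ℂ → Prop}, (∀ z ∈ ball o R, p z) →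
      ∀ᵐ z ∂(vol (ball o r)), p z := fun hp =>
    (ae_restrict_iff' measurableSet_ball).2 (ae_of_all _ fun z hz =>
      hp z (ball_subset_ball hrR.le hz))
  have hkW : LpBdd σ (vol (ball o r))
      fun n z => ‖k z‖ + ‖covDer (Fn n) (Zn n) z‖ := by
    have h0 : LpBdd σ (vol (ball o r)) fun _ : ℕ => k := LpBdd.of_memLp
      ((hk.continuous.memLp_of_hasCompactSupport hkc).mono_measure restrict_le)
    refine h0.of_norm_le_add (hσ.le.trans (by simp)) hWr (fun n => (h0.meas n).norm.add
      (hWr.meas n).norm) (c := 1) fun n => ae_of_all _ fun z => ?_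
    rw [norm_of_nonneg (by positivity), one_mul]
  have cY : ∀ n, ∀ z ∈ ball o R, ContDiffAt ℝ ∞ (dualFrame (Fn n) (Zn n)) z :=
    fun n z hz => contDiffAt_dualFrame (cF n z) (cZ n z) (h.ne_zero n z hz)
  refine ⟨?_, ?_, ?_⟩
  · refine LpBdd.mono ((hZb.mono_measure restrict_le).of_norm_le_mul hinv'
      (fun n => hcm hrR.le fun z hz => (cY n z hz).continuousAt) (c := 2) fun n =>
      hrae fun z hz => ?_) (add_le_add hμσ hμσ)
    refine (norm_le_of_herm (h.ne_zero n z hz) _).trans ?_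
    rw [herm_dualFrame (h.ne_zero n z hz), herm_dualFrame_J (h.ne_zero n z hz), RCLike.norm_conj,
      one_mul, ← mul_assoc]
    gcongr
    linarith [norm_fst_le (Zn n z), norm_snd_le (Zn n z)]
  · refine LpBdd.mono (hkW.of_norm_le_mul hinv' (fun n => hcm hrR.le fun z hz =>
      (contDiffAt_delV (cY n z hz) infty_add_one_le).continuousAt) (c := 1) fun n =>
      hrae fun z hz => ?_) (add_le_add le_rfl hμσ)
    refine (norm_le_of_herm (h.ne_zero n z hz) _).trans ?_
    rw [herm_delV_dualFrame (hsp n) hz, herm_delV_dualFrame_J (hsp n) hz, RCLike.norm_conj,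
      norm_of_nonneg (by positivity : 0 ≤ ‖k z‖ + ‖covDer (Fn n) (Zn n) z‖)]
    gcongr
    · exact norm_snd_le _
    · exact norm_fst_le _
  · refine LpBdd.mono (hkW.of_norm_le_mul hinv' (fun n => hcm hrR.le fun z hz =>
      (contDiffAt_delBarV (cY n z hz) infty_add_one_le).continuousAt) (c := 1) fun n =>
      hrae fun z hz => ?_) (add_le_add le_rfl hμσ)
    refine (norm_le_of_herm (h.ne_zero n z hz) _).trans ?_
    rw [herm_delBarV_dualFrame_F (hsp n) hz, herm_delBarV_dualFrame (hsp n) hz, RCLike.norm_conj,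
      norm_of_nonneg (by positivity : 0 ≤ ‖k z‖ + ‖covDer (Fn n) (Zn n) z‖),
      add_comm ‖(covDer (Fn n) (Zn n) z).2‖]
    gcongr
    · exact norm_fst_le _
    · exact norm_snd_le _

end CovariantEstimate

/-! ### Testing a closed pairing against dual frames -/

section Testing

theorem LpTo.of_norm_le_mul {E₁ E₂ E₃ : Type*} [NormedAddCommGroup E₁] [NormedAddCommGroup E₂]
    [NormedAddCommGroup E₃] {θ₁ θ₂ : ENNReal} {μ : Measure ℂ} {f : ℕ → ℂ → E₁} {f' : ℂ → E₁}
    {g : ℕ → ℂ → E₂} {h : ℕ → ℂ → E₃} {h' : ℂ → E₃} (hf : LpTo θ₁ μ f f') (hg : LpBdd θ₂ μ g)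
    (hh : ∀ n, AEStronglyMeasurable (h n) μ) (hh' : MemLp h' (θ₁ + θ₂)⁻¹ μ) {c : ℝ}
    (hle : ∀ n, ∀ᵐ z ∂μ, ‖h n z - h' z‖ ≤ c * (‖f n z - f' z‖ * ‖g n z‖)) :
    LpTo (θ₁ + θ₂) μ h h' := by
  obtain ⟨C, hC, hb⟩ := hg.norm.bdd
  have hm : ∀ n, AEStronglyMeasurable (fun z => (‖f n z - f' z‖ : ℂ)) μ := fun n =>
    continuous_ofReal.comp_aestronglyMeasurable ((hf.memLp n).1.sub hf.memLp_lim.1).norm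
  have hle' : ∀ n, eLpNorm (fun z => h n z - h' z) (θ₁ + θ₂)⁻¹ μ
      ≤ ofReal c * (eLpNorm (fun z => f n z - f' z) θ₁⁻¹ μ * C) := fun n => by
    have h1 : ∀ᵐ z ∂μ, ‖h n z - h' z‖ ≤ c * ‖(‖f n z - f' z‖ : ℂ) * (‖g n z‖ : ℂ)‖ := by
      filter_upwards [hle n] with z hz
      simpa using hz
    refine (eLpNorm_le_mul_eLpNorm_of_ae_le_mul h1 _).trans ?_
    gcongr
    refine (eLpNorm_mul_inv_le (hm n) (hg.norm.meas n)).trans (mul_le_mul' (le_of_eq ?_) (hb n))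
    refine eLpNorm_congr_norm_ae (ae_of_all _ fun z => by simp)
  refine LpTo.of_le (fun n => ?_) hh' ?_ hle'
  · have h2 : MemLp (fun z => h n z - h' z) (θ₁ + θ₂)⁻¹ μ :=
      ⟨(hh n).sub hh'.1, (hle' n).trans_lt (ENNReal.mul_lt_top ofReal_lt_top
        (ENNReal.mul_lt_top ((hf.memLp n).sub hf.memLp_lim).2 hC.lt_top))⟩
    exact (h2.add hh').ae_eq (ae_of_all _ fun z => by simp)
  · simpa using ENNReal.Tendsto.const_mul (ENNReal.Tendsto.mul_const hf.tendsto (Or.inr hC))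
      (Or.inr (ofReal_ne_top (r := c)))

/-- The `1`-forms `F_i P₁ dz + (J F)_i (-conj P₂) dz̄` are closed on `S`. -/
def ClosedPairing (S : Set ℂ) (F P : ℂ → ℂ × ℂ) : Prop :=
  ∀ η : ℂ → ℂ, ContDiff ℝ ∞ η → HasCompactSupport η → tsupport η ⊆ S →
    (∫ z, ((P z).1 * ((F z).1 * delBar η z) - conj (P z).2 * ((J (F z)).1 * del η z)) = 0) ∧
    ∫ z, ((P z).1 * ((F z).2 * delBar η z) - conj (P z).2 * ((J (F z)).2 * del η z)) = 0

theorem MemLp.mul_norm_le {E₁ E₂ : Type*} [NormedAddCommGroup E₁] [NormedAddCommGroup E₂]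
    {θ₁ θ₂ : ENNReal} {μ : Measure ℂ} [IsFiniteMeasure μ] {f : ℂ → E₁} {g : ℂ → E₂} {h : ℂ → ℂ}
    (hf : MemLp f θ₁⁻¹ μ) (hg : MemLp g θ₂⁻¹ μ) (hθ : θ₁ + θ₂ ≤ 1) (hh : AEStronglyMeasurable h μ)
    {c : ℝ} (hle : ∀ z, ‖h z‖ ≤ c * (‖f z‖ * ‖g z‖)) : Integrable h μ := by
  have h1 := (((LpBdd.of_memLp hf).of_norm_le_mul (LpBdd.of_memLp hg) (h := fun _ => h)
    (fun _ => hh) fun _ => ae_of_all _ hle).mono hθ).memLp 0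
  rwa [inv_one, memLp_one_iff_integrable] at h1

theorem ClosedPairing.integral_herm {o : ℂ} {R : ℝ} {F P X : ℂ → ℂ × ℂ} {μ ν : ENNReal}
    (h : ClosedPairing (ball o R) F P)
    (hF : MemLp F μ⁻¹ (vol (ball o R)))
    (hP : MemLp P ν⁻¹ (vol (ball o R))) (hμν : μ + ν ≤ 1)
    (hX : ContDiff ℝ ∞ X) (hc : HasCompactSupport X) (hs : tsupport X ⊆ ball o R) :
    ∫ z, ((P z).1 * herm (F z) (delV X z) - conj (P z).2 * herm (J (F z)) (delBarV X z)) = 0 := by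
  have key : ∀ {x : ℂ → ℂ}, ContDiff ℝ ∞ x → HasCompactSupport x → tsupport x ⊆ ball o R →
      ContDiff ℝ ∞ (fun z => conj (x z)) ∧ HasCompactSupport (fun z => conj (x z)) ∧
      tsupport (fun z => conj (x z)) ⊆ ball o R ∧
      ∀ (l m : ℂ × ℂ →L[ℝ] ℂ), (∀ v, ‖l v‖ ≤ ‖v‖) → (∀ v, ‖m v‖ ≤ ‖v‖) →
      Integrable fun z => (P z).1 * (l (F z) * delBar (fun w => conj (x w)) z)
        - conj (P z).2 * (m (F z) * del (fun w => conj (x w)) z) := by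
    intro x h1 h2 h3
    have c1 : ContDiff ℝ ∞ (fun z => conj (x z)) := Complex.conjCLE.contDiff.comp h1
    have c2 : HasCompactSupport (fun z => conj (x z)) := h2.comp_left (g := conj) (map_zero _)
    have c3 : tsupport (fun z => conj (x z)) = tsupport x := by
      unfold tsupport; congr 1; ext z; simp
    refine ⟨c1, c2, c3.trans_subset h3, fun l m hl hm => ?_⟩
    have hint : ∀ {a : ℂ → ℂ} (l : ℂ × ℂ →L[ℝ] ℂ), (∀ v, ‖l v‖ ≤ ‖v‖) →
        AEStronglyMeasurable a (vol (ball o R)) → (∀ z, ‖a z‖ ≤ ‖P z‖) →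
        LocallyIntegrableOn (fun z => l (F z) * a z) (ball o R) := fun {a} l hl ha hle =>
      IntegrableOn.locallyIntegrableOn (MemLp.mul_norm_le hF hP hμν
        ((l.continuous.comp_aestronglyMeasurable hF.1).mul ha) (c := 1) fun z => by
          rw [norm_mul, one_mul]; exact mul_le_mul (hl _) (hle z) (norm_nonneg _) (norm_nonneg _))
    have i1 := integrable_mul_of_tsupport_subset (hint l hl hP.1.fst fun z => norm_fst_le _)
      (c1.continuous_delBar one_le_infty) c2.delBar
      (tsupport_delBar_subset.trans (c3.trans_subset h3))
    have i2 := integrable_mul_of_tsupport_subset (hint m hm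
      (continuous_conj.comp_aestronglyMeasurable hP.1.snd) fun z => by
        rw [RCLike.norm_conj]; exact norm_snd_le _)
      (c1.continuous_del one_le_infty) c2.del (tsupport_del_subset.trans (c3.trans_subset h3))
    refine (i1.sub i2).congr (ae_of_all _ fun z => ?_)
    simp only [Pi.sub_apply]; ring
  have ts : ∀ {g : ℂ × ℂ → ℂ}, g 0 = 0 → tsupport (fun z => g (X z)) ⊆ tsupport X := fun {g} hg =>
    closure_mono fun z hz h0 => hz (by simp only [h0, hg])
  obtain ⟨a1, a2, a3, a4⟩ := key hX.fst (hc.comp_left (g := Prod.fst) rfl)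
    ((ts (g := Prod.fst) rfl).trans hs)
  obtain ⟨b1, b2, b3, b4⟩ := key hX.snd (hc.comp_left (g := Prod.snd) rfl)
    ((ts (g := Prod.snd) rfl).trans hs)
  have hl1 : ∀ v : ℂ × ℂ, ‖ContinuousLinearMap.fst ℝ ℂ ℂ v‖ ≤ ‖v‖ := fun v => norm_fst_le v
  have hl2 : ∀ v : ℂ × ℂ, ‖ContinuousLinearMap.snd ℝ ℂ ℂ v‖ ≤ ‖v‖ := fun v => norm_snd_le v
  have e := congrArg₂ (· + ·) (h _ a1 a2 a3).1 (h _ b1 b2 b3).2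
  have i1 := a4 (ContinuousLinearMap.fst ℝ ℂ ℂ) ((ContinuousLinearMap.fst ℝ ℂ ℂ).comp J) hl1
    fun v => (hl1 _).trans_eq (norm_J v)
  have i2 := b4 (ContinuousLinearMap.snd ℝ ℂ ℂ) ((ContinuousLinearMap.snd ℝ ℂ ℂ).comp J) hl2
    fun v => (hl2 _).trans_eq (norm_J v)
  simp only [ContinuousLinearMap.coe_fst', ContinuousLinearMap.coe_snd',
    ContinuousLinearMap.comp_apply] at i1 i2
  simp only [add_zero] at e
  rw [← integral_add i1 i2] at e
  rw [← e]
  refine integral_congr_ae (ae_of_all _ fun z => ?_)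
  have hXd := hX.differentiable (by simp) z
  simp only [delBar_conj hXd.fst, delBar_conj hXd.snd, del_conj hXd.fst, del_conj hXd.snd, herm,
    delV, delBarV]
  ring

end Testing

section Limit

variable {M σ p : ENNReal} {o : ℂ} {r R : ℝ} {u : ℂ → ℂ} {F k P Z : ℂ → ℂ × ℂ} {un : ℕ → ℂ → ℂ}
  {Fn Zn : ℕ → ℂ → ℂ × ℂ}

theorem Approx.exists_solutions (hM : 4 ≤ M) (hMt : M < ⊤) (h : Approx M o R u F un Fn)
    (hk : ContDiff ℝ ∞ k) (hkc : HasCompactSupport k)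
    (hZ : MemLp Z M) (hZe : Z = cauchyT fun z => k z + u z • J (Z z)) :
    ∃ Zn : ℕ → ℂ → ℂ × ℂ, (∀ n, ContDiff ℝ ∞ (Zn n)) ∧ LpTo M⁻¹ volume Zn Z ∧
      ∀ n z, delBarV (Zn n) z = k z + un n z • J (Zn n z) := by
  have hM2 := two_lt_of_four_le hM
  have hun2 : ∀ n, MemLp (un n) 2 := by simpa using h.lpTo_u.memLp
  have hu2 : MemLp u 2 := by simpa using h.lpTo_u.memLp_lim
  have hkM : MemLp k (sobExp M) := hk.continuous.memLp_of_hasCompactSupport hkc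
  choose Zn hZn hZne using fun n =>
    (isPot_smul_J (hun2 n).1).exists_solution hM2 hMt (hun2 n) (h.small_u n) hkM
  have hZs : ∀ n, ContDiff ℝ ∞ (Zn n) := fun n =>
    contDiff_solution hM2 hMt (h.contDiff_u n) (h.hasCompactSupport_u n) (h.small_u n) hk hkc
      (hZn n) (hZne n)
  refine ⟨Zn, hZs, ?_, fun n z => ?_⟩
  · exact IsPot.lpTo hM2 hMt (fun n => isPot_smul_J (hun2 n).1) (isPot_smul_J hu2.1) hun2 hu2
      h.small_u hZn hZ (LpTo.const hkM) (lpTo_smul_J h.lpTo_u hZ)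
      (fun n => (hZne n).eventuallyEq) hZe.eventuallyEq
  · have h1 : ContDiff ℝ 1 fun z => k z + un n z • J (Zn n z) :=
      (hk.add ((h.contDiff_u n).smul (J.contDiff.comp (hZs n)))).of_le one_le_infty
    have h2 : HasCompactSupport fun z => k z + un n z • J (Zn n z) :=
      hkc.add (h.hasCompactSupport_u n).smul_right
    conv_lhs => rw [hZne n]
    rw [delBarV_cauchyT h1 h2]

/-- The first derivatives of a cut off dual frame. -/
theorem cutoff_dualFrame {S : Set ℂ} {un' : ℂ → ℂ} {F' Z' : ℂ → ℂ × ℂ} (h : SpinorPair S un' F' k Z')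
    {κ : ℂ → ℂ} (hκ : ContDiff ℝ ∞ κ) (hκS : tsupport κ ⊆ S) :
    ContDiff ℝ ∞ (fun z => κ z • dualFrame F' Z' z) ∧ ∀ z,
      (delV (fun z => κ z • dualFrame F' Z' z) z = del κ z •
        dualFrame F' Z' z + κ z • delV (dualFrame F' Z') z) ∧
      (delBarV (fun z => κ z • dualFrame F' Z' z) z = delBar κ z •
        dualFrame F' Z' z + κ z • delBarV (dualFrame F' Z') z) := by
  suffices hd : ∀ z, ContDiffAt ℝ ∞ (fun z => κ z • dualFrame F' Z' z) z ∧ _ from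
    ⟨contDiff_iff_contDiffAt.2 fun z => (hd z).1, fun z => (hd z).2⟩
  intro z
  by_cases hz : z ∈ tsupport κ
  · have hc := contDiffAt_dualFrame h.contDiff_F.contDiffAt h.contDiff_Z.contDiffAt
      (h.ne_zero z (hκS hz))
    exact ⟨hκ.contDiffAt.smul hc,
      delV_smul (hκ.differentiable (by simp) z) (hc.differentiableAt (by simp)),
      delBarV_smul (hκ.differentiable (by simp) z) (hc.differentiableAt (by simp))⟩
  · have hz0 : κ =ᶠ[nhds z] fun _ => 0 := by
      filter_upwards [notMem_tsupport_iff_eventuallyEq.1 hz] with w hw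
      simp [hw]
    have e0 : (fun z => κ z • dualFrame F' Z' z) =ᶠ[nhds z] fun _ => 0 :=
      hz0.mono fun w hw => by simp only [hw, zero_smul]
    have e1 : (fun w => (κ w • dualFrame F' Z' w).1) =ᶠ[nhds z] fun _ => 0 :=
      e0.mono fun w hw => by simp only [hw, Prod.fst_zero]
    have e2 : (fun w => (κ w • dualFrame F' Z' w).2) =ᶠ[nhds z] fun _ => 0 :=
      e0.mono fun w hw => by simp only [hw, Prod.snd_zero]
    have h0 : κ z = 0 := hz0.self_of_nhds
    refine ⟨contDiffAt_const.congr_of_eventuallyEq e0, ?_, ?_⟩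
    · rw [del_congr hz0, del_const, h0, zero_smul, zero_smul, add_zero]
      simp only [delV, del_congr e1, del_congr e2, del_const, Prod.mk_zero_zero]
    · rw [delBar_congr hz0, delBar_const, h0, zero_smul, zero_smul, add_zero]
      simp only [delBarV, delBar_congr e1, delBar_congr e2, delBar_const, Prod.mk_zero_zero]

theorem conj_del_of_real {κ : ℂ → ℂ} (hκ : ContDiff ℝ ∞ κ) (hκ' : ∀ z, conj (κ z) = κ z) (z : ℂ) :
    conj (del κ z) = delBar κ z := by
  rw [← delBar_conj (hκ.differentiable (by simp) z)]
  simp only [hκ']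

theorem herm_cutoff_dualFrame {S : Set ℂ} {un' : ℂ → ℂ} {F' Z' : ℂ → ℂ × ℂ}
    (h : SpinorPair S un' F' k Z') {κ : ℂ → ℂ} (hκ : ContDiff ℝ ∞ κ)
    (hκ' : ∀ z, conj (κ z) = κ z) (hκS : tsupport κ ⊆ S) (z : ℂ) :
    (herm (F' z) (delV (fun z => κ z • dualFrame F' Z' z) z)
      = delBar κ z * (Z' z).2 + κ z * (k z).2) ∧
    herm (J (F' z)) (delBarV (fun z => κ z • dualFrame F' Z' z) z)
      = conj (delBar κ z * (Z' z).1 + κ z * (k z).1) := by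
  obtain ⟨-, h1⟩ := cutoff_dualFrame h hκ hκS
  rw [(h1 z).1, (h1 z).2]
  by_cases hz : z ∈ tsupport κ
  · have hS := hκS hz
    rw [← conj_herm _ (F' z), ← conj_herm _ (J (F' z)), herm_add_left, herm_add_left,
      herm_smul_left, herm_smul_left, herm_smul_left, herm_smul_left,
      herm_dualFrame (h.ne_zero z hS), herm_dualFrame_J (h.ne_zero z hS),
      herm_delV_dualFrame h hS, herm_delBarV_dualFrame h hS]
    simp only [map_add, map_mul, Complex.conj_conj, hκ', conj_del_of_real hκ hκ',
      and_self]
  · simp [off_tsupport fun h => hz (tsupport_del_subset h),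
      off_tsupport fun h => hz (tsupport_delBar_subset h), off_tsupport hz, herm]

set_option maxHeartbeats 1000000 in
theorem integral_det2_eq_zero (hM : 4 ≤ M) (hMt : M < ⊤) (hσ : σ < 2⁻¹) (hσM : 4 * M⁻¹ ≤ σ)
    (hσp : p⁻¹ + (σ + (σ + σ)) ≤ 1) (hr : 0 < r) (hrR : r < R) (h : Approx M o R u F un Fn)
    (hb : ∀ n, SmallPot σ⁻¹ ((ball o R).indicator (sff (Fn n))))
    (hb2 : ∀ n, MemLp ((ball o R).indicator (sff (Fn n))) 2)
    (hP : MemLp P p (vol (ball o R)))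
    (hcl : ClosedPairing (ball o R) F P)
    {κ : ℂ → ℂ} (hκ : ContDiff ℝ ∞ κ) (hκ' : ∀ z, conj (κ z) = κ z) (hκc : HasCompactSupport κ)
    (hκs : tsupport κ ⊆ closedBall o r) (hk : ContDiff ℝ ∞ k) (hkc : HasCompactSupport k)
    (hZ : MemLp Z M) (hZe : Z = cauchyT fun z => k z + u z • J (Z z)) :
    Integrable (fun z => det2 (delBar κ z • Z z + κ z • k z) (P z)) ∧
    ∫ z, (det2 (delBar κ z • Z z + κ z • k z) (P z)).re = 0 := by
  obtain ⟨Zn, hZn, hZto, hZne⟩ := h.exists_solutions hM hMt hk hkc hZ hZe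
  obtain ⟨R', hrR', hR'⟩ := exists_between hrR
  obtain ⟨hY, hdY, hDY⟩ := exists_lpBdd_dualFrame hM hσ hσM hMt (hr.trans hrR') hR' h hb hb2 hk hkc
    hZn (hZto.bdd ((inv_le_quarter hM).trans (by simp))) hZne
  have hsp := h.spinorPair hZn hZne
  have hRR := ball_subset_ball (x := o) hR'.le
  set B := ball o R' with hB
  have hfin : IsFiniteMeasure (vol B) :=
    by rw [hB]; infer_instance
  have hκB : tsupport κ ⊆ B := hκs.trans (closedBall_subset_ball hrR')
  have hκR : tsupport κ ⊆ ball o R := hκB.trans hRR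
  have hPB : MemLp P p⁻¹⁻¹ (vol B) := by
    rw [inv_inv]; exact hP.mono_measure (Measure.restrict_mono_set _ hRR)
  have hMσ : M⁻¹ ≤ σ := (le_mul_of_one_le_left' (by norm_num : (1 : ENNReal) ≤ 4)).trans hσM
  have hpσ : p⁻¹ + σ ≤ 1 := (add_le_add le_rfl (self_le_add_right _ _)).trans hσp
  have hσ2 : σ + σ ≤ 1 := (add_le_add hσ.le hσ.le).trans inv_two_add_inv_two.le
  set X : ℕ → ℂ → ℂ × ℂ := fun n z => κ z • dualFrame (Fn n) (Zn n) z with hX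
  have hXs : ∀ n, ContDiff ℝ ∞ (X n) := fun n => (cutoff_dualFrame (hsp n) hκ hκR).1
  have hXc : ∀ n, HasCompactSupport (X n) := fun n => hκc.smul_right
  have hXt : ∀ n, tsupport (X n) ⊆ ball o R := fun n =>
    (closure_mono (show Function.support (X n) ⊆ Function.support κ from
      fun z hz h0 => hz (by simp [hX, h0]))).trans hκR
  obtain ⟨K₁, hK₁⟩ := hκ.delBar_infty.continuous.bounded_above_of_compact_support
    hκc.delBar
  obtain ⟨K₂, hK₂⟩ := hκ.continuous.bounded_above_of_compact_support hκc
  have hK₁' : ∀ z, ‖del κ z‖ ≤ K₁ := fun z => by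
    rw [← RCLike.norm_conj, conj_del_of_real hκ hκ']; exact hK₁ z
  have hK₁0 : 0 ≤ K₁ := (norm_nonneg _).trans (hK₁ 0)
  have hK₂0 : 0 ≤ K₂ := (norm_nonneg _).trans (hK₂ 0)
  have hbd : ∀ {a b : ℂ} {x y : ℂ × ℂ}, ‖a‖ ≤ K₁ → ‖b‖ ≤ K₂ →
      ‖a • x + b • y‖ ≤ (K₁ + K₂) * (‖x‖ + ‖y‖) := fun {a b x y} ha hb => by
    refine (norm_add_le _ _).trans ?_
    rw [norm_smul, norm_smul]
    nlinarith [norm_nonneg x, norm_nonneg y, mul_le_mul_of_nonneg_right ha (norm_nonneg x),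
      mul_le_mul_of_nonneg_right hb (norm_nonneg y)]
  have hdX : LpBdd (σ + σ) (vol B) fun n => delV (X n) :=
    hY.of_norm_le_add hσ2 hdY (fun n => (contDiff_delV (hXs n)).continuous.aestronglyMeasurable)
      fun n => ae_of_all _ fun z => by
        rw [((cutoff_dualFrame (hsp n) hκ hκR).2 z).1]; exact hbd (hK₁' z) (hK₂ z)
  have hDX : LpBdd (σ + σ) (vol B) fun n => delBarV (X n) :=
    hY.of_norm_le_add hσ2 hDY (fun n => (contDiff_delBarV (hXs n)).continuous.aestronglyMeasurable)
      fun n => ae_of_all _ fun z => by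
        rw [((cutoff_dualFrame (hsp n) hκ hκR).2 z).2]; exact hbd (hK₁ z) (hK₂ z)
  -- the pairings with `F` and with its approximations
  set A : (ℂ → ℂ × ℂ) → ℂ → ℂ := fun Y z =>
    (P z).1 * (delBar κ z * (Y z).2 + κ z * (k z).2)
      - conj (P z).2 * conj (delBar κ z * (Y z).1 + κ z * (k z).1) with hA
  set Q : ℕ → ℂ → ℂ := fun n z =>
    (P z).1 * herm (F z) (delV (X n) z) - conj (P z).2 * herm (J (F z)) (delBarV (X n) z) with hQ
  have hAn : ∀ n z, A (Zn n) z = (P z).1 * herm (Fn n z) (delV (X n) z)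
      - conj (P z).2 * herm (J (Fn n z)) (delBarV (X n) z) := fun n z => by
    obtain ⟨e1, e2⟩ := herm_cutoff_dualFrame (hsp n) hκ hκ' hκR z
    simp only [hA, hX, e1, e2]
  have hQ0 : ∀ n, ∫ z, Q n z = 0 := fun n =>
    hcl.integral_herm (h.lpTo_F.memLp_lim.mono_measure restrict_le)
      (by rwa [inv_inv]) (by rw [add_comm]; exact (add_le_add le_rfl hMσ).trans hpσ)
      (hXs n) (hXc n) (hXt n)
  have hZB : LpTo M⁻¹ (vol B) Zn Z := hZto.mono_measure restrict_le
  have hmA : ∀ {Y : ℂ → ℂ × ℂ}, AEStronglyMeasurable Y (vol B) →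
      AEStronglyMeasurable (A Y) (vol B) := fun {Y} hY => by
    have c1 := hκ.delBar_infty.continuous.aestronglyMeasurable (μ := vol B)
    have c2 := hκ.continuous.aestronglyMeasurable (μ := vol B)
    have c3 := hk.continuous.aestronglyMeasurable (μ := vol B)
    exact (hPB.1.fst.mul ((c1.mul hY.snd).add (c2.mul c3.snd))).sub
      ((continuous_conj.comp_aestronglyMeasurable hPB.1.snd).mul
        (continuous_conj.comp_aestronglyMeasurable ((c1.mul hY.fst).add (c2.mul c3.fst))))
  have hAle : ∀ (Y : ℂ → ℂ × ℂ) z, ‖A Y z‖ ≤ 2 * (K₁ + K₂) * ((‖Y z‖ + ‖k z‖) * ‖P z‖) :=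
    fun Y z => by
      have e := hbd (x := Y z) (y := k z) (hK₁ z) (hK₂ z)
      have e1 := (norm_fst_le (delBar κ z • Y z + κ z • k z)).trans e
      have e2 := (norm_snd_le (delBar κ z • Y z + κ z • k z)).trans e
      refine (norm_sub_le _ _).trans ?_
      rw [norm_mul, norm_mul, RCLike.norm_conj, RCLike.norm_conj]
      have f1 := mul_le_mul (norm_fst_le (P z)) e2 (norm_nonneg _) (norm_nonneg _)
      have f2 := mul_le_mul (norm_snd_le (P z)) e1 (norm_nonneg _) (norm_nonneg _)
      simp only [Prod.fst_add, Prod.snd_add, Prod.smul_fst, Prod.smul_snd, smul_eq_mul] at f1 f2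
      linarith
  have hAi : MemLp (A Z) (M⁻¹ + p⁻¹)⁻¹ (vol B) := by
    have hkB : MemLp k M⁻¹⁻¹ (vol B) :=
      (hk.continuous.memLp_of_hasCompactSupport hkc).mono_measure restrict_le
    refine ((LpBdd.of_memLp ((hZB.memLp_lim).norm.add hkB.norm)).of_norm_le_mul (LpBdd.of_memLp hPB)
      (h := fun _ => A Z) (fun _ => hmA hZB.memLp_lim.1) (c := 2 * (K₁ + K₂))
      fun _ => ae_of_all _ fun z => ?_).memLp 0
    simpa [norm_of_nonneg (by positivity : 0 ≤ ‖Z z‖ + ‖k z‖)] using hAle Z z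
  have hMp : M⁻¹ + p⁻¹ ≤ 1 := by rw [add_comm]; exact (add_le_add le_rfl hMσ).trans hpσ
  have hA1 : LpTo 1 (vol B) (fun n => A (Zn n)) (A Z) := by
    refine (hZB.of_norm_le_mul (LpBdd.of_memLp hPB) (fun n => hmA (hZB.memLp n).1) hAi
      (c := 2 * K₁) fun n => ae_of_all _ fun z => ?_).mono hMp
    have e : A (Zn n) z - A Z z = (P z).1 * (delBar κ z * (Zn n z - Z z).2)
        - conj (P z).2 * conj (delBar κ z * (Zn n z - Z z).1) := by
      simp only [hA, Prod.fst_sub, Prod.snd_sub, map_add, map_mul, map_sub]; ring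
    rw [e]
    refine (norm_sub_le _ _).trans ?_
    simp only [norm_mul, RCLike.norm_conj]
    have f1 := mul_le_mul (norm_fst_le (P z)) (mul_le_mul (hK₁ z) (norm_snd_le (Zn n z - Z z))
      (norm_nonneg _) hK₁0) (by positivity) (norm_nonneg _)
    have f2 := mul_le_mul (norm_snd_le (P z)) (mul_le_mul (hK₁ z) (norm_fst_le (Zn n z - Z z))
      (norm_nonneg _) hK₁0) (by positivity) (norm_nonneg _)
    linarith
  have hPX : LpBdd (p⁻¹ + (σ + σ)) (vol B)
      fun n z => ‖P z‖ * (‖delV (X n) z‖ + ‖delBarV (X n) z‖) := by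
    have h1 : LpBdd (σ + σ) (vol B) fun n z => ‖delV (X n) z‖ + ‖delBarV (X n) z‖ :=
      hdX.of_norm_le_add hσ2 hDX (fun n => (hdX.meas n).norm.add (hDX.meas n).norm) (c := 1)
        fun n => ae_of_all _ fun z => by rw [norm_of_nonneg (by positivity), one_mul]
    exact (LpBdd.of_memLp hPB).of_norm_le_mul h1 (fun n => hPB.1.norm.mul (h1.meas n)) (c := 1)
      fun n => ae_of_all _ fun z => by rw [norm_mul, norm_norm, one_mul]
  have hFB : LpTo M⁻¹ (vol B) Fn F := h.lpTo_F.mono_measure restrict_le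
  have hQ1 : LpTo 1 (vol B) (fun n z => Q n z - A (Zn n) z) fun _ => 0 := by
    have h0 : MemLp (fun _ : ℂ => (0 : ℂ)) (M⁻¹ + (p⁻¹ + (σ + σ)))⁻¹ (vol B) :=
      MemLp.zero'
    refine (LpTo.of_norm_le_mul (h := fun n z => Q n z - A (Zn n) z) (h' := fun _ => (0 : ℂ))
      hFB hPX (fun n => ?_) h0 (c := 2) fun n => ae_of_all _ fun z => ?_).mono ?_
    · refine AEStronglyMeasurable.sub ?_ (hmA (hZB.memLp n).1)
      have hJF := J.continuous.comp_aestronglyMeasurable hFB.memLp_lim.1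
      exact (hPB.1.fst.mul (continuous_herm.comp_aestronglyMeasurable
        (hFB.memLp_lim.1.prodMk (hdX.meas n)))).sub
        ((continuous_conj.comp_aestronglyMeasurable hPB.1.snd).mul
          (continuous_herm.comp_aestronglyMeasurable (hJF.prodMk (hDX.meas n))))
    · have e : Q n z - A (Zn n) z = (P z).1 * herm (F z - Fn n z) (delV (X n) z)
          - conj (P z).2 * herm (J (F z - Fn n z)) (delBarV (X n) z) := by
        rw [hAn, map_sub]; simp only [hQ, herm, Prod.fst_sub, Prod.snd_sub]; ring
      rw [sub_zero, e, norm_mul, norm_norm, norm_sub_rev (Fn n z),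
        norm_of_nonneg (by positivity : 0 ≤ ‖delV (X n) z‖ + ‖delBarV (X n) z‖)]
      refine (norm_sub_le _ _).trans ?_
      rw [norm_mul, norm_mul, RCLike.norm_conj]
      have f1 := mul_le_mul (norm_fst_le (P z)) (norm_herm_le (F z - Fn n z) (delV (X n) z))
        (norm_nonneg _) (norm_nonneg _)
      have f2 := mul_le_mul (norm_snd_le (P z)) (norm_herm_le (J (F z - Fn n z)) (delBarV (X n) z))
        (norm_nonneg _) (norm_nonneg _)
      rw [norm_J] at f2
      linarith
    · refine le_trans ?_ hσp
      rw [add_left_comm]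
      gcongr
  have hoff : ∀ z, z ∉ B → κ z = 0 ∧ delBar κ z = 0 := fun z hz => by
    have ht := fun h => hz (hκB h)
    exact ⟨off_tsupport ht, off_tsupport fun h => ht (tsupport_delBar_subset h)⟩
  have hA0 : ∀ Y z, z ∉ B → A Y z = 0 := fun Y z hz => by
    simp [hA, (hoff z hz).1, (hoff z hz).2]
  have hQB : ∀ n z, z ∉ B → Q n z = 0 := fun n z hz => by
    have h1 : del κ z = 0 := by
      rw [← Complex.conj_conj (del _ z), conj_del_of_real hκ hκ', (hoff z hz).2, map_zero]
    obtain ⟨e1, e2⟩ := (cutoff_dualFrame (hsp n) hκ hκR).2 z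
    simp only [hQ, hX, e1, e2, h1, (hoff z hz).1, (hoff z hz).2, zero_smul, add_zero]
    simp [herm]
  have hlim := hA1.integral
  have hlim' : Tendsto (fun n => ∫ z in B, A (Zn n) z) atTop (𝓝 0) := by
    have h1 := hQ1.integral
    rw [integral_zero] at h1
    have h2 : ∀ n, ∫ z in B, A (Zn n) z = -∫ z in B, (Q n z - A (Zn n) z) := fun n => by
      have i1 : Integrable (A (Zn n)) (vol B) := by
        have := hA1.memLp n; rwa [inv_one, memLp_one_iff_integrable] at this
      have i2 : Integrable (fun z => Q n z - A (Zn n) z) (vol B) := by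
        have := hQ1.memLp n; rwa [inv_one, memLp_one_iff_integrable] at this
      have i3 : Integrable (Q n) (vol B) :=
        (i2.add i1).congr (ae_of_all _ fun z => by simp)
      rw [integral_sub i3 i1, setIntegral_eq_integral_of_forall_compl_eq_zero (hQB n), hQ0]
      ring
    simp only [h2]
    simpa using h1.neg
  have hAZ : ∫ z in B, A Z z = 0 := tendsto_nhds_unique hlim hlim'
  have iA : Integrable (A Z) := by
    have h1 := hA1.memLp_lim
    rw [inv_one, memLp_one_iff_integrable] at h1
    exact IntegrableOn.integrable_of_forall_notMem_eq_zero h1 (hA0 Z)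
  rw [setIntegral_eq_integral_of_forall_compl_eq_zero (hA0 Z)] at hAZ
  have hre : ∀ z, (det2 (delBar κ z • Z z + κ z • k z) (P z)).re
      = -(A Z z).re := fun z => by
    simp only [hA, det2, Prod.fst_add, Prod.snd_add, Prod.smul_fst, Prod.smul_snd, smul_eq_mul,
      ← map_mul, Complex.sub_re, Complex.conj_re]
    rw [mul_comm (P z).1, mul_comm (P z).2]
    ring
  refine ⟨IntegrableOn.integrable_of_forall_notMem_eq_zero (s := B) ?_ fun z hz => ?_, ?_⟩
  · have hkB : MemLp k M⁻¹⁻¹ (vol B) :=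
      (hk.continuous.memLp_of_hasCompactSupport hkc).mono_measure restrict_le
    have c1 := hκ.delBar_infty.continuous.aestronglyMeasurable (μ := vol B)
    have c2 := hκ.continuous.aestronglyMeasurable (μ := vol B)
    have c3 := (c1.smul hZB.memLp_lim.1).add (c2.smul hkB.1)
    refine MemLp.mul_norm_le (hZB.memLp_lim.norm.add hkB.norm) hPB hMp
      ((c3.fst.mul hPB.1.snd).sub (c3.snd.mul hPB.1.fst)) (c := 2 * (K₁ + K₂)) fun z => ?_
    refine (norm_det2_le _ _).trans ?_
    have e := mul_le_mul_of_nonneg_right (hbd (x := Z z) (y := k z) (hK₁ z) (hK₂ z))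
      (norm_nonneg (P z))
    simp only [Pi.add_apply, norm_of_nonneg (by positivity : 0 ≤ ‖Z z‖ + ‖k z‖)]
    linarith
  · simp [(hoff z hz).1, (hoff z hz).2, det2]
  · simp only [hre]
    rw [integral_neg, ← RCLike.re_eq_complex_re, integral_re iA, hAZ]
    simp

end Limit

/-! ### Duality: a closed pairing forces the dual equation -/

section Duality

variable {M σ p p' s : ENNReal} {o : ℂ} {r R : ℝ} {u : ℂ → ℂ} {F h k P Z Ψ : ℂ → ℂ × ℂ}
  {un : ℕ → ℂ → ℂ} {Fn : ℕ → ℂ → ℂ × ℂ}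

theorem integrable_det2 {a b : ENNReal} [a.HolderConjugate b] {x y : ℂ → ℂ × ℂ}
    (hx : MemLp x a) (hy : MemLp y b) : Integrable fun z => det2 (x z) (y z) :=
  (hx.fst.integrable_mul hy.snd).sub (hx.snd.integrable_mul hy.fst)

theorem holderConjugate_sobExp (hpp : p'.HolderConjugate p) (hsp : sobExp s = p) :
    (sobExp p').HolderConjugate s := by
  refine ⟨?_⟩
  have h1 := hpp.inv_add_inv_eq_inv
  rw [← hsp, sobExp, inv_inv] at h1
  rw [sobExp, inv_inv, ← h1, add_assoc, add_comm 2⁻¹]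

theorem integral_det2_cauchyT (hr : 2 < p') (hrt : p' < ⊤) (hpp : p'.HolderConjugate p)
    (hs : 2 < s) (hst : s < ⊤) (hsp : sobExp s = p) {x y : ℂ → ℂ × ℂ}
    (hx : MemLp x (sobExp p')) (hy : MemLp y p) :
    ∫ z, det2 (x z) (cauchyT y z) = -∫ z, det2 (cauchyT x z) (y z) := by
  have hc := holderConjugate_sobExp hpp hsp
  have hyT := memLp_cauchyT hs hst (hsp ▸ hy)
  have hxT := memLp_cauchyT hr hrt hx
  have e1 := integral_mul_cauchyT hr hrt hpp hx.fst hy.snd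
  have e2 := integral_mul_cauchyT hr hrt hpp hx.snd hy.fst
  have f1 : ∫ z, (x z).1 * (cauchyT y z).2 = ∫ z, (x z).1 * cauchyT (fun w => (y w).2) z :=
    integral_congr_ae ((cauchyT_snd hs hst (hsp ▸ hy)).mono fun z hz => congrArg ((x z).1 * ·) hz)
  have f2 : ∫ z, (x z).2 * (cauchyT y z).1 = ∫ z, (x z).2 * cauchyT (fun w => (y w).1) z :=
    integral_congr_ae ((cauchyT_fst hs hst (hsp ▸ hy)).mono fun z hz => congrArg ((x z).2 * ·) hz)
  have f3 : ∫ z, (cauchyT x z).1 * (y z).2 = ∫ z, cauchyT (fun w => (x w).1) z * (y z).2 :=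
    integral_congr_ae ((cauchyT_fst hr hrt hx).mono fun z hz => congrArg (· * (y z).2) hz)
  have f4 : ∫ z, (cauchyT x z).2 * (y z).1 = ∫ z, cauchyT (fun w => (x w).2) z * (y z).1 :=
    integral_congr_ae ((cauchyT_snd hr hrt hx).mono fun z hz => congrArg (· * (y z).1) hz)
  have i1 : Integrable fun z => (x z).1 * (cauchyT y z).2 := hx.fst.integrable_mul hyT.snd
  have i2 : Integrable fun z => (x z).2 * (cauchyT y z).1 := hx.snd.integrable_mul hyT.fst
  have i3 : Integrable fun z => (cauchyT x z).1 * (y z).2 := hxT.fst.integrable_mul hy.snd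
  have i4 : Integrable fun z => (cauchyT x z).2 * (y z).1 := hxT.snd.integrable_mul hy.fst
  simp only [det2]
  rw [integral_sub i1 i2, integral_sub i3 i4, f1, f2, f3, f4, e1, e2]
  ring

theorem re_integral_det2 (hr : 2 < p') (hrt : p' < ⊤) (hpp : p'.HolderConjugate p)
    (hs : 2 < s) (hst : s < ⊤) (hsp : sobExp s = p) (hu : MemLp u 2)
    (hk : MemLp k (sobExp p')) (hZ : MemLp Z p')
    (hZe : Z = cauchyT fun z => k z + u z • J (Z z)) (hh : MemLp h p)
    (hΨ : MemLp Ψ s) (hΨe : Ψ = cauchyT fun z => h z + conj (u z) • J (Ψ z)) :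
    ∫ z, (det2 (k z) (Ψ z)).re = -∫ z, (det2 (Z z) (h z)).re := by
  have hc := holderConjugate_sobExp hpp hsp
  have hu' : MemLp (fun z => conj (u z)) 2 := hu.star
  have huZ : MemLp (fun z => u z • J (Z z)) (sobExp p') := (isPot_smul_J hu.1).memLp hu hZ
  have huΨ : MemLp (fun z => conj (u z) • J (Ψ z)) p :=
    hsp ▸ (isPot_smul_J hu'.1).memLp hu' hΨ
  have key := integral_det2_cauchyT hr hrt hpp hs hst hsp (hk.add huZ) (hh.add huΨ)
  simp only [Pi.add_apply] at key
  have e1 : cauchyT (k + fun z => u z • J (Z z)) = Z := hZe.symm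
  have e2 : cauchyT (h + fun z => conj (u z) • J (Ψ z)) = Ψ := hΨe.symm
  rw [e1, e2] at key
  have d1 : ∀ x y z : ℂ × ℂ, det2 (x + y) z = det2 x z + det2 y z := fun x y z => by
    simp only [det2, Prod.fst_add, Prod.snd_add]; ring
  have d2 : ∀ x y z : ℂ × ℂ, det2 x (y + z) = det2 x y + det2 x z := fun x y z => by
    simp only [det2, Prod.fst_add, Prod.snd_add]; ring
  have d3 : ∀ z, det2 (Z z) (conj (u z) • J (Ψ z)) = -conj (det2 (u z • J (Z z)) (Ψ z)) :=
    fun z => by simp [det2]; ring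
  have i1 := integrable_det2 hk hΨ
  have i2 := integrable_det2 huZ hΨ
  have i3 := integrable_det2 hZ hh
  simp only [d1, d2, d3] at key
  have i4 : Integrable fun z => -conj (det2 (u z • J (Z z)) (Ψ z)) :=
    (integrable_det2 hZ huΨ).congr (ae_of_all _ d3)
  rw [integral_add i1 i2, integral_add i3 i4, integral_neg, integral_conj] at key
  have e3 := congrArg Complex.re key
  simp only [Complex.add_re, Complex.neg_re, Complex.conj_re] at e3
  have r1 : ∫ z, (det2 (k z) (Ψ z)).re = (∫ z, det2 (k z) (Ψ z)).re := integral_re i1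
  have r2 : ∫ z, (det2 (Z z) (h z)).re = (∫ z, det2 (Z z) (h z)).re := integral_re i3
  rw [r1, r2]
  linarith

theorem ae_eq_zero_of_re_integral_det2 {X : ℂ → ℂ × ℂ} (hX : LocallyIntegrable X)
    (h : ∀ k : ℂ → ℂ × ℂ, ContDiff ℝ ∞ k → HasCompactSupport k →
      ∫ z, (det2 (k z) (X z)).re = 0) : X =ᵐ[volume] 0 := by
  have key : ∀ {x : ℂ → ℂ}, LocallyIntegrable x → (∀ g : ℂ → ℂ, ContDiff ℝ ∞ g →
      HasCompactSupport g → ∫ z, (g z * x z).re = 0) → ∀ᵐ z, x z = 0 := by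
    intro x hx hg
    refine ae_eq_zero_of_integral_contDiff_smul_eq_zero hx fun g hgs hgc => ?_
    have i1 : Integrable fun z => (g z : ℂ) * x z := by
      have := hx.integrable_smul_left_of_hasCompactSupport hgs.continuous hgc
      simpa using this
    have e1 := hg (fun z => (g z : ℂ)) (contDiff_ofReal hgs) (hasCompactSupport_ofReal hgc)
    have e2 := hg (fun z => I * (g z : ℂ)) (contDiff_const.mul (contDiff_ofReal hgs))
      (hasCompactSupport_ofReal hgc).mul_left
    have r1 : ∫ z, ((g z : ℂ) * x z).re = (∫ z, (g z : ℂ) * x z).re := integral_re i1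
    have r2 : ∫ z, (I * (g z : ℂ) * x z).re = (∫ z, I * ((g z : ℂ) * x z)).re := by
      simp_rw [mul_assoc]; exact integral_re (i1.const_mul _)
    rw [r1] at e1
    rw [r2, integral_const_mul] at e2
    simp only [real_smul]
    refine Complex.ext e1 ?_
    simpa using e2
  have h1 := key (x := fun z => (X z).1)
    (fun z => (hX z).imp fun _ hs => ⟨hs.1, hs.2.fst⟩) fun g hg hgc => by
      have := h (fun z => (0, -g z)) (contDiff_const.prodMk hg.neg)
        (hgc.comp_left (g := fun a => ((0 : ℂ), -a)) (by simp))
      simpa [det2] using this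
  have h2 := key (x := fun z => (X z).2)
    (fun z => (hX z).imp fun _ hs => ⟨hs.1, hs.2.snd⟩) fun g hg hgc => by
      have := h (fun z => (g z, 0)) (hg.prodMk contDiff_const)
        (hgc.comp_left (g := fun a => (a, (0 : ℂ))) (by simp))
      simpa [det2] using this
  filter_upwards [h1, h2] with z e1 e2 using Prod.ext e1 e2

theorem ClosedPairing.exists_eq_solution (hM : 4 ≤ M) (hMt : M < ⊤) (hσ : σ < 2⁻¹)
    (hσM : 4 * M⁻¹ ≤ σ) (hσp : p⁻¹ + (σ + (σ + σ)) ≤ 1) (hr : 0 < r) (hrR : r < R)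
    (ha : Approx M o R u F un Fn)
    (hb : ∀ n, SmallPot σ⁻¹ ((ball o R).indicator (sff (Fn n))))
    (hb2 : ∀ n, MemLp ((ball o R).indicator (sff (Fn n))) 2)
    (hP : MemLp P p (vol (ball o R)))
    (hcl : ClosedPairing (ball o R) F P)
    (hp' : 2 < p') (hp'M : p' ≤ M) (hpp : p'.HolderConjugate p) (hs : 2 < s) (hst : s < ⊤)
    (hsp : sobExp s = p) {K : Set ℂ} (hK : IsCompact K) (huK : ∀ z ∉ K, u z = 0)
    (huM : SmallPot M u) (hus : SmallPot s u) :
    ∃ r₁ > 0, MemLp P s (vol (ball o r₁)) ∧ r₁ ≤ r ∧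
      WeakDBV (ball o r₁) P fun z => conj (u z) • J (P z) := by
  have hM2 := two_lt_of_four_le hM
  have hp't := hp'M.trans_lt hMt
  obtain ⟨κ₀, hκ, hκc, hκs, hκ1, -⟩ := exists_cutoff o (r := r / 2) (R := r) (by linarith)
    (by linarith)
  obtain ⟨κ, hκ₀⟩ : ∃ κ : ℂ → ℂ, κ = fun z => (κ₀ z : ℂ) := ⟨_, rfl⟩
  have hκC := hκ₀ ▸ contDiff_ofReal hκ
  have hκCc := hκ₀ ▸ hasCompactSupport_ofReal hκc
  have hκs' : tsupport κ ⊆ closedBall o r := by rwa [hκ₀, tsupport_ofReal]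
  have hκB := hκs'.trans (closedBall_subset_ball hrR)
  have hu2 : MemLp u 2 := by simpa using ha.lpTo_u.memLp_lim
  have hu2' : MemLp (fun z => conj (u z)) 2 := hu2.star
  have hus' : SmallPot s fun z => conj (u z) := by
    have : eLpNorm (fun z => conj (u z)) 2 volume = eLpNorm u 2 volume :=
      eLpNorm_congr_norm_ae (ae_of_all _ fun z => RCLike.norm_conj _)
    rw [SmallPot, this]; exact hus
  set G : ℂ → ℂ × ℂ := fun z => κ z • P z with hG
  set h : ℂ → ℂ × ℂ := fun z => delBar κ z • P z with hh
  have hGp : MemLp G p :=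
    memLp_smul_of_tsupport_subset measurableSet_ball hP hκC.continuous hκCc hκB
  have hhp : MemLp h p :=
    memLp_smul_of_tsupport_subset measurableSet_ball hP hκC.delBar_infty.continuous hκCc.delBar
      (tsupport_delBar_subset.trans hκB)
  obtain ⟨Ψ, hΨ, hΨe⟩ := (isPot_smul_J hu2'.1).exists_solution hs hst hu2' hus' (hsp.symm ▸ hhp)
  have hp1 : 1 ≤ p := hsp ▸ (one_lt_sobExp hs).le
  have hae : (fun z => Ψ z - G z) =ᵐ[volume] 0 := by
    refine ae_eq_zero_of_re_integral_det2 ((hΨ.locallyIntegrable (one_le_two.trans hs.le)).sub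
      (hGp.locallyIntegrable hp1)) fun k hk hkc => ?_
    have hks : ∀ t, MemLp k t := fun t => hk.continuous.memLp_of_hasCompactSupport hkc
    obtain ⟨Z, hZ, hZe⟩ := (isPot_smul_J hu2.1).exists_solution hM2 hMt hu2 huM (hks _)
    have hZp := memLp_solution_of_le hp' hp'M hMt hu2 (hK.union hkc.isCompact)
      (fun z hz => huK z fun h => hz (Or.inl h)) (hks _)
      (fun z hz => off_tsupport fun h => hz (Or.inr h)) hZ hZe
    obtain ⟨-, e1⟩ := integral_det2_eq_zero hM hMt hσ hσM hσp hr hrR ha hb hb2 hP hcl hκC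
      (by simp [hκ₀]) hκCc hκs' hk hkc hZ hZe
    have e2 := re_integral_det2 hp' hp't hpp hs hst hsp hu2 (hks _) hZp hZe hhp hΨ hΨe
    have i1 : Integrable fun z => (det2 (Z z) (h z)).re := (integrable_det2 hZp hhp).re
    have i2 : Integrable fun z => (det2 (k z) (G z)).re := (integrable_det2 (hks p') hGp).re
    have hsc : s.HolderConjugate s.conjExponent :=
      ENNReal.HolderConjugate.conjExponent (one_le_two.trans hs.le)
    have i3 : Integrable fun z => (det2 (k z) (Ψ z)).re :=
      (integrable_det2 (a := s.conjExponent) (b := s) (hks _) hΨ).re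
    have e3 : ∀ z, (det2 (delBar κ z • Z z + κ z • k z) (P z)).re
        = (det2 (Z z) (h z)).re + (det2 (k z) (G z)).re := fun z => by
      rw [← Complex.add_re]; congr 1; simp [det2, hh, hG]; ring
    have e4 : ∀ z, (det2 (k z) (Ψ z - G z)).re = (det2 (k z) (Ψ z)).re - (det2 (k z) (G z)).re :=
      fun z => by rw [← Complex.sub_re]; congr 1; simp [det2]; ring
    simp only [e3] at e1
    simp only [e4]
    rw [integral_add i1 i2] at e1
    rw [integral_sub i3 i2]
    linarith
  have hPΨ : ∀ᵐ z, z ∈ ball o (r / 2) → Ψ z = P z := by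
    filter_upwards [hae] with z hz hzr
    rw [sub_eq_zero.1 hz, hG]
    simp [hκ₀, hκ1 z (ball_subset_closedBall hzr)]
  refine ⟨r / 2, by linarith, ?_, by linarith, ?_⟩
  · refine (hΨ.mono_measure restrict_le).ae_eq ?_
    exact (ae_restrict_iff' measurableSet_ball).2 hPΨ
  · have h1 := weakDBV_cauchyT hs hst
      ((hsp.symm ▸ hhp).add ((isPot_smul_J hu2'.1).memLp hu2' hΨ))
    have e2 : cauchyT (h + fun z => conj (u z) • J (Ψ z)) = Ψ := hΨe.symm
    rw [e2] at h1
    refine (h1.mono (Set.subset_univ _)).congr_ae hPΨ ?_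
    filter_upwards [hPΨ] with z hz hzr
    rw [Pi.add_apply, hz hzr, hh]
    have : delBar κ z = 0 :=
      delBar_eq_zero_of_eqOn_ball (o := o) (r := r / 2) (c := 1) (fun w hw => by
        simp [hκ₀, hκ1 w (ball_subset_closedBall hw)]) hzr
    simp [this]

end Duality

/-! ### Regularity near a point -/

section Regularity

variable {p q r s : ENNReal} {o : ℂ} {R : ℝ} {U : ℂ → ℂ} {Φ P : ℂ → ℂ × ℂ}

theorem MemLp.congr_on {B B' : Set ℂ} {f g : ℂ → ℂ × ℂ} (hB : MeasurableSet B')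
    (h : MemLp f p (vol B)) (hBB : B' ⊆ B) (hfg : ∀ᵐ z, z ∈ B' → f z = g z) :
    MemLp g p (vol B') :=
  (h.mono_measure (Measure.restrict_mono_set _ hBB)).ae_eq ((ae_restrict_iff' hB).2 hfg)

theorem exists_mul_le {a c : ENNReal} (hc : c ≠ ⊤) (ha : a ≠ 0) : ∃ ε ≠ 0, ∀ x ≤ ε, c * x ≤ a := by
  refine ⟨a / (c + 1), (ENNReal.div_pos ha (by simp [hc])).ne', fun x hx => ?_⟩
  calc c * x ≤ (c + 1) * (a / (c + 1)) := mul_le_mul' le_self_add hx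
    _ ≤ a := ENNReal.mul_div_le

/-- Solutions of `∂̄P = U J P` in `L^s`, `s > 2`, are in `L^r` for all finite `r`. -/
theorem WeakDBV.memLp_of_lt_top (hR : 0 < R) (hs : 2 < s) (hst : s < ⊤) (hr : r < ⊤)
    (hU : MemLp U 2 (vol (ball o R)))
    (hP : MemLp P s (vol (ball o R)))
    (h : WeakDBV (ball o R) P fun z => U z • J (P z)) :
    ∃ R' > 0, R' ≤ R ∧ MemLp P r (vol (ball o R')) := by
  set m := max s r
  have hmt : m < ⊤ := max_lt hst hr
  obtain ⟨ε₁, h1, hε₁⟩ := exists_mul_le (sobConst_ne_top s) (show (2⁻¹ : ENNReal) ≠ 0 by simp)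
  obtain ⟨ε₂, h2, hε₂⟩ := exists_mul_le (sobConst_ne_top m) (show (2⁻¹ : ENNReal) ≠ 0 by simp)
  obtain ⟨R', hR', hRR, hsm⟩ := exists_ball_small hR hU (lt_min h1.bot_lt h2.bot_lt).ne'
  have hsub := ball_subset_ball (x := o) hRR
  have hm := Measure.restrict_mono hsub (le_refl (volume : Measure ℂ))
  obtain ⟨F, -, hF, -, -, -, hFP, -⟩ := WeakDBV.exists_solution hR' hs (le_max_left s r) hmt
    (hU.mono_measure hm) (hP.mono_measure hm) (h.mono hsub)
    (hε₁ _ ((hsm R' le_rfl).trans (min_le_left _ _)))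
    (hε₂ _ ((hsm R' le_rfl).trans (min_le_right _ _)))
  refine ⟨R' / 2, half_pos hR', (half_le_self hR'.le).trans hRR, ?_⟩
  exact (((hF.mono_measure restrict_le).ae_eq
    ((ae_restrict_iff' measurableSet_ball).2 hFP)).mono_exponent (le_max_right s r))

theorem exists_large_exponent {a b δ σ : ENNReal} (ha : a < ⊤) (hb : b < ⊤) (hδ : δ ≠ 0) (hσ : σ ≠ 0)
    (K : ℝ) : ∃ M : ENNReal, M < ⊤ ∧ 4 ≤ M ∧ a ≤ M ∧ b ≤ M ∧ 4 * M⁻¹ ≤ σ ∧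
      ofReal (K / M.toReal) ≤ δ := by
  have h1 : Tendsto ofReal atTop (𝓝 ⊤) := ENNReal.tendsto_ofReal_nhds_top.mpr tendsto_id
  have h2 : Tendsto (fun t : ℝ => 4 * (ofReal t)⁻¹) atTop (𝓝 0) := by
    have := ENNReal.Tendsto.const_mul (a := 4) ((continuous_inv.tendsto (⊤ : ENNReal)).comp h1)
      (Or.inr (by norm_num))
    simpa [Function.comp_def] using this
  have h3 : Tendsto (fun t : ℝ => ofReal (K / t)) atTop (𝓝 0) := by
    have := (ENNReal.continuous_ofReal.tendsto 0).comp (tendsto_const_nhds.div_atTop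
      (tendsto_id (α := ℝ)) : Tendsto (fun t : ℝ => K / t) atTop (𝓝 0))
    simpa [Function.comp_def] using this
  obtain ⟨t, t1, t2, t3, t4, t5, t6⟩ := ((h1.eventually_const_le (u := 4) (by simp)).and
    ((h1.eventually_const_le ha).and ((h1.eventually_const_le hb).and
      ((h2.eventually_le_const hσ.bot_lt).and ((h3.eventually_le_const hδ.bot_lt).and
        (eventually_ge_atTop 0)))))).exists
  exact ⟨ofReal t, ofReal_lt_top, t1, t2, t3, t4,
    by rwa [ENNReal.toReal_ofReal t6]⟩

theorem exists_exponents (hp : 1 < p) (hp' : p < 2) : ∃ p' s σ : ENNReal, 2 < p' ∧ p' < ⊤ ∧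
    p'.HolderConjugate p ∧ 2 < s ∧ s < ⊤ ∧ sobExp s = p ∧ σ ≠ 0 ∧ σ < 2⁻¹ ∧
    p⁻¹ + (σ + (σ + σ)) ≤ 1 := by
  have h1 : p⁻¹ < 1 := ENNReal.inv_lt_one.2 hp
  have h2 : 2⁻¹ < p⁻¹ := ENNReal.inv_lt_inv.2 hp'
  have e1 : p⁻¹ + (1 - p⁻¹) = 1 := add_tsub_cancel_of_le h1.le
  have e2 : 2⁻¹ + (p⁻¹ - 2⁻¹) = p⁻¹ := add_tsub_cancel_of_le h2.le
  have hpt : p⁻¹ ≠ ⊤ := h1.ne_top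
  have l1 : 1 - p⁻¹ < 2⁻¹ := by
    by_contra! h
    have := ENNReal.add_lt_add_of_lt_of_le (by simp) h2 h
    rw [e1, inv_two_add_inv_two] at this
    exact lt_irrefl _ this
  have l2 : p⁻¹ - 2⁻¹ < 2⁻¹ := by
    by_contra! h
    have := add_le_add (le_refl (2⁻¹ : ENNReal)) h
    rw [e2, inv_two_add_inv_two] at this
    exact this.not_gt h1
  have p1 : 0 < 1 - p⁻¹ := tsub_pos_of_lt h1
  have p2 : 0 < p⁻¹ - 2⁻¹ := tsub_pos_of_lt h2
  refine ⟨(1 - p⁻¹)⁻¹, (p⁻¹ - 2⁻¹)⁻¹, (1 - p⁻¹) / 3, ?_, ENNReal.inv_lt_top.2 p1, ⟨?_⟩, ?_,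
    ENNReal.inv_lt_top.2 p2, ?_, (ENNReal.div_pos p1.ne' (by simp)).ne', ?_, ?_⟩
  · exact (inv_inv (2 : ENNReal)).symm.trans_lt (ENNReal.inv_lt_inv.2 l1)
  · rw [inv_inv, inv_one, add_comm, e1]
  · exact (inv_inv (2 : ENNReal)).symm.trans_lt (ENNReal.inv_lt_inv.2 l2)
  · rw [sobExp, inv_inv, add_comm, e2, inv_inv]
  · refine lt_of_le_of_lt ?_ l1
    exact ENNReal.div_le_of_le_mul (le_mul_of_one_le_right' (by norm_num))
  · rw [← add_assoc ((1 - p⁻¹) / 3), ENNReal.add_thirds, e1]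

theorem exists_approx_small (hR : 0 < R) (hq : 2 < q) {M : ENNReal} (hM : 4 ≤ M)
    (hMt : M < ⊤) (hqM : q ≤ M) {δ ε : ENNReal} (hδ : δ ≠ 0) (hε : ε ≠ 0)
    (hU : MemLp U 2 (vol (ball o R)))
    (hΦ : MemLp Φ q (vol (ball o R)))
    (h : WeakDBV (ball o R) Φ fun z => U z • J (Φ z))
    (hnz : ∀ R > 0, ¬ MemLp (fun z => (z - o)⁻¹ • Φ z) q (vol (ball o R))) :
    ∃ R₁ > 0, R₁ ≤ R ∧ SmallPot M ((ball o R₁).indicator U) ∧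
      eLpNorm ((ball o R₁).indicator U) 2 volume ≤ ε ∧
      ∃ F : ℂ → ℂ × ℂ, ∃ R₂ > 0, R₂ ≤ R₁ ∧ (∀ᵐ z, z ∈ ball o R₂ → F z = Φ z) ∧
        ∃ (un : ℕ → ℂ → ℂ) (Fn : ℕ → ℂ → ℂ × ℂ),
          Approx M o R₂ ((ball o R₁).indicator U) F un Fn ∧
          ∀ n, eLpNorm (un n) 2 volume ≤ δ := by
  have h8 : (8⁻¹ : ENNReal) ≤ 2⁻¹ := inv_le_inv.2 (by norm_num)
  obtain ⟨ε₁, h1, hε₁⟩ := exists_mul_le (sobConst_ne_top q) (show (2⁻¹ : ENNReal) ≠ 0 by simp)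
  obtain ⟨ε₂, h2, hε₂⟩ := exists_mul_le (sobConst_ne_top M) (show (8⁻¹ : ENNReal) ≠ 0 by simp)
  have hδ2 : 0 < δ / 2 := ENNReal.half_pos hδ
  obtain ⟨R₁, hR₁, hRR, hsm⟩ := exists_ball_small hR hU
    (lt_min (lt_min h1.bot_lt h2.bot_lt) (lt_min hε.bot_lt hδ2)).ne'
  replace hsm := hsm R₁ le_rfl
  simp only [le_min_iff] at hsm
  obtain ⟨⟨s1, s2⟩, s3, s4⟩ := hsm
  have hsub := ball_subset_ball (x := o) hRR
  have hm := Measure.restrict_mono hsub (le_refl (volume : Measure ℂ))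
  set u := (ball o R₁).indicator U with hu
  have hu2 : MemLp u 2 :=
    (memLp_indicator_iff_restrict measurableSet_ball).2 (hU.mono_measure hm)
  have hs8 := hε₂ _ s2
  obtain ⟨F, k, hF, hk, hk0, hkR, hFΦ, hFe⟩ := WeakDBV.exists_solution hR₁ hq hqM hMt
    (hU.mono_measure hm) (hΦ.mono_measure hm) (h.mono hsub) (hε₁ _ s1) (hs8.trans h8)
  have hkM : MemLp k (sobExp M) := hk.mono_exponent_of_measure_support_ne_top
    hkR (volume_ball_ne_top o R₁) (sobExp_le_of_two_le hq.le)
  obtain ⟨R₂, hR₂, hR₂₁, un, Fn, ha⟩ := exists_approx hM hMt hqM (half_pos hR₁) hu2 hs8 hF hkM hk0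
    hFe fun R' hR' hc => hnz (min R' (R₁ / 2)) (lt_min hR' (half_pos hR₁)) (MemLp.congr_on
      measurableSet_ball hc (ball_subset_ball (min_le_left _ _)) (by
        filter_upwards [hFΦ] with z hz hzR
        rw [hz (ball_subset_ball (min_le_right _ _) hzR)]))
  have hev : ∀ᶠ n in atTop, eLpNorm (un n) 2 volume ≤ δ := by
    have h3 := ha.lpTo_u.tendsto
    rw [inv_inv] at h3
    have h4 : ∀ n, MemLp (un n) 2 := by simpa using ha.lpTo_u.memLp
    filter_upwards [h3.eventually_le_const hδ2] with n hn
    have e : un n = (fun z => un n z - u z) + u := by ext z; simp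
    rw [e, ← ENNReal.add_halves δ]
    exact (eLpNorm_add_le ((h4 n).sub hu2).1 hu2.1 one_le_two).trans (add_le_add hn s4)
  obtain ⟨N, hN⟩ := eventually_atTop.1 hev
  exact ⟨R₁, hR₁, hRR, hs8.trans h8, s3, F, R₂, hR₂, hR₂₁.trans (half_le_self hR₁.le),
    hFΦ.mono fun z hz hzR => hz (ball_subset_ball hR₂₁ hzR), _, _,
    ha.shift le_rfl (σ := fun n => n + N) (fun a b hab => Nat.add_lt_add_right hab N),
    fun n => hN _ (Nat.le_add_left N n)⟩

theorem ClosedPairing.congr_ae {S S' : Set ℂ} {F : ℂ → ℂ × ℂ} (h : ClosedPairing S Φ P)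
    (hS : S' ⊆ S) (hF : ∀ᵐ z, z ∈ S' → F z = Φ z) : ClosedPairing S' F P := by
  intro η h1 h2 h3
  have key : ∀ l m : ℂ × ℂ → ℂ,
      ∫ z, ((P z).1 * (l (F z) * delBar η z) - conj (P z).2 * (m (J (F z)) * del η z))
        = ∫ z, ((P z).1 * (l (Φ z) * delBar η z) - conj (P z).2 * (m (J (Φ z)) * del η z)) := by
    intro l m
    refine integral_congr_ae ?_
    filter_upwards [hF] with z hz
    by_cases hzS : z ∈ S'
    · rw [hz hzS]
    · have h4 : z ∉ tsupport η := fun h5 => hzS (h3 h5)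
      rw [off_tsupport fun h5 => h4 (tsupport_del_subset h5),
        off_tsupport fun h5 => h4 (tsupport_delBar_subset h5)]
      simp only [mul_zero]
  obtain ⟨e1, e2⟩ := h η h1 h2 (h3.trans hS)
  exact ⟨(key Prod.fst Prod.fst).trans e1, (key Prod.snd Prod.snd).trans e2⟩

/-- **Weyl's lemma** near a point. -/
theorem ClosedPairing.exists_regular (hR : 0 < R) (hq : 2 < q) (hqt : q < ⊤) (hp : 1 < p)
    (hp2 : p < 2) (hU : MemLp U 2 (vol (ball o R)))
    (hΦ : MemLp Φ q (vol (ball o R)))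
    (h : WeakDBV (ball o R) Φ fun z => U z • J (Φ z))
    (hnz : ∀ R > 0, ¬ MemLp (fun z => (z - o)⁻¹ • Φ z) q (vol (ball o R)))
    (hP : MemLp P p (vol (ball o R)))
    (hcl : ClosedPairing (ball o R) Φ P) (hr : r < ⊤) :
    ∃ R' > 0, R' ≤ R ∧ MemLp P r (vol (ball o R')) ∧
      WeakDBV (ball o R') P fun z => conj (U z) • J (P z) := by
  obtain ⟨p', s, σ, hp', hp't, hpp, hs, hst, hsp, hσ0, hσ, hσp⟩ := exists_exponents hp hp2
  obtain ⟨K₀, -, hK⟩ := exists_sff_le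
  obtain ⟨e, he, hse⟩ := exists_mul_le (sobConst_ne_top σ⁻¹) (show (2⁻¹ : ENNReal) ≠ 0 by simp)
  obtain ⟨ε, hε, hsε⟩ := exists_mul_le (sobConst_ne_top s) (show (2⁻¹ : ENNReal) ≠ 0 by simp)
  set e' : ENNReal := min e 1 with he'
  have he'0 : 0 < e' := lt_min he.bot_lt one_pos
  have he't : e' ≠ ⊤ := ((min_le_right e 1).trans_lt ENNReal.one_lt_top).ne
  have hd : e' ^ 2 / 2 ≠ 0 := (ENNReal.half_pos (pow_ne_zero 2 he'0.ne')).ne'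
  obtain ⟨M, hMt, hM, hqM, hpM, hσM, hKM⟩ := exists_large_exponent hqt hp't hd hσ0 K₀
  obtain ⟨R₁, hR₁, hRR, hu, huε, F, R₂, hR₂, hR₂₁, hF, un, Fn, ha, hun⟩ :=
    exists_approx_small hR hq hM hMt hqM (ENNReal.half_pos he'0.ne').ne' hε hU hΦ h hnz
  obtain ⟨R₃, hR₃, hR₃₂, hsff⟩ := hK hM hMt hR₂ ha
  have hle : ∀ n, eLpNorm ((ball o R₃).indicator (sff (Fn n))) 2 volume ≤ e' := fun n => by
    rw [eLpNorm_indicator_eq_eLpNorm_restrict measurableSet_ball]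
    refine (ENNReal.pow_le_pow_left_iff two_ne_zero).1 ((hsff n).trans ?_)
    calc _ ≤ (e' / 2) ^ 2 + e' ^ 2 / 2 := add_le_add (pow_le_pow_left₀ zero_le (hun n) 2) hKM
      _ ≤ e' ^ 2 / 2 + e' ^ 2 / 2 := by
        gcongr
        rw [ENNReal.div_eq_inv_mul, ENNReal.div_eq_inv_mul, mul_pow]
        gcongr
        rw [sq]
        exact mul_le_of_le_one_left' (by simp)
      _ = e' ^ 2 := ENNReal.add_halves _
  have hms : ∀ n, AEStronglyMeasurable ((ball o R₃).indicator (sff (Fn n))) :=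
    fun n => (aestronglyMeasurable_indicator_iff measurableSet_ball).2
      (ContinuousOn.aestronglyMeasurable (fun z hz => (contDiffAt_sff (ha.contDiff_F n).contDiffAt
        (ha.ne_zero n z (ball_subset_ball hR₃₂ hz))).continuousAt.continuousWithinAt)
        measurableSet_ball)
  have ha' := ha.shift hR₃₂ (σ := id) strictMono_id
  have hsub : ball o R₃ ⊆ ball o R :=
    ball_subset_ball (hR₃₂.trans (hR₂₁.trans hRR))
  obtain ⟨r₁, hr₁, hPs, hr₁₃, hw⟩ := ClosedPairing.exists_eq_solution hM hMt hσ hσM hσp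
    (half_pos hR₃) (half_lt_self hR₃) ha' (fun n => hse _ ((hle n).trans (min_le_left _ _)))
    (fun n => ⟨hms n, (hle n).trans_lt he't.lt_top⟩)
    (hP.mono_measure (Measure.restrict_mono_set _ hsub))
    (hcl.congr_ae hsub (hF.mono fun z hz hzR => hz (ball_subset_ball hR₃₂ hzR)))
    hp' hpM hpp hs hst hsp (isCompact_closedBall o R₁)
    (fun z hz => indicator_of_notMem (fun h => hz (ball_subset_closedBall h)) _) hu
    (hsε _ huε)
  have hr₁₁ : r₁ ≤ R₁ := hr₁₃.trans ((half_le_self hR₃.le).trans (hR₃₂.trans hR₂₁))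
  have hw' : WeakDBV (ball o r₁) P fun z => conj (U z) • J (P z) :=
    hw.congr_ae (ae_of_all _ fun _ _ => rfl) (ae_of_all _ fun z hz => by
      rw [indicator_of_mem (ball_subset_ball hr₁₁ hz)])
  have hUc : MemLp (fun z => conj (U z)) 2 (vol (ball o r₁)) :=
    (hU.mono_measure (Measure.restrict_mono_set _ (ball_subset_ball (hr₁₁.trans hRR)))).star
  obtain ⟨R', hR', hRr, hPr⟩ := hw'.memLp_of_lt_top hr₁ hs hst hr hUc hPs
  exact ⟨R', hR', hRr.trans (hr₁₁.trans hRR), hPr, hw'.mono (ball_subset_ball hRr)⟩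

end Regularity

/-! ### Distributional equations on an open set -/

section Global

variable {Ω : Opens ℂ} {q : ENNReal} {f g : ℂ → ℂ} {V : ℂ → ℂ} {ψ : Spinor}

theorem setIntegral_test {h : ℂ → ℂ} {K : Set ℂ} (hK : K ⊆ Ω) (h0 : ∀ z ∉ K, h z = 0) :
    ∫ z in (Ω : Set ℂ), h z = ∫ z, h z :=
  setIntegral_eq_integral_of_forall_compl_eq_zero fun z hz => h0 z fun hz' => hz (hK hz')

theorem integral_mul_test (f : ℂ → ℂ) {η θ : ℂ → ℂ} (hη : tsupport η ⊆ Ω)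
    (hθ : tsupport θ ⊆ tsupport η) : ∫ z in (Ω : Set ℂ), f z * θ z = ∫ z, f z * θ z :=
  setIntegral_test hη fun z hz => by
    rw [off_tsupport fun h => hz (hθ h), mul_zero]

theorem weakDelBar_iff : WeakDelBar Ω f g ↔ WeakDB Ω f g := by
  constructor
  · intro h η h1 h2 h3
    have := h ⟨η, h1, h2, h3⟩
    exact (integral_mul_test f h3 tsupport_delBar_subset).symm.trans
      (this.trans (congrArg _ (integral_mul_test g h3 subset_rfl)))
  · intro h η
    have h3 := η.tsupport_subset
    have := h η η.contDiff η.hasCompactSupport h3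
    exact (integral_mul_test f h3 tsupport_delBar_subset).trans
      (this.trans (congrArg _ (integral_mul_test g h3 subset_rfl).symm))

theorem tsupport_subset_of_zero {E E' : Type*} [Zero E] [Zero E'] {f : ℂ → E} {g : ℂ → E'}
    (h : ∀ z, g z = 0 → f z = 0) : tsupport f ⊆ tsupport g :=
  closure_mono fun z hz h0 => hz (h z h0)

theorem conj_test {η : ℂ → ℂ} (h1 : ContDiff ℝ ∞ η) (h2 : HasCompactSupport η)
    (h3 : tsupport η ⊆ Ω) : ContDiff ℝ ∞ (fun z => conj (η z)) ∧
      HasCompactSupport (fun z => conj (η z)) ∧ tsupport (fun z => conj (η z)) ⊆ Ω := by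
  refine ⟨Complex.conjCLE.contDiff.comp h1, h2.comp_left (g := conj) (map_zero _), ?_⟩
  exact (tsupport_subset_of_zero fun z h0 => by rw [h0, map_zero]).trans h3

theorem weakDel_iff : WeakDel Ω f g ↔ WeakDB Ω (fun z => conj (f z)) fun z => conj (g z) := by
  have key : ∀ {η : ℂ → ℂ}, ContDiff ℝ ∞ η → tsupport η ⊆ Ω →
      (∫ z in (Ω : Set ℂ), f z * del η z = -∫ z in (Ω : Set ℂ), g z * η z ↔
      ∫ z, conj (f z) * delBar (fun w => conj (η w)) z = -∫ z, conj (g z) * conj (η z)) := by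
    intro η h1 h3
    rw [integral_mul_test f h3 tsupport_del_subset, integral_mul_test g h3 subset_rfl,
      ← (starRingEnd ℂ).injective.eq_iff, map_neg, ← integral_conj, ← integral_conj]
    simp only [map_mul, delBar_conj (h1.differentiable (by simp) _)]
  constructor
  · intro h η h1 h2 h3
    obtain ⟨c1, c2, c3⟩ := conj_test h1 h2 h3
    simpa using (key c1 c3).1 (h ⟨_, c1, c2, c3⟩)
  · intro h η
    obtain ⟨c1, c2, c3⟩ := conj_test η.contDiff η.hasCompactSupport η.tsupport_subset
    exact (key η.contDiff η.tsupport_subset).2 (h _ c1 c2 c3)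

theorem inKernel_iff : InKernel q Ω V ψ ↔ (∀ i, MemLpLoc q Ω fun z => ψ z i) ∧
    WeakDB Ω (fun z => ψ z 0) (fun z => conj (V z) * ψ z 1) ∧
    WeakDB Ω (fun z => conj (ψ z 1)) fun z => -(conj (V z) * conj (ψ z 0)) := by
  constructor
  · rintro ⟨h1, h2, h3⟩
    exact ⟨h1, weakDelBar_iff.1 h2, by simpa using weakDel_iff.1 h3⟩
  · rintro ⟨h1, h2, h3⟩
    exact ⟨h1, weakDelBar_iff.2 h2, weakDel_iff.2 (by simpa using h3)⟩

theorem MemLpLoc.locallyIntegrableOn (hq : 1 ≤ q) (h : MemLpLoc q Ω f) :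
    LocallyIntegrableOn f (Ω : Set ℂ) := by
  refine (locallyIntegrableOn_iff Ω.isOpen.isLocallyClosed).2 fun K hK hc => ?_
  have : IsFiniteMeasure (vol K) := ⟨by simpa using hc.measure_lt_top⟩
  exact (h K hc hK).integrable hq

/-- Sets on which a function is in `L^q` are closed under unions. -/
theorem memLp_restrict_union {E : Type*} [NormedAddCommGroup E] {f : ℂ → E} {s t : Set ℂ}
    (hq0 : q ≠ 0) (hqt : q ≠ ⊤) (hs : MemLp f q (vol s))
    (ht : MemLp f q (vol t)) : MemLp f q (vol (s ∪ t)) := by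
  refine ⟨aestronglyMeasurable_union_iff.2 ⟨hs.1, ht.1⟩, ?_⟩
  rw [eLpNorm_lt_top_iff_lintegral_rpow_enorm_lt_top hq0 hqt]
  refine (lintegral_union_le _ _ _).trans_lt (ENNReal.add_lt_top.2 ⟨?_, ?_⟩)
  · exact (eLpNorm_lt_top_iff_lintegral_rpow_enorm_lt_top hq0 hqt).1 hs.2
  · exact (eLpNorm_lt_top_iff_lintegral_rpow_enorm_lt_top hq0 hqt).1 ht.2

theorem memLpLoc_of_local (hq0 : q ≠ 0) (hqt : q ≠ ⊤)
    (h : ∀ z ∈ Ω, ∃ R > 0, MemLp f q (vol (ball z R))) : MemLpLoc q Ω f := by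
  intro K hK hKΩ
  refine hK.induction_on (p := fun s => MemLp f q (vol s)) (by simp)
    (fun s t hst ht => ht.mono_measure (Measure.restrict_mono_set _ hst))
    (fun s t hs ht => memLp_restrict_union hq0 hqt hs ht) fun z hz => ?_
  obtain ⟨R, hR, hm⟩ := h z (hKΩ hz)
  exact ⟨_, mem_nhdsWithin_of_mem_nhds (ball_mem_nhds z hR), hm⟩

theorem weakDB_of_local (hf : LocallyIntegrableOn f (Ω : Set ℂ))
    (hg : LocallyIntegrableOn g (Ω : Set ℂ))
    (h : ∀ z ∈ Ω, ∃ R > 0, WeakDB (ball z R) f g) : WeakDB Ω f g := by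
  intro η h1 h2 h3
  choose! R hR hw using h
  obtain ⟨ρ, hρ⟩ := SmoothPartitionOfUnity.exists_isSubordinate (modelWithCornersSelf ℝ ℂ)
    (isClosed_tsupport η) (fun i : Ω => ball (i : ℂ) (R i))
    (fun i => isOpen_ball)
    fun z hz => Set.mem_iUnion.2 ⟨⟨z, h3 hz⟩, mem_ball_self (hR z (h3 hz))⟩
  have hfin := ρ.locallyFinite.finite_nonempty_inter_compact h2
  set I := hfin.toFinset
  set e : Ω → ℂ → ℂ := fun i z => (ρ i z : ℂ) * η z with he
  have hes : ∀ i, ContDiff ℝ ∞ (e i) := fun i =>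
    (contDiff_ofReal (ρ i).contMDiff.contDiff).mul h1
  have hec : ∀ i, HasCompactSupport (e i) := fun i => h2.mul_left
  have het : ∀ i, tsupport (e i) ⊆ ball (i : ℂ) (R i) := fun i =>
    (tsupport_subset_of_zero (g := ρ i) fun z h0 => by simp [he, h0]).trans (hρ i)
  have heη : ∀ i, tsupport (e i) ⊆ Ω := fun i =>
    (tsupport_subset_of_zero fun z h0 => by simp [he, h0]).trans h3
  have hsum : η = fun z => ∑ i ∈ I, e i z := by
    ext z
    by_cases hz : z ∈ tsupport η
    · have h4 : ∑ i ∈ I, ρ i z = 1 := ρ.sum_finsupport' z hz fun i hi => by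
        rw [ρ.mem_finsupport z] at hi
        exact hfin.mem_toFinset.2 ⟨z, hi, hz⟩
      simp only [he, ← Finset.sum_mul]
      rw [← Complex.ofReal_sum, h4, Complex.ofReal_one, one_mul]
    · simp [he, off_tsupport hz]
  have hD : ∀ z, delBar η z = ∑ i ∈ I, delBar (e i) z := fun z => by
    have h5 : fderiv ℝ η z = ∑ i ∈ I, fderiv ℝ (e i) z := by
      conv_lhs => rw [hsum]
      exact fderiv_fun_sum fun i _ => (hes i).differentiable (by simp) z
    simp only [delBar, h5, _root_.sum_apply, Finset.mul_sum, ← Finset.sum_add_distrib]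
  simp only [hD, Finset.mul_sum]
  rw [integral_finsetSum _ fun i _ => integrable_mul_of_tsupport_subset hf
    ((hes i).continuous_delBar one_le_infty) (hec i).delBar (tsupport_delBar_subset.trans (heη i))]
  conv_rhs => rw [hsum]
  simp only [Finset.mul_sum]
  rw [integral_finsetSum _ fun i _ => integrable_mul_of_tsupport_subset hg
    (hes i).continuous (hec i) (heη i), ← Finset.sum_neg_distrib]
  exact Finset.sum_congr rfl fun i _ => hw i i.2 _ (hes i) (hec i) (het i)

end Global

/-! ### Removable singularities -/

section Removable

variable {S : Set ℂ} {f g : ℂ → ℂ} {o : ℂ} {R : ℝ}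

theorem exists_scaled_cutoff : ∃ C : ℝ, 0 ≤ C ∧ ∀ (o : ℂ) {r : ℝ}, 0 < r → ∃ χ : ℂ → ℂ,
    ContDiff ℝ ∞ χ ∧ (∀ z ∈ ball o (r / 2), χ z = 1) ∧ tsupport χ ⊆ ball o r ∧
    (∀ z, ‖χ z‖ ≤ 1) ∧ ∀ z, ‖delBar χ z‖ ≤ C / r := by
  obtain ⟨ρ, h1, h2, h3, h4, h5⟩ := exists_cutoff 0 (r := 1 / 2) (R := 3 / 4) (by norm_num)
    (by norm_num)
  have hC := contDiff_ofReal h1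
  obtain ⟨C, hC'⟩ := hC.delBar_infty.continuous.bounded_above_of_compact_support
    (hasCompactSupport_ofReal h2).delBar
  refine ⟨C, (norm_nonneg _).trans (hC' 0), fun o r hr => ?_⟩
  have hn : ∀ z, ‖r⁻¹ • (z - o)‖ = dist z o / r := fun z => by
    rw [norm_smul, norm_of_nonneg (by positivity), dist_eq_norm]; ring
  refine ⟨fun z => ρ (r⁻¹ • (z - o)), hC.comp ((contDiff_id.sub contDiff_const).const_smul r⁻¹),
    fun z hz => ?_, ?_, fun z => ?_, fun z => ?_⟩
  · have h6 := h4 (r⁻¹ • (z - o)) ?_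
    · simp only [h6, Complex.ofReal_one]
    rw [mem_closedBall_zero_iff, hn, div_le_iff₀ hr]
    linarith [mem_ball.1 hz]
  · refine (closure_minimal (fun z hz => ?_) isClosed_closedBall).trans
      (closedBall_subset_ball (show 3 / 4 * r < r by linarith))
    have h6 := h3 (subset_tsupport ρ (show ρ (r⁻¹ • (z - o)) ≠ 0 from fun h0 => hz (by
      simp only [h0, Complex.ofReal_zero])))
    rw [mem_closedBall_zero_iff, hn, div_le_iff₀ hr] at h6
    exact mem_closedBall.2 h6
  · rw [norm_real, norm_of_nonneg (h5 _).1]; exact (h5 _).2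
  · have e : fderiv ℝ (fun z => (ρ (r⁻¹ • (z - o)) : ℂ)) z
        = r⁻¹ • fderiv ℝ (fun w => (ρ w : ℂ)) (r⁻¹ • (z - o)) := by
      rw [fderiv_comp_sub (f := fun y : ℂ => (ρ (r⁻¹ • y) : ℂ)) o,
        fderiv_comp_smul (f := fun y : ℂ => (ρ y : ℂ))]
    have e2 : delBar (fun z => (ρ (r⁻¹ • (z - o)) : ℂ)) z
        = (r⁻¹ : ℝ) * delBar (fun w => (ρ w : ℂ)) (r⁻¹ • (z - o)) := by
      rw [delBar, e]; simp only [delBar, smul_apply, real_smul]; ring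
    rw [e2, norm_mul, norm_real, norm_of_nonneg (by positivity), div_eq_inv_mul]
    gcongr
    exact hC' _

/-- A weak solution divided by `z - o` is a weak solution if the quotient is square integrable
near `o`. -/
theorem WeakDB.inv_sub_mul (h : WeakDB S f g)
    (hf : LocallyIntegrableOn (fun z => (z - o)⁻¹ * f z) S)
    (hg : LocallyIntegrableOn (fun z => (z - o)⁻¹ * g z) S) (hR : 0 < R)
    (h2 : MemLp (fun z => (z - o)⁻¹ * f z) 2 (vol (ball o R))) :
    WeakDB S (fun z => (z - o)⁻¹ * f z) fun z => (z - o)⁻¹ * g z := by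
  intro η h3 h4 h5
  obtain ⟨C, hC, hcut⟩ := exists_scaled_cutoff
  obtain ⟨B, hB⟩ := h3.continuous.bounded_above_of_compact_support h4
  have hB0 : 0 ≤ B := (norm_nonneg _).trans (hB 0)
  have i1 := integrable_mul_of_tsupport_subset hf h3.delBar_infty.continuous h4.delBar
    (tsupport_delBar_subset.trans h5)
  have i2 := integrable_mul_of_tsupport_subset hg h3.continuous h4 h5
  set w : ℂ → ℂ := fun z => (z - o)⁻¹ * f z * delBar η z + (z - o)⁻¹ * g z * η z with hw
  have iw : Integrable w := i1.add i2
  rw [eq_neg_iff_add_eq_zero, ← integral_add i1 i2]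
  have hr : ∀ n : ℕ, (0 : ℝ) < 1 / ((n : ℝ) + 1) := fun n => Nat.one_div_pos_of_nat
  choose χ c1 c2 c3 c4 c5 using fun n : ℕ => hcut o (hr n)
  have hχc : ∀ n z, DifferentiableAt ℝ (χ n) z := fun n => (c1 n).differentiable (by simp)
  -- the equation tested away from `o`
  have key : ∀ n, ∫ z, w z = (∫ z, χ n z * w z)
      + ∫ z, (z - o)⁻¹ * f z * (η z * delBar (χ n) z) := by
    intro n
    set θ : ℂ → ℂ := fun z => (z - o)⁻¹ * ((1 - χ n z) * η z) with hθ
    have hθz : ∀ z, ContDiffAt ℝ ∞ θ z ∧ delBar θ z = (z - o)⁻¹ *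
        ((1 - χ n z) * delBar η z - delBar (χ n) z * η z) := by
      intro z
      by_cases hz : z = o
      · have e0 : θ =ᶠ[𝓝 z] fun _ => 0 := by
          filter_upwards [ball_mem_nhds z (half_pos (hr n))] with y hy
          simp [hθ, c2 n y (hz ▸ hy)]
        exact ⟨contDiffAt_const.congr_of_eventuallyEq e0, by
          rw [delBar_congr e0, delBar_const]; simp [hz]⟩
      · have hz' : z - o ≠ 0 := sub_ne_zero.2 hz
        have d1 : DifferentiableAt ℂ (fun y => (y - o)⁻¹) z :=
          (differentiableAt_id.sub_const o).inv hz'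
        have d2 : ContDiffAt ℝ ∞ (fun y => (y - o)⁻¹) z :=
          (contDiffAt_id.sub contDiffAt_const).inv hz'
        have d3 : ContDiffAt ℝ ∞ (fun y => (1 - χ n y) * η y) z :=
          (contDiffAt_const.sub (c1 n).contDiffAt).mul h3.contDiffAt
        refine ⟨d2.mul d3, ?_⟩
        rw [hθ, delBar_mul (d2.differentiableAt (by simp)) (d3.differentiableAt (by simp)),
          delBar_eq_zero_of_differentiableAt d1,
          delBar_mul ((differentiableAt_const _).fun_sub (hχc n z)) (h3.differentiable (by simp) z),
          delBar_sub (differentiableAt_const _) (hχc n z), delBar_const]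
        ring
    have hθc : HasCompactSupport θ := h4.mul_left.mul_left
    have e1 := h θ (contDiff_iff_contDiffAt.2 fun z => (hθz z).1) hθc
      ((tsupport_subset_of_zero fun z h0 => by simp [hθ, h0]).trans h5)
    have i3 : Integrable fun z => χ n z * w z := iw.bdd_mul
      (c1 n).continuous.aestronglyMeasurable (ae_of_all _ (c4 n))
    have i4 : Integrable fun z => (z - o)⁻¹ * f z * (η z * delBar (χ n) z) :=
      integrable_mul_of_tsupport_subset hf
        (h3.continuous.mul (c1 n).delBar_infty.continuous) h4.mul_right
        ((tsupport_subset_of_zero fun z h0 => by simp [h0]).trans h5)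
    have i5 : Integrable fun z => (z - o)⁻¹ * g z * ((1 - χ n z) * η z) :=
      integrable_mul_of_tsupport_subset hg
        ((continuous_const.sub (c1 n).continuous).mul h3.continuous) h4.mul_left
        ((tsupport_subset_of_zero fun z h0 => by simp [h0]).trans h5)
    have e2 : ∀ z, f z * delBar θ z = w z - χ n z * w z
        - (z - o)⁻¹ * f z * (η z * delBar (χ n) z)
        - (z - o)⁻¹ * g z * ((1 - χ n z) * η z) := fun z => by
      rw [(hθz z).2, hw]; ring
    have e3 : ∀ z, g z * θ z = (z - o)⁻¹ * g z * ((1 - χ n z) * η z) := fun z => by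
      rw [hθ]; ring
    simp only [e2, e3] at e1
    have i6 : Integrable fun z => w z - χ n z * w z := iw.sub i3
    have i7 : Integrable fun z => w z - χ n z * w z
        - (z - o)⁻¹ * f z * (η z * delBar (χ n) z) := i6.sub i4
    rw [integral_sub i7 i5, integral_sub i6 i4, integral_sub iw i3] at e1
    linear_combination e1
  have t1 : Tendsto (fun n => ∫ z, χ n z * w z) atTop (𝓝 0) := by
    rw [← integral_zero ℂ ℂ]
    refine tendsto_integral_of_dominated_convergence (fun z => ‖w z‖)
      (fun n => (c1 n).continuous.aestronglyMeasurable.mul iw.1) iw.norm (fun n => ae_of_all _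
        fun z => ?_) ?_
    · rw [norm_mul]; exact mul_le_of_le_one_left (norm_nonneg _) (c4 n z)
    · filter_upwards [compl_mem_ae_iff.2 (measure_singleton o)] with z hz
      have hd : 0 < dist z o := dist_pos.2 hz
      refine tendsto_const_nhds.congr' ?_
      filter_upwards [tendsto_one_div_add_atTop_nhds_zero_nat.eventually_lt_const hd] with n hn
      rw [off_tsupport fun h6 => hn.not_gt (mem_ball.1 (c3 n h6)),
        zero_mul]
  have t2 : Tendsto (fun n => ∫ z, (z - o)⁻¹ * f z * (η z * delBar (χ n) z)) atTop (𝓝 0) := by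
    have hπ : (NNReal.pi : ENNReal) ^ (1 / (2 : ENNReal).toReal) ≠ ⊤ := by finiteness
    have hD : ∀ n, eLpNorm (fun z => η z * delBar (χ n) z) 2 volume
        ≤ ofReal (B * C) * (NNReal.pi : ENNReal) ^ (1 / (2 : ENNReal).toReal) := fun n => by
      set r := 1 / ((n : ℝ) + 1) with hrn
      have hr0 : 0 < r := hr n
      have h6 : ∀ z, ‖η z * delBar (χ n) z‖
          ≤ ‖(ball o r).indicator (fun _ => B * (C / r)) z‖ := fun z => by
        by_cases hz : z ∈ ball o r
        · rw [indicator_of_mem hz, norm_mul, norm_of_nonneg (by positivity)]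
          exact mul_le_mul (hB z) (c5 n z) (norm_nonneg _) hB0
        · rw [off_tsupport fun h7 => hz (c3 n (tsupport_delBar_subset h7)),
            mul_zero, norm_zero]
          exact norm_nonneg _
      refine (eLpNorm_mono h6).trans ((eLpNorm_indicator_const_le _ _).trans (le_of_eq ?_))
      rw [Complex.volume_ball, mul_rpow_of_nonneg _ _ (by positivity), ← mul_assoc,
        Real.enorm_of_nonneg (by positivity), ENNReal.toReal_ofNat, one_div]
      have h7 : (ofReal r ^ 2) ^ (2 : ℝ)⁻¹ = ofReal r :=
        ENNReal.pow_rpow_inv_natCast two_ne_zero _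
      rw [h7, ← ofReal_mul (by positivity)]
      congr 2
      field_simp
    have hb : Tendsto (fun n : ℕ => eLpNorm ((ball o (1 / ((n : ℝ) + 1))).indicator
        fun z => (z - o)⁻¹ * f z) 2 volume) atTop (𝓝 0) := by
      refine ENNReal.tendsto_nhds_zero.2 fun ε hε => ?_
      obtain ⟨R', hR', -, hs⟩ := exists_ball_small hR h2 hε.ne'
      filter_upwards [tendsto_one_div_add_atTop_nhds_zero_nat.eventually_lt_const hR'] with n hn
      exact hs _ hn.le
    have hb' := ENNReal.Tendsto.mul_const hb
      (Or.inr (ENNReal.mul_ne_top (ofReal_ne_top (r := B * C)) hπ))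
    rw [zero_mul] at hb'
    rw [tendsto_zero_iff_enorm_tendsto_zero]
    obtain ⟨N, hN⟩ := eventually_atTop.1
      (tendsto_one_div_add_atTop_nhds_zero_nat.eventually_lt_const hR)
    refine tendsto_of_tendsto_of_tendsto_of_le_of_le' tendsto_const_nhds hb'
      (.of_forall fun _ => zero_le) (eventually_atTop.2 ⟨N, fun n hn => ?_⟩)
    have hm : AEStronglyMeasurable ((ball o (1 / ((n : ℝ) + 1))).indicator
        fun z => (z - o)⁻¹ * f z) :=
      (aestronglyMeasurable_indicator_iff measurableSet_ball).2
        (h2.1.mono_measure (Measure.restrict_mono_set _ (ball_subset_ball (hN n hn).le)))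
    refine (enorm_integral_le_lintegral_enorm _).trans ?_
    rw [← eLpNorm_one_eq_lintegral_enorm]
    refine le_trans (le_of_eq ?_) ((eLpNorm_fun_smul_le (p := 2) (q := 2) (s := 1) hm
      (h3.continuous.mul (c1 n).delBar_infty.continuous).aestronglyMeasurable).trans
        (mul_le_mul' le_rfl (hD n)))
    congr 1
    ext z
    by_cases hz : z ∈ ball o (1 / ((n : ℝ) + 1))
    · rw [indicator_of_mem hz, smul_eq_mul]; rfl
    · have h8 : delBar (χ n) z = 0 := off_tsupport fun h7 =>
        hz (c3 n (tsupport_delBar_subset h7))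
      rw [indicator_of_notMem hz, h8, mul_zero, mul_zero, zero_smul]
  have t3 := t1.add t2
  rw [add_zero] at t3
  exact tendsto_nhds_unique (tendsto_const_nhds.congr key) t3

end Removable

/-! ### Weyl's lemma -/

section Weyl

variable {Ω : Opens ℂ} {p q : ENNReal} {f g : ℂ → ℂ} {U V : ℂ → ℂ} {φ ψ : Spinor} {o : ℂ}

theorem MemLpLoc.conj (h : MemLpLoc q Ω f) : MemLpLoc q Ω fun z => conj (f z) :=
  fun K hK hKΩ => (h K hK hKΩ).star

theorem MemLpLoc.locallyIntegrableOn_mul (hV : MemLpLoc 2 Ω V) (hq : 2 ≤ q) (hf : MemLpLoc q Ω f) :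
    LocallyIntegrableOn (fun z => V z * f z) (Ω : Set ℂ) := by
  refine (locallyIntegrableOn_iff Ω.isOpen.isLocallyClosed).2 fun K hK hc => ?_
  have : IsFiniteMeasure (vol K) := ⟨by simpa using hc.measure_lt_top⟩
  exact (hV K hc hK).integrable_mul ((hf K hc hK).mono_exponent hq)

theorem MemLpLoc.inv_sub_mul (hq0 : q ≠ 0) (hqt : q ≠ ⊤) (hf : MemLpLoc q Ω f) {R : ℝ} (hR : 0 < R)
    (h : MemLp (fun z => (z - o)⁻¹ * f z) q (vol (ball o R))) :
    MemLpLoc q Ω fun z => (z - o)⁻¹ * f z := by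
  intro K hK hKΩ
  rw [← Set.inter_union_sdiff K (ball o R)]
  refine memLp_restrict_union hq0 hqt
    (h.mono_measure (Measure.restrict_mono_set _ Set.inter_subset_right)) ?_
  have hf' := (hf K hK hKΩ).mono_measure
    (Measure.restrict_mono_set _ (Set.sdiff_subset (s := K) (t := ball o R)))
  have hm : Measurable fun z : ℂ => (z - o)⁻¹ := by fun_prop
  refine hf'.of_le_mul (c := R⁻¹) (hm.aestronglyMeasurable.mul hf'.1)
    ((ae_restrict_iff' (hK.measurableSet.diff measurableSet_ball)).2 (ae_of_all _ fun z hz => ?_))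
  have hz' : R ≤ ‖z - o‖ := by
    have := hz.2
    rwa [mem_ball, not_lt, dist_eq_norm] at this
  rw [norm_mul, norm_inv]
  gcongr

theorem inKernel_divPow_one (hV : MemLpLoc 2 Ω V) (hq : 2 < q) (hqt : q < ⊤)
    (h : InKernel q Ω V φ) {R : ℝ} (hR : 0 < R)
    (hm : MemLp (fun z => (z - o)⁻¹ • (φ z 0, conj (φ z 1))) q
      (vol (ball o R))) :
    InKernel q Ω (twistPotential o 1 V) (divPow o 1 φ) := by
  obtain ⟨h1, h2, h3⟩ := inKernel_iff.1 h
  have hq0 : q ≠ 0 := (zero_lt_two.trans hq).ne'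
  have hq1 : 1 ≤ q := one_le_two.trans hq.le
  have m0 : MemLp (fun z => (z - o)⁻¹ * φ z 0) q (vol (ball o R)) := hm.fst
  have m1 : MemLp (fun z => (z - o)⁻¹ * conj (φ z 1)) q (vol (ball o R)) :=
    hm.snd
  have l0 := (h1 0).inv_sub_mul hq0 hqt.ne hR m0
  have l1 := (h1 1).conj.inv_sub_mul hq0 hqt.ne hR m1
  have l1' : MemLpLoc q Ω fun z => (z - o)⁻¹ * φ z 1 := fun K hK hKΩ =>
    (l1 K hK hKΩ).of_le ((by fun_prop : Measurable fun z : ℂ => (z - o)⁻¹).aestronglyMeasurable.mul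
      (h1 1 K hK hKΩ).1) (ae_of_all _ fun z => by simp)
  have l0' : MemLpLoc q Ω fun z => (z - o)⁻¹ * conj (φ z 0) := fun K hK hKΩ =>
    (l0 K hK hKΩ).of_le ((by fun_prop : Measurable fun z : ℂ => (z - o)⁻¹).aestronglyMeasurable.mul
      (h1 0 K hK hKΩ).star.1) (ae_of_all _ fun z => by simp)
  have i1 := (hV.conj.locallyIntegrableOn_mul hq.le l1')
  have i2 := (hV.conj.locallyIntegrableOn_mul hq.le l0').neg
  have hz : ∀ᵐ z, z ≠ o := compl_mem_ae_iff.2 (measure_singleton o)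
  refine inKernel_iff.2 ⟨Fin.forall_fin_two.2 ⟨?_, ?_⟩, ?_, ?_⟩
  · simpa [divPow] using l0
  · simpa [divPow] using l1.conj
  · refine (h2.inv_sub_mul (l0.locallyIntegrableOn hq1) (i1.congr (ae_of_all _ fun z => ?_)) hR
      (m0.mono_exponent hq.le)).congr_ae (ae_of_all _ fun z _ => by simp [divPow]) ?_
    · ring
    · filter_upwards [hz] with z hz _
      have h5 := sub_ne_zero.2 hz
      have h6 : conj (z - o) ≠ 0 := (map_ne_zero _).2 h5
      simp [divPow, twistPotential] at h6 ⊢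
      field_simp
  · refine (h3.inv_sub_mul (l1.locallyIntegrableOn hq1) (i2.congr (ae_of_all _ fun z => ?_)) hR
      (m1.mono_exponent hq.le)).congr_ae (ae_of_all _ fun z _ => by simp [divPow]) ?_
    · simp only [Pi.neg_apply]; ring
    · filter_upwards [hz] with z hz _
      have h5 := sub_ne_zero.2 hz
      have h6 : conj (z - o) ≠ 0 := (map_ne_zero _).2 h5
      simp [divPow, twistPotential] at h6 ⊢
      field_simp

theorem HasNoZeros.not_memLp (hV : MemLpLoc 2 Ω V) (hq : 2 < q) (hqt : q < ⊤)
    (h : InKernel q Ω V φ) (h0 : HasNoZeros q Ω V φ) (hz : o ∈ Ω) :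
    ∀ R > 0, ¬ MemLp (fun z => (z - o)⁻¹ • (φ z 0, conj (φ z 1))) q
      (vol (ball o R)) := fun R hR hm =>
  absurd ((h0 o hz).2 (inKernel_divPow_one hV hq hqt h hR hm)) (by norm_num)

theorem PairingIsClosedCurrent.closedPairing (h : PairingIsClosedCurrent Ω φ ψ) :
    ClosedPairing Ω (fun z => (φ z 0, conj (φ z 1))) fun z => (ψ z 0, -conj (ψ z 1)) := by
  intro η h1 h2 h3
  have key : ∀ {F : ℂ → ℂ}, (∀ z ∉ tsupport η, F z = 0) → ∀ i : Fin 2, ∀ c : ℂ,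
      (∀ z, F z = c * ((pairedQuat φ z * !![1, 0; 0, 0] * quat ψ z : Matrix (Fin 2) (Fin 2) ℂ) i 0
        * delBar η z - (pairedQuat φ z * !![0, 0; 0, 1] * quat ψ z : Matrix (Fin 2) (Fin 2) ℂ) i 0
        * del η z)) → ∫ z, F z = 0 := by
    intro F h0 i c hF
    have e := (h i 0).closed ⟨η, h1, h2, h3⟩
    rw [← setIntegral_test h3 h0]
    simp only [hF]
    rw [integral_const_mul]
    exact (congrArg (c * ·) e).trans (mul_zero c)
  have d0 : ∀ z ∉ tsupport η, del η z = 0 ∧ delBar η z = 0 := fun z hz =>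
    ⟨off_tsupport fun h => hz (tsupport_del_subset h),
      off_tsupport fun h => hz (tsupport_delBar_subset h)⟩
  constructor
  · refine key (fun z hz => by simp [d0 z hz]) 0 1 fun z => ?_
    simp [pairedQuat, quat, Matrix.mul_apply, Fin.sum_univ_two]; ring
  · refine key (fun z hz => by simp [d0 z hz]) 1 (-1) fun z => ?_
    simp [pairedQuat, quat, Matrix.mul_apply, Fin.sum_univ_two]; ring

theorem WeakDB.neg {S : Set ℂ} (h : WeakDB S f g) : WeakDB S (fun z => -f z) fun z => -g z := by
  intro η h1 h2 h3
  simp only [neg_mul, integral_neg, h η h1 h2 h3]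

theorem inKernel_of_closed (hU : MemLpLoc 2 Ω U) (hq : 2 < q) (hq' : q < ⊤)
    (hφ : InKernel q Ω (pairedPotential U) φ) (hφ₀ : HasNoZeros q Ω (pairedPotential U) φ)
    (hp : 1 < p) (hp' : p < 2) (hψ : ∀ i, MemLpLoc p Ω fun z => ψ z i)
    (hclosed : PairingIsClosedCurrent Ω φ ψ) {r : ENNReal} (hr : 2 < r) (hr' : r < ⊤) :
    InKernel r Ω U ψ := by
  set Φ : ℂ → ℂ × ℂ := fun z => (φ z 0, conj (φ z 1)) with hΦ
  set P : ℂ → ℂ × ℂ := fun z => (ψ z 0, -conj (ψ z 1)) with hP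
  have hV : MemLpLoc 2 Ω (pairedPotential U) := fun K hK hKΩ => (hU.conj K hK hKΩ).neg
  obtain ⟨a1, a2, a3⟩ := inKernel_iff.1 hφ
  have hw : WeakDBV Ω Φ fun z => U z • J (Φ z) :=
    ⟨by simpa [hΦ, pairedPotential] using a2, by simpa [hΦ, pairedPotential] using a3⟩
  have hcl := hclosed.closedPairing
  have hloc : ∀ z ∈ Ω, ∃ R > 0, MemLp P r (vol (ball z R)) ∧
      WeakDBV (ball z R) P fun w => conj (U w) • J (P w) := by
    intro z hz
    obtain ⟨R, hR, hRΩ⟩ := nhds_basis_closedBall.mem_iff.1 (Ω.isOpen.mem_nhds hz)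
    have hb := ball_subset_closedBall.trans hRΩ
    have hm : ∀ {t : ENNReal} {x : ℂ → ℂ}, MemLpLoc t Ω x →
        MemLp x t (vol (ball z R)) := fun h =>
      (h _ (isCompact_closedBall z R) hRΩ).mono_measure
        (Measure.restrict_mono_set _ ball_subset_closedBall)
    obtain ⟨R', hR', -, h1, h2⟩ := ClosedPairing.exists_regular (r := r) hR hq hq' hp hp' (hm hU)
      (memLp_prod_iff.2 ⟨hm (a1 0), hm (a1 1).conj⟩) (hw.mono hb)
      (hφ₀.not_memLp hV hq hq' hφ hz)
      (memLp_prod_iff.2 ⟨hm (hψ 0), (hm (hψ 1).conj).neg⟩)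
      (hcl.congr_ae hb (ae_of_all _ fun _ _ => rfl)) hr'
    exact ⟨R', hR', h1, h2⟩
  have hr0 : r ≠ 0 := (zero_lt_two.trans hr).ne'
  have hr1 : 1 ≤ r := one_le_two.trans hr.le
  have m0 : MemLpLoc r Ω fun z => ψ z 0 := memLpLoc_of_local hr0 hr'.ne fun z hz => by
    obtain ⟨R, hR, h1, -⟩ := hloc z hz
    exact ⟨R, hR, h1.fst⟩
  have m1 : MemLpLoc r Ω fun z => ψ z 1 := memLpLoc_of_local hr0 hr'.ne fun z hz => by
    obtain ⟨R, hR, h1, -⟩ := hloc z hz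
    exact ⟨R, hR, h1.snd.star.neg.ae_eq (ae_of_all _ fun w => by simp [hP])⟩
  refine inKernel_iff.2 ⟨Fin.forall_fin_two.2 ⟨m0, m1⟩, ?_, ?_⟩
  · refine weakDB_of_local (m0.locallyIntegrableOn hr1)
      (hU.conj.locallyIntegrableOn_mul hr.le m1) fun z hz => ?_
    obtain ⟨R, hR, -, h2⟩ := hloc z hz
    exact ⟨R, hR, by simpa [hP] using h2.1⟩
  · refine weakDB_of_local (m1.conj.locallyIntegrableOn hr1)
      (hU.conj.locallyIntegrableOn_mul hr.le m0.conj).neg fun z hz => ?_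
    obtain ⟨R, hR, -, h2⟩ := hloc z hz
    exact ⟨R, hR, by simpa [hP] using h2.2.neg⟩

end Weyl

end QuaternionicSpinor

end

theorem mainTheorem12 (Ω : TopologicalSpace.Opens ℂ) (U : ℂ → ℂ)
    (hU : QuaternionicSpinor.MemLpLoc 2 Ω U)
    (q : ENNReal) (hq : 2 < q) (hq' : q < ⊤)
    (φ : QuaternionicSpinor.Spinor)
    (hφ : QuaternionicSpinor.InKernel q Ω (QuaternionicSpinor.pairedPotential U) φ)
    (hφ₀ : QuaternionicSpinor.HasNoZeros q Ω (QuaternionicSpinor.pairedPotential U) φ)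
    (p : ENNReal) (hp : 1 < p) (hp' : p < 2)
    (ψ : QuaternionicSpinor.Spinor)
    (hψ : ∀ i, QuaternionicSpinor.MemLpLoc p Ω (fun z => ψ z i))
    (hclosed : QuaternionicSpinor.PairingIsClosedCurrent Ω φ ψ) :
    ∀ r : ENNReal, 2 < r → r < ⊤ → QuaternionicSpinor.InKernel r Ω U ψ := 
  fun _ hr hr' => QuaternionicSpinor.inKernel_of_closed hU hq hq' hφ hφ₀ hp hp' hψ hclosed hr hr'
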